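/- **Setting.** Let $k$ be a field; all algebras (associative, with unit), vector spaces and tensor products are over $k$, with summation understood in Sweedler-type notations. A *quasi-bialgebra* is an algebra $H$ with algebra maps $\Delta:H\to H\otimes H$, $\varepsilon:H\to k$ and an invertible $\Phi=X^1\otimes X^2\otimes X^3\in H^{\otimes 3}$, $\Phi^{-1}=x^1\otimes x^2\otimes x^3$, such that $(\mathrm{id}\otimes\Delta)\Delta(h)=\Phi\,(\Delta\otimes \mathrm{id})\Delta(h)\,\Phi^{-1}$, $(\mathrm{id}\otimes\varepsilon)\Delta=(\varepsilon\otimes\mathrm{id})\Delta=\mathrm{id}$, $(1\otimes\Phi)(\mathrm{id}\otimes\Delta\otimes\mathrm{id})(\Phi)(\Phi\otimes1)=(\mathrm{id}\otimes\mathrm{id}\otimes\Delta)(\Phi)(\Delta\otimes\mathrm{id}\otimes\mathrm{id})(\Phi)$ and $(\mathrm{id}\otimes\varepsilon\otimes\mathrm{id})(\Phi)=1\otimes1$. It is a *quasi-Hopf algebra* if it is equipped with an anti-automorphism $S$ of the algebra $H$ and $\alpha,\beta\in H$ with $S(h_1)\alpha h_2=\varepsilon(h)\alpha$, $h_1\beta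 S(h_2)=\varepsilon(h)\beta$, $X^1\beta S(X^2)\alpha X^3=1=S(x^1)\alpha x^2\beta S(x^3)$, normalized by $\varepsilon(\alpha)=\varepsilon(\beta)=1$. Its *Drinfeld twist* is $$f=f^1\otimes f^2=(S\otimes S)(\Delta^{\rm cop}(x^1))\,\gamma\,\Delta(x^2\beta S(x^3)),\qquad \gamma=S(A^2)\alpha A^3\otimes S(A^1)\alpha A^4,$$ where $A^1\otimes A^2\otimes A^3\otimes A^4=(\Phi\otimes1)(\Delta\otimes\mathrm{id}\otimes\mathrm{id})(\Phi^{-1})$; $f$ is invertible, and $f^{-1}=g^1\otimes g^2$. An *$H$-bicomodule algebra* is an algebra $\mathbb A$ with algebra maps $\lambda:\mathbb A\to H\otimes\mathbb A$, $\lambda(u)=u_{[-1]}\otimes u_{[0]}$, and $\rho:\mathbb A\to\mathbb A\otimes H$, $\rho(u)=u_{<0>}\otimes u_{<1>}$, and invertible elements $\Phi_\lambda\in H\otimes H\otimes\mathbb A$, $\Phi_\rho\in\mathbb A\otimes H\otimes H$, $\Phi_{\lambda,\rho}\in H\otimes\mathbb A\otimes H$, such that * $(\mathbb A,\rho,\Phi_\rho)$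 is a right $H$-comodule algebra: $\Phi_\rho(\rho\otimes\mathrm{id})\rho(u)=(\mathrm{id}\otimes\Delta)\rho(u)\Phi_\rho$, $(1\otimes\Phi)(\mathrm{id}\otimes\Delta\otimes\mathrm{id})(\Phi_\rho)(\Phi_\rho\otimes1)=(\mathrm{id}\otimes\mathrm{id}\otimes\Delta)(\Phi_\rho)(\rho\otimes\mathrm{id}\otimes\mathrm{id})(\Phi_\rho)$, $(\mathrm{id}\otimes\varepsilon)\rho=\mathrm{id}$, $(\mathrm{id}\otimes\varepsilon\otimes\mathrm{id})(\Phi_\rho)=(\mathrm{id}\otimes\mathrm{id}\otimes\varepsilon)(\Phi_\rho)=1\otimes1$; * $(\mathbb A,\lambda,\Phi_\lambda)$ is a left $H$-comodule algebra: $(\mathrm{id}\otimes\lambda)\lambda(u)\Phi_\lambda=\Phi_\lambda(\Delta\otimes\mathrm{id})\lambda(u)$, $(1\otimes\Phi_\lambda)(\mathrm{id}\otimes\Delta\otimes\mathrm{id})(\Phi_\lambda)(\Phi\otimes1)=(\mathrm{id}\otimes\mathrm{id}\otimes\lambda)(\Phi_\lambda)(\Delta\otimes\mathrm{id}\otimes\mathrm{id})(\Phi_\lambda)$,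 $(\varepsilon\otimes\mathrm{id})\lambda=\mathrm{id}$, $(\mathrm{id}\otimes\varepsilon\otimes\mathrm{id})(\Phi_\lambda)=(\varepsilon\otimes\mathrm{id}\otimes\mathrm{id})(\Phi_\lambda)=1\otimes1$; * $\Phi_{\lambda,\rho}(\lambda\otimes\mathrm{id})\rho(u)=(\mathrm{id}\otimes\rho)\lambda(u)\Phi_{\lambda,\rho}$, $(1\otimes\Phi_{\lambda,\rho})(\mathrm{id}\otimes\lambda\otimes\mathrm{id})(\Phi_{\lambda,\rho})(\Phi_\lambda\otimes1)=(\mathrm{id}\otimes\mathrm{id}\otimes\rho)(\Phi_\lambda)(\Delta\otimes\mathrm{id}\otimes\mathrm{id})(\Phi_{\lambda,\rho})$ and $(1\otimes\Phi_\rho)(\mathrm{id}\otimes\rho\otimes\mathrm{id})(\Phi_{\lambda,\rho})(\Phi_{\lambda,\rho}\otimes1)=(\mathrm{id}\otimes\mathrm{id}\otimes\Delta)(\Phi_{\lambda,\rho})(\lambda\otimes\mathrm{id}\otimes\mathrm{id})(\Phi_\rho)$. Write $\Phi_\rho=\tilde X^1_\rho\otimes\tilde X^2_\rho\otimes\tilde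 X^3_\rho$, $\Phi_\lambda^{-1}=\tilde x^1_\lambda\otimes\tilde x^2_\lambda\otimes\tilde x^3_\lambda$, $\Phi_{\lambda,\rho}=\Theta^1\otimes\Theta^2\otimes\Theta^3$, $\Phi_{\lambda,\rho}^{-1}=\theta^1\otimes\theta^2\otimes\theta^3$. An *$H$-bimodule coalgebra* is an $H$-bimodule $C$ with linear maps $\underline\Delta:C\to C\otimes C$, $\underline\Delta(c)=c_1\otimes c_2$, and $\underline\varepsilon:C\to k$ such that $\Phi\cdot(\underline\Delta\otimes\mathrm{id})\underline\Delta(c)\cdot\Phi^{-1}=(\mathrm{id}\otimes\underline\Delta)\underline\Delta(c)$, $\underline\varepsilon$ is a two-sided counit for $\underline\Delta$, and $\underline\Delta(h\cdot c\cdot h')=h_1\cdot c_1\cdot h'_1\otimes h_2\cdot c_2\cdot h'_2$, $\underline\varepsilon(h\cdot c\cdot h')=\varepsilon(h)\underline\varepsilon(c)\varepsilon(h')$. Its linear dual $C^*$ has the convolution product $(\varphi\psi)(c)=\varphi(c_1)\psi(c_2)$, the unit $\underline\varepsilon$, the $H$-bimodule structure $(h\cdot\varphi\cdot h')(c)=\varphi(h'\cdot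 c\cdot h)$ (it is an $H$-bimodule algebra), and the right $H^{\rm op}\otimes H$-action $\varphi\cdot(h\otimes h')=h\cdot\varphi\cdot h'$. **The smash products.** For a right $K$-coaction $\rho_0(u)=u_0\otimes u_1$ on $\mathbb A$ with reassociator $\Phi_0\in\mathbb A\otimes K\otimes K$, $\Phi_0^{-1}=y^1\otimes y^2\otimes y^3$, the right generalized smash product of $\mathbb A$ and $C^*$ is $\mathbb A\otimes C^*$ with unit $1\otimes\underline\varepsilon$ and product $$(u\otimes\varphi)(u'\otimes\psi)=u\,u'_0\,y^1\otimes(\varphi\cdot u'_1y^2)(\psi\cdot y^3).$$ With $K=H^{\rm op}\otimes H$ this gives $\mathbb A^1\rtimes C^*$ and $\mathbb A^2\rtimes C^*$ for $\mathbb A^i=(\mathbb A,\rho_i,\Phi_{\rho_i})$, where $$\rho_1(u)=u_{<0>_{[0]}}\otimes\big(S^{-1}(u_{<0>_{[-1]}})\otimes u_{<1>}\big),\qquad \rho_2(u)=u_{[0]_{<0>}}\otimes\big(S^{-1}(u_{[-1]})\otimes u_{[0]_{<1>}}\big),$$ $$\Phi_{\rho_1}=(\tilde X^1_\rho)_{[0]}\tilde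 x^3_\lambda\theta^2_{[0]}\otimes\big(S^{-1}(f^2(\tilde X^1_\rho)_{[-1]_2}\tilde x^2_\lambda\theta^2_{[-1]})\otimes\tilde X^2_\rho\theta^3\big)\otimes\big(S^{-1}(f^1(\tilde X^1_\rho)_{[-1]_1}\tilde x^1_\lambda\theta^1)\otimes\tilde X^3_\rho\big),$$ $$\Phi_{\rho_2}=(\tilde x^3_\lambda)_{<0>}\tilde X^1_\rho\Theta^2_{<0>}\otimes\big(S^{-1}(f^2\tilde x^2_\lambda\Theta^1)\otimes(\tilde x^3_\lambda)_{<1>_1}\tilde X^2_\rho\Theta^2_{<1>}\big)\otimes\big(S^{-1}(f^1\tilde x^1_\lambda)\otimes(\tilde x^3_\lambda)_{<1>_2}\tilde X^3_\rho\Theta^3\big).$$ **The generalized diagonal crossed products.** Put $\delta_l=(\lambda\otimes\mathrm{id})\rho$, $\delta_r=(\mathrm{id}\otimes\rho)\lambda$, $$\Psi_l=(\mathrm{id}\otimes\lambda\otimes\mathrm{id}^{\otimes2})\big((\Phi_{\lambda,\rho}\otimes1)(\lambda\otimes\mathrm{id}^{\otimes2})(\Phi_\rho^{-1})\big)[\Phi_\lambda\otimes1\otimes1],$$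 $$\Psi_r=(\mathrm{id}^{\otimes2}\otimes\rho\otimes\mathrm{id})\big((1\otimes\Phi_{\lambda,\rho}^{-1})(\mathrm{id}^{\otimes2}\otimes\rho)(\Phi_\lambda)\big)[1\otimes1\otimes\Phi_\rho^{-1}],$$ and for $s\in\{l,r\}$ let $$\Omega_{L_s}=(\mathrm{id}^{\otimes3}\otimes S^{-1}\otimes S^{-1})(\Psi_s^{-1})\,[1\otimes1\otimes1\otimes S^{-1}(f^1)\otimes S^{-1}(f^2)],$$ $$\Omega_{R_s}=[S^{-1}(g^1)\otimes S^{-1}(g^2)\otimes1\otimes1\otimes1]\,(S^{-1}\otimes S^{-1}\otimes\mathrm{id}^{\otimes3})(\Psi_s).$$ With $\delta_s(u)=u_{(-1)}\otimes u_{(0)}\otimes u_{(1)}$ and $\Omega=\Omega^1\otimes\cdots\otimes\Omega^5$, the left crossed product $C^*\bowtie_{\delta_s}\mathbb A$ is $C^*\otimes\mathbb A$ with unit $\underline\varepsilon\otimes1$ and, for $\Omega=\Omega_{L_s}$, the product $$(\varphi\otimes u)(\psi\otimes u')=(\Omega^1\cdot\varphi\cdot\Omega^5)(\Omega^2u_{(-1)}\cdot\psi\cdot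 S^{-1}(u_{(1)})\Omega^4)\otimes\Omega^3u_{(0)}u',$$ and the right crossed product $\mathbb A\bowtie_{\delta_s}C^*$ is $\mathbb A\otimes C^*$ with unit $1\otimes\underline\varepsilon$ and, for $\Omega=\Omega_{R_s}$, the product $$(u\otimes\varphi)(u'\otimes\psi)=u\,u'_{(0)}\Omega^3\otimes(\Omega^2S^{-1}(u'_{(-1)})\cdot\varphi\cdot u'_{(1)}\Omega^4)(\Omega^1\cdot\psi\cdot\Omega^5).$$ **Proposition.** Let $H$ be a quasi-Hopf algebra, $\mathbb A$ an $H$-bicomodule algebra and $C$ an $H$-bimodule coalgebra. Then $f$, $\Phi_{\rho_1}$ and $\Phi_{\rho_2}$ are invertible, the two smash products and the four crossed products above are associative algebras with the indicated units, and $$\mathbb A^1\rtimes C^*=\mathbb A\bowtie_{\delta_l}C^*,\qquad \mathbb A^2\rtimes C^*=\mathbb A\bowtie_{\delta_r}C^*$$ as algebras (same vector space, same product, same unit). In particular, the algebras $\mathbb A^1\rtimes C^*$ and $\mathbb A^2\rtimes C^*$ are isomorphic to each other and to each of the four generalized diagonal crossed products $C^*\bowtie_{\delta_l}\mathbb A$,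 $C^*\bowtie_{\delta_r}\mathbb A$, $\mathbb A\bowtie_{\delta_l}C^*$, $\mathbb A\bowtie_{\delta_r}C^*$. -/

import Mathlib

open scoped TensorProduct

set_option maxSynthPendingDepth 3

noncomputable section

namespace QHA

/-! Conventions: iterated tensor products are associated to the right, so that
`H ⊗ H ⊗ H` of the text is `H ⊗[k] (H ⊗[k] H)`, and so on. -/

section Legs

variable (k : Type*) [Field k]

/-- `f ⊗ id : P ⊗ D → B ⊗ C ⊗ D` for an algebra morphism `f : P → B ⊗ C`. -/
def onFirst {P B C : Type*} (D : Type*) [Ring P] [Algebra k P] [Ring B] [Algebra k B]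
    [Ring C] [Algebra k C] [Ring D] [Algebra k D] (f : P →ₐ[k] B ⊗[k] C) :
    P ⊗[k] D →ₐ[k] B ⊗[k] (C ⊗[k] D) :=
  (Algebra.TensorProduct.assoc k k k B C D).toAlgHom.comp
    (Algebra.TensorProduct.map f (AlgHom.id k D))

/-- `id ⊗ f : P ⊗ D → P ⊗ E` for an algebra morphism `f : D → E`. -/
def onRest (P : Type*) {D E : Type*} [Ring P] [Algebra k P] [Ring D] [Algebra k D]
    [Ring E] [Algebra k E] (f : D →ₐ[k] E) : P ⊗[k] D →ₐ[k] P ⊗[k] E :=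
  Algebra.TensorProduct.map (AlgHom.id k P) f

/-- `b ↦ b ⊗ 1`. -/
def oneRight (B D : Type*) [Ring B] [Algebra k B] [Ring D] [Algebra k D] :
    B →ₐ[k] B ⊗[k] D :=
  Algebra.TensorProduct.includeLeft

/-- `d ↦ 1 ⊗ d`. -/
def oneLeft (B D : Type*) [Ring B] [Algebra k B] [Ring D] [Algebra k D] :
    D →ₐ[k] B ⊗[k] D :=
  Algebra.TensorProduct.includeRight

/-- `e ⊗ id : P ⊗ D → k ⊗ D = D` for `e : P → k`. -/
def dropFirst {P : Type*} (D : Type*) [Ring P] [Algebra k P] [Ring D] [Algebra k D]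
    (e : P →ₐ[k] k) : P ⊗[k] D →ₐ[k] D :=
  (Algebra.TensorProduct.lid k D).toAlgHom.comp
    (Algebra.TensorProduct.map e (AlgHom.id k D))

/-- `id ⊗ e : D ⊗ P → D ⊗ k = D` for `e : P → k`. -/
def dropLast {P : Type*} (D : Type*) [Ring P] [Algebra k P] [Ring D] [Algebra k D]
    (e : P →ₐ[k] k) : D ⊗[k] P →ₐ[k] D :=
  (Algebra.TensorProduct.rid k k D).toAlgHom.comp
    (Algebra.TensorProduct.map (AlgHom.id k D) e)

/-- `x ⊗ y ↦ f x * g y`. -/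
def mulMap {U V R : Type*} [AddCommGroup U] [Module k U] [AddCommGroup V] [Module k V]
    [Ring R] [Algebra k R] (f : U →ₗ[k] R) (g : V →ₗ[k] R) : U ⊗[k] V →ₗ[k] R :=
  LinearMap.mul' k R ∘ₗ TensorProduct.map f g

end Legs

/-! ### Quasi-bialgebras and quasi-Hopf algebras -/

/-- A quasi-bialgebra structure `(Δ, ε, Φ)` on the `k`-algebra `H`. -/
structure QuasiBialgebra (k H : Type*) [Field k] [Ring H] [Algebra k H] where
  Δ : H →ₐ[k] H ⊗[k] H
  ε : H →ₐ[k] k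
  /-- the reassociator -/
  Φ : (H ⊗[k] (H ⊗[k] H))ˣ
  /-- `(id ⊗ Δ)(Δ(h)) = Φ (Δ ⊗ id)(Δ(h)) Φ⁻¹` -/
  quasi_coassoc : ∀ h, onRest k H Δ (Δ h) = ↑Φ * onFirst k H Δ (Δ h) * ↑Φ⁻¹
  counit_right : ∀ h, dropLast k H ε (Δ h) = h
  counit_left : ∀ h, dropFirst k H ε (Δ h) = h
  /-- `(1 ⊗ Φ)(id ⊗ Δ ⊗ id)(Φ)(Φ ⊗ 1) = (id ⊗ id ⊗ Δ)(Φ)(Δ ⊗ id ⊗ id)(Φ)` -/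
  cocycle :
    oneLeft k H (H ⊗[k] (H ⊗[k] H)) Φ * onRest k H (onFirst k H Δ) Φ
        * onRest k H (onRest k H (oneRight k H H)) Φ
      = onRest k H (onRest k H Δ) Φ * onFirst k (H ⊗[k] H) Δ Φ
  /-- `(id ⊗ ε ⊗ id)(Φ) = 1 ⊗ 1` -/
  counit_Φ : onRest k H (dropFirst k H ε) Φ = 1

/-- A quasi-Hopf algebra structure `(Δ, ε, Φ, S, α, β)` on the `k`-algebra `H`, with
bijective antipode and with the usual normalization `ε(α) = ε(β) = 1`. -/
structure QuasiHopf (k H : Type*) [Field k] [Ring H] [Algebra k H] extends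
    QuasiBialgebra k H where
  /-- the antipode, an anti-automorphism of the algebra `H` -/
  S : H ≃ₗ[k] H
  S_one : S 1 = 1
  S_mul : ∀ h h', S (h * h') = S h' * S h
  α : H
  β : H
  /-- `S(h₁) α h₂ = ε(h) α` -/
  antipode_α : ∀ h,
    mulMap k (LinearMap.mulRight k α ∘ₗ S.toLinearMap) LinearMap.id (Δ h) = ε h • α
  /-- `h₁ β S(h₂) = ε(h) β` -/
  antipode_β : ∀ h,
    mulMap k (LinearMap.mulRight k β) S.toLinearMap (Δ h) = ε h • β
  /-- `X¹ β S(X²) α X³ = 1` -/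
  antipode_Φ :
    mulMap k (LinearMap.mulRight k β)
      (mulMap k (LinearMap.mulRight k α ∘ₗ S.toLinearMap) LinearMap.id)
      (Φ : H ⊗[k] (H ⊗[k] H)) = 1
  /-- `S(x¹) α x² β S(x³) = 1` -/
  antipode_Φ_inv :
    mulMap k (LinearMap.mulRight k α ∘ₗ S.toLinearMap)
      (mulMap k (LinearMap.mulRight k β) S.toLinearMap)
      (↑Φ⁻¹ : H ⊗[k] (H ⊗[k] H)) = 1
  ε_α : ε α = 1
  ε_β : ε β = 1

/-! ### Comodule algebras and bicomodule algebras -/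

/-- A right comodule algebra structure `(ρ, Φ_ρ)` on the algebra `A`. -/
structure RightComoduleAlgebra {k H : Type*} [Field k] [Ring H] [Algebra k H]
    (Q : QuasiBialgebra k H) (A : Type*) [Ring A] [Algebra k A] where
  ρ : A →ₐ[k] A ⊗[k] H
  Φρ : (A ⊗[k] (H ⊗[k] H))ˣ
  /-- `Φ_ρ (ρ ⊗ id)(ρ(a)) = (id ⊗ Δ)(ρ(a)) Φ_ρ` -/
  coassoc_ρ : ∀ a, ↑Φρ * onFirst k H ρ (ρ a) = onRest k A Q.Δ (ρ a) * ↑Φρ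
  /-- `(1 ⊗ Φ)(id ⊗ Δ ⊗ id)(Φ_ρ)(Φ_ρ ⊗ 1) = (id ⊗ id ⊗ Δ)(Φ_ρ)(ρ ⊗ id ⊗ id)(Φ_ρ)` -/
  cocycle_ρ :
    oneLeft k A (H ⊗[k] (H ⊗[k] H)) Q.Φ * onRest k A (onFirst k H Q.Δ) Φρ
        * onRest k A (onRest k H (oneRight k H H)) Φρ
      = onRest k A (onRest k H Q.Δ) Φρ * onFirst k (H ⊗[k] H) ρ Φρ
  counit_ρ : ∀ a, dropLast k A Q.ε (ρ a) = a
  counit_Φρ_mid : onRest k A (dropFirst k H Q.ε) Φρ = 1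
  counit_Φρ_last : onRest k A (dropLast k H Q.ε) Φρ = 1

/-- A left comodule algebra structure `(λ, Φ_λ)` on the algebra `B`. -/
structure LeftComoduleAlgebra {k H : Type*} [Field k] [Ring H] [Algebra k H]
    (Q : QuasiBialgebra k H) (B : Type*) [Ring B] [Algebra k B] where
  lam : B →ₐ[k] H ⊗[k] B
  Φlam : (H ⊗[k] (H ⊗[k] B))ˣ
  /-- `(id ⊗ λ)(λ(b)) Φ_λ = Φ_λ (Δ ⊗ id)(λ(b))` -/
  coassoc_lam : ∀ b, onRest k H lam (lam b) * ↑Φlam = ↑Φlam * onFirst k B Q.Δ (lam b)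
  /-- `(1 ⊗ Φ_λ)(id ⊗ Δ ⊗ id)(Φ_λ)(Φ ⊗ 1) = (id ⊗ id ⊗ λ)(Φ_λ)(Δ ⊗ id ⊗ id)(Φ_λ)` -/
  cocycle_lam :
    oneLeft k H (H ⊗[k] (H ⊗[k] B)) Φlam * onRest k H (onFirst k B Q.Δ) Φlam
        * onRest k H (onRest k H (oneRight k H B)) Q.Φ
      = onRest k H (onRest k H lam) Φlam * onFirst k (H ⊗[k] B) Q.Δ Φlam
  counit_lam : ∀ b, dropFirst k B Q.ε (lam b) = b
  counit_Φlam_mid : onRest k H (dropFirst k B Q.ε) Φlam = 1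
  counit_Φlam_first : dropFirst k (H ⊗[k] B) Q.ε Φlam = 1

/-- A bicomodule algebra structure `(λ, ρ, Φ_λ, Φ_ρ, Φ_{λ,ρ})` on the algebra `A`. -/
structure BicomoduleAlgebra {k H : Type*} [Field k] [Ring H] [Algebra k H]
    (Q : QuasiBialgebra k H) (A : Type*) [Ring A] [Algebra k A] extends
    LeftComoduleAlgebra Q A, RightComoduleAlgebra Q A where
  Φlr : (H ⊗[k] (A ⊗[k] H))ˣ
  /-- `Φ_{λ,ρ} (λ ⊗ id)(ρ(u)) = (id ⊗ ρ)(λ(u)) Φ_{λ,ρ}` -/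
  quasi_comm : ∀ u, ↑Φlr * onFirst k H lam (ρ u) = onRest k H ρ (lam u) * ↑Φlr
  /-- `(1 ⊗ Φ_{λ,ρ})(id ⊗ λ ⊗ id)(Φ_{λ,ρ})(Φ_λ ⊗ 1)
      = (id ⊗ id ⊗ ρ)(Φ_λ)(Δ ⊗ id ⊗ id)(Φ_{λ,ρ})` -/
  compat_lam :
    oneLeft k H (H ⊗[k] (A ⊗[k] H)) Φlr * onRest k H (onFirst k H lam) Φlr
        * onRest k H (onRest k H (oneRight k A H)) Φlam
      = onRest k H (onRest k H ρ) Φlam * onFirst k (A ⊗[k] H) Q.Δ Φlr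
  /-- `(1 ⊗ Φ_ρ)(id ⊗ ρ ⊗ id)(Φ_{λ,ρ})(Φ_{λ,ρ} ⊗ 1)
      = (id ⊗ id ⊗ Δ)(Φ_{λ,ρ})(λ ⊗ id ⊗ id)(Φ_ρ)` -/
  compat_ρ :
    oneLeft k H (A ⊗[k] (H ⊗[k] H)) Φρ * onRest k H (onFirst k H ρ) Φlr
        * onRest k H (onRest k A (oneRight k H H)) Φlr
      = onRest k H (onRest k A Q.Δ) Φlr * onFirst k (H ⊗[k] H) lam Φρ

/-! ### Bimodules, bimodule coalgebras and bimodule algebras -/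

/-- An `H`-bimodule structure on the `k`-vector space `M`:
`left h m = h · m` and `right h m = m · h`. -/
structure Bimodule (k H M : Type*) [Field k] [Ring H] [Algebra k H] [AddCommGroup M]
    [Module k M] where
  left : H →ₗ[k] Module.End k M
  right : H →ₗ[k] Module.End k M
  left_one : ∀ m, left 1 m = m
  left_mul : ∀ h h' m, left (h * h') m = left h (left h' m)
  right_one : ∀ m, right 1 m = m
  right_mul : ∀ h h' m, right (h * h') m = right h' (right h m)
  left_right : ∀ h h' m, left h (right h' m) = right h' (left h m)

section TensorAct

variable {k : Type*} [Field k] {P P' M M' : Type*} [AddCommGroup P] [Module k P]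
  [AddCommGroup P'] [Module k P'] [AddCommGroup M] [Module k M] [AddCommGroup M'] [Module k M']

/-- Componentwise action: `tensorAct a b (p ⊗ p') (m ⊗ m') = a p m ⊗ b p' m'`. -/
def tensorAct (a : P →ₗ[k] Module.End k M) (b : P' →ₗ[k] Module.End k M') :
    P ⊗[k] P' →ₗ[k] Module.End k (M ⊗[k] M') :=
  TensorProduct.homTensorHomMap (σ₁₂ := RingHom.id k) M M' M M' ∘ₗ TensorProduct.map a b

theorem tensorAct_tmul (a : P →ₗ[k] Module.End k M) (b : P' →ₗ[k] Module.End k M')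
    (p : P) (p' : P') (m : M) (m' : M') :
    tensorAct a b (p ⊗ₜ[k] p') (m ⊗ₜ[k] m') = a p m ⊗ₜ[k] b p' m' := by
  simp [tensorAct]

end TensorAct

/-- An `H`-bimodule coalgebra structure on the vector space `C`: a coalgebra in the monoidal
category of `H`-bimodules. -/
structure BimoduleCoalgebra {k H : Type*} [Field k] [Ring H] [Algebra k H]
    (Q : QuasiBialgebra k H) (C : Type*) [AddCommGroup C] [Module k C] extends
    Bimodule k H C where
  comul : C →ₗ[k] C ⊗[k] C
  counit : C →ₗ[k] k
  /-- `Φ · (Δ ⊗ id)(Δ(c)) · Φ⁻¹ = (id ⊗ Δ)(Δ(c))` -/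
  coassoc : ∀ c,
    tensorAct right (tensorAct right right) (↑Q.Φ⁻¹ : H ⊗[k] (H ⊗[k] H))
      (tensorAct left (tensorAct left left) (Q.Φ : H ⊗[k] (H ⊗[k] H))
        (TensorProduct.assoc k C C C (TensorProduct.map comul LinearMap.id (comul c))))
      = TensorProduct.map LinearMap.id comul (comul c)
  comul_left : ∀ h c, comul (left h c) = tensorAct left left (Q.Δ h) (comul c)
  comul_right : ∀ h c, comul (right h c) = tensorAct right right (Q.Δ h) (comul c)
  counit_comul_left : ∀ c,
    TensorProduct.lid k C (TensorProduct.map counit LinearMap.id (comul c)) = c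
  counit_comul_right : ∀ c,
    TensorProduct.rid k C (TensorProduct.map LinearMap.id counit (comul c)) = c
  counit_left : ∀ h c, counit (left h c) = Q.ε h * counit c
  counit_right : ∀ h c, counit (right h c) = counit c * Q.ε h

/-- An `H`-bimodule algebra structure on the vector space `M`: an algebra in the monoidal
category of `H`-bimodules. -/
structure BimoduleAlgebra {k H : Type*} [Field k] [Ring H] [Algebra k H]
    (Q : QuasiBialgebra k H) (M : Type*) [AddCommGroup M] [Module k M] extends
    Bimodule k H M where
  mul : M →ₗ[k] M →ₗ[k] M
  one : M
  /-- `(a b) c = (X¹ · a · x¹) [(X² · b · x²) (X³ · c · x³)]` -/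
  quasi_assoc : ∀ a b c, mul (mul a b) c =
    TensorProduct.lift mul (TensorProduct.map LinearMap.id (TensorProduct.lift mul)
      (tensorAct right (tensorAct right right) (↑Q.Φ⁻¹ : H ⊗[k] (H ⊗[k] H))
        (tensorAct left (tensorAct left left) (Q.Φ : H ⊗[k] (H ⊗[k] H))
          (a ⊗ₜ[k] (b ⊗ₜ[k] c)))))
  one_mul' : ∀ a, mul one a = a
  mul_one' : ∀ a, mul a one = a
  left_map_mul : ∀ h a b, left h (mul a b) =
    TensorProduct.lift mul (tensorAct left left (Q.Δ h) (a ⊗ₜ[k] b))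
  right_map_mul : ∀ h a b, right h (mul a b) =
    TensorProduct.lift mul (tensorAct right right (Q.Δ h) (a ⊗ₜ[k] b))
  left_map_one : ∀ h, left h one = Q.ε h • one
  right_map_one : ∀ h, right h one = Q.ε h • one

/-! ### The linear dual of a bimodule coalgebra -/

section Dual

variable {k : Type*} [Field k]

/-- The transpose of an action: `(transposeAct a p) φ = φ ∘ a p`. -/
def transposeAct {P C : Type*} [AddCommGroup P] [Module k P] [AddCommGroup C] [Module k C]
    (a : P →ₗ[k] Module.End k C) : P →ₗ[k] Module.End k (Module.Dual k C) where
  toFun p := Module.Dual.transpose (a p)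
  map_add' p q := by ext; simp [Module.Dual.transpose]
  map_smul' t p := by ext; simp [Module.Dual.transpose]

/-- The convolution `(φ ψ)(c) = φ(c₁) ψ(c₂)`. -/
def convolution {C : Type*} [AddCommGroup C] [Module k C] (d : C →ₗ[k] C ⊗[k] C) :
    Module.Dual k C →ₗ[k] Module.Dual k C →ₗ[k] Module.Dual k C :=
  LinearMap.mk₂ k (fun φ ψ => LinearMap.mul' k k ∘ₗ TensorProduct.map φ ψ ∘ₗ d)
    (fun φ φ' ψ => by simp [TensorProduct.map_add_left, LinearMap.add_comp, LinearMap.comp_add])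
    (fun t φ ψ => by simp [TensorProduct.map_smul_left, LinearMap.smul_comp, LinearMap.comp_smul])
    (fun φ ψ ψ' => by simp [TensorProduct.map_add_right, LinearMap.add_comp, LinearMap.comp_add])
    (fun t φ ψ => by
      simp [TensorProduct.map_smul_right, LinearMap.smul_comp, LinearMap.comp_smul])

theorem convolution_apply {C : Type*} [AddCommGroup C] [Module k C] (d : C →ₗ[k] C ⊗[k] C)
    (φ ψ : Module.Dual k C) (c : C) :
    convolution d φ ψ c = TensorProduct.dualDistrib k C C (φ ⊗ₜ[k] ψ) (d c) := by
  simp only [convolution, LinearMap.mk₂_apply, LinearMap.comp_apply]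
  generalize d c = z
  induction z using TensorProduct.induction_on with
  | zero => simp
  | tmul x y => simp
  | add x y hx hy => simp only [map_add, hx, hy]

theorem lift_convolution_apply {C : Type*} [AddCommGroup C] [Module k C]
    (d : C →ₗ[k] C ⊗[k] C) (t : Module.Dual k C ⊗[k] Module.Dual k C) (c : C) :
    TensorProduct.lift (convolution d) t c = TensorProduct.dualDistrib k C C t (d c) := by
  induction t using TensorProduct.induction_on with
  | zero => simp
  | tmul x y => rw [TensorProduct.lift.tmul, convolution_apply]
  | add x y hx hy => simp only [map_add, LinearMap.add_apply, hx, hy]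

theorem dualDistrib_map {C : Type*} [AddCommGroup C] [Module k C]
    (d : C →ₗ[k] C ⊗[k] C)
    (t : Module.Dual k C ⊗[k] (Module.Dual k C ⊗[k] Module.Dual k C)) (z : C ⊗[k] C) :
    TensorProduct.dualDistrib k C C
        (TensorProduct.map LinearMap.id (TensorProduct.lift (convolution d)) t) z
      = TensorProduct.dualDistrib k C (C ⊗[k] C)
          (TensorProduct.map LinearMap.id (TensorProduct.dualDistrib k C C) t)
          (TensorProduct.map LinearMap.id d z) := by
  induction t using TensorProduct.induction_on with
  | zero => simp
  | add x y hx hy => simp only [map_add, LinearMap.add_apply, hx, hy]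
  | tmul φ s =>
    induction z using TensorProduct.induction_on with
    | zero => simp
    | add x y hx hy => simp only [map_add, hx, hy]
    | tmul x y => simp [lift_convolution_apply]

theorem dualDistrib_act {P P' C C' : Type*} [AddCommGroup P] [Module k P]
    [AddCommGroup P'] [Module k P'] [AddCommGroup C] [Module k C] [AddCommGroup C'] [Module k C']
    (a : P →ₗ[k] Module.End k C) (b : P' →ₗ[k] Module.End k C') (X : P ⊗[k] P')
    (t : Module.Dual k C ⊗[k] Module.Dual k C') (z : C ⊗[k] C') :
    TensorProduct.dualDistrib k C C' (tensorAct (transposeAct a) (transposeAct b) X t) z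
      = TensorProduct.dualDistrib k C C' t (tensorAct a b X z) := by
  induction X using TensorProduct.induction_on with
  | zero => simp
  | add x y hx hy => simp only [map_add, LinearMap.add_apply, hx, hy]
  | tmul p p' =>
    induction t using TensorProduct.induction_on with
    | zero => simp
    | add x y hx hy => simp only [map_add, LinearMap.add_apply, hx, hy]
    | tmul φ ψ =>
      induction z using TensorProduct.induction_on with
      | zero => simp
      | add x y hx hy => simp only [map_add, hx, hy]
      | tmul x y => simp [tensorAct_tmul, transposeAct, Module.Dual.transpose]

theorem dualDistrib_act₃ {P C : Type*} [AddCommGroup P] [Module k P] [AddCommGroup C] [Module k C]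
    (a : P →ₗ[k] Module.End k C) (X : P ⊗[k] (P ⊗[k] P))
    (t : Module.Dual k C ⊗[k] (Module.Dual k C ⊗[k] Module.Dual k C)) (z : C ⊗[k] (C ⊗[k] C)) :
    TensorProduct.dualDistrib k C (C ⊗[k] C)
        (TensorProduct.map LinearMap.id (TensorProduct.dualDistrib k C C)
          (tensorAct (transposeAct a) (tensorAct (transposeAct a) (transposeAct a)) X t)) z
      = TensorProduct.dualDistrib k C (C ⊗[k] C)
          (TensorProduct.map LinearMap.id (TensorProduct.dualDistrib k C C) t)
          (tensorAct a (tensorAct a a) X z) := by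
  induction X using TensorProduct.induction_on with
  | zero => simp
  | add x y hx hy => simp only [map_add, LinearMap.add_apply, hx, hy]
  | tmul p X =>
    induction t using TensorProduct.induction_on with
    | zero => simp
    | add x y hx hy => simp only [map_add, LinearMap.add_apply, hx, hy]
    | tmul φ t =>
      induction z using TensorProduct.induction_on with
      | zero => simp
      | add x y hx hy => simp only [map_add, hx, hy]
      | tmul x y =>
        simp only [tensorAct_tmul, TensorProduct.map_tmul, LinearMap.id_apply,
          TensorProduct.dualDistrib_apply, dualDistrib_act]
        rfl

theorem transposeAct_apply {P C : Type*} [AddCommGroup P] [Module k P] [AddCommGroup C]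
    [Module k C] (a : P →ₗ[k] Module.End k C) (p : P) (φ : Module.Dual k C) (c : C) :
    transposeAct a p φ c = φ (a p c) := rfl

end Dual

section TensorActAlg

variable {k : Type*} [Field k] {P P' M M' : Type*} [Ring P] [Algebra k P]
  [Ring P'] [Algebra k P'] [AddCommGroup M] [Module k M] [AddCommGroup M'] [Module k M']

theorem tensorAct_one {a : P →ₗ[k] Module.End k M} {b : P' →ₗ[k] Module.End k M'}
    (ha : ∀ m, a 1 m = m) (hb : ∀ m, b 1 m = m) (z : M ⊗[k] M') :
    tensorAct a b 1 z = z := by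
  induction z using TensorProduct.induction_on with
  | zero => simp
  | add x y hx hy => simp only [map_add, hx, hy]
  | tmul x y => rw [Algebra.TensorProduct.one_def, tensorAct_tmul, ha, hb]

theorem tensorAct_mul {a : P →ₗ[k] Module.End k M} {b : P' →ₗ[k] Module.End k M'}
    (ha : ∀ p q m, a (p * q) m = a p (a q m)) (hb : ∀ p q m, b (p * q) m = b p (b q m))
    (X Y : P ⊗[k] P') (z : M ⊗[k] M') :
    tensorAct a b (X * Y) z = tensorAct a b X (tensorAct a b Y z) := by
  induction X using TensorProduct.induction_on with
  | zero => simp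
  | add x y hx hy => simp only [add_mul, map_add, LinearMap.add_apply, hx, hy]
  | tmul p p' =>
    induction Y using TensorProduct.induction_on with
    | zero => simp
    | add x y hx hy => simp only [mul_add, map_add, LinearMap.add_apply, hx, hy]
    | tmul q q' =>
      induction z using TensorProduct.induction_on with
      | zero => simp
      | add x y hx hy => simp only [map_add, hx, hy]
      | tmul x y =>
        simp only [Algebra.TensorProduct.tmul_mul_tmul, tensorAct_tmul, ha, hb]

theorem tensorAct_mul_rev {a : P →ₗ[k] Module.End k M} {b : P' →ₗ[k] Module.End k M'}
    (ha : ∀ p q m, a (p * q) m = a q (a p m)) (hb : ∀ p q m, b (p * q) m = b q (b p m))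
    (X Y : P ⊗[k] P') (z : M ⊗[k] M') :
    tensorAct a b (X * Y) z = tensorAct a b Y (tensorAct a b X z) := by
  induction X using TensorProduct.induction_on with
  | zero => simp
  | add x y hx hy => simp only [add_mul, map_add, LinearMap.add_apply, hx, hy]
  | tmul p p' =>
    induction Y using TensorProduct.induction_on with
    | zero => simp
    | add x y hx hy => simp only [mul_add, map_add, LinearMap.add_apply, hx, hy]
    | tmul q q' =>
      induction z using TensorProduct.induction_on with
      | zero => simp
      | add x y hx hy => simp only [map_add, hx, hy]
      | tmul x y =>
        simp only [Algebra.TensorProduct.tmul_mul_tmul, tensorAct_tmul, ha, hb]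

theorem tensorAct_comm {a c : P →ₗ[k] Module.End k M} {b d : P' →ₗ[k] Module.End k M'}
    (ha : ∀ p q m, a p (c q m) = c q (a p m)) (hb : ∀ p q m, b p (d q m) = d q (b p m))
    (X Y : P ⊗[k] P') (z : M ⊗[k] M') :
    tensorAct a b X (tensorAct c d Y z) = tensorAct c d Y (tensorAct a b X z) := by
  induction X using TensorProduct.induction_on with
  | zero => simp
  | add x y hx hy => simp only [map_add, LinearMap.add_apply, hx, hy]
  | tmul p p' =>
    induction Y using TensorProduct.induction_on with
    | zero => simp
    | add x y hx hy => simp only [map_add, LinearMap.add_apply, hx, hy]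
    | tmul q q' =>
      induction z using TensorProduct.induction_on with
      | zero => simp
      | add x y hx hy => simp only [map_add, hx, hy]
      | tmul x y => simp only [tensorAct_tmul, ha, hb]

end TensorActAlg

/-- The linear dual `C*` of an `H`-bimodule coalgebra `C` is an `H`-bimodule algebra: the
multiplication is the convolution, the unit is the counit of `C`, and
`(h ⇀ φ ↼ h')(c) = φ(h' · c · h)`. -/
def BimoduleCoalgebra.dual {k H : Type*} [Field k] [Ring H] [Algebra k H]
    {Q : QuasiBialgebra k H} {C : Type*} [AddCommGroup C] [Module k C]
    (K : BimoduleCoalgebra Q C) : BimoduleAlgebra Q (Module.Dual k C) where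
  left := transposeAct K.right
  right := transposeAct K.left
  left_one φ := by ext c; simp [transposeAct_apply, K.right_one]
  left_mul h h' φ := by ext c; simp [transposeAct_apply, K.right_mul]
  right_one φ := by ext c; simp [transposeAct_apply, K.left_one]
  right_mul h h' φ := by ext c; simp [transposeAct_apply, K.left_mul]
  left_right h h' φ := by ext c; simp [transposeAct_apply, K.left_right]
  mul := convolution K.comul
  one := K.counit
  quasi_assoc φ ψ ξ := by
    ext c
    rw [lift_convolution_apply, dualDistrib_map, dualDistrib_act₃, dualDistrib_act₃, ← K.coassoc]
    rw [tensorAct_comm K.left_right (tensorAct_comm K.left_right K.left_right),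
      ← tensorAct_mul_rev K.right_mul (tensorAct_mul_rev K.right_mul K.right_mul),
      ← tensorAct_mul K.left_mul (tensorAct_mul K.left_mul K.left_mul),
      Units.inv_mul, tensorAct_one K.right_one (tensorAct_one K.right_one K.right_one),
      tensorAct_one K.left_one (tensorAct_one K.left_one K.left_one), convolution_apply]
    generalize K.comul c = z
    induction z using TensorProduct.induction_on with
    | zero => simp
    | add x y hx hy => simp only [map_add, hx, hy]
    | tmul x y =>
      simp only [TensorProduct.dualDistrib_apply, TensorProduct.map_tmul, LinearMap.id_apply,
        convolution_apply]
      generalize K.comul x = w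
      induction w using TensorProduct.induction_on with
      | zero => simp
      | add x y hx hy => simp only [map_add, TensorProduct.add_tmul, add_mul, hx, hy]
      | tmul x y => simp [mul_assoc]
  one_mul' φ := by
    ext c
    have h := congrArg φ (K.counit_comul_left c)
    rw [convolution_apply, ← h]
    generalize K.comul c = z
    induction z using TensorProduct.induction_on with
    | zero => simp
    | add x y hx hy => simp only [map_add, hx, hy]
    | tmul x y => simp
  mul_one' φ := by
    ext c
    have h := congrArg φ (K.counit_comul_right c)
    rw [convolution_apply, ← h]
    generalize K.comul c = z
    induction z using TensorProduct.induction_on with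
    | zero => simp
    | add x y hx hy => simp only [map_add, hx, hy]
    | tmul x y => simp [mul_comm]
  left_map_mul h φ ψ := by
    ext c
    rw [lift_convolution_apply, dualDistrib_act, transposeAct_apply, convolution_apply,
      K.comul_right]
  right_map_mul h φ ψ := by
    ext c
    rw [lift_convolution_apply, dualDistrib_act, transposeAct_apply, convolution_apply,
      K.comul_left]
  left_map_one h := by ext c; simp [transposeAct_apply, K.counit_right, mul_comm]
  right_map_one h := by ext c; simp [transposeAct_apply, K.counit_left]

/-! ### Products on a vector space, regarded as (candidates for) algebra structures -/

/-- A bilinear product and a distinguished element on the vector space `V`. -/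
@[ext]
structure Product (k V : Type*) [Field k] [AddCommGroup V] [Module k V] where
  mul : V →ₗ[k] V →ₗ[k] V
  one : V

section Product

variable {k : Type*} [Field k] {V W : Type*} [AddCommGroup V] [Module k V]
  [AddCommGroup W] [Module k W]

/-- The product is an associative algebra structure on `V` with the distinguished element as
unit. -/
structure Product.IsAlgebra (p : Product k V) : Prop where
  assoc : ∀ x y z, p.mul (p.mul x y) z = p.mul x (p.mul y z)
  one_mul : ∀ x, p.mul p.one x = x
  mul_one : ∀ x, p.mul x p.one = x

/-- Isomorphism of unital algebras. -/
def Product.Iso (p : Product k V) (q : Product k W) : Prop :=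
  ∃ e : V ≃ₗ[k] W, e p.one = q.one ∧ ∀ x y, e (p.mul x y) = q.mul (e x) (e y)

end Product

/-! ### Products on `A ⊗ M` and `M ⊗ A` -/

section Construct

variable {k : Type*} [Field k]

/-- `(a ⊗ (p ⊗ q)) ⊗ (φ ⊗ ψ) ↦ a ⊗ (act p φ)(act q ψ)`. -/
def evalTensor {A P M : Type*} [AddCommGroup A] [Module k A] [AddCommGroup P] [Module k P]
    [AddCommGroup M] [Module k M] (act : P →ₗ[k] Module.End k M) (mul : M →ₗ[k] M →ₗ[k] M) :
    (A ⊗[k] (P ⊗[k] P)) ⊗[k] (M ⊗[k] M) →ₗ[k] A ⊗[k] M :=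
  TensorProduct.map LinearMap.id
      (TensorProduct.lift mul ∘ₗ TensorProduct.lift (tensorAct act act)) ∘ₗ
    (TensorProduct.assoc k A (P ⊗[k] P) (M ⊗[k] M)).toLinearMap

/-- The product `(u ⊗ φ)(u' ⊗ ψ) = a ⊗ (act p φ)(act q ψ)` on `A ⊗ M`, where
`a ⊗ (p ⊗ q) = E u u'`. -/
def productAM {A P M : Type*} [AddCommGroup A] [Module k A] [AddCommGroup P] [Module k P]
    [AddCommGroup M] [Module k M] (act : P →ₗ[k] Module.End k M) (mul : M →ₗ[k] M →ₗ[k] M)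
    (E : A →ₗ[k] A →ₗ[k] A ⊗[k] (P ⊗[k] P)) :
    A ⊗[k] M →ₗ[k] A ⊗[k] M →ₗ[k] A ⊗[k] M :=
  TensorProduct.curry
    (evalTensor act mul ∘ₗ TensorProduct.map (TensorProduct.lift E) LinearMap.id ∘ₗ
      (TensorProduct.tensorTensorTensorComm k A M A M).toLinearMap)

/-- The product `(φ ⊗ u)(ψ ⊗ u') = (act p φ)(act q ψ) ⊗ a` on `M ⊗ A`, where
`a ⊗ (p ⊗ q) = E u u'`. -/
def productMA {A P M : Type*} [AddCommGroup A] [Module k A] [AddCommGroup P] [Module k P]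
    [AddCommGroup M] [Module k M] (act : P →ₗ[k] Module.End k M) (mul : M →ₗ[k] M →ₗ[k] M)
    (E : A →ₗ[k] A →ₗ[k] A ⊗[k] (P ⊗[k] P)) :
    M ⊗[k] A →ₗ[k] M ⊗[k] A →ₗ[k] M ⊗[k] A :=
  TensorProduct.curry
    ((TensorProduct.comm k A M).toLinearMap ∘ₗ evalTensor act mul ∘ₗ
      TensorProduct.map (TensorProduct.lift E) LinearMap.id ∘ₗ
      (TensorProduct.comm k (M ⊗[k] M) (A ⊗[k] A)).toLinearMap ∘ₗ
      (TensorProduct.tensorTensorTensorComm k M A M A).toLinearMap)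

/-- The right generalized smash product `A ⋊ M` over an algebra `K`, with the product
`(u ⋊ φ)(u' ⋊ ψ) = u u'₀ x̃¹ ⋊ (φ · u'₁ x̃²)(ψ · x̃³)`, where `u'₀ ⊗ u'₁ = ρ(u')`, where
`x̃¹ ⊗ x̃² ⊗ x̃³` is the inverse of the reassociator `Φρ`, and where `act κ φ = φ · κ`
is the right action of `K` on the algebra `M` with product `mul` and unit `one`. Only these
data of the right `K`-comodule algebra `A` and of the right `K`-module algebra `M` enter. -/
def smashProduct {A K M : Type*} [Ring A] [Algebra k A] [Ring K] [Algebra k K]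
    [AddCommGroup M] [Module k M] (ρ : A →ₐ[k] A ⊗[k] K) (Φρ : A ⊗[k] (K ⊗[k] K))
    (act : K →ₗ[k] Module.End k M) (mul : M →ₗ[k] M →ₗ[k] M) (one : M) :
    Product k (A ⊗[k] M) where
  mul := productAM act mul
    (LinearMap.mk₂ k
      (fun u u' => (u ⊗ₜ[k] (1 : K ⊗[k] K)) * onRest k A (oneRight k K K) (ρ u')
        * Ring.inverse Φρ)
      (fun u v u' => by simp only [TensorProduct.add_tmul, add_mul])
      (fun t u u' => by rw [← TensorProduct.smul_tmul', smul_mul_assoc, smul_mul_assoc])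
      (fun u u' v' => by simp only [map_add, mul_add, add_mul])
      (fun t u u' => by simp only [map_smul, mul_smul_comm, smul_mul_assoc]))
  one := 1 ⊗ₜ[k] one

end Construct

/-! ### The Drinfeld twist -/

namespace QuasiHopf

variable {k H : Type*} [Field k] [Ring H] [Algebra k H] (Q : QuasiHopf k H)

/-- The inverse of the antipode. -/
def Sinv : H →ₗ[k] H := Q.S.symm.toLinearMap

/-- `h ⊗ h' ↦ S(h) α h'`. -/
def contrα : H ⊗[k] H →ₗ[k] H :=
  mulMap k (LinearMap.mulRight k Q.α ∘ₗ Q.S.toLinearMap) LinearMap.id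

/-- `h ⊗ h' ↦ h β S(h')`. -/
def contrβ : H ⊗[k] H →ₗ[k] H :=
  mulMap k (LinearMap.mulRight k Q.β) Q.S.toLinearMap

/-- `γ = S(A²) α A³ ⊗ S(A¹) α A⁴`, where
`A¹ ⊗ A² ⊗ A³ ⊗ A⁴ = (Φ ⊗ 1)(Δ ⊗ id ⊗ id)(Φ⁻¹)`. -/
def γ : H ⊗[k] H :=
  TensorProduct.map Q.contrα Q.contrα
    (TensorProduct.leftComm k H (H ⊗[k] H) H
      (TensorProduct.map LinearMap.id (TensorProduct.assoc k H H H).symm.toLinearMap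
        (onRest k H (onRest k H (oneRight k H H)) Q.Φ
          * onFirst k (H ⊗[k] H) Q.Δ (↑Q.Φ⁻¹ : H ⊗[k] (H ⊗[k] H)))))

/-- The Drinfeld twist `f = (S ⊗ S)(Δᶜᵒᵖ(x¹)) γ Δ(x² β S(x³))`, where
`x¹ ⊗ x² ⊗ x³ = Φ⁻¹`. -/
def twist : H ⊗[k] H :=
  mulMap k
    (LinearMap.mulRight k Q.γ ∘ₗ TensorProduct.map Q.S.toLinearMap Q.S.toLinearMap ∘ₗ
      (TensorProduct.comm k H H).toLinearMap ∘ₗ Q.Δ.toLinearMap)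
    (Q.Δ.toLinearMap ∘ₗ Q.contrβ)
    (↑Q.Φ⁻¹ : H ⊗[k] (H ⊗[k] H))

/-- The inverse `f⁻¹` of the Drinfeld twist. -/
def twistInv : H ⊗[k] H := Ring.inverse Q.twist

/-- `S⁻¹` as an algebra morphism `H → Hᵒᵖ`. -/
def SinvOp : H →ₐ[k] Hᵐᵒᵖ :=
  AlgHom.ofLinearMap ((MulOpposite.opLinearEquiv k).toLinearMap ∘ₗ Q.Sinv)
    (by
      have h : Q.S.symm 1 = 1 := by rw [LinearEquiv.symm_apply_eq, Q.S_one]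
      simp [Sinv, h])
    (fun x y => by
      have h : Q.S.symm (x * y) = Q.S.symm y * Q.S.symm x := by
        rw [LinearEquiv.symm_apply_eq, Q.S_mul]; simp
      simp [Sinv, h])

end QuasiHopf

section Regroup

variable {k : Type*} [Field k]

/-- `p ⊗ q ⊗ a ⊗ r ⊗ t ↦ a ⊗ (q ⊗ r) ⊗ (p ⊗ t)`. -/
def regroup (P P' A R T : Type*) [Ring P] [Algebra k P] [Ring P'] [Algebra k P'] [Ring A]
    [Algebra k A] [Ring R] [Algebra k R] [Ring T] [Algebra k T] :
    P ⊗[k] (P' ⊗[k] (A ⊗[k] (R ⊗[k] T))) →ₐ[k] A ⊗[k] ((P' ⊗[k] R) ⊗[k] (P ⊗[k] T)) :=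
  (onRest k A ((Algebra.TensorProduct.leftComm k P (P' ⊗[k] R) T).toAlgHom.comp
      (onRest k P (Algebra.TensorProduct.assoc k k k P' R T).symm.toAlgHom))).comp
    ((Algebra.TensorProduct.leftComm k P A (P' ⊗[k] (R ⊗[k] T))).toAlgHom.comp
      (onRest k P (Algebra.TensorProduct.leftComm k P' A (R ⊗[k] T)).toAlgHom))

theorem regroup_tmul {P P' A R T : Type*} [Ring P] [Algebra k P] [Ring P'] [Algebra k P'] [Ring A]
    [Algebra k A] [Ring R] [Algebra k R] [Ring T] [Algebra k T]
    (p : P) (q : P') (a : A) (r : R) (t : T) :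
    regroup (k := k) P P' A R T (p ⊗ₜ (q ⊗ₜ (a ⊗ₜ (r ⊗ₜ t)))) =
      a ⊗ₜ ((q ⊗ₜ r) ⊗ₜ (p ⊗ₜ t)) := by
  simp [regroup, onRest]

end Regroup

/-! ### The comodule algebras `A¹`, `A²` over `Hᵒᵖ ⊗ H` and the smash products -/

section Smash

variable {k H : Type*} [Field k] [Ring H] [Algebra k H] (Q : QuasiHopf k H)
  {A : Type*} [Ring A] [Algebra k A] (𝔸 : BicomoduleAlgebra Q.toQuasiBialgebra A)

/-- `δ_l = (λ ⊗ id) ∘ ρ`. -/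
def δl {Q : QuasiBialgebra k H} (𝔸 : BicomoduleAlgebra Q A) : A →ₐ[k] H ⊗[k] (A ⊗[k] H) :=
  (onFirst k H 𝔸.lam).comp 𝔸.ρ

/-- `δ_r = (id ⊗ ρ) ∘ λ`. -/
def δr {Q : QuasiBialgebra k H} (𝔸 : BicomoduleAlgebra Q A) : A →ₐ[k] H ⊗[k] (A ⊗[k] H) :=
  (onRest k H 𝔸.ρ).comp 𝔸.lam

/-- `h ⊗ a ⊗ h' ↦ a ⊗ (S⁻¹(h) ⊗ h')`, with values in `A ⊗ (Hᵒᵖ ⊗ H)`. -/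
def toRightCoaction (A : Type*) [Ring A] [Algebra k A] :
    H ⊗[k] (A ⊗[k] H) →ₐ[k] A ⊗[k] (Hᵐᵒᵖ ⊗[k] H) :=
  (onRest k A (Algebra.TensorProduct.map Q.SinvOp (AlgHom.id k H))).comp
    (Algebra.TensorProduct.leftComm k H A H).toAlgHom

/-- `ρ₁(u) = u_{<0>[0]} ⊗ (S⁻¹(u_{<0>[-1]}) ⊗ u_{<1>})`. -/
def ρ₁ : A →ₐ[k] A ⊗[k] (Hᵐᵒᵖ ⊗[k] H) := (toRightCoaction Q A).comp (δl 𝔸)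

/-- `ρ₂(u) = u_{[0]<0>} ⊗ (S⁻¹(u_{[-1]}) ⊗ u_{[0]<1>})`. -/
def ρ₂ : A →ₐ[k] A ⊗[k] (Hᵐᵒᵖ ⊗[k] H) := (toRightCoaction Q A).comp (δr 𝔸)

/-- `p ⊗ q ⊗ a ⊗ r ⊗ t ↦ a ⊗ (S⁻¹(q) ⊗ r) ⊗ (S⁻¹(p) ⊗ t)`, with values in
`A ⊗ (Hᵒᵖ ⊗ H) ⊗ (Hᵒᵖ ⊗ H)`. -/
def toReassociator (A : Type*) [Ring A] [Algebra k A] :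
    H ⊗[k] (H ⊗[k] (A ⊗[k] (H ⊗[k] H))) →ₐ[k]
      A ⊗[k] ((Hᵐᵒᵖ ⊗[k] H) ⊗[k] (Hᵐᵒᵖ ⊗[k] H)) :=
  (regroup Hᵐᵒᵖ Hᵐᵒᵖ A H H).comp
    (Algebra.TensorProduct.map Q.SinvOp (Algebra.TensorProduct.map Q.SinvOp (AlgHom.id k _)))

/-- The reassociator
`Φ_{ρ₁} = X̃¹_{ρ[0]} x̃³_λ θ²_{[0]} ⊗ (S⁻¹(f² X̃¹_{ρ[-1]₂} x̃²_λ θ²_{[-1]}) ⊗ X̃²_ρ θ³)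
⊗ (S⁻¹(f¹ X̃¹_{ρ[-1]₁} x̃¹_λ θ¹) ⊗ X̃³_ρ)`, where `X̃_ρ = Φ_ρ`, `x̃_λ = Φ_λ⁻¹`,
`θ = Φ_{λ,ρ}⁻¹`. -/
def Φρ₁ : A ⊗[k] ((Hᵐᵒᵖ ⊗[k] H) ⊗[k] (Hᵐᵒᵖ ⊗[k] H)) :=
  toReassociator Q A
    (onRest k H (oneRight k H (A ⊗[k] (H ⊗[k] H))) Q.twist
      * onFirst k (A ⊗[k] (H ⊗[k] H)) Q.Δ
          (onFirst k (H ⊗[k] H) 𝔸.lam (𝔸.Φρ : A ⊗[k] (H ⊗[k] H)))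
      * onRest k H (onRest k H (oneRight k A (H ⊗[k] H)))
          (↑𝔸.Φlam⁻¹ : H ⊗[k] (H ⊗[k] A))
      * onRest k H (onRest k H (onRest k A (oneRight k H H)))
          (onRest k H (onFirst k H 𝔸.lam) (↑𝔸.Φlr⁻¹ : H ⊗[k] (A ⊗[k] H))))

/-- The reassociator
`Φ_{ρ₂} = x̃³_{λ<0>} X̃¹_ρ Θ²_{<0>} ⊗ (S⁻¹(f² x̃²_λ Θ¹) ⊗ x̃³_{λ<1>₁} X̃²_ρ Θ²_{<1>})
⊗ (S⁻¹(f¹ x̃¹_λ) ⊗ x̃³_{λ<1>₂} X̃³_ρ Θ³)`, where `X̃_ρ = Φ_ρ`, `x̃_λ = Φ_λ⁻¹`,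
`Θ = Φ_{λ,ρ}`. -/
def Φρ₂ : A ⊗[k] ((Hᵐᵒᵖ ⊗[k] H) ⊗[k] (Hᵐᵒᵖ ⊗[k] H)) :=
  toReassociator Q A
    (onRest k H (oneRight k H (A ⊗[k] (H ⊗[k] H))) Q.twist
      * onRest k H (onRest k H ((onRest k A Q.Δ).comp 𝔸.ρ))
          (↑𝔸.Φlam⁻¹ : H ⊗[k] (H ⊗[k] A))
      * oneLeft k H (H ⊗[k] (A ⊗[k] (H ⊗[k] H)))
          (oneLeft k H (A ⊗[k] (H ⊗[k] H)) (𝔸.Φρ : A ⊗[k] (H ⊗[k] H)))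
      * oneLeft k H (H ⊗[k] (A ⊗[k] (H ⊗[k] H)))
          (onRest k H (onFirst k H 𝔸.ρ) (𝔸.Φlr : H ⊗[k] (A ⊗[k] H))))

variable {C : Type*} [AddCommGroup C] [Module k C] {Q₀ : QuasiBialgebra k H}

/-- The left action `(h ⊗ h') · c = h' · c · h` of `Hᵒᵖ ⊗ H` on a bimodule coalgebra. -/
def BimoduleCoalgebra.opAct (K : BimoduleCoalgebra Q₀ C) :
    Hᵐᵒᵖ ⊗[k] H →ₗ[k] Module.End k C :=
  mulMap k K.left (K.right ∘ₗ (MulOpposite.opLinearEquiv k).symm.toLinearMap) ∘ₗ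
    (TensorProduct.comm k Hᵐᵒᵖ H).toLinearMap

theorem BimoduleCoalgebra.opAct_tmul (K : BimoduleCoalgebra Q₀ C) (h h' : H) (c : C) :
    K.opAct (MulOpposite.op h ⊗ₜ h') c = K.left h' (K.right h c) := by
  simp [BimoduleCoalgebra.opAct, mulMap]

/-- The right generalized smash product `A¹ ⋊ C*`, where `A¹ = (A, ρ₁, Φ_{ρ₁})` and where
`C*` has the convolution product and the right action `(φ · κ)(c) = φ(κ · c)` of
`κ ∈ Hᵒᵖ ⊗ H`. -/
def smash₁ (K : BimoduleCoalgebra Q.toQuasiBialgebra C) : Product k (A ⊗[k] Module.Dual k C) :=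
  smashProduct (ρ₁ Q 𝔸) (Φρ₁ Q 𝔸) (transposeAct K.opAct) (convolution K.comul) K.counit

/-- The right generalized smash product `A² ⋊ C*`, where `A² = (A, ρ₂, Φ_{ρ₂})`. -/
def smash₂ (K : BimoduleCoalgebra Q.toQuasiBialgebra C) : Product k (A ⊗[k] Module.Dual k C) :=
  smashProduct (ρ₂ Q 𝔸) (Φρ₂ Q 𝔸) (transposeAct K.opAct) (convolution K.comul) K.counit

end Smash

/-! ### Generalized diagonal crossed products -/

section Diagonal

variable {k H : Type*} [Field k] [Ring H] [Algebra k H]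
  {A : Type*} [Ring A] [Algebra k A]

/-- `Ψ_l = (id ⊗ λ ⊗ id ⊗ id)((Φ_{λ,ρ} ⊗ 1)(λ ⊗ id ⊗ id)(Φ_ρ⁻¹)) [Φ_λ ⊗ 1 ⊗ 1]`. -/
def Ψl {Q : QuasiBialgebra k H} (𝔸 : BicomoduleAlgebra Q A) :
    (H ⊗[k] (H ⊗[k] (A ⊗[k] (H ⊗[k] H))))ˣ :=
  Units.map (onRest k H (onFirst k (H ⊗[k] H) 𝔸.lam)).toMonoidHom
      (Units.map (onRest k H (onRest k A (oneRight k H H))).toMonoidHom 𝔸.Φlr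
        * Units.map (onFirst k (H ⊗[k] H) 𝔸.lam).toMonoidHom 𝔸.Φρ⁻¹)
    * Units.map (onRest k H (onRest k H (oneRight k A (H ⊗[k] H)))).toMonoidHom 𝔸.Φlam

/-- `Ψ_r = (id ⊗ id ⊗ ρ ⊗ id)((1 ⊗ Φ_{λ,ρ}⁻¹)(id ⊗ id ⊗ ρ)(Φ_λ)) [1 ⊗ 1 ⊗ Φ_ρ⁻¹]`. -/
def Ψr {Q : QuasiBialgebra k H} (𝔸 : BicomoduleAlgebra Q A) :
    (H ⊗[k] (H ⊗[k] (A ⊗[k] (H ⊗[k] H))))ˣ :=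
  Units.map (onRest k H (onRest k H (onFirst k H 𝔸.ρ))).toMonoidHom
      (Units.map (oneLeft k H (H ⊗[k] (A ⊗[k] H))).toMonoidHom 𝔸.Φlr⁻¹
        * Units.map (onRest k H (onRest k H 𝔸.ρ)).toMonoidHom 𝔸.Φlam)
    * Units.map ((oneLeft k H (H ⊗[k] (A ⊗[k] (H ⊗[k] H)))).comp
        (oneLeft k H (A ⊗[k] (H ⊗[k] H)))).toMonoidHom 𝔸.Φρ⁻¹

variable (Q : QuasiHopf k H)

/-- `Ω_L = (id ⊗ id ⊗ id ⊗ S⁻¹ ⊗ S⁻¹)(Ψ⁻¹) · [1 ⊗ 1 ⊗ 1 ⊗ S⁻¹(f¹) ⊗ S⁻¹(f²)]`. -/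
def ΩL (Ψ : (H ⊗[k] (H ⊗[k] (A ⊗[k] (H ⊗[k] H))))ˣ) :
    H ⊗[k] (H ⊗[k] (A ⊗[k] (H ⊗[k] H))) :=
  TensorProduct.map LinearMap.id (TensorProduct.map LinearMap.id
      (TensorProduct.map LinearMap.id (TensorProduct.map Q.Sinv Q.Sinv)))
      (↑Ψ⁻¹ : H ⊗[k] (H ⊗[k] (A ⊗[k] (H ⊗[k] H))))
    * ((1 : H) ⊗ₜ[k] ((1 : H) ⊗ₜ[k] ((1 : A) ⊗ₜ[k] TensorProduct.map Q.Sinv Q.Sinv Q.twist)))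

/-- `Ω_R = [S⁻¹(g¹) ⊗ S⁻¹(g²) ⊗ 1 ⊗ 1 ⊗ 1] · (S⁻¹ ⊗ S⁻¹ ⊗ id ⊗ id ⊗ id)(Ψ)`, where
`g¹ ⊗ g² = f⁻¹`. -/
def ΩR (Ψ : (H ⊗[k] (H ⊗[k] (A ⊗[k] (H ⊗[k] H))))ˣ) :
    H ⊗[k] (H ⊗[k] (A ⊗[k] (H ⊗[k] H))) :=
  onRest k H (oneRight k H (A ⊗[k] (H ⊗[k] H))) (TensorProduct.map Q.Sinv Q.Sinv Q.twistInv)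
    * TensorProduct.map Q.Sinv (TensorProduct.map Q.Sinv LinearMap.id)
        (Ψ : H ⊗[k] (H ⊗[k] (A ⊗[k] (H ⊗[k] H))))

/-- Five-fold tensor obtained from `Ω` for the right products: for `v¹ ⊗ v² ⊗ v³` it is
`Ω¹ ⊗ Ω² S⁻¹(v¹) ⊗ v² Ω³ ⊗ v³ Ω⁴ ⊗ Ω⁵`. -/
def mulΩR (Ω : H ⊗[k] (H ⊗[k] (A ⊗[k] (H ⊗[k] H)))) :
    H ⊗[k] (A ⊗[k] H) →ₗ[k] H ⊗[k] (H ⊗[k] (A ⊗[k] (H ⊗[k] H))) :=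
  TensorProduct.lift (LinearMap.mk₂ k
    (fun (h : H) (w : A ⊗[k] H) =>
      ((1 : H) ⊗ₜ[k] ((1 : H) ⊗ₜ[k] onRest k A (oneRight k H H) w)) * Ω
        * ((1 : H) ⊗ₜ[k] (Q.Sinv h ⊗ₜ[k] (1 : A ⊗[k] (H ⊗[k] H)))))
    (fun h h' w => by
      simp only [map_add, TensorProduct.add_tmul, TensorProduct.tmul_add, mul_add])
    (fun t h w => by
      rw [map_smul, ← TensorProduct.smul_tmul', TensorProduct.tmul_smul, mul_smul_comm])
    (fun h w w' => by simp only [map_add, TensorProduct.tmul_add, add_mul])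
    (fun t h w => by
      rw [map_smul, TensorProduct.tmul_smul, TensorProduct.tmul_smul, smul_mul_assoc,
        smul_mul_assoc]))

/-- Five-fold tensor obtained from `Ω` for the left products: for `v¹ ⊗ v² ⊗ v³` it is
`Ω¹ ⊗ Ω² v¹ ⊗ Ω³ v² ⊗ S⁻¹(v³) Ω⁴ ⊗ Ω⁵`. -/
def mulΩL (Ω : H ⊗[k] (H ⊗[k] (A ⊗[k] (H ⊗[k] H)))) :
    H ⊗[k] (A ⊗[k] H) →ₗ[k] H ⊗[k] (H ⊗[k] (A ⊗[k] (H ⊗[k] H))) :=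
  TensorProduct.lift (LinearMap.mk₂ k
    (fun (w : H ⊗[k] A) (h : H) =>
      ((1 : H) ⊗ₜ[k] ((1 : H) ⊗ₜ[k] ((1 : A) ⊗ₜ[k] (Q.Sinv h ⊗ₜ[k] (1 : H))))) * Ω
        * ((1 : H) ⊗ₜ[k] onRest k H (oneRight k A (H ⊗[k] H)) w))
    (fun w w' h => by simp only [map_add, TensorProduct.tmul_add, mul_add])
    (fun t w h => by rw [map_smul, TensorProduct.tmul_smul, mul_smul_comm])
    (fun w h h' => by
      simp only [map_add, TensorProduct.add_tmul, TensorProduct.tmul_add, add_mul])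
    (fun t w h => by
      rw [map_smul, ← TensorProduct.smul_tmul', TensorProduct.tmul_smul, TensorProduct.tmul_smul,
        TensorProduct.tmul_smul, smul_mul_assoc, smul_mul_assoc])) ∘ₗ
    (TensorProduct.assoc k H A H).symm.toLinearMap

variable {M : Type*} [AddCommGroup M] [Module k M]

/-- `h ⊗ h' ↦ (φ ↦ h · φ · h')`. -/
def Bimodule.biAct (B : Bimodule k H M) : H ⊗[k] H →ₗ[k] Module.End k M :=
  mulMap k B.left B.right

theorem Bimodule.biAct_tmul (B : Bimodule k H M) (h h' : H) (m : M) :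
    B.biAct (h ⊗ₜ h') m = B.left h (B.right h' m) := by
  simp [Bimodule.biAct, mulMap]

/-- The right crossed product on `A ⊗ M` determined by `δ` and `Ω`:
`(u ⋈ φ)(u' ⋈ ψ) = u u'₍₀₎ Ω³ ⋈ (Ω² S⁻¹(u'₍₋₁₎) · φ · u'₍₁₎ Ω⁴)(Ω¹ · ψ · Ω⁵)`, where
`u'₍₋₁₎ ⊗ u'₍₀₎ ⊗ u'₍₁₎ = δ(u')`. -/
def rightCrossed (δ : A →ₐ[k] H ⊗[k] (A ⊗[k] H)) (Ω : H ⊗[k] (H ⊗[k] (A ⊗[k] (H ⊗[k] H))))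
    (ℳ : BimoduleAlgebra Q.toQuasiBialgebra M) : Product k (A ⊗[k] M) where
  mul := productAM ℳ.biAct ℳ.mul
    (LinearMap.mk₂ k
      (fun u u' => (u ⊗ₜ[k] (1 : (H ⊗[k] H) ⊗[k] (H ⊗[k] H)))
        * regroup H H A H H (mulΩR Q Ω (δ u')))
      (fun u v u' => by simp only [TensorProduct.add_tmul, add_mul])
      (fun t u u' => by rw [← TensorProduct.smul_tmul', smul_mul_assoc])
      (fun u u' v' => by simp only [map_add, mul_add])
      (fun t u u' => by simp only [map_smul, mul_smul_comm]))
  one := 1 ⊗ₜ[k] ℳ.one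

/-- The left crossed product on `M ⊗ A` determined by `δ` and `Ω`:
`(φ ⋈ u)(ψ ⋈ u') = (Ω¹ · φ · Ω⁵)(Ω² u₍₋₁₎ · ψ · S⁻¹(u₍₁₎) Ω⁴) ⋈ Ω³ u₍₀₎ u'`, where
`u₍₋₁₎ ⊗ u₍₀₎ ⊗ u₍₁₎ = δ(u)`. -/
def leftCrossed (δ : A →ₐ[k] H ⊗[k] (A ⊗[k] H)) (Ω : H ⊗[k] (H ⊗[k] (A ⊗[k] (H ⊗[k] H))))
    (ℳ : BimoduleAlgebra Q.toQuasiBialgebra M) : Product k (M ⊗[k] A) where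
  mul := productMA ℳ.biAct ℳ.mul
    (LinearMap.mk₂ k
      (fun u u' => onRest k A (Algebra.TensorProduct.comm k (H ⊗[k] H) (H ⊗[k] H)).toAlgHom
          (regroup H H A H H (mulΩL Q Ω (δ u)))
        * (u' ⊗ₜ[k] (1 : (H ⊗[k] H) ⊗[k] (H ⊗[k] H))))
      (fun u v u' => by simp only [map_add, add_mul])
      (fun t u u' => by simp only [map_smul, smul_mul_assoc])
      (fun u u' v' => by simp only [TensorProduct.add_tmul, mul_add])
      (fun t u u' => by rw [← TensorProduct.smul_tmul', mul_smul_comm]))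
  one := ℳ.one ⊗ₜ[k] 1

variable (𝔸 : BicomoduleAlgebra Q.toQuasiBialgebra A) (ℳ : BimoduleAlgebra Q.toQuasiBialgebra M)

/-- The right generalized diagonal crossed product of `A` and `M` with respect to `δ_l`. -/
def rightDiagonal_l : Product k (A ⊗[k] M) := rightCrossed Q (δl 𝔸) (ΩR Q (Ψl 𝔸)) ℳ

/-- The right generalized diagonal crossed product of `A` and `M` with respect to `δ_r`. -/
def rightDiagonal_r : Product k (A ⊗[k] M) := rightCrossed Q (δr 𝔸) (ΩR Q (Ψr 𝔸)) ℳ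

/-- The left generalized diagonal crossed product of `M` and `A` with respect to `δ_l`. -/
def leftDiagonal_l : Product k (M ⊗[k] A) := leftCrossed Q (δl 𝔸) (ΩL Q (Ψl 𝔸)) ℳ

/-- The left generalized diagonal crossed product of `M` and `A` with respect to `δ_r`. -/
def leftDiagonal_r : Product k (M ⊗[k] A) := leftCrossed Q (δr 𝔸) (ΩL Q (Ψr 𝔸)) ℳ

end Diagonal

end QHA

end

/-! The tensor product `Hᵒᵖ ⊗ H` is again a quasi-Hopf algebra, and an `H`-bimodule algebra such as
`C*` is a right module algebra over it. The proposition therefore reduces to general facts about one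
quasi-Hopf algebra `K` together with the two coactions `ρ₁`, `ρ₂` of `K = Hᵒᵖ ⊗ H` on `A`. The smash
product of a right `K`-comodule algebra with a right `K`-module algebra is associative by the
pentagon for `Φ_ρ` (`smash_isAlgebra`).

All coherence identities are handled by "legs": elementwise commuting algebra maps into a common
algebra `B`. A reassociator placed in legs is a unit of `B`, `(Δ ⊗ id)` becomes the replacement of a
leg by the combined leg `star Δ i j`, and a counit becomes the scalar leg `triv`. Pentagons and
hexagons are then equations between words in the group `Bˣ`, and naturality squares come for free.
Antipode axioms enter through linear contractions, under which a combined leg next to `α` or `β` may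
be replaced by the scalar leg (`CollapseRel`).

Drinfeld's uniqueness of antipode data is the engine for the twist `f`. Two triples `(σ, a, b)` and
`(σ', a', b')` for the same algebra map `g : H → B` are related by an invertible `F` with `F σ(h) =
σ'(h) F` and `F a = a'`, and these two relations determine `F` (`compare_unique`). For `g = Δ`, the
image of `(S, α, β)` under `Δ` and the triple `((S ⊗ S)Δᶜᵒᵖ, γ, δ)` are related by `f`. This gives
the invertibility of `f`. Uniqueness gives its counit normalization, its twisted cocycle identity
and its values for `Hᵒᵖ` and for tensor products.

The element `Ψ_l` satisfies a two-sided pentagon and `f` a twisted cocycle identity. Together they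
make `(ρ₁, f Ψ_l⁻¹)`, transported to `A ⊗ K ⊗ K` with `S⁻¹` on the two left legs, a `K`-comodule
algebra `A¹`. Gauge twisting `A¹` by `Φ_{λ,ρ}` yields `A²`, with `Ψ_r` in place of `Ψ_l`, and a
gauge twist does not change the smash product up to isomorphism. Unwinding `Ω_R` shows that the
right crossed products are literally these smash products.

For the left crossed products a left smash product `M ⊗ A` is defined over any `K`, with a formula
containing the twist of `K`, and `φ ⊗ u ↦ X̃¹ u₀ ⊗ φ · S⁻¹(α X̃³) X̃² u₁` is an isomorphism onto the
right one (`leftSmash_iso`). For `K = Hᵒᵖ ⊗ H` the `Hᵒᵖ`-part of the twist is built from `f⁻¹` and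
cancels the `f` in the reassociator. The `H`-part is the `f` visible in `Ω_L`. -/

noncomputable section

namespace QHA

section Shortcuts

variable {k U V : Type*} [Field k]

instance algHom_zeroHomClass [Ring U] [Algebra k U] [Ring V] [Algebra k V] :
    ZeroHomClass (U →ₐ[k] V) U V := inferInstance

instance algHom_addHomClass [Ring U] [Algebra k U] [Ring V] [Algebra k V] :
    AddHomClass (U →ₐ[k] V) U V := inferInstance

instance algHom_mulHomClass [Ring U] [Algebra k U] [Ring V] [Algebra k V] :
    MulHomClass (U →ₐ[k] V) U V := inferInstance

instance linearMap_zeroHomClass [AddCommGroup U] [Module k U] [AddCommGroup V] [Module k V] :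
    ZeroHomClass (U →ₗ[k] V) U V := inferInstance

instance linearMap_addHomClass [AddCommGroup U] [Module k U] [AddCommGroup V] [Module k V] :
    AddHomClass (U →ₗ[k] V) U V := inferInstance

end Shortcuts

/-! ### Commuting algebra maps into a common algebra -/

section Legs

variable {k : Type*} [Field k] {B : Type*} [Ring B] [Algebra k B]
  {U V W P : Type*} [Ring U] [Algebra k U] [Ring V] [Algebra k V] [Ring W] [Algebra k W]
  [Ring P] [Algebra k P]

/-- The images of `i` and `j` commute elementwise. -/
class LegComm (i : U →ₐ[k] B) (j : V →ₐ[k] B) : Prop where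
  comm : ∀ x y, Commute (i x) (j y)

/-- `x ⊗ y ↦ i(x) j(y)`. -/
def lift₂ (i : U →ₐ[k] B) (j : V →ₐ[k] B) [LegComm i j] : U ⊗[k] V →ₐ[k] B :=
  Algebra.TensorProduct.lift i j LegComm.comm

@[simp]
theorem lift₂_tmul (i : U →ₐ[k] B) (j : V →ₐ[k] B) [LegComm i j] (x : U) (y : V) :
    lift₂ i j (x ⊗ₜ y) = i x * j y := by
  simp [lift₂]

/-- Tensor induction in relational form: a relation stable under addition that holds for products of
leg values holds for two lifts of the same tensor. Semiconjugation and collapsing are both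
propagated through it. -/
theorem lift₂_induction {i i' : U →ₐ[k] B} {j j' : V →ₐ[k] B} [LegComm i j] [LegComm i' j']
    {r : B → B → Prop} (h₀ : r 0 0) (hadd : ∀ x x' y y', r x x' → r y y' → r (x + y) (x' + y'))
    (hi : ∀ x y, r (i x * j y) (i' x * j' y)) (t : U ⊗[k] V) :
    r (lift₂ i j t) (lift₂ i' j' t) := by
  induction t using TensorProduct.induction_on with
  | zero => simpa using h₀
  | tmul x y => simpa using hi x y
  | add x y hx hy => simpa using hadd _ _ _ _ hx hy

theorem lift₂_semiconj {i i' : U →ₐ[k] B} {j j' : V →ₐ[k] B} [LegComm i j] [LegComm i' j']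
    {b : B} (hi : ∀ x, SemiconjBy b (i x) (i' x)) (hj : ∀ y, SemiconjBy b (j y) (j' y))
    (t : U ⊗[k] V) : SemiconjBy b (lift₂ i j t) (lift₂ i' j' t) :=
  lift₂_induction (by simp) (fun _ _ _ _ h h' => h.add_right h')
    (fun x y => (hi x).mul_right (hj y)) t

theorem lift₂_comp (θ : B →ₐ[k] W) (i : U →ₐ[k] B) (j : V →ₐ[k] B) [LegComm i j]
    [LegComm (θ.comp i) (θ.comp j)] (t : U ⊗[k] V) :
    θ (lift₂ i j t) = lift₂ (θ.comp i) (θ.comp j) t := by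
  induction t using TensorProduct.induction_on with
  | zero => simp
  | tmul x y => simp
  | add x y hx hy => simp only [map_add, hx, hy]

instance lift₂_left (i : U →ₐ[k] B) (j : V →ₐ[k] B) (l : W →ₐ[k] B) [LegComm i j] [LegComm i l]
    [LegComm j l] : LegComm (lift₂ i j) l where
  comm t y := by
    refine (Commute.symm ?_)
    exact lift₂_semiconj (fun x => (LegComm.comm x y).symm) (fun x => (LegComm.comm x y).symm) t

instance lift₂_right (i : U →ₐ[k] B) (j : V →ₐ[k] B) (l : W →ₐ[k] B) [LegComm j l] [LegComm i j]
    [LegComm i l] : LegComm i (lift₂ j l) where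
  comm x t := lift₂_semiconj (fun y => LegComm.comm x y) (fun y => LegComm.comm x y) t

/-- `u ↦ i(u₁) j(u₂)`, where `u₁ ⊗ u₂ = d(u)`. -/
def star (d : P →ₐ[k] U ⊗[k] V) (i : U →ₐ[k] B) (j : V →ₐ[k] B) [LegComm i j] : P →ₐ[k] B :=
  (lift₂ i j).comp d

theorem star_apply (d : P →ₐ[k] U ⊗[k] V) (i : U →ₐ[k] B) (j : V →ₐ[k] B) [LegComm i j] (x : P) :
    star d i j x = lift₂ i j (d x) := rfl

instance star_left (d : P →ₐ[k] U ⊗[k] V) (i : U →ₐ[k] B) (j : V →ₐ[k] B) (l : W →ₐ[k] B)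
    [LegComm i j] [LegComm i l] [LegComm j l] : LegComm (star d i j) l where
  comm x y := LegComm.comm (i := lift₂ i j) (d x) y

instance star_right (d : P →ₐ[k] V ⊗[k] W) (i : U →ₐ[k] B) (j : V →ₐ[k] B) (l : W →ₐ[k] B)
    [LegComm j l] [LegComm i j] [LegComm i l] : LegComm i (star d j l) where
  comm x y := LegComm.comm (j := lift₂ j l) x (d y)

instance comp_left (i : U →ₐ[k] B) (j : V →ₐ[k] B) (f : W →ₐ[k] U) [LegComm i j] :
    LegComm (i.comp f) j where
  comm x y := LegComm.comm (i := i) (f x) y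

instance comp_right (i : U →ₐ[k] B) (j : V →ₐ[k] B) (f : W →ₐ[k] V) [LegComm i j] :
    LegComm i (j.comp f) where
  comm x y := LegComm.comm (j := j) x (f y)

theorem lift₂_onRest (i : U →ₐ[k] B) (j : V →ₐ[k] B) [LegComm i j] (f : W →ₐ[k] V)
    (t : U ⊗[k] W) : lift₂ i j (onRest k U f t) = lift₂ i (j.comp f) t := by
  induction t using TensorProduct.induction_on with
  | zero => simp
  | tmul x y => simp [onRest]
  | add x y hx hy => simp only [map_add, hx, hy]

/-- This turns `f ⊗ id` inside a tensor into a combined leg `star f i j`. With `lift₂_onRest` it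
translates every axiom written with `onFirst` and `onRest` into a statement about legs. -/
theorem lift₂_onFirst (i : U →ₐ[k] B) (j : V →ₐ[k] B) (l : W →ₐ[k] B) [LegComm i j] [LegComm i l]
    [LegComm j l] (f : P →ₐ[k] U ⊗[k] V) (t : P ⊗[k] W) :
    lift₂ i (lift₂ j l) (onFirst k W f t) = lift₂ (star f i j) l t := by
  induction t using TensorProduct.induction_on with
  | zero => simp
  | add x y hx hy => simp only [map_add, hx, hy]
  | tmul x y =>
    simp only [onFirst, AlgHom.comp_apply, Algebra.TensorProduct.map_tmul, lift₂_tmul, star_apply,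
      AlgHom.id_apply]
    generalize f x = d
    induction d using TensorProduct.induction_on with
    | zero => simp
    | add x y hx hy => simp only [map_add, TensorProduct.add_tmul, add_mul, hx, hy]
    | tmul u v => simp [mul_assoc]

theorem lift₂_oneRight (i : U →ₐ[k] B) (j : V →ₐ[k] B) [LegComm i j] (x : U) :
    lift₂ i j (oneRight k U V x) = i x := by
  simp [oneRight]

theorem lift₂_oneLeft (i : U →ₐ[k] B) (j : V →ₐ[k] B) [LegComm i j] (y : V) :
    lift₂ i j (oneLeft k U V y) = j y := by
  simp [oneLeft]

theorem lift₂_comp_onRest (i : U →ₐ[k] B) (j : V →ₐ[k] B) [LegComm i j] (f : W →ₐ[k] V) :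
    (lift₂ i j).comp (onRest k U f) = lift₂ i (j.comp f) :=
  AlgHom.ext (lift₂_onRest i j f)

theorem lift₂_comp_onFirst (i : U →ₐ[k] B) (j : V →ₐ[k] B) (l : W →ₐ[k] B) [LegComm i j]
    [LegComm i l] [LegComm j l] (f : P →ₐ[k] U ⊗[k] V) :
    (lift₂ i (lift₂ j l)).comp (onFirst k W f) = lift₂ (star f i j) l :=
  AlgHom.ext (lift₂_onFirst i j l f)

theorem lift₂_comp_oneRight (i : U →ₐ[k] B) (j : V →ₐ[k] B) [LegComm i j] :
    (lift₂ i j).comp (oneRight k U V) = i :=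
  AlgHom.ext (lift₂_oneRight i j)

theorem lift₂_comp_oneLeft (i : U →ₐ[k] B) (j : V →ₐ[k] B) [LegComm i j] :
    (lift₂ i j).comp (oneLeft k U V) = j :=
  AlgHom.ext (lift₂_oneLeft i j)

/-- The map `p ↦ e(p) 1` of a character `e`. -/
def triv (B : Type*) [Ring B] [Algebra k B] (e : P →ₐ[k] k) : P →ₐ[k] B :=
  (Algebra.ofId k B).comp e

theorem triv_apply (e : P →ₐ[k] k) (x : P) : triv B e x = algebraMap k B (e x) := rfl

instance triv_left (e : P →ₐ[k] k) (i : U →ₐ[k] B) : LegComm (triv B e) i where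
  comm _ _ := Algebra.commutes _ _

instance triv_right (e : P →ₐ[k] k) (i : U →ₐ[k] B) : LegComm i (triv B e) where
  comm _ _ := (Algebra.commutes _ _).symm

/-- Removing a tensor factor by a character is the same as sending that leg to the scalars, so the
counit axioms become evaluations at `triv` legs. -/
theorem lift₂_comp_dropFirst (i : U →ₐ[k] B) (e : P →ₐ[k] k) :
    i.comp (dropFirst k U e) = lift₂ (triv B e) i := by
  refine AlgHom.ext fun t => ?_
  induction t using TensorProduct.induction_on with
  | zero => simp
  | add x y hx hy => simp only [map_add, hx, hy]
  | tmul x y => simp [dropFirst, triv_apply, Algebra.smul_def]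

theorem lift₂_comp_dropLast (i : U →ₐ[k] B) (e : P →ₐ[k] k) :
    i.comp (dropLast k U e) = lift₂ i (triv B e) := by
  refine AlgHom.ext fun t => ?_
  induction t using TensorProduct.induction_on with
  | zero => simp
  | add x y hx hy => simp only [map_add, hx, hy]
  | tmul x y => simp [dropLast, triv_apply, Algebra.smul_def, Algebra.commutes]

theorem lift₂_dropFirst (i : U →ₐ[k] B) (e : P →ₐ[k] k) (t : P ⊗[k] U) :
    lift₂ (triv B e) i t = i (dropFirst k U e t) :=
  (DFunLike.congr_fun (lift₂_comp_dropFirst i e) t).symm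

theorem lift₂_dropLast (i : U →ₐ[k] B) (e : P →ₐ[k] k) (t : U ⊗[k] P) :
    lift₂ i (triv B e) t = i (dropLast k U e t) :=
  (DFunLike.congr_fun (lift₂_comp_dropLast i e) t).symm

/-- The image of a unit of `U ⊗ V` under `x ⊗ y ↦ i(x) j(y)`. -/
def place₂ (u : (U ⊗[k] V)ˣ) (i : U →ₐ[k] B) (j : V →ₐ[k] B) [LegComm i j] : Bˣ :=
  Units.map (lift₂ i j).toMonoidHom u

/-- The image of a unit of `U ⊗ V ⊗ W` under `x ⊗ y ⊗ z ↦ i(x) j(y) l(z)`. -/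
def place₃ (u : (U ⊗[k] (V ⊗[k] W))ˣ) (i : U →ₐ[k] B) (j : V →ₐ[k] B) (l : W →ₐ[k] B)
    [LegComm i j] [LegComm i l] [LegComm j l] : Bˣ :=
  place₂ u i (lift₂ j l)

theorem coe_unitsMap (f : U →ₐ[k] V) (u : Uˣ) :
    ((Units.map f.toMonoidHom u : Vˣ) : V) = f u := rfl

theorem coe_place₂ (u : (U ⊗[k] V)ˣ) (i : U →ₐ[k] B) (j : V →ₐ[k] B) [LegComm i j] :
    (place₂ u i j : B) = lift₂ i j (u : U ⊗[k] V) := rfl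

theorem coe_place₂_inv (u : (U ⊗[k] V)ˣ) (i : U →ₐ[k] B) (j : V →ₐ[k] B) [LegComm i j] :
    ((place₂ u i j)⁻¹ : Bˣ) = lift₂ i j (↑u⁻¹ : U ⊗[k] V) := rfl

theorem coe_place₃ (u : (U ⊗[k] (V ⊗[k] W))ˣ) (i : U →ₐ[k] B) (j : V →ₐ[k] B) (l : W →ₐ[k] B)
    [LegComm i j] [LegComm i l] [LegComm j l] :
    (place₃ u i j l : B) = lift₂ i (lift₂ j l) (u : U ⊗[k] (V ⊗[k] W)) := rfl

theorem coe_place₃_inv (u : (U ⊗[k] (V ⊗[k] W))ˣ) (i : U →ₐ[k] B) (j : V →ₐ[k] B) (l : W →ₐ[k] B)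
    [LegComm i j] [LegComm i l] [LegComm j l] :
    ((place₃ u i j l)⁻¹ : Bˣ) = lift₂ i (lift₂ j l) (↑u⁻¹ : U ⊗[k] (V ⊗[k] W)) := rfl

/-- `b i(x) = i'(x) b` for all `x`. -/
class Intertwines (b : Bˣ) (i i' : P →ₐ[k] B) : Prop where
  semiconj : ∀ x, SemiconjBy (b : B) (i x) (i' x)

theorem Intertwines.eq {b : Bˣ} {i i' : P →ₐ[k] B} (h : Intertwines b i i') (x : P) :
    (b : B) * i x = i' x * b := h.semiconj x

instance intertwines_lift₂ (b : Bˣ) (i i' : U →ₐ[k] B) (j j' : V →ₐ[k] B) [LegComm i j]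
    [LegComm i' j'] [Intertwines b i i'] [Intertwines b j j'] :
    Intertwines b (lift₂ i j) (lift₂ i' j') where
  semiconj := lift₂_semiconj Intertwines.semiconj Intertwines.semiconj

instance intertwines_star (d : P →ₐ[k] U ⊗[k] V) (b : Bˣ) (i i' : U →ₐ[k] B) (j j' : V →ₐ[k] B)
    [LegComm i j] [LegComm i' j'] [Intertwines b i i'] [Intertwines b j j'] :
    Intertwines b (star d i j) (star d i' j') where
  semiconj x := Intertwines.semiconj (i := lift₂ i j) (i' := lift₂ i' j') (d x)

instance intertwines_inv (b : Bˣ) (i i' : P →ₐ[k] B) [Intertwines b i i'] :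
    Intertwines b⁻¹ i' i where
  semiconj x := (Intertwines.semiconj (b := b) (i := i) (i' := i') x).units_inv_symm_left

instance intertwines_place₂ (u : (U ⊗[k] V)ˣ) (i : U →ₐ[k] B) (j : V →ₐ[k] B) (p : P →ₐ[k] B)
    [LegComm i j] [LegComm i p] [LegComm j p] : Intertwines (place₂ u i j) p p where
  semiconj x := LegComm.comm (i := lift₂ i j) (u : U ⊗[k] V) x

instance intertwines_place₂' (u : (U ⊗[k] V)ˣ) (i : U →ₐ[k] B) (j : V →ₐ[k] B) (p : P →ₐ[k] B)
    [LegComm i j] [LegComm p i] [LegComm p j] : Intertwines (place₂ u i j) p p where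
  semiconj x := (LegComm.comm (i := p) (j := lift₂ i j) x (u : U ⊗[k] V)).symm

instance intertwines_place₃ (u : (U ⊗[k] (V ⊗[k] W))ˣ) (i : U →ₐ[k] B) (j : V →ₐ[k] B)
    (l : W →ₐ[k] B) (p : P →ₐ[k] B) [LegComm i j] [LegComm i l] [LegComm j l]
    [LegComm i p] [LegComm j p] [LegComm l p] : Intertwines (place₃ u i j l) p p :=
  intertwines_place₂ u i (lift₂ j l) p

instance intertwines_place₃' (u : (U ⊗[k] (V ⊗[k] W))ˣ) (i : U →ₐ[k] B) (j : V →ₐ[k] B)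
    (l : W →ₐ[k] B) (p : P →ₐ[k] B) [LegComm i j] [LegComm i l] [LegComm j l]
    [LegComm p i] [LegComm p j] [LegComm p l] : Intertwines (place₃ u i j l) p p :=
  intertwines_place₂' u i (lift₂ j l) p

/-- Naturality of a placed unit under change of legs by `b`. The naturality squares fed to the word
lemmas are instances of it and of its threefold version; with unchanged legs they are commutation
relations. -/
theorem place₂_intertwine (b : Bˣ) (u : (U ⊗[k] V)ˣ) (i i' : U →ₐ[k] B) (j j' : V →ₐ[k] B)
    [LegComm i j] [LegComm i' j'] [Intertwines b i i'] [Intertwines b j j'] :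
    b * place₂ u i j = place₂ u i' j' * b :=
  Units.ext (Intertwines.semiconj (i := lift₂ i j) (i' := lift₂ i' j') (u : U ⊗[k] V))

theorem place₃_intertwine (b : Bˣ) (u : (U ⊗[k] (V ⊗[k] W))ˣ) (i i' : U →ₐ[k] B)
    (j j' : V →ₐ[k] B) (l l' : W →ₐ[k] B) [LegComm i j] [LegComm i l] [LegComm j l]
    [LegComm i' j'] [LegComm i' l'] [LegComm j' l']
    [Intertwines b i i'] [Intertwines b j j'] [Intertwines b l l'] :
    b * place₃ u i j l = place₃ u i' j' l' * b :=
  place₂_intertwine b u i i' (lift₂ j l) (lift₂ j' l')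

end Legs

/-! ### The reassociator of a quasi-bialgebra in arbitrary legs. -/

namespace QuasiBialgebra

variable {k H : Type*} [Field k] [Ring H] [Algebra k H] (Q : QuasiBialgebra k H)
  {B : Type*} [Ring B] [Algebra k B]

instance intertwines_Φ (i j l : H →ₐ[k] B) [LegComm i j] [LegComm i l] [LegComm j l] :
    Intertwines (place₃ Q.Φ i j l) (star Q.Δ (star Q.Δ i j) l) (star Q.Δ i (star Q.Δ j l)) where
  semiconj x := by
    have h := congrArg (lift₂ i (lift₂ j l)) (Q.quasi_coassoc x)
    rw [lift₂_onRest, map_mul, map_mul, lift₂_onFirst] at h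
    change lift₂ i (star Q.Δ j l) _ = _ at h
    rw [SemiconjBy, coe_place₃, star_apply _ i, h, mul_assoc, ← map_mul, Units.inv_mul, map_one,
      mul_one, star_apply]

/-- The cocycle axiom is pushed forward along the algebra map out of `H ⊗ H ⊗ H ⊗ H` that the four
legs define. -/
theorem pentagon (i j l m : H →ₐ[k] B) [LegComm i j] [LegComm i l] [LegComm j l] [LegComm i m]
    [LegComm j m] [LegComm l m] :
    place₃ Q.Φ j l m * place₃ Q.Φ i (star Q.Δ j l) m * place₃ Q.Φ i j l =
      place₃ Q.Φ i j (star Q.Δ l m) * place₃ Q.Φ (star Q.Δ i j) l m := by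
  have h := congrArg (lift₂ i (lift₂ j (lift₂ l m))) Q.cocycle
  simp only [map_mul, lift₂_oneLeft, lift₂_onRest, lift₂_onFirst, lift₂_comp_onFirst,
    lift₂_comp_onRest, lift₂_comp_oneRight] at h
  exact Units.ext h

theorem star_triv_left (i : H →ₐ[k] B) : star Q.Δ (triv B Q.ε) i = i :=
  AlgHom.ext fun x => by rw [star_apply, lift₂_dropFirst, Q.counit_left]

theorem star_triv_right (i : H →ₐ[k] B) : star Q.Δ i (triv B Q.ε) = i :=
  AlgHom.ext fun x => by rw [star_apply, lift₂_dropLast, Q.counit_right]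

theorem place_triv_mid (i l : H →ₐ[k] B) [LegComm i l] :
    place₃ Q.Φ i (triv B Q.ε) l = 1 := by
  have h := congrArg (lift₂ i l) Q.counit_Φ
  rw [lift₂_onRest, map_one] at h
  simp only [lift₂_comp_dropFirst] at h
  exact Units.ext h

/-- Only the middle counit of `Φ` is an axiom. The pentagon with its first two legs trivial reads `x
x = x` in a group, whence `x = 1`; `place_triv_right` is symmetric. -/
theorem place_triv_left (j l : H →ₐ[k] B) [LegComm j l] :
    place₃ Q.Φ (triv B Q.ε) j l = 1 := by
  have h := Q.pentagon (triv B Q.ε) (triv B Q.ε) j l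
  simp only [star_triv_left, place_triv_mid, mul_one] at h
  simpa using h

theorem place_triv_right (i j : H →ₐ[k] B) [LegComm i j] :
    place₃ Q.Φ i j (triv B Q.ε) = 1 := by
  have h := Q.pentagon i j (triv B Q.ε) (triv B Q.ε)
  simp only [star_triv_right, place_triv_mid, one_mul, mul_one] at h
  simpa using h

end QuasiBialgebra

end QHA
end

noncomputable section

namespace QHA

/-! ### Identities between words in a group -/

/-- The `p`'s are pentagons and `n₁` to `n₄` naturality squares. Each is solved for one letter and
substituted away, which leaves an identity in a free group. The commutation `n₅` cannot be
eliminated in this way and is used by hand. The other word lemmas follow the same pattern. -/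
theorem nest_nest_word {G : Type*} [Group G] {a₁ a₂ a₃ a₄ a₅ b₁ b₂ b₃ b₄ b₅ b₆ c₁ c₂ c₃ d₁ d₂ e : G}
    (p₁ : b₁ * c₁ * b₅ = a₃ * a₄) (p₂ : b₂ * c₂ * c₁ = b₃ * c₃) (p₃ : b₆ * b₄ * c₃ = d₁ * d₂)
    (n₁ : b₁ * c₂ = a₁ * b₁) (n₂ : b₁ * e = a₂ * b₁) (n₃ : c₁ * d₂ = e * c₁)
    (n₄ : b₅ * a₅ = d₁ * b₅) (n₅ : b₅ * b₆ = b₆ * b₅) :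
    a₁ * a₂⁻¹ * a₃ * (a₄ * a₅⁻¹) = b₁ * b₂⁻¹ * (b₃ * b₄⁻¹) * (b₅ * b₆⁻¹) := by
  obtain rfl := eq_inv_mul_of_mul_eq p₁.symm
  obtain rfl := eq_mul_inv_of_mul_eq n₁.symm
  obtain rfl := eq_mul_inv_of_mul_eq n₂.symm
  obtain rfl := eq_mul_inv_of_mul_eq n₃.symm
  obtain rfl := eq_inv_mul_of_mul_eq n₄
  obtain rfl := eq_inv_mul_of_mul_eq p₃.symm
  rw [mul_assoc] at p₂
  obtain rfl := eq_mul_inv_of_mul_eq (eq_inv_mul_of_mul_eq p₂)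
  have h : b₅ * b₆⁻¹ = b₆⁻¹ * b₅ := (show Commute b₅ b₆ from n₅).inv_right
  rw [h]
  group

theorem zigzag_word {G : Type*} [Group G] {x₁ x₂ x₃ x₄ x₅ l₁ l₂ r₁ r₂ y₁ y₂ w₁ w₂ w₃ : G}
    (h₁ : x₄ * y₁ = r₁ * x₄) (h₂ : x₄ * y₂ = r₂ * x₄) (p₁ : x₁ * w₁ * x₅ = l₂ * y₁)
    (h₃ : x₁ * w₂ = l₁ * x₁) (h₄ : x₅ * y₂ = w₃ * x₅) (p₂ : x₂ * w₂ * w₁ = x₃ * w₃) :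
    x₁ * x₂⁻¹ * x₃ * (x₄ * x₅⁻¹)⁻¹ = l₁ * l₂ * x₄⁻¹ * (r₁ * r₂⁻¹) := by
  obtain rfl := eq_mul_inv_of_mul_eq h₁.symm
  obtain rfl := eq_mul_inv_of_mul_eq h₂.symm
  obtain rfl := eq_mul_inv_of_mul_eq p₁.symm
  obtain rfl := eq_mul_inv_of_mul_eq h₃.symm
  obtain rfl := eq_mul_inv_of_mul_eq h₄.symm
  obtain rfl := eq_mul_inv_of_mul_eq p₂.symm
  group

/-! ### Coherence for reassociators -/

namespace QuasiBialgebra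

variable {k H : Type*} [Field k] [Ring H] [Algebra k H] (Q : QuasiBialgebra k H)
  {B : Type*} [Ring B] [Algebra k B]

section Four

variable (i j l m : H →ₐ[k] B) [LegComm i j] [LegComm i l] [LegComm i m] [LegComm j l]
  [LegComm j m] [LegComm l m]

/-- The reassociator `(i j)(l m) → (i (j l)) m`. -/
def nest : Bˣ := place₃ Q.Φ i j l * (place₃ Q.Φ (star Q.Δ i j) l m)⁻¹

instance intertwines_nest : Intertwines (Q.nest i j l m)
    (star Q.Δ (star Q.Δ i j) (star Q.Δ l m))
    (star Q.Δ (star Q.Δ i (star Q.Δ j l)) m) where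
  semiconj x := by
    rw [nest, Units.val_mul]
    have h₁ := Intertwines.semiconj (b := (place₃ Q.Φ (star Q.Δ i j) l m)⁻¹)
      (i := star Q.Δ (star Q.Δ i j) (star Q.Δ l m))
      (i' := star Q.Δ (star Q.Δ (star Q.Δ i j) l) m) x
    have h₂ := Intertwines.semiconj (b := place₃ Q.Φ i j l)
      (i := star Q.Δ (star Q.Δ (star Q.Δ i j) l) m)
      (i' := star Q.Δ (star Q.Δ i (star Q.Δ j l)) m) x
    exact h₂.mul_left h₁

end Four

section Six

variable (i₁ i₂ i₃ i₄ i₅ i₆ : H →ₐ[k] B) [LegComm i₁ i₂] [LegComm i₁ i₃] [LegComm i₁ i₄]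
  [LegComm i₁ i₅] [LegComm i₁ i₆] [LegComm i₂ i₃] [LegComm i₂ i₄] [LegComm i₂ i₅]
  [LegComm i₂ i₆] [LegComm i₃ i₄] [LegComm i₃ i₅] [LegComm i₃ i₆] [LegComm i₄ i₅]
  [LegComm i₄ i₆] [LegComm i₅ i₆]

/-- The two ways `((1 2) (3 4)) (5 6) → (1 ((2 (3 4)) 5)) 6` of splitting off the pair `3 4`,
precomposed with reassociators, agree. -/
theorem nest_nest :
    (place₃ Q.Φ i₁ (star Q.Δ i₂ (star Q.Δ i₃ i₄)) i₅ *
        (place₃ Q.Φ (star Q.Δ i₁ (star Q.Δ i₂ (star Q.Δ i₃ i₄))) i₅ i₆)⁻¹ *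
        place₃ Q.Φ i₁ i₂ (star Q.Δ i₃ i₄)) *
      Q.nest (star Q.Δ i₁ i₂) i₃ i₄ (star Q.Δ i₅ i₆) =
    Q.nest i₂ i₃ i₄ i₅ * Q.nest i₁ (star Q.Δ i₂ i₃) (star Q.Δ i₄ i₅) i₆ *
      (place₃ Q.Φ i₁ i₂ i₃ * (place₃ Q.Φ i₄ i₅ i₆)⁻¹) := by
  -- Three pentagons remove the pair `3 4` from the legs to its left and right; the remaining
  -- relations slide one reassociator past another acting on a coarser bracketing.
  have p₁ := Q.pentagon i₁ i₂ i₃ i₄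
  have p₂ := Q.pentagon i₁ (star Q.Δ i₂ i₃) i₄ i₅
  have p₃ := Q.pentagon (star Q.Δ i₁ (star Q.Δ i₂ i₃)) i₄ i₅ i₆
  have n₁ := place₃_intertwine (place₃ Q.Φ i₂ i₃ i₄) Q.Φ i₁ i₁
    (star Q.Δ (star Q.Δ i₂ i₃) i₄) (star Q.Δ i₂ (star Q.Δ i₃ i₄)) i₅ i₅
  have n₂ := place₃_intertwine (place₃ Q.Φ i₂ i₃ i₄) Q.Φ
    (star Q.Δ i₁ (star Q.Δ (star Q.Δ i₂ i₃) i₄)) (star Q.Δ i₁ (star Q.Δ i₂ (star Q.Δ i₃ i₄)))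
    i₅ i₅ i₆ i₆
  have n₃ := place₃_intertwine (place₃ Q.Φ i₁ (star Q.Δ i₂ i₃) i₄) Q.Φ
    (star Q.Δ (star Q.Δ i₁ (star Q.Δ i₂ i₃)) i₄) (star Q.Δ i₁ (star Q.Δ (star Q.Δ i₂ i₃) i₄))
    i₅ i₅ i₆ i₆
  have n₄ := place₃_intertwine (place₃ Q.Φ i₁ i₂ i₃) Q.Φ
    (star Q.Δ (star Q.Δ i₁ i₂) i₃) (star Q.Δ i₁ (star Q.Δ i₂ i₃)) i₄ i₄
    (star Q.Δ i₅ i₆) (star Q.Δ i₅ i₆)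
  have n₅ := place₃_intertwine (place₃ Q.Φ i₁ i₂ i₃) Q.Φ i₄ i₄ i₅ i₅ i₆ i₆
  exact nest_nest_word p₁ p₂ p₃ n₁ n₂ n₃ n₄ n₅

/-- The map `((1 (2 3)) 4) (5 6) → (1 2) ((3 (4 5)) 6)` is natural in the pair `2 3` before it is
natural in the pair `4 5`. -/
theorem nest_mul_nest_inv :
    Q.nest i₃ i₄ i₅ i₆ * place₃ Q.Φ (star Q.Δ i₁ i₂) (star Q.Δ i₃ i₄) (star Q.Δ i₅ i₆) *
        (Q.nest i₁ i₂ i₃ i₄)⁻¹ =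
      (place₃ Q.Φ (star Q.Δ i₁ i₂) (star Q.Δ i₃ (star Q.Δ i₄ i₅)) i₆ *
        place₃ Q.Φ (star Q.Δ i₁ i₂) i₃ (star Q.Δ i₄ i₅) * (place₃ Q.Φ i₁ i₂ i₃)⁻¹) *
      (place₃ Q.Φ (star Q.Δ i₁ (star Q.Δ i₂ i₃)) i₄ i₅ *
        (place₃ Q.Φ (star Q.Δ (star Q.Δ i₁ (star Q.Δ i₂ i₃)) i₄) i₅ i₆)⁻¹) := by
  have h₁ := place₃_intertwine (place₃ Q.Φ i₁ i₂ i₃) Q.Φ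
    (star Q.Δ (star Q.Δ i₁ i₂) i₃) (star Q.Δ i₁ (star Q.Δ i₂ i₃)) i₄ i₄ i₅ i₅
  have h₂ := place₃_intertwine (place₃ Q.Φ i₁ i₂ i₃) Q.Φ
    (star Q.Δ (star Q.Δ (star Q.Δ i₁ i₂) i₃) i₄) (star Q.Δ (star Q.Δ i₁ (star Q.Δ i₂ i₃)) i₄)
    i₅ i₅ i₆ i₆
  have h₃ := place₃_intertwine (place₃ Q.Φ i₃ i₄ i₅) Q.Φ (star Q.Δ i₁ i₂) (star Q.Δ i₁ i₂)
    (star Q.Δ (star Q.Δ i₃ i₄) i₅) (star Q.Δ i₃ (star Q.Δ i₄ i₅)) i₆ i₆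
  have h₄ := place₃_intertwine (place₃ Q.Φ (star Q.Δ i₁ i₂) i₃ i₄) Q.Φ
    (star Q.Δ (star Q.Δ (star Q.Δ i₁ i₂) i₃) i₄) (star Q.Δ (star Q.Δ i₁ i₂) (star Q.Δ i₃ i₄))
    i₅ i₅ i₆ i₆
  exact zigzag_word h₁ h₂ (Q.pentagon (star Q.Δ i₁ i₂) i₃ i₄ i₅) h₃ h₄
    (Q.pentagon (star Q.Δ i₁ i₂) (star Q.Δ i₃ i₄) i₅ i₆)

end Six

end QuasiBialgebra
end QHA
end

noncomputable section

namespace QHA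

/-! ### Coherence for comodule algebras -/

namespace RightComoduleAlgebra

variable {k H : Type*} [Field k] [Ring H] [Algebra k H] {Q : QuasiBialgebra k H}
  {A : Type*} [Ring A] [Algebra k A] (R : RightComoduleAlgebra Q A)
  {B : Type*} [Ring B] [Algebra k B]

instance intertwines_Φρ (n : A →ₐ[k] B) (i j : H →ₐ[k] B) [LegComm n i] [LegComm n j]
    [LegComm i j] :
    Intertwines (place₃ R.Φρ n i j) (star R.ρ (star R.ρ n i) j) (star R.ρ n (star Q.Δ i j)) where
  semiconj x := by
    have h := congrArg (lift₂ n (lift₂ i j)) (R.coassoc_ρ x)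
    rw [map_mul, map_mul, lift₂_onRest, lift₂_onFirst] at h
    exact h

theorem pentagon_ρ (n : A →ₐ[k] B) (i j l : H →ₐ[k] B) [LegComm n i] [LegComm n j] [LegComm n l]
    [LegComm i j] [LegComm i l] [LegComm j l] :
    place₃ Q.Φ i j l * place₃ R.Φρ n (star Q.Δ i j) l * place₃ R.Φρ n i j =
      place₃ R.Φρ n i (star Q.Δ j l) * place₃ R.Φρ (star R.ρ n i) j l := by
  have h := congrArg (lift₂ n (lift₂ i (lift₂ j l))) R.cocycle_ρ
  simp only [map_mul, lift₂_oneLeft, lift₂_onRest, lift₂_onFirst, lift₂_comp_onFirst,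
    lift₂_comp_onRest, lift₂_comp_oneRight] at h
  exact Units.ext h

theorem star_triv (n : A →ₐ[k] B) : star R.ρ n (triv B Q.ε) = n :=
  AlgHom.ext fun x => by rw [star_apply, lift₂_dropLast, R.counit_ρ]

theorem place_triv_mid (n : A →ₐ[k] B) (l : H →ₐ[k] B) [LegComm n l] :
    place₃ R.Φρ n (triv B Q.ε) l = 1 := by
  have h := congrArg (lift₂ n l) R.counit_Φρ_mid
  rw [lift₂_onRest, map_one] at h
  simp only [lift₂_comp_dropFirst] at h
  exact Units.ext h

theorem place_triv_right (n : A →ₐ[k] B) (l : H →ₐ[k] B) [LegComm n l] :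
    place₃ R.Φρ n l (triv B Q.ε) = 1 := by
  have h := congrArg (lift₂ n l) R.counit_Φρ_last
  rw [lift₂_onRest, map_one] at h
  simp only [lift₂_comp_dropLast] at h
  exact Units.ext h

/-- The two ways `((n (1 2)) 3) 4 → n ((1 (2 3)) 4)` of splitting off the pair `2 3` agree. -/
theorem nest_mul (n : A →ₐ[k] B) (i₁ i₂ i₃ i₄ : H →ₐ[k] B) [LegComm n i₁] [LegComm n i₂]
    [LegComm n i₃] [LegComm n i₄] [LegComm i₁ i₂] [LegComm i₁ i₃] [LegComm i₁ i₄]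
    [LegComm i₂ i₃] [LegComm i₂ i₄] [LegComm i₃ i₄] :
    Q.nest i₁ i₂ i₃ i₄ * place₃ R.Φρ n (star Q.Δ i₁ i₂) (star Q.Δ i₃ i₄) *
        place₃ R.Φρ (star R.ρ n (star Q.Δ i₁ i₂)) i₃ i₄ * place₃ R.Φρ n i₁ i₂ =
      place₃ R.Φρ n (star Q.Δ i₁ (star Q.Δ i₂ i₃)) i₄ * place₃ R.Φρ n i₁ (star Q.Δ i₂ i₃) *
        place₃ R.Φρ (star R.ρ n i₁) i₂ i₃ := by
  have p₁ := R.pentagon_ρ n i₁ i₂ i₃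
  have p₂ := R.pentagon_ρ n (star Q.Δ i₁ i₂) i₃ i₄
  have h := place₃_intertwine (place₃ Q.Φ i₁ i₂ i₃) R.Φρ n n
    (star Q.Δ (star Q.Δ i₁ i₂) i₃) (star Q.Δ i₁ (star Q.Δ i₂ i₃)) i₄ i₄
  -- The pentagon `p₂` cancels the inverse factor of `nest`, and `p₁` rewrites the right-hand side.
  -- What remains is that `Φ` in the legs `1, 2, 3` slides past `Φ_ρ`, which is `h`.
  rw [QuasiBialgebra.nest, mul_assoc (_ * _) (place₃ R.Φρ n _ _), ← p₂,
    mul_assoc _ _ (place₃ R.Φρ (star R.ρ n i₁) i₂ i₃), ← p₁]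
  simp only [mul_assoc, inv_mul_cancel_left]
  rw [← mul_assoc, h, mul_assoc]

end RightComoduleAlgebra

/-- The group-theoretic content of the pentagon for `Ψ_l`. The last two relations say that `g`,
which stands for `Φ` on the right-hand legs, commutes with `Φ_λ` on the left-hand legs; they are
used in `hg`, after all other relations have been substituted. -/
theorem diagonal_pentagon_word {G : Type*} [Group G]
    {a₁ a₂ a₃ b₁ b₂ b₃ c₁ c₂ c₃ d₁ d₂ d₃ e₁ e₂ e₃ e₄ e₅ e₆ e₇ e₈ f g h : G}
    (r₁ : a₁ * e₁ * h = c₃ * d₁) (r₂ : h * d₂ = e₂ * h) (r₃ : a₃ * b₃ * f = h * d₃)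
    (r₄ : a₁ * e₃ = c₂ * a₁) (r₅ : a₁ * e₄ = c₁ * a₁) (r₆ : e₁ * e₅ = e₃ * e₁)
    (r₇ : a₂ * e₄ * e₁ = e₆ * e₇) (r₈ : g * e₈ * e₇ = e₂ * e₅) (r₉ : a₃ * b₁ = e₆ * a₃)
    (r₁₀ : a₃ * b₂ = e₈ * a₃) (r₁₁ : h * g = g * h) (r₁₂ : d₃ * g = g * d₃) :
    a₁ * a₂⁻¹ * a₃ * (b₁ * b₂⁻¹ * b₃) * (f * g⁻¹) =
      c₁ * c₂⁻¹ * c₃ * (d₁ * d₂⁻¹ * d₃) := by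
  obtain rfl := eq_mul_inv_of_mul_eq r₅.symm
  obtain rfl := eq_mul_inv_of_mul_eq r₄.symm
  obtain rfl := eq_mul_inv_of_mul_eq r₆.symm
  obtain rfl := eq_mul_inv_of_mul_eq r₁.symm
  obtain rfl := eq_inv_mul_of_mul_eq r₂
  obtain rfl := eq_inv_mul_of_mul_eq r₉
  obtain rfl := eq_inv_mul_of_mul_eq r₁₀
  obtain rfl := eq_inv_mul_of_mul_eq r₃
  obtain rfl := eq_mul_inv_of_mul_eq r₈.symm
  rw [mul_assoc] at r₇
  obtain rfl := eq_mul_inv_of_mul_eq (eq_inv_mul_of_mul_eq r₇)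
  have hg : h * d₃ * g⁻¹ = g⁻¹ * (h * d₃) :=
    ((show Commute h g from r₁₁).mul_left (show Commute d₃ g from r₁₂)).inv_right
  calc _ = a₁ * a₂⁻¹ * e₆ * e₈⁻¹ * (h * d₃ * g⁻¹) := by group
    _ = _ := by rw [hg]; group

theorem diagonal_twist_word {G : Type*} [Group G]
    {s₁ s₂ s₃ t q₁ q₂ q₃ q₄ q₅ w₁ w₂ w₃ w₄ : G} (r₁ : s₃ * s₂ = w₁ * s₃)
    (r₂ : w₂ * w₃ * q₅ = w₁ * t) (r₃ : s₃ * s₁ * q₁ = w₂ * w₄) (r₄ : w₄ * q₂ * q₃ = w₃ * q₄) :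
    s₁⁻¹ * s₂ * s₃⁻¹ * t = q₁ * q₂ * (q₃ * q₄⁻¹ * q₅) := by
  obtain rfl := eq_inv_mul_of_mul_eq r₁
  obtain rfl := eq_mul_inv_of_mul_eq r₂.symm
  obtain rfl := eq_mul_inv_of_mul_eq r₃.symm
  obtain rfl := eq_mul_inv_of_mul_eq r₄.symm
  group

namespace BicomoduleAlgebra

variable {k H : Type*} [Field k] [Ring H] [Algebra k H] {Q : QuasiBialgebra k H}
  {A : Type*} [Ring A] [Algebra k A] (𝔸 : BicomoduleAlgebra Q A)
  {B : Type*} [Ring B] [Algebra k B]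

instance intertwines_Φlam (i j : H →ₐ[k] B) (n : A →ₐ[k] B) [LegComm i j] [LegComm i n]
    [LegComm j n] :
    Intertwines (place₃ 𝔸.Φlam i j n) (star 𝔸.lam (star Q.Δ i j) n)
      (star 𝔸.lam i (star 𝔸.lam j n)) where
  semiconj x := by
    have h := congrArg (lift₂ i (lift₂ j n)) (𝔸.coassoc_lam x)
    rw [map_mul, map_mul, lift₂_onRest, lift₂_onFirst] at h
    exact h.symm

instance intertwines_Φρ (n : A →ₐ[k] B) (i j : H →ₐ[k] B) [LegComm n i] [LegComm n j]
    [LegComm i j] :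
    Intertwines (place₃ 𝔸.Φρ n i j) (star 𝔸.ρ (star 𝔸.ρ n i) j) (star 𝔸.ρ n (star Q.Δ i j)) :=
  𝔸.toRightComoduleAlgebra.intertwines_Φρ n i j

instance intertwines_Φlr (i : H →ₐ[k] B) (n : A →ₐ[k] B) (j : H →ₐ[k] B) [LegComm i n]
    [LegComm i j] [LegComm n j] :
    Intertwines (place₃ 𝔸.Φlr i n j) (star 𝔸.ρ (star 𝔸.lam i n) j)
      (star 𝔸.lam i (star 𝔸.ρ n j)) where
  semiconj x := by
    have h := congrArg (lift₂ i (lift₂ n j)) (𝔸.quasi_comm x)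
    rw [map_mul, map_mul, lift₂_onRest, lift₂_onFirst] at h
    exact h

theorem pentagon_ρ (n : A →ₐ[k] B) (i j l : H →ₐ[k] B) [LegComm n i] [LegComm n j] [LegComm n l]
    [LegComm i j] [LegComm i l] [LegComm j l] :
    place₃ Q.Φ i j l * place₃ 𝔸.Φρ n (star Q.Δ i j) l * place₃ 𝔸.Φρ n i j =
      place₃ 𝔸.Φρ n i (star Q.Δ j l) * place₃ 𝔸.Φρ (star 𝔸.ρ n i) j l :=
  𝔸.toRightComoduleAlgebra.pentagon_ρ n i j l

theorem pentagon_lam (i j l : H →ₐ[k] B) (n : A →ₐ[k] B) [LegComm i j] [LegComm i l]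
    [LegComm j l] [LegComm i n] [LegComm j n] [LegComm l n] :
    place₃ 𝔸.Φlam j l n * place₃ 𝔸.Φlam i (star Q.Δ j l) n * place₃ Q.Φ i j l =
      place₃ 𝔸.Φlam i j (star 𝔸.lam l n) * place₃ 𝔸.Φlam (star Q.Δ i j) l n := by
  have h := congrArg (lift₂ i (lift₂ j (lift₂ l n))) 𝔸.cocycle_lam
  simp only [map_mul, lift₂_oneLeft, lift₂_onRest, lift₂_onFirst, lift₂_comp_onFirst,
    lift₂_comp_onRest, lift₂_comp_oneRight] at h
  exact Units.ext h

theorem hexagon_lam (i j : H →ₐ[k] B) (n : A →ₐ[k] B) (l : H →ₐ[k] B) [LegComm i j] [LegComm i l]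
    [LegComm j l] [LegComm i n] [LegComm j n] [LegComm n l] :
    place₃ 𝔸.Φlr j n l * place₃ 𝔸.Φlr i (star 𝔸.lam j n) l * place₃ 𝔸.Φlam i j n =
      place₃ 𝔸.Φlam i j (star 𝔸.ρ n l) * place₃ 𝔸.Φlr (star Q.Δ i j) n l := by
  have h := congrArg (lift₂ i (lift₂ j (lift₂ n l))) 𝔸.compat_lam
  simp only [map_mul, lift₂_oneLeft, lift₂_onRest, lift₂_onFirst, lift₂_comp_onFirst,
    lift₂_comp_onRest, lift₂_comp_oneRight] at h
  exact Units.ext h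

theorem hexagon_ρ (i : H →ₐ[k] B) (n : A →ₐ[k] B) (j l : H →ₐ[k] B) [LegComm i j] [LegComm i l]
    [LegComm j l] [LegComm i n] [LegComm n j] [LegComm n l] :
    place₃ 𝔸.Φρ n j l * place₃ 𝔸.Φlr i (star 𝔸.ρ n j) l * place₃ 𝔸.Φlr i n j =
      place₃ 𝔸.Φlr i n (star Q.Δ j l) * place₃ 𝔸.Φρ (star 𝔸.lam i n) j l := by
  have h := congrArg (lift₂ i (lift₂ n (lift₂ j l))) 𝔸.compat_ρ
  simp only [map_mul, lift₂_oneLeft, lift₂_onRest, lift₂_onFirst, lift₂_comp_onFirst,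
    lift₂_comp_onRest, lift₂_comp_oneRight] at h
  exact Units.ext h

theorem star_lam_triv (n : A →ₐ[k] B) : star 𝔸.lam (triv B Q.ε) n = n :=
  AlgHom.ext fun x => by rw [star_apply, lift₂_dropFirst, 𝔸.counit_lam]

theorem star_ρ_triv (n : A →ₐ[k] B) : star 𝔸.ρ n (triv B Q.ε) = n :=
  𝔸.toRightComoduleAlgebra.star_triv n

theorem Φlam_triv_mid (i : H →ₐ[k] B) (n : A →ₐ[k] B) [LegComm i n] :
    place₃ 𝔸.Φlam i (triv B Q.ε) n = 1 := by
  have h := congrArg (lift₂ i n) 𝔸.counit_Φlam_mid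
  rw [lift₂_onRest, map_one] at h
  simp only [lift₂_comp_dropFirst] at h
  exact Units.ext h

theorem Φlam_triv_first (i : H →ₐ[k] B) (n : A →ₐ[k] B) [LegComm i n] :
    place₃ 𝔸.Φlam (triv B Q.ε) i n = 1 := by
  have h := congrArg (lift₂ i n) 𝔸.counit_Φlam_first
  rw [← lift₂_dropFirst, map_one] at h
  exact Units.ext h

/-- A consequence of the axioms: the hexagon for `λ` with two trivial legs reduces to `x x = x`. -/
theorem Φlr_triv_first (n : A →ₐ[k] B) (j : H →ₐ[k] B) [LegComm n j] :
    place₃ 𝔸.Φlr (triv B Q.ε) n j = 1 := by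
  have h := 𝔸.hexagon_lam (triv B Q.ε) (triv B Q.ε) n j
  simp only [star_lam_triv, Φlam_triv_first, Q.star_triv_left, mul_one, one_mul] at h
  simpa using h

theorem Φlr_triv_last (i : H →ₐ[k] B) (n : A →ₐ[k] B) [LegComm i n] :
    place₃ 𝔸.Φlr i n (triv B Q.ε) = 1 := by
  have h := 𝔸.hexagon_ρ i n (triv B Q.ε) (triv B Q.ε)
  simp only [star_ρ_triv, 𝔸.toRightComoduleAlgebra.place_triv_right, Q.star_triv_left, mul_one,
    one_mul] at h
  simpa using h

section Five

variable (x y : H →ₐ[k] B) (n : A →ₐ[k] B) (u v : H →ₐ[k] B) [LegComm x y] [LegComm x n]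
  [LegComm x u] [LegComm x v] [LegComm y n] [LegComm y u] [LegComm y v] [LegComm n u]
  [LegComm n v] [LegComm u v]

/-- The image of a unit of `H ⊗ H ⊗ A ⊗ H ⊗ H` under the product of five commuting maps. -/
def _root_.QHA.place₅ (ω : (H ⊗[k] (H ⊗[k] (A ⊗[k] (H ⊗[k] H))))ˣ) : Bˣ :=
  place₂ ω x (lift₂ y (lift₂ n (lift₂ u v)))

/-- In legs `Ψ_l` is a word in three placed reassociators, the form in which the hexagons and
pentagons apply to it. -/
theorem place_Ψl : place₅ x y n u v (Ψl 𝔸) =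
    place₃ 𝔸.Φlr x (star 𝔸.lam y n) u *
      (place₃ 𝔸.Φρ (star 𝔸.lam x (star 𝔸.lam y n)) u v)⁻¹ * place₃ 𝔸.Φlam x y n := by
  refine Units.ext ?_
  simp only [Ψl, place₅, coe_place₂, map_mul, Units.val_mul, coe_place₃, coe_place₃_inv,
    coe_unitsMap, lift₂_onRest, lift₂_onFirst, lift₂_comp_onFirst, lift₂_comp_onRest,
    lift₂_comp_oneRight]

theorem place_Ψr : place₅ x y n u v (Ψr 𝔸) =
    (place₃ 𝔸.Φlr y (star 𝔸.ρ n u) v)⁻¹ * place₃ 𝔸.Φlam x y (star 𝔸.ρ (star 𝔸.ρ n u) v) *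
      (place₃ 𝔸.Φρ n u v)⁻¹ := by
  refine Units.ext ?_
  simp only [Ψr, place₅, coe_place₂, map_mul, Units.val_mul, coe_place₃, coe_place₃_inv,
    coe_unitsMap, lift₂_onRest, lift₂_comp_onFirst, lift₂_comp_onRest, lift₂_oneLeft,
    AlgHom.comp_apply]
  rfl

/-- The element `Ψ_l` plays the role of a reassociator for the two-sided coaction `δ_l`: it compares
splitting the two outer legs by `Δ` with iterating `δ_l`. Its three factors implement the three
elementary rebracketings. -/
instance intertwines_Ψl : Intertwines (place₅ x y n u v (Ψl 𝔸))
    (star 𝔸.ρ (star 𝔸.lam (star Q.Δ x y) n) (star Q.Δ u v))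
    (star 𝔸.ρ (star 𝔸.lam x (star 𝔸.ρ (star 𝔸.lam y n) u)) v) where
  semiconj t := by
    rw [place_Ψl, Units.val_mul, Units.val_mul]
    have h₁ := Intertwines.semiconj (b := place₃ 𝔸.Φlam x y n)
      (i := star 𝔸.ρ (star 𝔸.lam (star Q.Δ x y) n) (star Q.Δ u v))
      (i' := star 𝔸.ρ (star 𝔸.lam x (star 𝔸.lam y n)) (star Q.Δ u v)) t
    have h₂ := Intertwines.semiconj
      (b := (place₃ 𝔸.Φρ (star 𝔸.lam x (star 𝔸.lam y n)) u v)⁻¹)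
      (i := star 𝔸.ρ (star 𝔸.lam x (star 𝔸.lam y n)) (star Q.Δ u v))
      (i' := star 𝔸.ρ (star 𝔸.ρ (star 𝔸.lam x (star 𝔸.lam y n)) u) v) t
    have h₃ := Intertwines.semiconj (b := place₃ 𝔸.Φlr x (star 𝔸.lam y n) u)
      (i := star 𝔸.ρ (star 𝔸.ρ (star 𝔸.lam x (star 𝔸.lam y n)) u) v)
      (i' := star 𝔸.ρ (star 𝔸.lam x (star 𝔸.ρ (star 𝔸.lam y n) u)) v) t
    exact (h₃.mul_left h₂).mul_left h₁

/-- The elements `Ψ_l` and `Ψ_r` differ by the gauge transformation with `Φ_{λ,ρ}`, which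
intertwines `δ_l` and `δ_r`. The proof uses one hexagon for `λ`, two for `ρ`, and naturality of
`Φ_ρ` against `Φ_λ`. This is the source of the isomorphism between the two smash products. -/
theorem Ψr_twist : place₅ x y n u v (Ψr 𝔸) * place₃ 𝔸.Φlr (star Q.Δ x y) n (star Q.Δ u v) =
    place₃ 𝔸.Φlr y n u * place₃ 𝔸.Φlr x (star 𝔸.ρ (star 𝔸.lam y n) u) v *
      place₅ x y n u v (Ψl 𝔸) := by
  rw [place_Ψr, place_Ψl]
  have r₁ := place₃_intertwine (place₃ 𝔸.Φρ n u v) 𝔸.Φlam x x y y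
    (star 𝔸.ρ (star 𝔸.ρ n u) v) (star 𝔸.ρ n (star Q.Δ u v))
  exact diagonal_twist_word r₁ (𝔸.hexagon_lam x y n (star Q.Δ u v)) (𝔸.hexagon_ρ y n u v)
    (𝔸.hexagon_ρ x (star 𝔸.lam y n) u v)

theorem Ψl_triv_outer (y : H →ₐ[k] B) (n : A →ₐ[k] B) (u : H →ₐ[k] B) [LegComm y n] [LegComm y u]
    [LegComm n u] : place₅ (triv B Q.ε) y n u (triv B Q.ε) (Ψl 𝔸) = 1 := by
  simp only [place_Ψl, star_lam_triv, Φlam_triv_first, Φlr_triv_first,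
    𝔸.toRightComoduleAlgebra.place_triv_right, inv_one, mul_one]

theorem Ψl_triv_inner (x : H →ₐ[k] B) (n : A →ₐ[k] B) (v : H →ₐ[k] B) [LegComm x n] [LegComm x v]
    [LegComm n v] : place₅ x (triv B Q.ε) n (triv B Q.ε) v (Ψl 𝔸) = 1 := by
  simp only [place_Ψl, star_lam_triv, Φlam_triv_mid, Φlr_triv_last,
    𝔸.toRightComoduleAlgebra.place_triv_mid, inv_one, mul_one]

end Five

/-- The pentagon for a two-sided coaction: `Φ` governs the three left legs and `Φ⁻¹` the three right
legs. It combines one instance each of the pentagons for `Φ_λ` and `Φ_ρ` and of the two hexagons;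
all other inputs are naturality squares. -/
theorem Ψl_pentagon (x y z : H →ₐ[k] B) (n : A →ₐ[k] B) (u v w : H →ₐ[k] B)
    [LegComm x y] [LegComm x z] [LegComm x n] [LegComm x u] [LegComm x v] [LegComm x w]
    [LegComm y z] [LegComm y n] [LegComm y u] [LegComm y v] [LegComm y w]
    [LegComm z n] [LegComm z u] [LegComm z v] [LegComm z w]
    [LegComm n u] [LegComm n v] [LegComm n w] [LegComm u v] [LegComm u w] [LegComm v w] :
    place₅ y z n u v (Ψl 𝔸) * place₅ x (star Q.Δ y z) n (star Q.Δ u v) w (Ψl 𝔸) *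
        (place₃ Q.Φ x y z * (place₃ Q.Φ u v w)⁻¹) =
      place₅ x y (star 𝔸.ρ (star 𝔸.lam z n) u) v w (Ψl 𝔸) *
        place₅ (star Q.Δ x y) z n u (star Q.Δ v w) (Ψl 𝔸) := by
  simp only [place_Ψl]
  have r₁ := 𝔸.hexagon_lam x y (star 𝔸.lam z n) u
  have r₂ := place₃_intertwine (place₃ 𝔸.Φlam x y (star 𝔸.lam z n)) 𝔸.Φρ
    (star 𝔸.lam (star Q.Δ x y) (star 𝔸.lam z n)) (star 𝔸.lam x (star 𝔸.lam y (star 𝔸.lam z n)))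
    u u (star Q.Δ v w) (star Q.Δ v w)
  have r₃ := 𝔸.pentagon_lam x y z n
  have r₄ := place₃_intertwine (place₃ 𝔸.Φlr y (star 𝔸.lam z n) u) 𝔸.Φρ
    (star 𝔸.lam x (star 𝔸.ρ (star 𝔸.lam y (star 𝔸.lam z n)) u))
    (star 𝔸.lam x (star 𝔸.lam y (star 𝔸.ρ (star 𝔸.lam z n) u))) v v w w
  have r₅ := place₃_intertwine (place₃ 𝔸.Φlr y (star 𝔸.lam z n) u) 𝔸.Φlr x x
    (star 𝔸.ρ (star 𝔸.lam y (star 𝔸.lam z n)) u)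
    (star 𝔸.lam y (star 𝔸.ρ (star 𝔸.lam z n) u)) v v
  have r₆ := place₃_intertwine (place₃ 𝔸.Φlr x (star 𝔸.lam y (star 𝔸.lam z n)) u) 𝔸.Φρ
    (star 𝔸.ρ (star 𝔸.lam x (star 𝔸.lam y (star 𝔸.lam z n))) u)
    (star 𝔸.lam x (star 𝔸.ρ (star 𝔸.lam y (star 𝔸.lam z n)) u)) v v w w
  have r₇ := 𝔸.hexagon_ρ x (star 𝔸.lam y (star 𝔸.lam z n)) u v
  have r₈ := 𝔸.pentagon_ρ (star 𝔸.lam x (star 𝔸.lam y (star 𝔸.lam z n))) u v w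
  have r₉ := place₃_intertwine (place₃ 𝔸.Φlam y z n) 𝔸.Φlr x x (star 𝔸.lam (star Q.Δ y z) n)
    (star 𝔸.lam y (star 𝔸.lam z n)) (star Q.Δ u v) (star Q.Δ u v)
  have r₁₀ := place₃_intertwine (place₃ 𝔸.Φlam y z n) 𝔸.Φρ
    (star 𝔸.lam x (star 𝔸.lam (star Q.Δ y z) n))
    (star 𝔸.lam x (star 𝔸.lam y (star 𝔸.lam z n))) (star Q.Δ u v) (star Q.Δ u v) w w
  have r₁₁ := place₃_intertwine (place₃ 𝔸.Φlam x y (star 𝔸.lam z n)) Q.Φ u u v v w w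
  have r₁₂ := place₃_intertwine (place₃ 𝔸.Φlam (star Q.Δ x y) z n) Q.Φ u u v v w w
  exact diagonal_pentagon_word r₁ r₂ r₃ r₄ r₅ r₆ r₇ r₈ r₉ r₁₀ r₁₁ r₁₂

end BicomoduleAlgebra

end QHA
end

/-! ### Standard embeddings, contractions and the uniqueness of antipode data. -/

noncomputable section

namespace QHA

section StandardLegs

variable {k : Type*} [Field k] {B : Type*} [Ring B] [Algebra k B]
  {U V W P : Type*} [Ring U] [Algebra k U] [Ring V] [Algebra k V] [Ring W] [Algebra k W]
  [Ring P] [Algebra k P]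

instance oneRight_oneLeft : LegComm (oneRight k U V) (oneLeft k U V) where
  comm x y := by simp [oneRight, oneLeft, Commute, SemiconjBy]

instance oneLeft_oneRight : LegComm (oneLeft k U V) (oneRight k U V) where
  comm x y := by simp [oneRight, oneLeft, Commute, SemiconjBy]

instance comp_comp (f : B →ₐ[k] W) (i : U →ₐ[k] B) (j : V →ₐ[k] B) [LegComm i j] :
    LegComm (f.comp i) (f.comp j) where
  comm x y := (LegComm.comm (i := i) (j := j) x y).map f

theorem lift₂_comp_comp (f : B →ₐ[k] W) (i : U →ₐ[k] B) (j : V →ₐ[k] B) [LegComm i j] :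
    lift₂ (f.comp i) (f.comp j) = f.comp (lift₂ i j) :=
  AlgHom.ext fun t => (lift₂_comp f i j t).symm

theorem star_comp_comp (d : P →ₐ[k] U ⊗[k] V) (f : B →ₐ[k] W) (i : U →ₐ[k] B) (j : V →ₐ[k] B)
    [LegComm i j] : star d (f.comp i) (f.comp j) = f.comp (star d i j) := by
  rw [star, lift₂_comp_comp]; rfl

theorem lift₂_oneRight_comp (j : W →ₐ[k] V) :
    lift₂ (oneRight k U V) ((oneLeft k U V).comp j) = onRest k U j := by
  refine AlgHom.ext fun t => ?_
  induction t using TensorProduct.induction_on with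
  | zero => simp
  | add x y hx hy => simp only [map_add, hx, hy]
  | tmul x y => simp [oneRight, oneLeft, onRest]

theorem lift₂_oneRight_oneLeft : lift₂ (oneRight k U V) (oneLeft k U V) = AlgHom.id k _ := by
  have h := lift₂_oneRight_comp (k := k) (U := U) (AlgHom.id k V)
  rw [show onRest k U (AlgHom.id k V) = AlgHom.id k _ from Algebra.TensorProduct.map_id] at h
  exact h

end StandardLegs

/-! ### Collapsing a leg under a linear map -/

section Collapse

variable {k : Type*} [Field k] {B : Type*} [Ring B] [Algebra k B]
  {M : Type*} [AddCommGroup M] [Module k M]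
  {H U V W P : Type*} [Ring H] [Algebra k H] [Ring U] [Algebra k U] [Ring V] [Algebra k V]
  [Ring W] [Algebra k W] [Ring P] [Algebra k P]

/-- The factor on the side `s` (`true` is left) commutes with the image of `a`. -/
def SideComm (s : Bool) (a : H →ₐ[k] B) (u z : B) : Prop :=
  ∀ h, Commute (cond s u z) (a h)

/-- `x` may be replaced by `y` under `c` next to factors that commute with `a`. -/
structure CollapseRel (c : B →ₗ[k] M) (s : Bool) (a : H →ₐ[k] B) (x y : B) : Prop where
  eval : ∀ u z, SideComm s a u z → c (u * x * z) = c (u * y * z)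
  comm : ∀ h, Commute y (a h)

variable {c : B →ₗ[k] M} {s : Bool} {a : H →ₐ[k] B}

/-- Replacement works outward from the contracted edge. For the left side, `x` is replaced first;
since `y` commutes with `a` it then joins the left context, and `x'` can be replaced. For the right
side the order is reversed. This is why commutation of `y` is part of `CollapseRel`. -/
theorem CollapseRel.mul {x x' y y' : B} (h : CollapseRel c s a x y)
    (h' : CollapseRel c s a x' y') : CollapseRel c s a (x * x') (y * y') where
  eval u z hz := by
    cases s
    · calc _ = c (u * x * x' * z) := by simp only [mul_assoc]
        _ = c (u * x * y' * z) := h'.eval _ _ hz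
        _ = c (u * x * (y' * z)) := by simp only [mul_assoc]
        _ = c (u * y * (y' * z)) := h.eval _ _ fun t => (h'.comm t).mul_left (hz t)
        _ = _ := by simp only [mul_assoc]
    · calc _ = c (u * x * (x' * z)) := by simp only [mul_assoc]
        _ = c (u * y * (x' * z)) := h.eval _ _ hz
        _ = c (u * y * x' * z) := by simp only [mul_assoc]
        _ = c (u * y * y' * z) := h'.eval _ _ fun t => (hz t).mul_left (h.comm t)
        _ = _ := by simp only [mul_assoc]
  comm t := (h.comm t).mul_left (h'.comm t)

theorem CollapseRel.eval_left {x y : B} (h : CollapseRel c true a x y) (z : B) :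
    c (x * z) = c (y * z) := by
  simpa using h.eval 1 z fun _ => Commute.one_left _

theorem CollapseRel.eval_right {x y : B} (h : CollapseRel c false a x y) (z : B) :
    c (z * x) = c (z * y) := by
  simpa using h.eval z 1 fun _ => Commute.one_left _

variable (c s a)

/-- `CollapseRel` for the values of two maps. -/
class Collapse (i i' : P →ₐ[k] B) : Prop where
  rel : ∀ x, CollapseRel c s a (i x) (i' x)

instance Collapse.refl_left (i : P →ₐ[k] B) [LegComm i a] : Collapse c s a i i where
  rel x := ⟨fun _ _ _ => rfl, fun h => LegComm.comm x h⟩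

instance Collapse.refl_right (i : P →ₐ[k] B) [LegComm a i] : Collapse c s a i i where
  rel x := ⟨fun _ _ _ => rfl, fun h => (LegComm.comm h x).symm⟩

instance Collapse.lift₂ (i i' : U →ₐ[k] B) (j j' : V →ₐ[k] B) [LegComm i j] [LegComm i' j']
    [Collapse c s a i i'] [Collapse c s a j j'] :
    Collapse c s a (QHA.lift₂ i j) (QHA.lift₂ i' j') where
  rel := by
    refine lift₂_induction ⟨fun _ _ _ => rfl, fun h => Commute.zero_left _⟩ ?_
      fun x y => (Collapse.rel x).mul (Collapse.rel y)
    intro x x' y y' h h'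
    exact ⟨fun u z hz => by simp only [mul_add, add_mul, map_add, h.eval u z hz, h'.eval u z hz],
      fun t => (h.comm t).add_left (h'.comm t)⟩

instance Collapse.star (d : P →ₐ[k] U ⊗[k] V) (i i' : U →ₐ[k] B) (j j' : V →ₐ[k] B)
    [LegComm i j] [LegComm i' j'] [Collapse c s a i i'] [Collapse c s a j j'] :
    Collapse c s a (QHA.star d i j) (QHA.star d i' j') where
  rel x := Collapse.rel (i := QHA.lift₂ i j) (i' := QHA.lift₂ i' j') (d x)

/-- By commutation `a(t)` can be moved through the left context to the outer edge, where `c` absorbs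
it as a scalar. Every antipode axiom enters the coherence calculations through this lemma or its
mirror image. -/
theorem Collapse.of_left (e : H →ₐ[k] k) (h : ∀ t z, c (a t * z) = e t • c z) :
    Collapse c true a a (triv B e) where
  rel t := ⟨fun u z hz => by
    rw [(show Commute u (a t) from hz t).eq, mul_assoc, h, triv_apply, ← Algebra.commutes,
      mul_assoc, ← Algebra.smul_def, map_smul], fun _ => Algebra.commutes _ _⟩

theorem Collapse.of_right (e : H →ₐ[k] k) (h : ∀ t z, c (z * a t) = e t • c z) :
    Collapse c false a a (triv B e) where
  rel t := ⟨fun u z hz => by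
    rw [mul_assoc, ← (show Commute z (a t) from hz t).eq, ← mul_assoc, h, triv_apply,
      ← Algebra.commutes, mul_assoc, ← Algebra.smul_def, map_smul], fun _ => Algebra.commutes _ _⟩

theorem collapse_place₃ (u : (U ⊗[k] (V ⊗[k] W))ˣ) (i i' : U →ₐ[k] B) (j j' : V →ₐ[k] B)
    (l l' : W →ₐ[k] B) [LegComm i j] [LegComm i l] [LegComm j l] [LegComm i' j'] [LegComm i' l']
    [LegComm j' l'] [Collapse c s a i i'] [Collapse c s a j j'] [Collapse c s a l l'] :
    CollapseRel c s a (place₃ u i j l) (place₃ u i' j' l') :=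
  Collapse.rel (i := QHA.lift₂ i (QHA.lift₂ j l)) (i' := QHA.lift₂ i' (QHA.lift₂ j' l'))
    (u : U ⊗[k] (V ⊗[k] W))

theorem collapse_place₃_inv (u : (U ⊗[k] (V ⊗[k] W))ˣ) (i i' : U →ₐ[k] B) (j j' : V →ₐ[k] B)
    (l l' : W →ₐ[k] B) [LegComm i j] [LegComm i l] [LegComm j l] [LegComm i' j'] [LegComm i' l']
    [LegComm j' l'] [Collapse c s a i i'] [Collapse c s a j j'] [Collapse c s a l l'] :
    CollapseRel c s a ↑(place₃ u i j l)⁻¹ ↑(place₃ u i' j' l')⁻¹ :=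
  collapse_place₃ c s a u⁻¹ i i' j j' l l'

end Collapse

/-! ### Contractions -/

section Contraction

variable {k H : Type*} [Field k] [Ring H] [Algebra k H] (Q : QuasiBialgebra k H)
  {B : Type*} [Ring B] [Algebra k B] {U D : Type*} [Ring U] [Algebra k U] [Ring D] [Algebra k D]

@[simp]
theorem mulMap_tmul (f : U →ₗ[k] B) (g : D →ₗ[k] B) (x : U) (y : D) :
    mulMap k f g (x ⊗ₜ y) = f x * g y := by
  simp [mulMap]

/-- `f(h₁ x) g(h₂ y) = ε(h) f(x) g(y)`. -/
def LeftPair (f g : H →ₗ[k] B) : Prop :=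
  ∀ h z, mulMap k f g (Q.Δ h * z) = Q.ε h • mulMap k f g z

/-- `f(x h₁) g(y h₂) = ε(h) f(x) g(y)`. -/
def RightPair (f g : H →ₗ[k] B) : Prop :=
  ∀ h z, mulMap k f g (z * Q.Δ h) = Q.ε h • mulMap k f g z

variable {Q}

/-- The absorption of `Δ(h)` concerns two neighbouring factors only, so it survives when further
factors follow. -/
theorem LeftPair.tail {f g : H →ₗ[k] B} (hfg : LeftPair Q f g) (l : D →ₗ[k] B) (h : H)
    (z : H ⊗[k] (H ⊗[k] D)) :
    mulMap k f (mulMap k g l) (onRest k H (oneRight k H D) (Q.Δ h) * z) =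
      Q.ε h • mulMap k f (mulMap k g l) z := by
  have key : ∀ (d : H ⊗[k] H) (p q : H) (r : D),
      mulMap k f (mulMap k g l) (onRest k H (oneRight k H D) d * (p ⊗ₜ (q ⊗ₜ r))) =
        mulMap k f g (d * (p ⊗ₜ q)) * l r := by
    intro d p q r
    induction d using TensorProduct.induction_on with
    | zero => simp
    | add x y hx hy => simp only [map_add, add_mul, hx, hy]
    | tmul x y => simp [onRest, oneRight, mul_assoc]
  induction z using TensorProduct.induction_on with
  | zero => simp
  | add x y hx hy => simp only [map_add, mul_add, smul_add, hx, hy]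
  | tmul p z =>
    induction z using TensorProduct.induction_on with
    | zero => simp
    | add x y hx hy => simp only [map_add, mul_add, TensorProduct.tmul_add, smul_add, hx, hy]
    | tmul q r => rw [key, hfg]; simp [mul_assoc]

theorem RightPair.tail {f g : H →ₗ[k] B} (hfg : RightPair Q f g) (l : D →ₗ[k] B) (h : H)
    (z : H ⊗[k] (H ⊗[k] D)) :
    mulMap k f (mulMap k g l) (z * onRest k H (oneRight k H D) (Q.Δ h)) =
      Q.ε h • mulMap k f (mulMap k g l) z := by
  have key : ∀ (d : H ⊗[k] H) (p q : H) (r : D),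
      mulMap k f (mulMap k g l) ((p ⊗ₜ (q ⊗ₜ r)) * onRest k H (oneRight k H D) d) =
        mulMap k f g ((p ⊗ₜ q) * d) * l r := by
    intro d p q r
    induction d using TensorProduct.induction_on with
    | zero => simp
    | add x y hx hy => simp only [map_add, mul_add, add_mul, hx, hy]
    | tmul x y => simp [onRest, oneRight, mul_assoc]
  induction z using TensorProduct.induction_on with
  | zero => simp
  | add x y hx hy => simp only [map_add, add_mul, smul_add, hx, hy]
  | tmul p z =>
    induction z using TensorProduct.induction_on with
    | zero => simp
    | add x y hx hy => simp only [map_add, add_mul, TensorProduct.tmul_add, smul_add, hx, hy]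
    | tmul q r => rw [key, hfg]; simp [mul_assoc]

theorem mulMap_oneLeft_mul (f : U →ₗ[k] B) (c : D →ₗ[k] B) {w : D} {e : k}
    (h : ∀ z, c (w * z) = e • c z) (z : U ⊗[k] D) :
    mulMap k f c (oneLeft k U D w * z) = e • mulMap k f c z := by
  induction z using TensorProduct.induction_on with
  | zero => simp
  | add x y hx hy => simp only [map_add, mul_add, smul_add, hx, hy]
  | tmul p z => simp [oneLeft, h]

theorem mulMap_mul_oneLeft (f : U →ₗ[k] B) (c : D →ₗ[k] B) {w : D} {e : k}
    (h : ∀ z, c (z * w) = e • c z) (z : U ⊗[k] D) :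
    mulMap k f c (z * oneLeft k U D w) = e • mulMap k f c z := by
  induction z using TensorProduct.induction_on with
  | zero => simp
  | add x y hx hy => simp only [map_add, add_mul, smul_add, hx, hy]
  | tmul p z => simp [oneLeft, h]

theorem mulMap_map {B' : Type*} [Ring B'] [Algebra k B'] (θ : B →ₐ[k] B') (f : U →ₗ[k] B)
    (g : D →ₗ[k] B) {f' : U →ₗ[k] B'} (g' : D →ₗ[k] B') (hf : ∀ x, f' x = θ (f x))
    (hg : ∀ x, g' x = θ (g x)) (z : U ⊗[k] D) : mulMap k f' g' z = θ (mulMap k f g z) := by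
  induction z using TensorProduct.induction_on with
  | zero => simp
  | add x y hx hy => simp only [map_add, hx, hy]
  | tmul p q => simp [hf, hg]

theorem mulMap_mulRight (f : U →ₗ[k] B) (g : D →ₗ[k] B) (b : B) (z : U ⊗[k] D) :
    mulMap k f (LinearMap.mulRight k b ∘ₗ g) z = mulMap k f g z * b := by
  induction z using TensorProduct.induction_on with
  | zero => simp
  | add x y hx hy => simp only [map_add, add_mul, hx, hy]
  | tmul p q => simp [mul_assoc]

theorem LeftPair.mulRight {f g : H →ₗ[k] B} (h : LeftPair Q f g) (b : B) :
    LeftPair Q f (LinearMap.mulRight k b ∘ₗ g) := fun t z => by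
  rw [mulMap_mulRight, mulMap_mulRight, h, smul_mul_assoc]

theorem RightPair.mulRight {f g : H →ₗ[k] B} (h : RightPair Q f g) (b : B) :
    RightPair Q f (LinearMap.mulRight k b ∘ₗ g) := fun t z => by
  rw [mulMap_mulRight, mulMap_mulRight, h, smul_mul_assoc]

end Contraction

/-! ### Antipode data relative to an algebra map -/

/-- Antipode data `(σ, a, b)` for the algebra map `g : H → B`. -/
structure AntipodeTriple {k H : Type*} [Field k] [Ring H] [Algebra k H] (Q : QuasiBialgebra k H)
    {B : Type*} [Ring B] [Algebra k B] (g : H →ₐ[k] B) where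
  σ : H →ₗ[k] B
  a : B
  b : B
  σ_one : σ 1 = 1
  σ_mul : ∀ x y, σ (x * y) = σ y * σ x
  counit_a : ∀ h, mulMap k (LinearMap.mulRight k a ∘ₗ σ) g.toLinearMap (Q.Δ h) = Q.ε h • a
  counit_b : ∀ h, mulMap k (LinearMap.mulRight k b ∘ₗ g.toLinearMap) σ (Q.Δ h) = Q.ε h • b
  contr_Φ : mulMap k (LinearMap.mulRight k b ∘ₗ g.toLinearMap)
    (mulMap k (LinearMap.mulRight k a ∘ₗ σ) g.toLinearMap) (Q.Φ : H ⊗[k] (H ⊗[k] H)) = 1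
  contr_Φ_inv : mulMap k (LinearMap.mulRight k a ∘ₗ σ)
    (mulMap k (LinearMap.mulRight k b ∘ₗ g.toLinearMap) σ)
      (↑Q.Φ⁻¹ : H ⊗[k] (H ⊗[k] H)) = 1

namespace AntipodeTriple

variable {k H : Type*} [Field k] [Ring H] [Algebra k H] {Q : QuasiBialgebra k H}
  {B : Type*} [Ring B] [Algebra k B] {g : H →ₐ[k] B} (T T' : AntipodeTriple Q g)

/-- `x ↦ σ(x) a`. -/
def σa : H →ₗ[k] B := LinearMap.mulRight k T.a ∘ₗ T.σ

/-- `x ↦ g(x) b`. -/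
def gb : H →ₗ[k] B := LinearMap.mulRight k T.b ∘ₗ g.toLinearMap

theorem σa_apply (x : H) : T.σa x = T.σ x * T.a := rfl

theorem gb_apply (x : H) : T.gb x = g x * T.b := rfl

/-- As `σ` reverses products and `g` preserves them, `σ(h₁ x) a g(h₂ y)` contains `σ(h₁) a g(h₂)` in
its interior, so the axiom at `Δ(h)` extends to `Δ(h) z`. -/
theorem leftPair : LeftPair Q T.σa g.toLinearMap := by
  have key : ∀ (d : H ⊗[k] H) (p q : H), mulMap k T.σa g.toLinearMap (d * (p ⊗ₜ q)) =
      T.σ p * mulMap k T.σa g.toLinearMap d * g q := by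
    intro d p q
    induction d using TensorProduct.induction_on with
    | zero => simp
    | add x y hx hy => simp only [map_add, add_mul, mul_add, hx, hy]
    | tmul x y => simp [σa_apply, T.σ_mul, mul_assoc]
  intro h z
  induction z using TensorProduct.induction_on with
  | zero => simp
  | add x y hx hy => simp only [map_add, mul_add, smul_add, hx, hy]
  | tmul p q => rw [key, show mulMap k T.σa g.toLinearMap (Q.Δ h) = _ from T.counit_a h]; simp [σa_apply]

theorem rightPair : RightPair Q T.gb T.σ := by
  have key : ∀ (d : H ⊗[k] H) (p q : H), mulMap k T.gb T.σ ((p ⊗ₜ q) * d) =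
      g p * mulMap k T.gb T.σ d * T.σ q := by
    intro d p q
    induction d using TensorProduct.induction_on with
    | zero => simp
    | add x y hx hy => simp only [map_add, add_mul, mul_add, hx, hy]
    | tmul x y => simp [gb_apply, T.σ_mul, mul_assoc]
  intro h z
  induction z using TensorProduct.induction_on with
  | zero => simp
  | add x y hx hy => simp only [map_add, add_mul, smul_add, hx, hy]
  | tmul p q => rw [key, show mulMap k T.gb T.σ (Q.Δ h) = _ from T.counit_b h]; simp [gb_apply]

/-- The comparison element `σ'(x¹) a' g(x²) b σ(x³)`. -/
def compare : B := mulMap k T'.σa (mulMap k T.gb T.σ) (↑Q.Φ⁻¹ : H ⊗[k] (H ⊗[k] H))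

theorem place_standard : place₃ Q.Φ (oneRight k H (H ⊗[k] H))
    ((oneLeft k H (H ⊗[k] H)).comp (oneRight k H H))
    ((oneLeft k H (H ⊗[k] H)).comp (oneLeft k H H)) = Q.Φ := by
  refine Units.ext ?_
  rw [coe_place₃]
  simp only [lift₂_comp_comp, lift₂_oneRight_oneLeft, AlgHom.comp_id]
  rfl

/-- Both sides are contractions of the quasi-coassociativity relation for `Φ⁻¹` at `h`. On one side
the legs `1, 2` carry `σ'(h₁) a' g(h₂)` and only `h` in leg `3` survives; on the other the legs `2,
3` carry `g(h₁) b σ(h₂)` and only `h` in leg `1` survives. -/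
theorem compare_mul_σ (h : H) : T.compare T' * T.σ h = T'.σ h * T.compare T' := by
  let l₁ := oneRight k H (H ⊗[k] H)
  let l₂ := (oneLeft k H (H ⊗[k] H)).comp (oneRight k H H)
  let l₃ := (oneLeft k H (H ⊗[k] H)).comp (oneLeft k H H)
  let c := mulMap k T'.σa (mulMap k T.gb T.σ)
  have _ : Collapse c true (star Q.Δ l₁ l₂) (star Q.Δ l₁ l₂) (triv _ Q.ε) :=
    Collapse.of_left c _ _ fun t z => by
      rw [star, lift₂_oneRight_comp]
      exact (T'.leftPair.mulRight T.b).tail T.σ t z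
  have _ : Collapse c false (star Q.Δ l₂ l₃) (star Q.Δ l₂ l₃) (triv _ Q.ε) :=
    Collapse.of_right c _ _ fun t z => by
      rw [star_comp_comp, star, lift₂_oneRight_oneLeft]
      exact mulMap_mul_oneLeft _ _ (T.rightPair t) z
  have hl : c (star Q.Δ (star Q.Δ l₁ l₂) l₃ h * ↑(place₃ Q.Φ l₁ l₂ l₃)⁻¹) =
      c (l₃ h * ↑(place₃ Q.Φ l₁ l₂ l₃)⁻¹) := by
    have := (Collapse.rel (c := c) (s := true) (a := star Q.Δ l₁ l₂)
      (i := star Q.Δ (star Q.Δ l₁ l₂) l₃) (i' := star Q.Δ (triv _ Q.ε) l₃) h).eval_left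
      ↑(place₃ Q.Φ l₁ l₂ l₃)⁻¹
    rwa [Q.star_triv_left] at this
  have hr : c (↑(place₃ Q.Φ l₁ l₂ l₃)⁻¹ * star Q.Δ l₁ (star Q.Δ l₂ l₃) h) =
      c (↑(place₃ Q.Φ l₁ l₂ l₃)⁻¹ * l₁ h) := by
    have := (Collapse.rel (c := c) (s := false) (a := star Q.Δ l₂ l₃)
      (i := star Q.Δ l₁ (star Q.Δ l₂ l₃)) (i' := star Q.Δ l₁ (triv _ Q.ε)) h).eval_right
      ↑(place₃ Q.Φ l₁ l₂ l₃)⁻¹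
    rwa [Q.star_triv_right] at this
  have e := congrArg c (Intertwines.eq (b := (place₃ Q.Φ l₁ l₂ l₃)⁻¹)
    (i := star Q.Δ l₁ (star Q.Δ l₂ l₃)) (i' := star Q.Δ (star Q.Δ l₁ l₂) l₃) inferInstance h)
  rw [hl, hr, place_standard] at e
  have h₃ : ∀ z, c (l₃ h * z) = c z * T.σ h := by
    intro z
    induction z using TensorProduct.induction_on with
    | zero => simp
    | add x y hx hy => simp only [map_add, mul_add, add_mul, hx, hy]
    | tmul p z =>
      induction z using TensorProduct.induction_on with
      | zero => simp
      | add x y hx hy =>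
        simp only [map_add, mul_add, add_mul, TensorProduct.tmul_add, hx, hy]
      | tmul q r => simp [c, l₃, oneLeft, T.σ_mul, mul_assoc]
  have h₁ : ∀ z, c (z * l₁ h) = T'.σ h * c z := by
    intro z
    induction z using TensorProduct.induction_on with
    | zero => simp
    | add x y hx hy => simp only [map_add, mul_add, add_mul, hx, hy]
    | tmul p z => simp [c, l₁, oneRight, σa_apply, T'.σ_mul, mul_assoc]
  rw [h₃, h₁] at e
  exact e.symm

section FourLegs

variable (k H)

/-- The first of the four standard maps `H → H ⊗ H ⊗ H ⊗ H`. -/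
def leg₁ : H →ₐ[k] H ⊗[k] (H ⊗[k] (H ⊗[k] H)) := oneRight k H _
/-- The second of the four standard maps `H → H ⊗ H ⊗ H ⊗ H`. -/
def leg₂ : H →ₐ[k] H ⊗[k] (H ⊗[k] (H ⊗[k] H)) := (oneLeft k H _).comp (oneRight k H _)
/-- The third of the four standard maps `H → H ⊗ H ⊗ H ⊗ H`. -/
def leg₃ : H →ₐ[k] H ⊗[k] (H ⊗[k] (H ⊗[k] H)) :=
  (oneLeft k H _).comp ((oneLeft k H _).comp (oneRight k H H))
/-- The fourth of the four standard maps `H → H ⊗ H ⊗ H ⊗ H`. -/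
def leg₄ : H →ₐ[k] H ⊗[k] (H ⊗[k] (H ⊗[k] H)) :=
  (oneLeft k H _).comp ((oneLeft k H _).comp (oneLeft k H H))

instance : LegComm (leg₁ k H) (leg₂ k H) := by unfold leg₁ leg₂; infer_instance
instance : LegComm (leg₁ k H) (leg₃ k H) := by unfold leg₁ leg₃; infer_instance
instance : LegComm (leg₁ k H) (leg₄ k H) := by unfold leg₁ leg₄; infer_instance
instance : LegComm (leg₂ k H) (leg₃ k H) := by unfold leg₂ leg₃; infer_instance
instance : LegComm (leg₂ k H) (leg₄ k H) := by unfold leg₂ leg₄; infer_instance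
instance : LegComm (leg₃ k H) (leg₄ k H) := by unfold leg₃ leg₄; infer_instance

theorem star_leg₁₂ (x : H) : star Q.Δ (leg₁ k H) (leg₂ k H) x =
    onRest k H (oneRight k H (H ⊗[k] H)) (Q.Δ x) := by
  rw [star_apply]; unfold leg₁ leg₂; rw [lift₂_oneRight_comp]

theorem star_leg₂₃ (x : H) : star Q.Δ (leg₂ k H) (leg₃ k H) x =
    oneLeft k H (H ⊗[k] (H ⊗[k] H)) (onRest k H (oneRight k H H) (Q.Δ x)) := by
  rw [star_apply]; unfold leg₂ leg₃; rw [lift₂_comp_comp, lift₂_oneRight_comp]; rfl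

theorem star_leg₃₄ (x : H) : star Q.Δ (leg₃ k H) (leg₄ k H) x =
    oneLeft k H (H ⊗[k] (H ⊗[k] H)) (oneLeft k H (H ⊗[k] H) (Q.Δ x)) := by
  rw [star_apply]; unfold leg₃ leg₄; rw [lift₂_comp_comp, lift₂_comp_comp, lift₂_oneRight_oneLeft]
  rfl

theorem lift_leg₁₂₃ (x : H ⊗[k] (H ⊗[k] H)) :
    lift₂ (leg₁ k H) (lift₂ (leg₂ k H) (leg₃ k H)) x =
      onRest k H (onRest k H (oneRight k H H)) x := by
  simp only [leg₁, leg₂, leg₃, lift₂_comp_comp, lift₂_oneRight_comp]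

theorem lift_leg₂₃₄ (x : H ⊗[k] (H ⊗[k] H)) :
    lift₂ (leg₂ k H) (lift₂ (leg₃ k H) (leg₄ k H)) x = oneLeft k H (H ⊗[k] (H ⊗[k] H)) x := by
  simp only [leg₂, leg₃, leg₄, lift₂_comp_comp, lift₂_oneRight_oneLeft, AlgHom.comp_id]

end FourLegs

/-- The contraction `σ'(1) a' g(2) b σ(3) a g(4)` is applied to the pentagon. Every factor with a
combined leg collapses; what remains is `Φ⁻¹` in the legs `1, 2, 3`, giving the comparison element
times `a`, and `Φ` in the legs `2, 3, 4`, giving `a'` by the axiom on `Φ`. -/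
theorem compare_mul_a : T.compare T' * T.a = T'.a := by
  let c := mulMap k T'.σa (mulMap k T.gb (mulMap k T.σa g.toLinearMap))
  have _ : Collapse c true (star Q.Δ (leg₁ k H) (leg₂ k H)) (star Q.Δ (leg₁ k H) (leg₂ k H))
      (triv _ Q.ε) := Collapse.of_left c _ _ fun t z => by
    rw [star_leg₁₂]; exact (T'.leftPair.mulRight T.b).tail _ t z
  have _ : Collapse c false (star Q.Δ (leg₂ k H) (leg₃ k H)) (star Q.Δ (leg₂ k H) (leg₃ k H))
      (triv _ Q.ε) := Collapse.of_right c _ _ fun t z => by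
    rw [star_leg₂₃]; exact mulMap_mul_oneLeft _ _ ((T.rightPair.mulRight T.a).tail _ t) z
  have _ : Collapse c true (star Q.Δ (leg₃ k H) (leg₄ k H)) (star Q.Δ (leg₃ k H) (leg₄ k H))
      (triv _ Q.ε) := Collapse.of_left c _ _ fun t z => by
    rw [star_leg₃₄]; exact mulMap_oneLeft_mul _ _ (mulMap_oneLeft_mul _ _ (T.leftPair t)) z
  -- The pentagon is arranged so that each factor with a combined leg stands at the end of the word
  -- where its contraction absorbs it.
  have e : place₃ Q.Φ (star Q.Δ (leg₁ k H) (leg₂ k H)) (leg₃ k H) (leg₄ k H) *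
      (place₃ Q.Φ (leg₁ k H) (leg₂ k H) (leg₃ k H))⁻¹ =
      (place₃ Q.Φ (leg₁ k H) (leg₂ k H) (star Q.Δ (leg₃ k H) (leg₄ k H)))⁻¹ *
        (place₃ Q.Φ (leg₂ k H) (leg₃ k H) (leg₄ k H) *
        place₃ Q.Φ (leg₁ k H) (star Q.Δ (leg₂ k H) (leg₃ k H)) (leg₄ k H)) := by
    rw [eq_inv_mul_iff_mul_eq, ← mul_assoc, ← Q.pentagon, mul_inv_cancel_right]
  have e' := congrArg (fun u : (H ⊗[k] (H ⊗[k] (H ⊗[k] H)))ˣ => c u) e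
  simp only [Units.val_mul] at e'
  rw [(collapse_place₃ c true (star Q.Δ (leg₁ k H) (leg₂ k H)) Q.Φ
      (star Q.Δ (leg₁ k H) (leg₂ k H)) (triv _ Q.ε) (leg₃ k H) (leg₃ k H)
      (leg₄ k H) (leg₄ k H)).eval_left, Q.place_triv_left,
    (collapse_place₃_inv c true (star Q.Δ (leg₃ k H) (leg₄ k H)) Q.Φ (leg₁ k H) (leg₁ k H)
      (leg₂ k H) (leg₂ k H) (star Q.Δ (leg₃ k H) (leg₄ k H)) (triv _ Q.ε)).eval_left,
    Q.place_triv_right, inv_one, Units.val_one, one_mul, one_mul,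
    (collapse_place₃ c false (star Q.Δ (leg₂ k H) (leg₃ k H)) Q.Φ (leg₁ k H) (leg₁ k H)
      (star Q.Δ (leg₂ k H) (leg₃ k H)) (triv _ Q.ε) (leg₄ k H) (leg₄ k H)).eval_right,
    Q.place_triv_mid, Units.val_one, mul_one, coe_place₃_inv, coe_place₃, lift_leg₁₂₃,
    lift_leg₂₃₄] at e'
  have h₁ : ∀ x, c (onRest k H (onRest k H (oneRight k H H)) x) =
      mulMap k T'.σa (mulMap k T.gb T.σ) x * T.a := by
    intro x
    induction x using TensorProduct.induction_on with
    | zero => simp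
    | add x y hx hy => simp only [map_add, add_mul, hx, hy]
    | tmul p x =>
      induction x using TensorProduct.induction_on with
      | zero => simp
      | add x y hx hy => simp only [map_add, add_mul, TensorProduct.tmul_add, hx, hy]
      | tmul q r => simp [c, onRest, oneRight, σa_apply, mul_assoc]
  rw [h₁] at e'
  have h₂ : ∀ x, c (oneLeft k H (H ⊗[k] (H ⊗[k] H)) x) =
      T'.a * mulMap k T.gb (mulMap k T.σa g.toLinearMap) x := by
    intro x
    simp [c, oneLeft, σa_apply, T'.σ_one]
  rw [h₂] at e'
  refine e'.trans ?_
  rw [show mulMap k T.gb (mulMap k T.σa g.toLinearMap) (Q.Φ : H ⊗[k] (H ⊗[k] H)) = 1 from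
    T.contr_Φ, mul_one]

/-- The same argument with `g(1) b σ(2) a g(3) b' σ'(4)` and the pentagon solved with the opposite
factors at the two ends. -/
theorem b_mul_compare : T.b * T'.compare T = T'.b := by
  let c := mulMap k T.gb (mulMap k T.σa (mulMap k T'.gb T'.σ))
  have _ : Collapse c false (star Q.Δ (leg₁ k H) (leg₂ k H)) (star Q.Δ (leg₁ k H) (leg₂ k H))
      (triv _ Q.ε) := Collapse.of_right c _ _ fun t z => by
    rw [star_leg₁₂]; exact (T.rightPair.mulRight T.a).tail _ t z
  have _ : Collapse c true (star Q.Δ (leg₂ k H) (leg₃ k H)) (star Q.Δ (leg₂ k H) (leg₃ k H))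
      (triv _ Q.ε) := Collapse.of_left c _ _ fun t z => by
    rw [star_leg₂₃]; exact mulMap_oneLeft_mul _ _ ((T.leftPair.mulRight T'.b).tail _ t) z
  have _ : Collapse c false (star Q.Δ (leg₃ k H) (leg₄ k H)) (star Q.Δ (leg₃ k H) (leg₄ k H))
      (triv _ Q.ε) := Collapse.of_right c _ _ fun t z => by
    rw [star_leg₃₄]; exact mulMap_mul_oneLeft _ _ (mulMap_mul_oneLeft _ _ (T'.rightPair t)) z
  have e : (place₃ Q.Φ (leg₂ k H) (leg₃ k H) (leg₄ k H))⁻¹ *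
      place₃ Q.Φ (leg₁ k H) (leg₂ k H) (star Q.Δ (leg₃ k H) (leg₄ k H)) =
      place₃ Q.Φ (leg₁ k H) (star Q.Δ (leg₂ k H) (leg₃ k H)) (leg₄ k H) *
        (place₃ Q.Φ (leg₁ k H) (leg₂ k H) (leg₃ k H) *
        (place₃ Q.Φ (star Q.Δ (leg₁ k H) (leg₂ k H)) (leg₃ k H) (leg₄ k H))⁻¹) := by
    rw [inv_mul_eq_iff_eq_mul, ← mul_assoc, ← mul_assoc, Q.pentagon, mul_inv_cancel_right]
  have e' := congrArg (fun u : (H ⊗[k] (H ⊗[k] (H ⊗[k] H)))ˣ => c u) e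
  simp only [Units.val_mul] at e'
  rw [(collapse_place₃ c false (star Q.Δ (leg₃ k H) (leg₄ k H)) Q.Φ (leg₁ k H) (leg₁ k H)
      (leg₂ k H) (leg₂ k H) (star Q.Δ (leg₃ k H) (leg₄ k H)) (triv _ Q.ε)).eval_right,
    Q.place_triv_right,
    (collapse_place₃ c true (star Q.Δ (leg₂ k H) (leg₃ k H)) Q.Φ (leg₁ k H) (leg₁ k H)
      (star Q.Δ (leg₂ k H) (leg₃ k H)) (triv _ Q.ε) (leg₄ k H) (leg₄ k H)).eval_left,
    Q.place_triv_mid, Units.val_one, one_mul, mul_one,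
    (collapse_place₃_inv c false (star Q.Δ (leg₁ k H) (leg₂ k H)) Q.Φ
      (star Q.Δ (leg₁ k H) (leg₂ k H)) (triv _ Q.ε) (leg₃ k H) (leg₃ k H)
      (leg₄ k H) (leg₄ k H)).eval_right, Q.place_triv_left,
    inv_one, Units.val_one, mul_one, coe_place₃_inv, coe_place₃, lift_leg₁₂₃,
    lift_leg₂₃₄] at e'
  have h₁ : ∀ x, c (onRest k H (onRest k H (oneRight k H H)) x) =
      mulMap k T.gb (mulMap k T.σa g.toLinearMap) x * T'.b := by
    intro x
    induction x using TensorProduct.induction_on with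
    | zero => simp
    | add x y hx hy => simp only [map_add, add_mul, hx, hy]
    | tmul p x =>
      induction x using TensorProduct.induction_on with
      | zero => simp
      | add x y hx hy => simp only [map_add, add_mul, TensorProduct.tmul_add, hx, hy]
      | tmul q r => simp [c, onRest, oneRight, gb_apply, T'.σ_one, mul_assoc]
  have h₂ : ∀ x, c (oneLeft k H (H ⊗[k] (H ⊗[k] H)) x) =
      T.b * mulMap k T.σa (mulMap k T'.gb T'.σ) x := by
    intro x
    simp [c, oneLeft, gb_apply]
  rw [h₁, h₂, show mulMap k T.gb (mulMap k T.σa g.toLinearMap) (Q.Φ : H ⊗[k] (H ⊗[k] H)) = 1 from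
    T.contr_Φ, one_mul] at e'
  exact e'

/-- Multiply `1 = σ(x¹) a g(x²) b σ(x³)` by `F` on the left and carry `F` past `σ(x¹)` and into `a`.
The result involves `σ'`, `a'` and the fixed triple, but no longer `F`. -/
theorem compare_eq {F : B} {σ' : H →ₗ[k] B} {a' : B} (hσ : ∀ h, F * T.σ h = σ' h * F)
    (ha : F * T.a = a') : F = mulMap k (LinearMap.mulRight k a' ∘ₗ σ') (mulMap k T.gb T.σ)
      (↑Q.Φ⁻¹ : H ⊗[k] (H ⊗[k] H)) := by
  have key : ∀ x : H ⊗[k] (H ⊗[k] H), F * mulMap k T.σa (mulMap k T.gb T.σ) x =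
      mulMap k (LinearMap.mulRight k a' ∘ₗ σ') (mulMap k T.gb T.σ) x := by
    intro x
    induction x using TensorProduct.induction_on with
    | zero => simp
    | add x y hx hy => simp only [map_add, mul_add, hx, hy]
    | tmul p z =>
      simp only [mulMap_tmul, σa_apply, LinearMap.comp_apply, LinearMap.mulRight_apply]
      rw [← mul_assoc, ← mul_assoc, hσ, mul_assoc (σ' p), ha]
  rw [← key, show mulMap k T.σa (mulMap k T.gb T.σ) (↑Q.Φ⁻¹ : H ⊗[k] (H ⊗[k] H)) = 1 from
    T.contr_Φ_inv, mul_one]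

/-- Identities for the Drinfeld twist are proved by this principle: it suffices that both sides
intertwine the same antipodes and send `a` to the same element. -/
theorem compare_unique {F F' : B} {σ' : H →ₗ[k] B} {a' : B} (hσ : ∀ h, F * T.σ h = σ' h * F)
    (ha : F * T.a = a') (hσ' : ∀ h, F' * T.σ h = σ' h * F') (ha' : F' * T.a = a') : F = F' :=
  (T.compare_eq hσ ha).trans (T.compare_eq hσ' ha').symm

/-- The first factor carries `σ(x¹) a` in the second to `σ'(x¹) a'`, so the product becomes the
normalization of `T'`. Exchanging the triples yields the other inverse relation. -/
theorem compare_mul_compare : T.compare T' * T'.compare T = 1 := by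
  have key : ∀ x : H ⊗[k] (H ⊗[k] H), T.compare T' * mulMap k T.σa (mulMap k T'.gb T'.σ) x =
      mulMap k T'.σa (mulMap k T'.gb T'.σ) x := by
    intro x
    induction x using TensorProduct.induction_on with
    | zero => simp
    | add x y hx hy => simp only [map_add, mul_add, hx, hy]
    | tmul p z =>
      simp only [mulMap_tmul, σa_apply]
      rw [← mul_assoc, ← mul_assoc, compare_mul_σ, mul_assoc (T'.σ p), compare_mul_a]
  exact (key _).trans T'.contr_Φ_inv

/-- The image of antipode data under an algebra map. -/
def map {B' : Type*} [Ring B'] [Algebra k B'] (θ : B →ₐ[k] B') : AntipodeTriple Q (θ.comp g) where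
  σ := θ.toLinearMap ∘ₗ T.σ
  a := θ T.a
  b := θ T.b
  σ_one := by simp [T.σ_one]
  σ_mul x y := by simp [T.σ_mul]
  counit_a h := by
    rw [← map_smul, ← T.counit_a h]
    exact mulMap_map θ _ _ _ (fun x => by simp) (fun x => rfl) _
  counit_b h := by
    rw [← map_smul, ← T.counit_b h]
    exact mulMap_map θ _ _ _ (fun x => by simp) (fun x => rfl) _
  contr_Φ := by
    rw [← map_one θ, ← T.contr_Φ]
    exact mulMap_map θ _ _ _ (fun x => by simp)
      (fun x => mulMap_map θ _ _ _ (fun x => by simp) (fun x => rfl) _) _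
  contr_Φ_inv := by
    rw [← map_one θ, ← T.contr_Φ_inv]
    exact mulMap_map θ _ _ _ (fun x => by simp)
      (fun x => mulMap_map θ _ _ _ (fun x => by simp) (fun x => rfl) _) _

end AntipodeTriple

end QHA
end

/-! ### Straightening nested zigzags under a contraction. -/

noncomputable section

namespace QHA

namespace QuasiBialgebra

variable {k H : Type*} [Field k] [Ring H] [Algebra k H] (Q : QuasiBialgebra k H)
  {B : Type*} [Ring B] [Algebra k B] {M : Type*} [AddCommGroup M] [Module k M] (c : B →ₗ[k] M)
  (i₁ i₂ i₃ i₄ i₅ i₆ : H →ₐ[k] B) [LegComm i₁ i₂] [LegComm i₁ i₃] [LegComm i₁ i₄]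
  [LegComm i₁ i₅] [LegComm i₁ i₆] [LegComm i₂ i₃] [LegComm i₂ i₄] [LegComm i₂ i₅]
  [LegComm i₂ i₆] [LegComm i₃ i₄] [LegComm i₃ i₅] [LegComm i₃ i₆] [LegComm i₄ i₅]
  [LegComm i₄ i₆] [LegComm i₅ i₆]

/-- In diagrammatic terms this straightens two nested zigzags, as they occur for the dual of a
tensor product. The pairs `4 5` and `3 6` are closed by evaluations and `2 3` and `1 4` by
coevaluations; the composite separates into the zigzag on `2, 3, 6` and the one on `1, 4, 5`. -/
theorem zigzag [Collapse c true (star Q.Δ i₄ i₅) (star Q.Δ i₄ i₅) (triv B Q.ε)]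
    [Collapse c true (star Q.Δ i₃ i₆) (star Q.Δ i₃ i₆) (triv B Q.ε)]
    [Collapse c false (star Q.Δ i₂ i₃) (star Q.Δ i₂ i₃) (triv B Q.ε)]
    [Collapse c false (star Q.Δ i₁ i₄) (star Q.Δ i₁ i₄) (triv B Q.ε)] :
    c ↑(Q.nest i₃ i₄ i₅ i₆ * place₃ Q.Φ (star Q.Δ i₁ i₂) (star Q.Δ i₃ i₄) (star Q.Δ i₅ i₆) *
        (Q.nest i₁ i₂ i₃ i₄)⁻¹) = c ↑(place₃ Q.Φ i₂ i₃ i₆ * place₃ Q.Φ i₁ i₄ i₅) := by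
  rw [nest_mul_nest_inv]
  simp only [Units.val_mul]
  -- The pairs `4 5` and `2 3` are absorbed first, from the left and from the right; only then does
  -- `1 4` occur as a combined leg at the right edge.
  have h₁ := ((collapse_place₃ c true (star Q.Δ i₄ i₅) Q.Φ (star Q.Δ i₁ i₂) (star Q.Δ i₁ i₂)
    (star Q.Δ i₃ (star Q.Δ i₄ i₅)) (star Q.Δ i₃ (triv B Q.ε)) i₆ i₆).mul
    (collapse_place₃ c true (star Q.Δ i₄ i₅) Q.Φ (star Q.Δ i₁ i₂) (star Q.Δ i₁ i₂) i₃ i₃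
      (star Q.Δ i₄ i₅) (triv B Q.ε))).mul
    (collapse_place₃_inv c true (star Q.Δ i₄ i₅) Q.Φ i₁ i₁ i₂ i₂ i₃ i₃)
  have h₂ := (collapse_place₃ c false (star Q.Δ i₂ i₃) Q.Φ (star Q.Δ i₁ (star Q.Δ i₂ i₃))
    (star Q.Δ i₁ (triv B Q.ε)) i₄ i₄ i₅ i₅).mul (collapse_place₃_inv c false (star Q.Δ i₂ i₃) Q.Φ
    (star Q.Δ (star Q.Δ i₁ (star Q.Δ i₂ i₃)) i₄) (star Q.Δ (star Q.Δ i₁ (triv B Q.ε)) i₄)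
    i₅ i₅ i₆ i₆)
  rw [h₁.eval_left, h₂.eval_right]
  simp only [star_triv_right, place_triv_right, Units.val_one, mul_one]
  rw [← mul_assoc, (collapse_place₃_inv c false (star Q.Δ i₁ i₄) Q.Φ (star Q.Δ i₁ i₄)
    (triv B Q.ε) i₅ i₅ i₆ i₆).eval_right, place_triv_left, inv_one, Units.val_one, mul_one,
    ← Units.val_mul]
  -- The remaining left part contains no collapsible pair. A pentagon creates the pairs `3 6` and `2
  -- 3` in positions where they can be absorbed.
  have e : place₃ Q.Φ (star Q.Δ i₁ i₂) i₃ i₆ * (place₃ Q.Φ i₁ i₂ i₃)⁻¹ =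
      (place₃ Q.Φ i₁ i₂ (star Q.Δ i₃ i₆))⁻¹ *
        (place₃ Q.Φ i₂ i₃ i₆ * place₃ Q.Φ i₁ (star Q.Δ i₂ i₃) i₆) := by
    rw [eq_inv_mul_iff_mul_eq, ← mul_assoc, ← Q.pentagon, mul_inv_cancel_right]
  rw [e]
  simp only [Units.val_mul, mul_assoc]
  rw [(collapse_place₃_inv c true (star Q.Δ i₃ i₆) Q.Φ i₁ i₁ i₂ i₂ (star Q.Δ i₃ i₆)
    (triv B Q.ε)).eval_left, place_triv_right, inv_one, Units.val_one, one_mul]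
  rw [((collapse_place₃ c false (star Q.Δ i₂ i₃) Q.Φ i₁ i₁ (star Q.Δ i₂ i₃) (triv B Q.ε)
    i₆ i₆).mul (collapse_place₃ c false (star Q.Δ i₂ i₃) Q.Φ i₁ i₁ i₄ i₄ i₅ i₅)).eval_right,
    place_triv_mid, Units.val_one, one_mul]

theorem zigzag_inv [Collapse c true (star Q.Δ i₂ i₃) (star Q.Δ i₂ i₃) (triv B Q.ε)]
    [Collapse c true (star Q.Δ i₁ i₄) (star Q.Δ i₁ i₄) (triv B Q.ε)]
    [Collapse c false (star Q.Δ i₄ i₅) (star Q.Δ i₄ i₅) (triv B Q.ε)]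
    [Collapse c false (star Q.Δ i₃ i₆) (star Q.Δ i₃ i₆) (triv B Q.ε)] :
    c ↑(Q.nest i₁ i₂ i₃ i₄ *
        (place₃ Q.Φ (star Q.Δ i₁ i₂) (star Q.Δ i₃ i₄) (star Q.Δ i₅ i₆))⁻¹ *
        (Q.nest i₃ i₄ i₅ i₆)⁻¹) = c ↑((place₃ Q.Φ i₁ i₄ i₅)⁻¹ * (place₃ Q.Φ i₂ i₃ i₆)⁻¹) := by
  have e₀ := congrArg (·⁻¹) (Q.nest_mul_nest_inv i₁ i₂ i₃ i₄ i₅ i₆)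
  simp only [mul_inv_rev, inv_inv, mul_assoc] at e₀
  rw [mul_assoc, e₀]
  have h₁ := (collapse_place₃ c true (star Q.Δ i₂ i₃) Q.Φ
    (star Q.Δ (star Q.Δ i₁ (star Q.Δ i₂ i₃)) i₄) (star Q.Δ (star Q.Δ i₁ (triv B Q.ε)) i₄)
    i₅ i₅ i₆ i₆).mul (collapse_place₃_inv c true (star Q.Δ i₂ i₃) Q.Φ
    (star Q.Δ i₁ (star Q.Δ i₂ i₃)) (star Q.Δ i₁ (triv B Q.ε)) i₄ i₄ i₅ i₅)
  have h₂ := (collapse_place₃ c false (star Q.Δ i₄ i₅) Q.Φ i₁ i₁ i₂ i₂ i₃ i₃).mul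
    ((collapse_place₃_inv c false (star Q.Δ i₄ i₅) Q.Φ (star Q.Δ i₁ i₂) (star Q.Δ i₁ i₂) i₃ i₃
      (star Q.Δ i₄ i₅) (triv B Q.ε)).mul (collapse_place₃_inv c false (star Q.Δ i₄ i₅) Q.Φ
      (star Q.Δ i₁ i₂) (star Q.Δ i₁ i₂) (star Q.Δ i₃ (star Q.Δ i₄ i₅))
      (star Q.Δ i₃ (triv B Q.ε)) i₆ i₆))
  simp only [Units.val_mul]
  rw [← mul_assoc, h₁.eval_left, h₂.eval_right]
  simp only [star_triv_right, place_triv_right, Units.val_one, inv_one, one_mul]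
  rw [mul_assoc, (collapse_place₃ c true (star Q.Δ i₁ i₄) Q.Φ (star Q.Δ i₁ i₄)
    (triv B Q.ε) i₅ i₅ i₆ i₆).eval_left, place_triv_left, Units.val_one, one_mul]
  have e : place₃ Q.Φ i₁ i₂ i₃ * (place₃ Q.Φ (star Q.Δ i₁ i₂) i₃ i₆)⁻¹ =
      (place₃ Q.Φ i₁ (star Q.Δ i₂ i₃) i₆)⁻¹ * ((place₃ Q.Φ i₂ i₃ i₆)⁻¹ *
        place₃ Q.Φ i₁ i₂ (star Q.Δ i₃ i₆)) := by
    rw [mul_inv_eq_iff_eq_mul, mul_assoc, mul_assoc, ← Q.pentagon]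
    simp only [mul_assoc, inv_mul_cancel_left]
  rw [← Units.val_mul _ (place₃ Q.Φ (star Q.Δ i₁ i₂) i₃ i₆)⁻¹, e]
  simp only [Units.val_mul]
  rw [← mul_assoc, ((collapse_place₃_inv c true (star Q.Δ i₂ i₃) Q.Φ i₁ i₁ i₄ i₄ i₅ i₅).mul
    (collapse_place₃_inv c true (star Q.Δ i₂ i₃) Q.Φ i₁ i₁ (star Q.Δ i₂ i₃) (triv B Q.ε)
    i₆ i₆)).eval_left, place_triv_mid, inv_one, Units.val_one, mul_one]
  rw [← mul_assoc, (collapse_place₃ c false (star Q.Δ i₃ i₆) Q.Φ i₁ i₁ i₂ i₂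
    (star Q.Δ i₃ i₆) (triv B Q.ε)).eval_right, place_triv_right, Units.val_one, mul_one]

/-- When the pair `3 4` is contracted, the bracket on the left of `nest_nest` loses these legs and
becomes `nest` of `1, 2, 5, 6`. This compares the two ways of contracting three nested pairs, which
is the cocycle identity of the twist at the level of `α`. -/
theorem collapse_nest_nest [Collapse c true (star Q.Δ i₃ i₄) (star Q.Δ i₃ i₄) (triv B Q.ε)] :
    c ↑(Q.nest i₁ i₂ i₅ i₆ * Q.nest (star Q.Δ i₁ i₂) i₃ i₄ (star Q.Δ i₅ i₆)) =
      c ↑(Q.nest i₂ i₃ i₄ i₅ * Q.nest i₁ (star Q.Δ i₂ i₃) (star Q.Δ i₄ i₅) i₆ *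
        (place₃ Q.Φ i₁ i₂ i₃ * (place₃ Q.Φ i₄ i₅ i₆)⁻¹)) := by
  rw [← nest_nest]
  simp only [Units.val_mul]
  rw [(((collapse_place₃ c true (star Q.Δ i₃ i₄) Q.Φ i₁ i₁ (star Q.Δ i₂ (star Q.Δ i₃ i₄))
    (star Q.Δ i₂ (triv B Q.ε)) i₅ i₅).mul (collapse_place₃_inv c true (star Q.Δ i₃ i₄) Q.Φ
    (star Q.Δ i₁ (star Q.Δ i₂ (star Q.Δ i₃ i₄))) (star Q.Δ i₁ (star Q.Δ i₂ (triv B Q.ε)))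
    i₅ i₅ i₆ i₆)).mul (collapse_place₃ c true (star Q.Δ i₃ i₄) Q.Φ i₁ i₁ i₂ i₂
    (star Q.Δ i₃ i₄) (triv B Q.ε))).eval_left]
  simp only [star_triv_right, place_triv_right, Units.val_one, mul_one]
  rw [nest, Units.val_mul]

end QuasiBialgebra

end QHA
end

/-! ### Antipode data for the comultiplication and invertibility of the Drinfeld twist. -/

noncomputable section

namespace QHA

section Induction

variable {k : Type*} [Field k] {U V W P : Type*} [AddCommGroup U] [Module k U]
  [AddCommGroup V] [Module k V] [AddCommGroup W] [Module k W] [AddCommGroup P] [Module k P]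

theorem tensor_induction₃ {p : U ⊗[k] (V ⊗[k] W) → Prop} (zero : p 0)
    (add : ∀ x y, p x → p y → p (x + y)) (tmul : ∀ u v w, p (u ⊗ₜ (v ⊗ₜ w))) (t) : p t := by
  induction t using TensorProduct.induction_on with
  | zero => exact zero
  | add x y hx hy => exact add x y hx hy
  | tmul u t =>
    induction t using TensorProduct.induction_on with
    | zero => simpa using zero
    | add x y hx hy => rw [TensorProduct.tmul_add]; exact add _ _ hx hy
    | tmul v w => exact tmul u v w

theorem tensor_induction₄ {p : U ⊗[k] (V ⊗[k] (W ⊗[k] P)) → Prop} (zero : p 0)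
    (add : ∀ x y, p x → p y → p (x + y)) (tmul : ∀ u v w q, p (u ⊗ₜ (v ⊗ₜ (w ⊗ₜ q)))) (t) : p t := by
  induction t using TensorProduct.induction_on with
  | zero => exact zero
  | add x y hx hy => exact add x y hx hy
  | tmul u t =>
    refine tensor_induction₃ (p := fun t => p (u ⊗ₜ t)) (by simpa using zero)
      (fun x y hx hy => ?_) (tmul u) t
    rw [TensorProduct.tmul_add]; exact add _ _ hx hy

theorem tensor_induction₂₂ {p : (U ⊗[k] V) ⊗[k] (W ⊗[k] P) → Prop} (zero : p 0)
    (add : ∀ x y, p x → p y → p (x + y)) (tmul : ∀ u v w q, p ((u ⊗ₜ v) ⊗ₜ (w ⊗ₜ q))) (t) : p t := by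
  refine tensor_induction₃ zero add (fun u v w => ?_) t
  induction u using TensorProduct.induction_on with
  | zero => simpa using zero
  | add x y hx hy => rw [TensorProduct.add_tmul]; exact add _ _ hx hy
  | tmul u t => exact tmul u t v w

end Induction

section MapCollapse

variable {k : Type*} [Field k] {U V : Type*} [Ring U] [Algebra k U] [Ring V] [Algebra k V]
  {M N : Type*} [AddCommGroup M] [Module k M] [AddCommGroup N] [Module k N]
  (c : U →ₗ[k] M) (c' : V →ₗ[k] N) {e : k}

theorem map_oneRight_mul {w : U} (h : ∀ z, c (w * z) = e • c z) (z : U ⊗[k] V) :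
    TensorProduct.map c c' (oneRight k U V w * z) = e • TensorProduct.map c c' z := by
  induction z using TensorProduct.induction_on with
  | zero => simp
  | add x y hx hy => simp only [map_add, mul_add, smul_add, hx, hy]
  | tmul p z => simp [oneRight, h, TensorProduct.smul_tmul']

theorem map_mul_oneRight {w : U} (h : ∀ z, c (z * w) = e • c z) (z : U ⊗[k] V) :
    TensorProduct.map c c' (z * oneRight k U V w) = e • TensorProduct.map c c' z := by
  induction z using TensorProduct.induction_on with
  | zero => simp
  | add x y hx hy => simp only [map_add, add_mul, smul_add, hx, hy]
  | tmul p z => simp [oneRight, h, TensorProduct.smul_tmul']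

theorem map_oneLeft_mul {w : V} (h : ∀ z, c' (w * z) = e • c' z) (z : U ⊗[k] V) :
    TensorProduct.map c c' (oneLeft k U V w * z) = e • TensorProduct.map c c' z := by
  induction z using TensorProduct.induction_on with
  | zero => simp
  | add x y hx hy => simp only [map_add, mul_add, smul_add, hx, hy]
  | tmul p z => simp [oneLeft, h]

theorem map_mul_oneLeft {w : V} (h : ∀ z, c' (z * w) = e • c' z) (z : U ⊗[k] V) :
    TensorProduct.map c c' (z * oneLeft k U V w) = e • TensorProduct.map c c' z := by
  induction z using TensorProduct.induction_on with
  | zero => simp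
  | add x y hx hy => simp only [map_add, add_mul, smul_add, hx, hy]
  | tmul p z => simp [oneLeft, h]

end MapCollapse

section NestUnit

variable {k H : Type*} [Field k] [Ring H] [Algebra k H] (Q : QuasiBialgebra k H)
  {B : Type*} [Ring B] [Algebra k B]

/-- `(Φ ⊗ 1)(Δ ⊗ id ⊗ id)(Φ⁻¹)`. -/
def QuasiBialgebra.nestUnit : (H ⊗[k] (H ⊗[k] (H ⊗[k] H)))ˣ :=
  Units.map (onRest k H (onRest k H (oneRight k H H))).toMonoidHom Q.Φ *
    (Units.map (onFirst k (H ⊗[k] H) Q.Δ).toMonoidHom Q.Φ)⁻¹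

theorem QuasiBialgebra.place_nestUnit (i j l m : H →ₐ[k] B) [LegComm i j] [LegComm i l]
    [LegComm i m] [LegComm j l] [LegComm j m] [LegComm l m] :
    Units.map (lift₂ i (lift₂ j (lift₂ l m))).toMonoidHom Q.nestUnit = Q.nest i j l m := by
  rw [nestUnit, nest, map_mul, map_inv]
  congr 1
  · refine Units.ext ?_
    simp only [coe_unitsMap, coe_place₃, lift₂_onRest, lift₂_comp_onRest, lift₂_comp_oneRight]
  · congr 1
    refine Units.ext ?_
    simp only [coe_unitsMap, coe_place₃, lift₂_onFirst]

theorem QuasiBialgebra.coe_nest (i j l m : H →ₐ[k] B) [LegComm i j] [LegComm i l]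
    [LegComm i m] [LegComm j l] [LegComm j m] [LegComm l m] :
    (Q.nest i j l m : B) = lift₂ i (lift₂ j (lift₂ l m)) (Q.nestUnit : H ⊗[k] (H ⊗[k] (H ⊗[k] H))) := by
  rw [← place_nestUnit]; rfl

theorem QuasiBialgebra.coe_nest_inv (i j l m : H →ₐ[k] B) [LegComm i j] [LegComm i l]
    [LegComm i m] [LegComm j l] [LegComm j m] [LegComm l m] :
    ((Q.nest i j l m)⁻¹ : Bˣ) =
      lift₂ i (lift₂ j (lift₂ l m)) (↑Q.nestUnit⁻¹ : H ⊗[k] (H ⊗[k] (H ⊗[k] H))) := by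
  rw [← place_nestUnit]; rfl

end NestUnit

namespace QuasiHopf

variable {k H : Type*} [Field k] [Ring H] [Algebra k H] (Q : QuasiHopf k H)

/-- The antipode data of a quasi-Hopf algebra. -/
def triple : AntipodeTriple Q.toQuasiBialgebra (AlgHom.id k H) where
  σ := Q.S.toLinearMap
  a := Q.α
  b := Q.β
  σ_one := Q.S_one
  σ_mul := Q.S_mul
  counit_a := Q.antipode_α
  counit_b := Q.antipode_β
  contr_Φ := Q.antipode_Φ
  contr_Φ_inv := Q.antipode_Φ_inv

/-- `x ⊗ y ↦ S(y) ⊗ S(x)`. -/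
def S₂ : H ⊗[k] H →ₗ[k] H ⊗[k] H :=
  TensorProduct.map Q.S.toLinearMap Q.S.toLinearMap ∘ₗ (TensorProduct.comm k H H).toLinearMap

@[simp]
theorem S₂_tmul (x y : H) : Q.S₂ (x ⊗ₜ y) = Q.S y ⊗ₜ Q.S x := by simp [S₂]

theorem S₂_mul (x y : H ⊗[k] H) : Q.S₂ (x * y) = Q.S₂ y * Q.S₂ x := by
  induction x using TensorProduct.induction_on with
  | zero => simp
  | add x y hx hy => simp only [map_add, mul_add, add_mul, hx, hy]
  | tmul p q =>
    induction y using TensorProduct.induction_on with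
    | zero => simp
    | add x y hx hy => simp only [map_add, mul_add, add_mul, hx, hy]
    | tmul r s => simp [Q.S_mul]

theorem S₂_one : Q.S₂ 1 = 1 := by simp [Algebra.TensorProduct.one_def, Q.S_one]

section PairLegs

variable (k H)

/-- The first map `H → (H ⊗ H) ⊗ (H ⊗ H)`. -/
abbrev pair₁ : H →ₐ[k] (H ⊗[k] H) ⊗[k] (H ⊗[k] H) := (oneRight k _ _).comp (oneRight k H H)
/-- The second map `H → (H ⊗ H) ⊗ (H ⊗ H)`. -/
abbrev pair₂ : H →ₐ[k] (H ⊗[k] H) ⊗[k] (H ⊗[k] H) := (oneRight k _ _).comp (oneLeft k H H)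
/-- The third map `H → (H ⊗ H) ⊗ (H ⊗ H)`. -/
abbrev pair₃ : H →ₐ[k] (H ⊗[k] H) ⊗[k] (H ⊗[k] H) := (oneLeft k _ _).comp (oneRight k H H)
/-- The fourth map `H → (H ⊗ H) ⊗ (H ⊗ H)`. -/
abbrev pair₄ : H →ₐ[k] (H ⊗[k] H) ⊗[k] (H ⊗[k] H) := (oneLeft k _ _).comp (oneLeft k H H)

theorem star_pair₁₂ (Q : QuasiBialgebra k H) (x : H) : star Q.Δ (pair₁ k H) (pair₂ k H) x =
    oneRight k (H ⊗[k] H) (H ⊗[k] H) (Q.Δ x) := by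
  rw [star_apply, lift₂_comp_comp, lift₂_oneRight_oneLeft]; rfl

theorem star_pair₃₄ (Q : QuasiBialgebra k H) (x : H) : star Q.Δ (pair₃ k H) (pair₄ k H) x =
    oneLeft k (H ⊗[k] H) (H ⊗[k] H) (Q.Δ x) := by
  rw [star_apply, lift₂_comp_comp, lift₂_oneRight_oneLeft]; rfl

end PairLegs

theorem contrα_Δ_mul (h : H) (z : H ⊗[k] H) : Q.contrα (Q.Δ h * z) = Q.ε h • Q.contrα z :=
  Q.triple.leftPair h z

theorem contrβ_mul_Δ (h : H) (z : H ⊗[k] H) : Q.contrβ (z * Q.Δ h) = Q.ε h • Q.contrβ z :=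
  Q.triple.rightPair h z

@[simp]
theorem contrα_tmul (x y : H) : Q.contrα (x ⊗ₜ y) = Q.S x * Q.α * y := by simp [contrα]

@[simp]
theorem contrβ_tmul (x y : H) : Q.contrβ (x ⊗ₜ y) = x * Q.β * Q.S y := by simp [contrβ]

/-- `1 ⊗ 2 ⊗ 3 ⊗ 4 ↦ (2 ⊗ 3) ⊗ (1 ⊗ 4)`. -/
abbrev innerFirst : H ⊗[k] (H ⊗[k] (H ⊗[k] H)) →ₐ[k] (H ⊗[k] H) ⊗[k] (H ⊗[k] H) :=
  lift₂ (pair₃ k H) (lift₂ (pair₁ k H) (lift₂ (pair₂ k H) (pair₄ k H)))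

/-- `1 ⊗ 2 ⊗ 3 ⊗ 4 ↦ (1 ⊗ 4) ⊗ (2 ⊗ 3)`. -/
abbrev outerFirst : H ⊗[k] (H ⊗[k] (H ⊗[k] H)) →ₐ[k] (H ⊗[k] H) ⊗[k] (H ⊗[k] H) :=
  lift₂ (pair₁ k H) (lift₂ (pair₃ k H) (lift₂ (pair₄ k H) (pair₂ k H)))

/-- `z ↦ S(2) α 3 ⊗ S(1) α 4`. -/
def contrα₂ : H ⊗[k] (H ⊗[k] (H ⊗[k] H)) →ₗ[k] H ⊗[k] H :=
  TensorProduct.map Q.contrα Q.contrα ∘ₗ innerFirst.toLinearMap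

/-- `z ↦ 1 β S(4) ⊗ 2 β S(3)`. -/
def contrβ₂ : H ⊗[k] (H ⊗[k] (H ⊗[k] H)) →ₗ[k] H ⊗[k] H :=
  TensorProduct.map Q.contrβ Q.contrβ ∘ₗ outerFirst.toLinearMap

@[simp]
theorem contrα₂_tmul (x y z w : H) : Q.contrα₂ (x ⊗ₜ (y ⊗ₜ (z ⊗ₜ w))) =
    (Q.S y * Q.α * z) ⊗ₜ (Q.S x * Q.α * w) := by
  simp [contrα₂, oneLeft, oneRight]

@[simp]
theorem contrβ₂_tmul (x y z w : H) : Q.contrβ₂ (x ⊗ₜ (y ⊗ₜ (z ⊗ₜ w))) =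
    (x * Q.β * Q.S w) ⊗ₜ (y * Q.β * Q.S z) := by
  simp [contrβ₂, oneLeft, oneRight]

/-- The tensor `A` in the definition of `γ` is the universal case of `nest`, so `γ` inherits its
intertwining property. -/
theorem γ_eq : Q.γ = Q.contrα₂ (Q.nestUnit : H ⊗[k] (H ⊗[k] (H ⊗[k] H))) := by
  have h : ∀ t : H ⊗[k] (H ⊗[k] (H ⊗[k] H)), TensorProduct.map Q.contrα Q.contrα
      (TensorProduct.leftComm k H (H ⊗[k] H) H
        (TensorProduct.map LinearMap.id (TensorProduct.assoc k H H H).symm.toLinearMap t)) =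
      Q.contrα₂ t := by
    refine tensor_induction₄ (by simp) (fun x y hx hy => by simp only [map_add, hx, hy]) ?_
    intro u v w q
    simp
  exact h _

/-- `1 β S(4) ⊗ 2 β S(3)` for the inverse of `(Φ ⊗ 1)(Δ ⊗ id ⊗ id)(Φ⁻¹)`. -/
def δ : H ⊗[k] H := Q.contrβ₂ (↑Q.nestUnit⁻¹ : H ⊗[k] (H ⊗[k] (H ⊗[k] H)))

/-- Factors outside a contraction are moved inside as right multiplications in the appropriate legs.
After this, relations between reassociators can be applied under the contraction; later sandwich
lemmas serve the same purpose. -/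
theorem S₂_mul_contrα₂_mul (P R : H ⊗[k] H) (z : H ⊗[k] (H ⊗[k] (H ⊗[k] H))) :
    Q.S₂ P * Q.contrα₂ z * R =
      TensorProduct.map Q.contrα Q.contrα (innerFirst z * lift₂ (pair₃ k H) (pair₁ k H) P *
        lift₂ (pair₂ k H) (pair₄ k H) R) := by
  induction P using TensorProduct.induction_on with
  | zero => simp
  | add x y hx hy => simp only [map_add, mul_add, add_mul, hx, hy]
  | tmul p p' =>
    induction R using TensorProduct.induction_on with
    | zero => simp
    | add x y hx hy => simp only [map_add, mul_add, hx, hy]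
    | tmul r r' =>
      induction z using tensor_induction₄ with
      | zero => simp
      | add x y hx hy => simp only [map_add, mul_add, add_mul, hx, hy]
      | tmul u v w q => simp [oneLeft, oneRight, Q.S_mul, mul_assoc]

theorem mul_contrβ₂_mul_S₂ (P R : H ⊗[k] H) (z : H ⊗[k] (H ⊗[k] (H ⊗[k] H))) :
    P * Q.contrβ₂ z * Q.S₂ R =
      TensorProduct.map Q.contrβ Q.contrβ (lift₂ (pair₁ k H) (pair₃ k H) P *
        lift₂ (pair₄ k H) (pair₂ k H) R * outerFirst z) := by
  induction P using TensorProduct.induction_on with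
  | zero => simp
  | add x y hx hy => simp only [map_add, add_mul, hx, hy]
  | tmul p p' =>
    induction R using TensorProduct.induction_on with
    | zero => simp
    | add x y hx hy => simp only [map_add, mul_add, add_mul, hx, hy]
    | tmul r r' =>
      induction z using tensor_induction₄ with
      | zero => simp
      | add x y hx hy => simp only [map_add, mul_add, add_mul, hx, hy]
      | tmul u v w q => simp [oneLeft, oneRight, Q.S_mul, mul_assoc]

/-- `h ↦ S(h₂) ⊗ S(h₁)`. -/
def S₂Δ : H →ₗ[k] H ⊗[k] H := Q.S₂ ∘ₗ Q.Δ.toLinearMap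

/-- The reassociator `nest` carries the fourfold comultiplication of `h` to the nested bracketing.
There the inner pair, contracted by `S(·) α ·`, is absorbed first and the outer pair afterwards. -/
theorem S₂Δ_γ_Δ (h : H) : mulMap k (LinearMap.mulRight k Q.γ ∘ₗ Q.S₂Δ) Q.Δ.toLinearMap (Q.Δ h) =
    Q.ε h • Q.γ := by
  let c := TensorProduct.map Q.contrα Q.contrα
  have _ : Collapse c true (star Q.Δ (pair₁ k H) (pair₂ k H)) (star Q.Δ (pair₁ k H) (pair₂ k H))
      (triv _ Q.ε) := Collapse.of_left c _ _ fun t z => by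
    rw [star_pair₁₂]; exact map_oneRight_mul _ _ (Q.contrα_Δ_mul t) z
  have h₀ : ∀ d : H ⊗[k] H, mulMap k (LinearMap.mulRight k Q.γ ∘ₗ Q.S₂Δ) Q.Δ.toLinearMap d =
      c (innerFirst (Q.nestUnit : H ⊗[k] (H ⊗[k] (H ⊗[k] H))) *
        lift₂ (star Q.Δ (pair₃ k H) (pair₁ k H)) (star Q.Δ (pair₂ k H) (pair₄ k H)) d) := by
    intro d
    induction d using TensorProduct.induction_on with
    | zero => simp
    | add x y hx hy => simp only [map_add, mul_add, hx, hy]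
    | tmul p q =>
      simp only [mulMap_tmul, LinearMap.comp_apply, LinearMap.mulRight_apply, lift₂_tmul, γ_eq]
      exact (Q.S₂_mul_contrα₂_mul _ _ _).trans (by rw [mul_assoc]; rfl)
  rw [h₀, ← star_apply]
  have e := Intertwines.eq (b := Q.nest (pair₃ k H) (pair₁ k H) (pair₂ k H) (pair₄ k H))
    (i := star Q.Δ (star Q.Δ (pair₃ k H) (pair₁ k H)) (star Q.Δ (pair₂ k H) (pair₄ k H)))
    (i' := star Q.Δ (star Q.Δ (pair₃ k H) (star Q.Δ (pair₁ k H) (pair₂ k H))) (pair₄ k H))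
    inferInstance h
  rw [QuasiBialgebra.coe_nest] at e
  rw [e, (Collapse.rel (c := c) (s := true) (a := star Q.Δ (pair₁ k H) (pair₂ k H))
    (i := star Q.Δ (star Q.Δ (pair₃ k H) (star Q.Δ (pair₁ k H) (pair₂ k H))) (pair₄ k H))
    (i' := star Q.Δ (star Q.Δ (pair₃ k H) (triv _ Q.ε)) (pair₄ k H)) h).eval_left]
  simp only [Q.star_triv_right]
  rw [star_pair₃₄, map_oneLeft_mul _ _ (Q.contrα_Δ_mul h), γ_eq]
  rfl

theorem Δ_δ_S₂Δ (h : H) : mulMap k (LinearMap.mulRight k Q.δ ∘ₗ Q.Δ.toLinearMap) Q.S₂Δ (Q.Δ h) =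
    Q.ε h • Q.δ := by
  let c := TensorProduct.map Q.contrβ Q.contrβ
  have _ : Collapse c false (star Q.Δ (pair₃ k H) (pair₄ k H)) (star Q.Δ (pair₃ k H) (pair₄ k H))
      (triv _ Q.ε) := Collapse.of_right c _ _ fun t z => by
    rw [star_pair₃₄]; exact map_mul_oneLeft _ _ (Q.contrβ_mul_Δ t) z
  have h₀ : ∀ d : H ⊗[k] H, mulMap k (LinearMap.mulRight k Q.δ ∘ₗ Q.Δ.toLinearMap) Q.S₂Δ d =
      c (lift₂ (star Q.Δ (pair₁ k H) (pair₃ k H)) (star Q.Δ (pair₄ k H) (pair₂ k H)) d *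
        outerFirst (↑Q.nestUnit⁻¹ : H ⊗[k] (H ⊗[k] (H ⊗[k] H)))) := by
    intro d
    induction d using TensorProduct.induction_on with
    | zero => simp
    | add x y hx hy => simp only [map_add, add_mul, hx, hy]
    | tmul p q =>
      simp only [mulMap_tmul, LinearMap.comp_apply, LinearMap.mulRight_apply, lift₂_tmul, δ]
      exact Q.mul_contrβ₂_mul_S₂ _ _ _
  rw [h₀, ← star_apply]
  have e := Intertwines.eq (b := (Q.nest (pair₁ k H) (pair₃ k H) (pair₄ k H) (pair₂ k H))⁻¹)
    (i := star Q.Δ (star Q.Δ (pair₁ k H) (star Q.Δ (pair₃ k H) (pair₄ k H))) (pair₂ k H))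
    (i' := star Q.Δ (star Q.Δ (pair₁ k H) (pair₃ k H)) (star Q.Δ (pair₄ k H) (pair₂ k H)))
    inferInstance h
  rw [QuasiBialgebra.coe_nest_inv] at e
  rw [← e, (Collapse.rel (c := c) (s := false) (a := star Q.Δ (pair₃ k H) (pair₄ k H))
    (i := star Q.Δ (star Q.Δ (pair₁ k H) (star Q.Δ (pair₃ k H) (pair₄ k H))) (pair₂ k H))
    (i' := star Q.Δ (star Q.Δ (pair₁ k H) (triv _ Q.ε)) (pair₂ k H)) h).eval_right]
  simp only [Q.star_triv_right]
  rw [star_pair₁₂, map_mul_oneRight _ _ (Q.contrβ_mul_Δ h), δ]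
  rfl

section ZigzagLegs

variable (k H)

/-- The maps of the first three legs `H → (H ⊗ H ⊗ H) ⊗ (H ⊗ H ⊗ H)`. -/
abbrev tri₁ : H →ₐ[k] (H ⊗[k] (H ⊗[k] H)) ⊗[k] (H ⊗[k] (H ⊗[k] H)) :=
  (oneRight k _ _).comp (oneRight k H _)
/-- See `tri₁`. -/
abbrev tri₂ : H →ₐ[k] (H ⊗[k] (H ⊗[k] H)) ⊗[k] (H ⊗[k] (H ⊗[k] H)) :=
  (oneRight k _ _).comp ((oneLeft k H _).comp (oneRight k H H))
/-- See `tri₁`. -/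
abbrev tri₃ : H →ₐ[k] (H ⊗[k] (H ⊗[k] H)) ⊗[k] (H ⊗[k] (H ⊗[k] H)) :=
  (oneRight k _ _).comp ((oneLeft k H _).comp (oneLeft k H H))
/-- The maps of the last three legs `H → (H ⊗ H ⊗ H) ⊗ (H ⊗ H ⊗ H)`. -/
abbrev tri₄ : H →ₐ[k] (H ⊗[k] (H ⊗[k] H)) ⊗[k] (H ⊗[k] (H ⊗[k] H)) :=
  (oneLeft k _ _).comp (oneRight k H _)
/-- See `tri₄`. -/
abbrev tri₅ : H →ₐ[k] (H ⊗[k] (H ⊗[k] H)) ⊗[k] (H ⊗[k] (H ⊗[k] H)) :=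
  (oneLeft k _ _).comp ((oneLeft k H _).comp (oneRight k H H))
/-- See `tri₄`. -/
abbrev tri₆ : H →ₐ[k] (H ⊗[k] (H ⊗[k] H)) ⊗[k] (H ⊗[k] (H ⊗[k] H)) :=
  (oneLeft k _ _).comp ((oneLeft k H _).comp (oneLeft k H H))

variable (Q : QuasiBialgebra k H) (x : H)

theorem star_tri₁₂ : star Q.Δ (tri₁ k H) (tri₂ k H) x =
    oneRight k _ _ (onRest k H (oneRight k H H) (Q.Δ x)) := by
  rw [star_apply, lift₂_comp_comp, lift₂_oneRight_comp]; rfl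

theorem star_tri₂₃ : star Q.Δ (tri₂ k H) (tri₃ k H) x =
    oneRight k _ _ (oneLeft k H (H ⊗[k] H) (Q.Δ x)) := by
  rw [star_apply, lift₂_comp_comp, lift₂_comp_comp, lift₂_oneRight_oneLeft]; rfl

theorem star_tri₄₅ : star Q.Δ (tri₄ k H) (tri₅ k H) x =
    oneLeft k _ _ (onRest k H (oneRight k H H) (Q.Δ x)) := by
  rw [star_apply, lift₂_comp_comp, lift₂_oneRight_comp]; rfl

theorem star_tri₅₆ : star Q.Δ (tri₅ k H) (tri₆ k H) x =
    oneLeft k _ _ (oneLeft k H (H ⊗[k] H) (Q.Δ x)) := by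
  rw [star_apply, lift₂_comp_comp, lift₂_comp_comp, lift₂_oneRight_oneLeft]; rfl

theorem lift_tri₁₂₃ (z : H ⊗[k] (H ⊗[k] H)) :
    lift₂ (tri₁ k H) (lift₂ (tri₂ k H) (tri₃ k H)) z = oneRight k _ _ z := by
  simp only [lift₂_comp_comp, lift₂_oneRight_oneLeft, AlgHom.comp_id]

theorem lift_tri₄₅₆ (z : H ⊗[k] (H ⊗[k] H)) :
    lift₂ (tri₄ k H) (lift₂ (tri₅ k H) (tri₆ k H)) z = oneLeft k _ _ z := by
  simp only [lift₂_comp_comp, lift₂_oneRight_oneLeft, AlgHom.comp_id]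

end ZigzagLegs

/-- `x ⊗ y ⊗ z ↦ x β S(y) α z`. -/
def contrβα : H ⊗[k] (H ⊗[k] H) →ₗ[k] H := mulMap k Q.triple.gb Q.contrα

/-- `x ⊗ y ⊗ z ↦ S(x) α y β S(z)`. -/
def contrαβ : H ⊗[k] (H ⊗[k] H) →ₗ[k] H := mulMap k Q.triple.σa Q.contrβ

@[simp]
theorem contrβα_tmul (x y z : H) :
    Q.contrβα (x ⊗ₜ (y ⊗ₜ z)) = x * Q.β * (Q.S y * Q.α * z) := by
  simp [contrβα, AntipodeTriple.gb_apply, triple]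

@[simp]
theorem contrαβ_tmul (x y z : H) :
    Q.contrαβ (x ⊗ₜ (y ⊗ₜ z)) = Q.S x * Q.α * (y * Q.β * Q.S z) := by
  simp [contrαβ, AntipodeTriple.σa_apply, triple]

theorem contrβα_sandwich (P₁ P₂ P₃ : H ⊗[k] H) (V W : H ⊗[k] (H ⊗[k] (H ⊗[k] H))) :
    P₁ * Q.contrβ₂ W * (Q.S₂ P₂ * Q.contrα₂ V * P₃) =
      TensorProduct.map Q.contrβα Q.contrβα
        (lift₂ (tri₅ k H) (lift₂ (tri₂ k H) (lift₂ (tri₃ k H) (tri₆ k H))) V *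
          (lift₂ (tri₁ k H) (tri₄ k H) P₁ *
            (lift₂ (tri₅ k H) (tri₂ k H) P₂ * lift₂ (tri₃ k H) (tri₆ k H) P₃)) *
          lift₂ (tri₁ k H) (lift₂ (tri₄ k H) (lift₂ (tri₅ k H) (tri₂ k H))) W) := by
  induction V using tensor_induction₄ with
  | zero => simp
  | add x y hx hy => simp only [map_add, mul_add, add_mul, hx, hy]
  | tmul u v w q =>
    induction W using tensor_induction₄ with
    | zero => simp
    | add x y hx hy => simp only [map_add, mul_add, add_mul, hx, hy]
    | tmul u' v' w' q' =>
      induction P₁ using TensorProduct.induction_on with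
      | zero => simp
      | add x y hx hy => simp only [map_add, mul_add, add_mul, hx, hy]
      | tmul a a' =>
        induction P₂ using TensorProduct.induction_on with
        | zero => simp
        | add x y hx hy => simp only [map_add, mul_add, add_mul, hx, hy]
        | tmul b b' =>
          induction P₃ using TensorProduct.induction_on with
          | zero => simp
          | add x y hx hy => simp only [map_add, mul_add, add_mul, hx, hy]
          | tmul d d' => simp [oneLeft, oneRight, Q.S_mul, mul_assoc]

theorem contrαβ_sandwich (P₁ P₂ P₃ : H ⊗[k] H) (V W : H ⊗[k] (H ⊗[k] (H ⊗[k] H))) :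
    Q.S₂ P₁ * Q.contrα₂ V * (P₂ * Q.contrβ₂ W * Q.S₂ P₃) =
      TensorProduct.map Q.contrαβ Q.contrαβ
        (lift₂ (tri₄ k H) (lift₂ (tri₁ k H) (lift₂ (tri₂ k H) (tri₅ k H))) V *
          (lift₂ (tri₄ k H) (tri₁ k H) P₁ *
            (lift₂ (tri₂ k H) (tri₅ k H) P₂ * lift₂ (tri₆ k H) (tri₃ k H) P₃)) *
          lift₂ (tri₂ k H) (lift₂ (tri₅ k H) (lift₂ (tri₆ k H) (tri₃ k H))) W) := by
  induction V using tensor_induction₄ with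
  | zero => simp
  | add x y hx hy => simp only [map_add, mul_add, add_mul, hx, hy]
  | tmul u v w q =>
    induction W using tensor_induction₄ with
    | zero => simp
    | add x y hx hy => simp only [map_add, mul_add, add_mul, hx, hy]
    | tmul u' v' w' q' =>
      induction P₁ using TensorProduct.induction_on with
      | zero => simp
      | add x y hx hy => simp only [map_add, mul_add, add_mul, hx, hy]
      | tmul a a' =>
        induction P₂ using TensorProduct.induction_on with
        | zero => simp
        | add x y hx hy => simp only [map_add, mul_add, add_mul, hx, hy]
        | tmul b b' =>
          induction P₃ using TensorProduct.induction_on with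
          | zero => simp
          | add x y hx hy => simp only [map_add, mul_add, add_mul, hx, hy]
          | tmul d d' => simp [oneLeft, oneRight, Q.S_mul, mul_assoc]

/-- The evaluation `γ` and coevaluation `δ` are built by nesting those of `H`, so their zigzag is a
pair of nested zigzags. By `zigzag` it separates into `X¹ β S(X²) α X³ = 1` in each of the two
tensor factors. -/
theorem contr_Φ_twisted : mulMap k (LinearMap.mulRight k Q.δ ∘ₗ Q.Δ.toLinearMap)
    (mulMap k (LinearMap.mulRight k Q.γ ∘ₗ Q.S₂Δ) Q.Δ.toLinearMap)
      (Q.Φ : H ⊗[k] (H ⊗[k] H)) = 1 := by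
  let c := TensorProduct.map Q.contrβα Q.contrβα
  have h₀ : ∀ d : H ⊗[k] (H ⊗[k] H), mulMap k (LinearMap.mulRight k Q.δ ∘ₗ Q.Δ.toLinearMap)
      (mulMap k (LinearMap.mulRight k Q.γ ∘ₗ Q.S₂Δ) Q.Δ.toLinearMap) d =
      c (↑(Q.nest (tri₅ k H) (tri₂ k H) (tri₃ k H) (tri₆ k H)) *
        lift₂ (star Q.Δ (tri₁ k H) (tri₄ k H)) (lift₂ (star Q.Δ (tri₅ k H) (tri₂ k H))
          (star Q.Δ (tri₃ k H) (tri₆ k H))) d *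
        ↑(Q.nest (tri₁ k H) (tri₄ k H) (tri₅ k H) (tri₂ k H))⁻¹) := by
    intro d
    rw [QuasiBialgebra.coe_nest, QuasiBialgebra.coe_nest_inv]
    induction d using tensor_induction₃ with
    | zero => simp
    | add x y hx hy => simp only [map_add, mul_add, add_mul, hx, hy]
    | tmul p q r =>
      simp only [mulMap_tmul, LinearMap.comp_apply, LinearMap.mulRight_apply, lift₂_tmul, γ_eq, δ]
      exact Q.contrβα_sandwich _ _ _ _ _
  have _ : Collapse c true (star Q.Δ (tri₂ k H) (tri₃ k H)) (star Q.Δ (tri₂ k H) (tri₃ k H))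
      (triv _ Q.ε) := Collapse.of_left c _ _ fun t z => by
    rw [star_tri₂₃]
    exact map_oneRight_mul _ _ (mulMap_oneLeft_mul _ _ (Q.contrα_Δ_mul t)) z
  have _ : Collapse c true (star Q.Δ (tri₅ k H) (tri₆ k H)) (star Q.Δ (tri₅ k H) (tri₆ k H))
      (triv _ Q.ε) := Collapse.of_left c _ _ fun t z => by
    rw [star_tri₅₆]
    exact map_oneLeft_mul _ _ (mulMap_oneLeft_mul _ _ (Q.contrα_Δ_mul t)) z
  have _ : Collapse c false (star Q.Δ (tri₁ k H) (tri₂ k H)) (star Q.Δ (tri₁ k H) (tri₂ k H))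
      (triv _ Q.ε) := Collapse.of_right c _ _ fun t z => by
    rw [star_tri₁₂]
    exact map_mul_oneRight _ _ ((Q.triple.rightPair.mulRight Q.α).tail _ t) z
  have _ : Collapse c false (star Q.Δ (tri₄ k H) (tri₅ k H)) (star Q.Δ (tri₄ k H) (tri₅ k H))
      (triv _ Q.ε) := Collapse.of_right c _ _ fun t z => by
    rw [star_tri₄₅]
    exact map_mul_oneLeft _ _ ((Q.triple.rightPair.mulRight Q.α).tail _ t) z
  -- The legs `1, 4` carry `Δ(X¹)`, `5, 2` carry the reversed `Δ(X²)`, and `3, 6` carry `Δ(X³)`. The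
  -- tensor factors are the triples `1, 2, 3` and `4, 5, 6`.
  have e := Q.zigzag c (tri₁ k H) (tri₄ k H) (tri₅ k H) (tri₂ k H) (tri₃ k H) (tri₆ k H)
  rw [Units.val_mul, Units.val_mul, coe_place₃] at e
  rw [h₀, e, Units.val_mul, coe_place₃, coe_place₃, lift_tri₁₂₃, lift_tri₄₅₆]
  have h : Q.contrβα (Q.Φ : H ⊗[k] (H ⊗[k] H)) = 1 := Q.antipode_Φ
  simp only [c, oneLeft, oneRight, Algebra.TensorProduct.includeLeft_apply,
    Algebra.TensorProduct.includeRight_apply, Algebra.TensorProduct.tmul_mul_tmul, mul_one, one_mul,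
    TensorProduct.map_tmul, h]
  rfl

theorem contr_Φ_inv_twisted : mulMap k (LinearMap.mulRight k Q.γ ∘ₗ Q.S₂Δ)
    (mulMap k (LinearMap.mulRight k Q.δ ∘ₗ Q.Δ.toLinearMap) Q.S₂Δ)
      (↑Q.Φ⁻¹ : H ⊗[k] (H ⊗[k] H)) = 1 := by
  let c := TensorProduct.map Q.contrαβ Q.contrαβ
  have h₀ : ∀ d : H ⊗[k] (H ⊗[k] H), mulMap k (LinearMap.mulRight k Q.γ ∘ₗ Q.S₂Δ)
      (mulMap k (LinearMap.mulRight k Q.δ ∘ₗ Q.Δ.toLinearMap) Q.S₂Δ) d =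
      c (↑(Q.nest (tri₄ k H) (tri₁ k H) (tri₂ k H) (tri₅ k H)) *
        lift₂ (star Q.Δ (tri₄ k H) (tri₁ k H)) (lift₂ (star Q.Δ (tri₂ k H) (tri₅ k H))
          (star Q.Δ (tri₆ k H) (tri₃ k H))) d *
        ↑(Q.nest (tri₂ k H) (tri₅ k H) (tri₆ k H) (tri₃ k H))⁻¹) := by
    intro d
    rw [QuasiBialgebra.coe_nest, QuasiBialgebra.coe_nest_inv]
    induction d using tensor_induction₃ with
    | zero => simp
    | add x y hx hy => simp only [map_add, mul_add, add_mul, hx, hy]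
    | tmul p q r =>
      simp only [mulMap_tmul, LinearMap.comp_apply, LinearMap.mulRight_apply, lift₂_tmul, γ_eq, δ]
      exact Q.contrαβ_sandwich _ _ _ _ _
  have _ : Collapse c true (star Q.Δ (tri₁ k H) (tri₂ k H)) (star Q.Δ (tri₁ k H) (tri₂ k H))
      (triv _ Q.ε) := Collapse.of_left c _ _ fun t z => by
    rw [star_tri₁₂]
    exact map_oneRight_mul _ _ ((Q.triple.leftPair.mulRight Q.β).tail _ t) z
  have _ : Collapse c true (star Q.Δ (tri₄ k H) (tri₅ k H)) (star Q.Δ (tri₄ k H) (tri₅ k H))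
      (triv _ Q.ε) := Collapse.of_left c _ _ fun t z => by
    rw [star_tri₄₅]
    exact map_oneLeft_mul _ _ ((Q.triple.leftPair.mulRight Q.β).tail _ t) z
  have _ : Collapse c false (star Q.Δ (tri₂ k H) (tri₃ k H)) (star Q.Δ (tri₂ k H) (tri₃ k H))
      (triv _ Q.ε) := Collapse.of_right c _ _ fun t z => by
    rw [star_tri₂₃]
    exact map_mul_oneRight _ _ (mulMap_mul_oneLeft _ _ (Q.contrβ_mul_Δ t)) z
  have _ : Collapse c false (star Q.Δ (tri₅ k H) (tri₆ k H)) (star Q.Δ (tri₅ k H) (tri₆ k H))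
      (triv _ Q.ε) := Collapse.of_right c _ _ fun t z => by
    rw [star_tri₅₆]
    exact map_mul_oneLeft _ _ (mulMap_mul_oneLeft _ _ (Q.contrβ_mul_Δ t)) z
  have e := Q.zigzag_inv c (tri₄ k H) (tri₁ k H) (tri₂ k H) (tri₅ k H) (tri₆ k H) (tri₃ k H)
  rw [Units.val_mul, Units.val_mul, coe_place₃_inv] at e
  rw [h₀, e, Units.val_mul, coe_place₃_inv, coe_place₃_inv, lift_tri₁₂₃, lift_tri₄₅₆]
  have h : Q.contrαβ (↑Q.Φ⁻¹ : H ⊗[k] (H ⊗[k] H)) = 1 := Q.antipode_Φ_inv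
  simp only [c, oneLeft, oneRight, Algebra.TensorProduct.includeLeft_apply,
    Algebra.TensorProduct.includeRight_apply, Algebra.TensorProduct.tmul_mul_tmul, mul_one, one_mul,
    TensorProduct.map_tmul, h]
  rfl

/-- The antipode data `((S ⊗ S)Δᶜᵒᵖ, γ, δ)` for `Δ`. -/
def twistedTriple : AntipodeTriple Q.toQuasiBialgebra Q.Δ where
  σ := Q.S₂Δ
  a := Q.γ
  b := Q.δ
  σ_one := by simp [S₂Δ, S₂_one]
  σ_mul x y := by simp [S₂Δ, S₂_mul]
  counit_a := Q.S₂Δ_γ_Δ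
  counit_b := Q.Δ_δ_S₂Δ
  contr_Φ := Q.contr_Φ_twisted
  contr_Φ_inv := Q.contr_Φ_inv_twisted

/-- The image of the antipode data of `H` under `Δ`. -/
def coproductTriple : AntipodeTriple Q.toQuasiBialgebra Q.Δ := Q.triple.map Q.Δ

/-- In the defining formula `Δ(x² β S(x³))` is the product `Δ(x²) Δ(β) Δ(S(x³))`. Hence `f` is
precisely the comparison element between two antipode triples for `Δ`, and its invertibility and
defining relations follow at once. -/
theorem twist_eq : Q.twist = Q.coproductTriple.compare Q.twistedTriple := by
  have h : ∀ z, (Q.Δ.toLinearMap ∘ₗ Q.contrβ) z =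
      mulMap k Q.coproductTriple.gb Q.coproductTriple.σ z := fun z =>
    (mulMap_map Q.Δ _ _ _ (fun x => by simp [AntipodeTriple.gb_apply, coproductTriple,
      AntipodeTriple.map, triple]) (fun x => rfl) z).symm
  rw [twist, LinearMap.ext h]
  rfl

theorem twist_mul_Δ_S (h : H) : Q.twist * Q.Δ (Q.S h) = Q.S₂ (Q.Δ h) * Q.twist := by
  rw [twist_eq]; exact Q.coproductTriple.compare_mul_σ Q.twistedTriple h

theorem twist_mul_Δ_α : Q.twist * Q.Δ Q.α = Q.γ := by
  rw [twist_eq]; exact Q.coproductTriple.compare_mul_a Q.twistedTriple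

/-- The Drinfeld twist as a unit. -/
def twistUnit : (H ⊗[k] H)ˣ where
  val := Q.twist
  inv := Q.twistedTriple.compare Q.coproductTriple
  val_inv := by rw [twist_eq]; exact AntipodeTriple.compare_mul_compare _ _
  inv_val := by rw [twist_eq]; exact AntipodeTriple.compare_mul_compare _ _

theorem Δ_β_mul_twist_inv : Q.Δ Q.β * ↑Q.twistUnit⁻¹ = Q.δ :=
  Q.coproductTriple.b_mul_compare Q.twistedTriple

theorem twistInv_eq : Q.twistInv = ↑Q.twistUnit⁻¹ :=
  Ring.inverse_unit Q.twistUnit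

end QuasiHopf

end QHA
end

/-! ### Counit and cocycle identities of the Drinfeld twist. -/

noncomputable section

namespace QHA

namespace QuasiHopf

variable {k H : Type*} [Field k] [Ring H] [Algebra k H] (Q : QuasiHopf k H)

section Counit

/-- Apply `ε` to `S(h₁) α h₂ = ε(h) α` and use `ε(α) = 1`. -/
theorem ε_S (h : H) : Q.ε (Q.S h) = Q.ε h := by
  have e : ∀ z : H ⊗[k] H, Q.ε (Q.contrα z) = Q.ε (Q.S (dropLast k H Q.ε z)) := by
    intro z
    induction z using TensorProduct.induction_on with
    | zero => simp
    | add x y hx hy => simp only [map_add, hx, hy]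
    | tmul p q => simp [dropLast, Q.ε_α, mul_comm]
  have := e (Q.Δ h)
  rw [Q.counit_right, show Q.contrα (Q.Δ h) = _ from Q.antipode_α h] at this
  simpa [Q.ε_α] using this.symm

theorem dropFirst_S₂ (z : H ⊗[k] H) :
    dropFirst k H Q.ε (Q.S₂ z) = Q.S (dropLast k H Q.ε z) := by
  induction z using TensorProduct.induction_on with
  | zero => simp
  | add x y hx hy => simp only [map_add, hx, hy]
  | tmul p q => simp [dropFirst, dropLast, Q.ε_S]

theorem dropLast_S₂ (z : H ⊗[k] H) :
    dropLast k H Q.ε (Q.S₂ z) = Q.S (dropFirst k H Q.ε z) := by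
  induction z using TensorProduct.induction_on with
  | zero => simp
  | add x y hx hy => simp only [map_add, hx, hy]
  | tmul p q => simp [dropFirst, dropLast, Q.ε_S]

/-- Applying `ε` to `S(A²) α A³` makes the two middle legs of `nest` trivial. Both reassociators in
it then have a trivial middle leg and disappear, and what remains is the contraction of `1 ⊗ 1`. -/
theorem dropFirst_γ : dropFirst k H Q.ε Q.γ = Q.α := by
  have h : ∀ t : H ⊗[k] (H ⊗[k] (H ⊗[k] H)), dropFirst k H Q.ε (Q.contrα₂ t) =
      Q.contrα (lift₂ (oneRight k H H) (lift₂ (triv _ Q.ε) (lift₂ (triv _ Q.ε)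
        (oneLeft k H H))) t) := by
    intro t
    induction t using tensor_induction₄ with
    | zero => simp
    | add x y hx hy => simp only [map_add, hx, hy]
    | tmul u v w q =>
      rw [lift₂_tmul, lift₂_tmul, lift₂_tmul, triv_apply, triv_apply, ← Algebra.smul_def,
        ← Algebra.smul_def, mul_smul_comm, mul_smul_comm]
      simp [dropFirst, Q.ε_S, Q.ε_α, oneLeft, oneRight, smul_smul]
  rw [γ_eq, h, ← QuasiBialgebra.coe_nest, QuasiBialgebra.nest, Q.place_triv_mid,
    Q.place_triv_mid]
  simp [Algebra.TensorProduct.one_def, Q.S_one]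

theorem dropLast_γ : dropLast k H Q.ε Q.γ = Q.α := by
  have h : ∀ t : H ⊗[k] (H ⊗[k] (H ⊗[k] H)), dropLast k H Q.ε (Q.contrα₂ t) =
      Q.contrα (lift₂ (triv _ Q.ε) (lift₂ (oneRight k H H) (lift₂ (oneLeft k H H)
        (triv _ Q.ε))) t) := by
    intro t
    induction t using tensor_induction₄ with
    | zero => simp
    | add x y hx hy => simp only [map_add, hx, hy]
    | tmul u v w q =>
      rw [lift₂_tmul, lift₂_tmul, lift₂_tmul, triv_apply, triv_apply, ← Algebra.smul_def,
        ← Algebra.commutes, ← Algebra.smul_def]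
      simp [dropLast, Q.ε_S, Q.ε_α, oneLeft, oneRight, smul_smul]
  rw [γ_eq, h, ← QuasiBialgebra.coe_nest, QuasiBialgebra.nest, Q.place_triv_left,
    Q.place_triv_right]
  simp [Algebra.TensorProduct.one_def, Q.S_one]

theorem dropFirst_twist : dropFirst k H Q.ε Q.twist = 1 := by
  -- Both `(ε ⊗ id)(f)` and `1` carry `(S, α)` to itself, so they agree by uniqueness.
  refine Q.triple.compare_unique (σ' := Q.S.toLinearMap) (a' := Q.α) (fun h => ?_) ?_
    (fun h => by simp [triple]) (by simp [triple])
  · have e := congrArg (dropFirst k H Q.ε) (Q.twist_mul_Δ_S h)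
    rw [map_mul, map_mul, Q.counit_left, dropFirst_S₂, Q.counit_right] at e
    exact e
  · have e := congrArg (dropFirst k H Q.ε) Q.twist_mul_Δ_α
    rw [map_mul, Q.counit_left, dropFirst_γ] at e
    exact e

theorem dropLast_twist : dropLast k H Q.ε Q.twist = 1 := by
  refine Q.triple.compare_unique (σ' := Q.S.toLinearMap) (a' := Q.α) (fun h => ?_) ?_
    (fun h => by simp [triple]) (by simp [triple])
  · have e := congrArg (dropLast k H Q.ε) (Q.twist_mul_Δ_S h)
    rw [map_mul, map_mul, Q.counit_right, dropLast_S₂, Q.counit_left] at e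
    exact e
  · have e := congrArg (dropLast k H Q.ε) Q.twist_mul_Δ_α
    rw [map_mul, Q.counit_right, dropLast_γ] at e
    exact e

end Counit

section Cocycle

theorem assoc_mul {U V W : Type*} [Ring U] [Algebra k U] [Ring V] [Algebra k V] [Ring W]
    [Algebra k W] (x y : (U ⊗[k] V) ⊗[k] W) : TensorProduct.assoc k U V W (x * y) =
      TensorProduct.assoc k U V W x * TensorProduct.assoc k U V W y :=
  map_mul (Algebra.TensorProduct.assoc k k k U V W) x y

theorem onRest_oneRight {U V W : Type*} [Ring U] [Algebra k U] [Ring V] [Algebra k V] [Ring W]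
    [Algebra k W] (z : U ⊗[k] V) : onRest k U (oneRight k V W) z =
      TensorProduct.assoc k U V W (z ⊗ₜ 1) := by
  induction z using TensorProduct.induction_on with
  | zero => simp
  | add x y hx hy => simp only [map_add, TensorProduct.add_tmul, hx, hy]
  | tmul a b => simp [onRest, oneRight]

/-- `x ⊗ y ⊗ z ↦ S(z) ⊗ S(y) ⊗ S(x)`. -/
def S₃ : H ⊗[k] (H ⊗[k] H) →ₗ[k] H ⊗[k] (H ⊗[k] H) :=
  (TensorProduct.assoc k H H H).toLinearMap ∘ₗ TensorProduct.map Q.S₂ Q.S.toLinearMap ∘ₗ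
    (TensorProduct.comm k H (H ⊗[k] H)).toLinearMap

@[simp]
theorem S₃_tmul (x y z : H) : Q.S₃ (x ⊗ₜ (y ⊗ₜ z)) = Q.S z ⊗ₜ (Q.S y ⊗ₜ Q.S x) := by
  simp [S₃]

theorem S₃_mul (x y : H ⊗[k] (H ⊗[k] H)) : Q.S₃ (x * y) = Q.S₃ y * Q.S₃ x := by
  induction x using tensor_induction₃ with
  | zero => simp
  | add x y hx hy => simp only [map_add, mul_add, add_mul, hx, hy]
  | tmul p q r =>
    induction y using tensor_induction₃ with
    | zero => simp
    | add x y hx hy => simp only [map_add, mul_add, add_mul, hx, hy]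
    | tmul p' q' r' => simp [Q.S_mul]

theorem S₃_onFirst (z : H ⊗[k] H) : oneLeft k H (H ⊗[k] H) Q.twist *
    onRest k H Q.Δ (Q.S₂ z) = Q.S₃ (onFirst k H Q.Δ z) * oneLeft k H (H ⊗[k] H) Q.twist := by
  induction z using TensorProduct.induction_on with
  | zero => simp
  | add x y hx hy => simp only [map_add, mul_add, add_mul, hx, hy]
  | tmul p q =>
    have h : ∀ d : H ⊗[k] H, Q.S₃ ((TensorProduct.assoc k H H H) (d ⊗ₜ q)) = Q.S q ⊗ₜ Q.S₂ d := by
      intro d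
      induction d using TensorProduct.induction_on with
      | zero => simp
      | add x y hx hy => simp only [map_add, TensorProduct.add_tmul, TensorProduct.tmul_add, hx, hy]
      | tmul a b => simp
    have h' : Q.S₃ (onFirst k H Q.Δ (p ⊗ₜ q)) = Q.S q ⊗ₜ Q.S₂ (Q.Δ p) := h _
    rw [h']
    simp [onRest, oneLeft, Q.twist_mul_Δ_S]

theorem S₃_onRest (z : H ⊗[k] H) : onRest k H (oneRight k H H) Q.twist *
    onFirst k H Q.Δ (Q.S₂ z) =
      Q.S₃ (onRest k H Q.Δ z) * onRest k H (oneRight k H H) Q.twist := by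
  induction z using TensorProduct.induction_on with
  | zero => simp
  | add x y hx hy => simp only [map_add, mul_add, add_mul, hx, hy]
  | tmul p q =>
    have h : ∀ d : H ⊗[k] H, Q.S₃ (p ⊗ₜ d) = TensorProduct.assoc k H H H (Q.S₂ d ⊗ₜ Q.S p) := by
      intro d
      induction d using TensorProduct.induction_on with
      | zero => simp
      | add x y hx hy => simp only [map_add, TensorProduct.add_tmul, TensorProduct.tmul_add, hx, hy]
      | tmul a b => simp
    have h' : Q.S₃ (onRest k H Q.Δ (p ⊗ₜ q)) = TensorProduct.assoc k H H H
      (Q.S₂ (Q.Δ q) ⊗ₜ Q.S p) := h _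
    have hm : ∀ x y : (H ⊗[k] H) ⊗[k] H, TensorProduct.assoc k H H H (x * y) =
      TensorProduct.assoc k H H H x * TensorProduct.assoc k H H H y :=
      map_mul (Algebra.TensorProduct.assoc k k k H H H)
    rw [h', onRest_oneRight, S₂_tmul, show onFirst k H Q.Δ (Q.S q ⊗ₜ Q.S p) =
      TensorProduct.assoc k H H H (Q.Δ (Q.S q) ⊗ₜ Q.S p) from rfl, ← assoc_mul,
      ← assoc_mul]
    simp [Q.twist_mul_Δ_S]

section SixLegs

variable (k H)

/-- The maps of the six legs `H → (H ⊗ H) ⊗ (H ⊗ H) ⊗ (H ⊗ H)`, where the three pairs of tensor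
factors are the legs `3, 4`, the legs `2, 5` and the legs `1, 6`. -/
abbrev pyr₁ : H →ₐ[k] (H ⊗[k] H) ⊗[k] ((H ⊗[k] H) ⊗[k] (H ⊗[k] H)) :=
  (oneLeft k _ _).comp (pair₃ k H)
/-- See `pyr₁`. -/
abbrev pyr₂ : H →ₐ[k] (H ⊗[k] H) ⊗[k] ((H ⊗[k] H) ⊗[k] (H ⊗[k] H)) :=
  (oneLeft k _ _).comp (pair₁ k H)
/-- See `pyr₁`. -/
abbrev pyr₃ : H →ₐ[k] (H ⊗[k] H) ⊗[k] ((H ⊗[k] H) ⊗[k] (H ⊗[k] H)) :=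
  (oneRight k _ _).comp (oneRight k H H)
/-- See `pyr₁`. -/
abbrev pyr₄ : H →ₐ[k] (H ⊗[k] H) ⊗[k] ((H ⊗[k] H) ⊗[k] (H ⊗[k] H)) :=
  (oneRight k _ _).comp (oneLeft k H H)
/-- See `pyr₁`. -/
abbrev pyr₅ : H →ₐ[k] (H ⊗[k] H) ⊗[k] ((H ⊗[k] H) ⊗[k] (H ⊗[k] H)) :=
  (oneLeft k _ _).comp (pair₂ k H)
/-- See `pyr₁`. -/
abbrev pyr₆ : H →ₐ[k] (H ⊗[k] H) ⊗[k] ((H ⊗[k] H) ⊗[k] (H ⊗[k] H)) :=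
  (oneLeft k _ _).comp (pair₄ k H)

theorem star_pyr₃₄ (Q : QuasiBialgebra k H) (x : H) : star Q.Δ (pyr₃ k H) (pyr₄ k H) x =
    oneRight k _ _ (Q.Δ x) := by
  rw [star_apply, lift₂_comp_comp, lift₂_oneRight_oneLeft]; rfl

end SixLegs

/-- `S(3) α 4 ⊗ S(2) α 5 ⊗ S(1) α 6` for the legs `pyr₁`. -/
def contrα₃ : (H ⊗[k] H) ⊗[k] ((H ⊗[k] H) ⊗[k] (H ⊗[k] H)) →ₗ[k] H ⊗[k] (H ⊗[k] H) :=
  TensorProduct.map Q.contrα (TensorProduct.map Q.contrα Q.contrα)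

theorem S₃_mul_contrα₃_mul (x y : H ⊗[k] (H ⊗[k] H))
    (z : (H ⊗[k] H) ⊗[k] ((H ⊗[k] H) ⊗[k] (H ⊗[k] H))) :
    Q.S₃ x * Q.contrα₃ z * y = Q.contrα₃ (z *
      (lift₂ (pyr₁ k H) (lift₂ (pyr₂ k H) (pyr₃ k H)) x *
        lift₂ (pyr₄ k H) (lift₂ (pyr₅ k H) (pyr₆ k H)) y)) := by
  induction x using tensor_induction₃ with
  | zero => simp
  | add x y hx hy => simp only [map_add, mul_add, add_mul, hx, hy]
  | tmul p q r =>
    induction y using tensor_induction₃ with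
    | zero => simp
    | add x y hx hy => simp only [map_add, mul_add, hx, hy]
    | tmul p' q' r' =>
      induction z using TensorProduct.induction_on with
      | zero => simp
      | add x y hx hy => simp only [map_add, mul_add, add_mul, hx, hy]
      | tmul a z =>
        induction a using TensorProduct.induction_on with
        | zero => simp
        | add x y hx hy => simp only [map_add, TensorProduct.add_tmul, mul_add, add_mul, hx, hy]
        | tmul a b =>
          induction z using tensor_induction₂₂ with
          | zero => simp
          | add x y hx hy => simp only [map_add, TensorProduct.tmul_add, mul_add, add_mul, hx, hy]
          | tmul u v w q => simp [contrα₃, oneLeft, oneRight, Q.S_mul, mul_assoc]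

/-- Since `f Δ(S(x)) = S₂(Δ(x)) f` and `f Δ(α) = γ`, applying `Δ` to `S(x) α y` and multiplying by
`f` opens one contraction into two nested ones. -/
theorem S₂Δ_mul_γ_mul_Δ (x y : H) : Q.S₂ (Q.Δ x) * Q.γ * Q.Δ y = Q.twist * Q.Δ (Q.contrα (x ⊗ₜ y)) := by
  rw [contrα_tmul, map_mul, map_mul, ← mul_assoc, ← mul_assoc, twist_mul_Δ_S, ← twist_mul_Δ_α,
    mul_assoc (Q.S₂ _)]
  simp only [mul_assoc]

theorem contrα_outer (u v w q : H) : oneLeft k H (H ⊗[k] H) Q.twist *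
    onRest k H Q.Δ (Q.contrα₂ (u ⊗ₜ (v ⊗ₜ (w ⊗ₜ q)))) =
      Q.contrα (v ⊗ₜ w) ⊗ₜ TensorProduct.map Q.contrα Q.contrα
        (innerFirst (Q.nestUnit : H ⊗[k] (H ⊗[k] (H ⊗[k] H))) *
          lift₂ (pair₃ k H) (pair₁ k H) (Q.Δ u) * lift₂ (pair₂ k H) (pair₄ k H) (Q.Δ q)) := by
  rw [← S₂_mul_contrα₂_mul, ← γ_eq, S₂Δ_mul_γ_mul_Δ]
  simp [oneLeft, onRest]

theorem contrα_inner (u v w q : H) : onRest k H (oneRight k H H) Q.twist *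
    onFirst k H Q.Δ (Q.contrα₂ (u ⊗ₜ (v ⊗ₜ (w ⊗ₜ q)))) =
      TensorProduct.assoc k H H H (TensorProduct.map Q.contrα Q.contrα
        (innerFirst (Q.nestUnit : H ⊗[k] (H ⊗[k] (H ⊗[k] H))) *
          lift₂ (pair₃ k H) (pair₁ k H) (Q.Δ v) * lift₂ (pair₂ k H) (pair₄ k H) (Q.Δ w)) ⊗ₜ
        Q.contrα (u ⊗ₜ q)) := by
  rw [← S₂_mul_contrα₂_mul, ← γ_eq, S₂Δ_mul_γ_mul_Δ, onRest_oneRight]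
  have : onFirst k H Q.Δ (Q.contrα₂ (u ⊗ₜ (v ⊗ₜ (w ⊗ₜ q)))) =
    TensorProduct.assoc k H H H (Q.Δ (Q.contrα (v ⊗ₜ w)) ⊗ₜ Q.contrα (u ⊗ₜ q)) := by
    rw [contrα₂_tmul, contrα_tmul, contrα_tmul]; rfl
  rw [this, ← assoc_mul]
  simp

/-- The comultiplication opens the outer contraction of `γ` into two, so three nested pairs appear,
with one `nest` from `γ` and one from the opened contraction. In `onRest_twist_γ` the inner
contraction is opened instead. -/
theorem oneLeft_twist_γ : oneLeft k H (H ⊗[k] H) Q.twist * onRest k H Q.Δ Q.γ =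
    Q.contrα₃ ↑(Q.nest (pyr₁ k H) (pyr₂ k H) (pyr₅ k H) (pyr₆ k H) *
      Q.nest (star Q.Δ (pyr₁ k H) (pyr₂ k H)) (pyr₃ k H) (pyr₄ k H)
        (star Q.Δ (pyr₅ k H) (pyr₆ k H))) := by
  rw [Units.val_mul, QuasiBialgebra.coe_nest, QuasiBialgebra.coe_nest, γ_eq]
  generalize hN : (Q.nestUnit : H ⊗[k] (H ⊗[k] (H ⊗[k] H))) = N
  have key : ∀ z : H ⊗[k] (H ⊗[k] (H ⊗[k] H)), oneLeft k H (H ⊗[k] H) Q.twist *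
      onRest k H Q.Δ (Q.contrα₂ z) = Q.contrα₃
        (lift₂ (pyr₁ k H) (lift₂ (pyr₂ k H) (lift₂ (pyr₅ k H) (pyr₆ k H))) N *
        lift₂ (star Q.Δ (pyr₁ k H) (pyr₂ k H)) (lift₂ (pyr₃ k H) (lift₂ (pyr₄ k H)
        (star Q.Δ (pyr₅ k H) (pyr₆ k H)))) z) := by
    intro z
    induction z using tensor_induction₄ with
    | zero => simp
    | add x y hx hy => simp only [map_add, mul_add, hx, hy]
    | tmul u v w q =>
      have h : ∀ (N : H ⊗[k] (H ⊗[k] (H ⊗[k] H))) (x y : H ⊗[k] H),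
          Q.contrα (v ⊗ₜ w) ⊗ₜ TensorProduct.map Q.contrα Q.contrα
            (innerFirst N * lift₂ (pair₃ k H) (pair₁ k H) x *
              lift₂ (pair₂ k H) (pair₄ k H) y) =
          Q.contrα₃ (lift₂ (pyr₁ k H) (lift₂ (pyr₂ k H) (lift₂ (pyr₅ k H) (pyr₆ k H))) N *
            (lift₂ (pyr₁ k H) (pyr₂ k H) x * (pyr₃ k H v * (pyr₄ k H w *
              lift₂ (pyr₅ k H) (pyr₆ k H) y)))) := by
        intro N x y
        induction x using TensorProduct.induction_on with
        | zero => simp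
        | add x y hx hy =>
          simp only [map_add, mul_add, add_mul, TensorProduct.tmul_add, hx, hy]
        | tmul a b =>
          induction y using TensorProduct.induction_on with
          | zero => simp
          | add x y hx hy => simp only [map_add, mul_add, TensorProduct.tmul_add, hx, hy]
          | tmul a' b' =>
            induction N using tensor_induction₄ with
            | zero => simp
            | add x y hx hy => simp only [map_add, add_mul, TensorProduct.tmul_add, hx, hy]
            | tmul u' v' w' q' => simp [contrα₃, oneLeft, oneRight, mul_assoc]
      rw [contrα_outer, hN, h]
      simp only [lift₂_tmul, star_apply]
  exact key N

theorem onRest_twist_γ : onRest k H (oneRight k H H) Q.twist * onFirst k H Q.Δ Q.γ =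
    Q.contrα₃ ↑(Q.nest (pyr₂ k H) (pyr₃ k H) (pyr₄ k H) (pyr₅ k H) *
      Q.nest (pyr₁ k H) (star Q.Δ (pyr₂ k H) (pyr₃ k H)) (star Q.Δ (pyr₄ k H) (pyr₅ k H))
        (pyr₆ k H)) := by
  rw [Units.val_mul, QuasiBialgebra.coe_nest, QuasiBialgebra.coe_nest, γ_eq]
  generalize hN : (Q.nestUnit : H ⊗[k] (H ⊗[k] (H ⊗[k] H))) = N
  have key : ∀ z : H ⊗[k] (H ⊗[k] (H ⊗[k] H)), onRest k H (oneRight k H H) Q.twist *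
      onFirst k H Q.Δ (Q.contrα₂ z) = Q.contrα₃
        (lift₂ (pyr₂ k H) (lift₂ (pyr₃ k H) (lift₂ (pyr₄ k H) (pyr₅ k H))) N *
        lift₂ (pyr₁ k H) (lift₂ (star Q.Δ (pyr₂ k H) (pyr₃ k H)) (lift₂
        (star Q.Δ (pyr₄ k H) (pyr₅ k H)) (pyr₆ k H))) z) := by
    intro z
    induction z using tensor_induction₄ with
    | zero => simp
    | add x y hx hy => simp only [map_add, mul_add, hx, hy]
    | tmul u v w q =>
      have h : ∀ (N : H ⊗[k] (H ⊗[k] (H ⊗[k] H))) (x y : H ⊗[k] H),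
          TensorProduct.assoc k H H H (TensorProduct.map Q.contrα Q.contrα
            (innerFirst N * lift₂ (pair₃ k H) (pair₁ k H) x *
              lift₂ (pair₂ k H) (pair₄ k H) y) ⊗ₜ Q.contrα (u ⊗ₜ q)) =
          Q.contrα₃ (lift₂ (pyr₂ k H) (lift₂ (pyr₃ k H) (lift₂ (pyr₄ k H) (pyr₅ k H))) N *
            (pyr₁ k H u * (lift₂ (pyr₂ k H) (pyr₃ k H) x * (lift₂ (pyr₄ k H) (pyr₅ k H) y *
              pyr₆ k H q)))) := by
        intro N x y
        induction x using TensorProduct.induction_on with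
        | zero => simp
        | add x y hx hy =>
          simp only [map_add, mul_add, add_mul, TensorProduct.add_tmul, hx, hy]
        | tmul a b =>
          induction y using TensorProduct.induction_on with
          | zero => simp
          | add x y hx hy =>
            simp only [map_add, mul_add, add_mul, TensorProduct.add_tmul, hx, hy]
          | tmul a' b' =>
            induction N using tensor_induction₄ with
            | zero => simp
            | add x y hx hy =>
              simp only [map_add, add_mul, TensorProduct.add_tmul, hx, hy]
            | tmul u' v' w' q' => simp [contrα₃, oneLeft, oneRight, mul_assoc]
      rw [contrα_inner, hN, h]
      simp only [lift₂_tmul, star_apply]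
  exact key N

/-- The Drinfeld twist is a twisted cocycle:
`(1 ⊗ f)(id ⊗ Δ)(f) Φ = (S ⊗ S ⊗ S)(Φ³²¹)(f ⊗ 1)(Δ ⊗ id)(f)`. -/
theorem twist_cocycle : oneLeft k H (H ⊗[k] H) Q.twist * onRest k H Q.Δ Q.twist * Q.Φ =
    Q.S₃ Q.Φ * onRest k H (oneRight k H H) Q.twist * onFirst k H Q.Δ Q.twist := by
  rw [← Units.eq_mul_inv_iff_mul_eq]
  -- Uniqueness is applied to the image of `(S, α, β)` under `(id ⊗ Δ) Δ`, after `Φ` has been moved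
  -- to the right-hand side.
  let T := Q.triple.map ((onRest k H Q.Δ).comp Q.Δ)
  have hα : T.a = onRest k H Q.Δ (Q.Δ Q.α) := rfl
  have hσ : ∀ h, T.σ h = onRest k H Q.Δ (Q.Δ (Q.S h)) := fun h => rfl
  refine T.compare_unique (σ' := Q.S₃ ∘ₗ (onFirst k H Q.Δ).toLinearMap ∘ₗ Q.Δ.toLinearMap)
    (a' := oneLeft k H (H ⊗[k] H) Q.twist * onRest k H Q.Δ Q.γ) (fun h => ?_) ?_ (fun h => ?_) ?_
  · change _ = Q.S₃ (onFirst k H Q.Δ (Q.Δ h)) * _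
    rw [hσ, mul_assoc, ← map_mul, twist_mul_Δ_S, map_mul, ← mul_assoc, S₃_onFirst, mul_assoc]
  · rw [hα, mul_assoc, ← map_mul, twist_mul_Δ_α]
  · change _ = Q.S₃ (onFirst k H Q.Δ (Q.Δ h)) * _
    -- Quasi-coassociativity is used twice: at `S(h)`, to pass from `(id ⊗ Δ)Δ` to `(Δ ⊗ id)Δ`, and
    -- at `h` under `S₃`, to return.
    have e := Q.quasi_coassoc h
    rw [Units.eq_mul_inv_iff_mul_eq] at e
    have e₁ := congrArg Q.S₃ e
    rw [S₃_mul, S₃_mul] at e₁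
    have e₂ := congrArg (onFirst k H Q.Δ) (Q.twist_mul_Δ_S h)
    rw [map_mul, map_mul] at e₂
    rw [hσ, Q.quasi_coassoc, mul_assoc, ← mul_assoc (↑Q.Φ⁻¹ : H ⊗[k] (H ⊗[k] H)), ← mul_assoc
      (↑Q.Φ⁻¹ : H ⊗[k] (H ⊗[k] H)), Units.inv_mul, one_mul, mul_assoc, ← mul_assoc (onFirst k H Q.Δ
      Q.twist), e₂, mul_assoc (onFirst k H Q.Δ _), mul_assoc (Q.S₃ _), ← mul_assoc _ (onFirst k H Q.Δ
      (Q.S₂ _)), S₃_onRest, mul_assoc (Q.S₃ _), ← mul_assoc _ (Q.S₃ _), e₁]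
    simp only [mul_assoc]
  · rw [hα, Q.quasi_coassoc, mul_assoc, ← mul_assoc (↑Q.Φ⁻¹ : H ⊗[k] (H ⊗[k] H)), ← mul_assoc
      (↑Q.Φ⁻¹ : H ⊗[k] (H ⊗[k] H)), Units.inv_mul, one_mul, mul_assoc, ← mul_assoc (onFirst k H Q.Δ
      Q.twist), ← map_mul, twist_mul_Δ_α, ← mul_assoc, mul_assoc (Q.S₃ _), onRest_twist_γ,
      oneLeft_twist_γ, S₃_mul_contrα₃_mul]
    -- Both candidates map `α` to a threefold nested contraction; collapsing the innermost pair `3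
    -- 4` identifies the two.
    have _ : Collapse Q.contrα₃ true (star Q.Δ (pyr₃ k H) (pyr₄ k H))
        (star Q.Δ (pyr₃ k H) (pyr₄ k H)) (triv _ Q.ε) := Collapse.of_left _ _ _ fun t z => by
      rw [star_pyr₃₄]
      exact map_oneRight_mul _ _ (Q.contrα_Δ_mul t) z
    exact (Q.collapse_nest_nest Q.contrα₃ (pyr₁ k H) (pyr₂ k H) (pyr₃ k H) (pyr₄ k H) (pyr₅ k H)
      (pyr₆ k H)).symm

end Cocycle

end QuasiHopf

end QHA
end

/-! ### The opposite quasi-Hopf algebra. -/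

noncomputable section

namespace QHA

section Opposite

open MulOpposite

variable {k : Type*} [Field k]

section Op

variable (k) (U V W P : Type*) [Ring U] [Algebra k U] [Ring V] [Algebra k V] [Ring W]
  [Algebra k W] [Ring P] [Algebra k P]

/-- `(U ⊗ V)ᵒᵖ → Uᵒᵖ ⊗ Vᵒᵖ`. -/
def opp₂ : (U ⊗[k] V)ᵐᵒᵖ →ₐ[k] Uᵐᵒᵖ ⊗[k] Vᵐᵒᵖ :=
  (Algebra.TensorProduct.opAlgEquiv k k U V).symm.toAlgHom

/-- `(U ⊗ V ⊗ W)ᵒᵖ → Uᵒᵖ ⊗ Vᵒᵖ ⊗ Wᵒᵖ`. -/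
def opp₃ : (U ⊗[k] (V ⊗[k] W))ᵐᵒᵖ →ₐ[k] Uᵐᵒᵖ ⊗[k] (Vᵐᵒᵖ ⊗[k] Wᵐᵒᵖ) :=
  (onRest k Uᵐᵒᵖ (opp₂ k V W)).comp (opp₂ k U (V ⊗[k] W))

/-- `(U ⊗ V ⊗ W ⊗ P)ᵒᵖ → Uᵒᵖ ⊗ Vᵒᵖ ⊗ Wᵒᵖ ⊗ Pᵒᵖ`. -/
def opp₄ : (U ⊗[k] (V ⊗[k] (W ⊗[k] P)))ᵐᵒᵖ →ₐ[k] Uᵐᵒᵖ ⊗[k] (Vᵐᵒᵖ ⊗[k] (Wᵐᵒᵖ ⊗[k] Pᵐᵒᵖ)) :=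
  (onRest k Uᵐᵒᵖ (opp₃ k V W P)).comp (opp₂ k U _)

variable {k U V W P}

@[simp]
theorem opp₂_tmul (u : U) (v : V) : opp₂ k U V (op (u ⊗ₜ v)) = op u ⊗ₜ op v := by
  simp [opp₂]

@[simp]
theorem opp₃_tmul (u : U) (v : V) (w : W) :
    opp₃ k U V W (op (u ⊗ₜ (v ⊗ₜ w))) = op u ⊗ₜ (op v ⊗ₜ op w) := by
  simp [opp₃, onRest]

theorem onRest_opp {D E E' : Type*} [Ring D] [Algebra k D] [Ring E] [Algebra k E] [Ring E']
    [Algebra k E'] {g : Dᵐᵒᵖ →ₐ[k] E'} {f : D →ₐ[k] E} {θ : Eᵐᵒᵖ →ₐ[k] E'}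
    (h : ∀ d, g (op d) = θ (op (f d))) (z : U ⊗[k] D) :
    onRest k Uᵐᵒᵖ g (opp₂ k U D (op z)) =
      onRest k Uᵐᵒᵖ θ (opp₂ k U E (op (onRest k U f z))) := by
  induction z using TensorProduct.induction_on with
  | zero => simp
  | add x y hx hy => simp only [map_add, op_add, hx, hy]
  | tmul p d => simp [onRest, h]

theorem onRest_onRest {D E E' : Type*} [Ring D] [Algebra k D] [Ring E] [Algebra k E]
    [Ring E'] [Algebra k E'] (g : E →ₐ[k] E') (θ : D →ₐ[k] E) (z : U ⊗[k] D) :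
    onRest k U g (onRest k U θ z) = onRest k U (g.comp θ) z := by
  induction z using TensorProduct.induction_on with
  | zero => simp
  | add x y hx hy => simp only [map_add, hx, hy]
  | tmul p d => simp [onRest]

theorem onFirst_opp {D : Type*} [Ring D] [Algebra k D] {g : Pᵐᵒᵖ →ₐ[k] Uᵐᵒᵖ ⊗[k] Vᵐᵒᵖ}
    {f : P →ₐ[k] U ⊗[k] V} (h : ∀ d, g (op d) = opp₂ k U V (op (f d))) (z : P ⊗[k] D) :
    onFirst k Dᵐᵒᵖ g (opp₂ k P D (op z)) = opp₃ k U V D (op (onFirst k D f z)) := by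
  induction z using TensorProduct.induction_on with
  | zero => simp
  | add x y hx hy => simp only [map_add, op_add, hx, hy]
  | tmul p d =>
    simp only [opp₂_tmul, onFirst, AlgHom.comp_apply, Algebra.TensorProduct.map_tmul, h]
    generalize f p = t
    induction t using TensorProduct.induction_on with
    | zero => simp
    | add x y hx hy =>
      simp only [op_add, map_add, TensorProduct.add_tmul, AlgHom.id_apply] at hx hy ⊢
      rw [hx, hy]
    | tmul a b => simp

theorem oneRight_opp (u : U) : oneRight k Uᵐᵒᵖ Vᵐᵒᵖ (op u) =
    opp₂ k U V (op (oneRight k U V u)) := by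
  simp [oneRight]

end Op

/-- The opposite of a unit. -/
def opUnit {M : Type*} [Monoid M] (u : Mˣ) : Mᵐᵒᵖˣ := Units.opEquiv.symm (op u)

variable {H : Type*} [Ring H] [Algebra k H]

namespace QuasiBialgebra

variable (Q : QuasiBialgebra k H)

/-- The comultiplication of the opposite algebra. -/
def opΔ : Hᵐᵒᵖ →ₐ[k] Hᵐᵒᵖ ⊗[k] Hᵐᵒᵖ := (opp₂ k H H).comp (AlgHom.op Q.Δ)

theorem opΔ_op (h : H) : Q.opΔ (op h) = opp₂ k H H (op (Q.Δ h)) := rfl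

/-- The counit of the opposite algebra. -/
def opε : Hᵐᵒᵖ →ₐ[k] k := Q.ε.fromOpposite fun x y => Commute.all (Q.ε x) (Q.ε y)

@[simp]
theorem opε_op (h : H) : Q.opε (op h) = Q.ε h := rfl

/-- The reassociator of the opposite algebra. -/
def opΦ : (Hᵐᵒᵖ ⊗[k] (Hᵐᵒᵖ ⊗[k] Hᵐᵒᵖ))ˣ := Units.map (opp₃ k H H H).toMonoidHom (opUnit Q.Φ⁻¹)

theorem coe_opΦ : (Q.opΦ : Hᵐᵒᵖ ⊗[k] (Hᵐᵒᵖ ⊗[k] Hᵐᵒᵖ)) = opp₃ k H H H (op ↑Q.Φ⁻¹) := rfl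

theorem coe_opΦ_inv : (↑Q.opΦ⁻¹ : Hᵐᵒᵖ ⊗[k] (Hᵐᵒᵖ ⊗[k] Hᵐᵒᵖ)) = opp₃ k H H H (op ↑Q.Φ) := rfl

theorem dropFirst_opp₂ {U : Type*} [Ring U] [Algebra k U] (z : H ⊗[k] U) :
    dropFirst k Uᵐᵒᵖ Q.opε (opp₂ k H U (op z)) = op (dropFirst k U Q.ε z) := by
  induction z using TensorProduct.induction_on with
  | zero => simp
  | add x y hx hy => simp only [map_add, op_add, hx, hy]
  | tmul p d => simp [dropFirst]

theorem dropLast_opp₂ {U : Type*} [Ring U] [Algebra k U] (z : U ⊗[k] H) :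
    dropLast k Uᵐᵒᵖ Q.opε (opp₂ k U H (op z)) = op (dropLast k U Q.ε z) := by
  induction z using TensorProduct.induction_on with
  | zero => simp
  | add x y hx hy => simp only [map_add, op_add, hx, hy]
  | tmul p d => simp [dropLast]

theorem onRest_opΔ (z : H ⊗[k] H) :
    onRest k Hᵐᵒᵖ Q.opΔ (opp₂ k H H (op z)) = opp₃ k H H H (op (onRest k H Q.Δ z)) :=
  onRest_opp Q.opΔ_op z

theorem onFirst_opΔ {U : Type*} [Ring U] [Algebra k U] (z : H ⊗[k] U) :
    onFirst k Uᵐᵒᵖ Q.opΔ (opp₂ k H U (op z)) = opp₃ k H H U (op (onFirst k U Q.Δ z)) :=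
  onFirst_opp Q.opΔ_op z

/-- The inverse of the pentagon has its factors in reversed order, which is exactly the pentagon for
`Φ⁻¹` in the opposite algebra. -/
theorem cocycle_inv :
    onRest k H (onRest k H (oneRight k H H)) (↑Q.Φ⁻¹ : H ⊗[k] (H ⊗[k] H)) *
        (onRest k H (onFirst k H Q.Δ) (↑Q.Φ⁻¹ : H ⊗[k] (H ⊗[k] H)) *
        oneLeft k H (H ⊗[k] (H ⊗[k] H)) ↑Q.Φ⁻¹) =
      onFirst k (H ⊗[k] H) Q.Δ (↑Q.Φ⁻¹ : H ⊗[k] (H ⊗[k] H)) *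
        onRest k H (onRest k H Q.Δ) (↑Q.Φ⁻¹ : H ⊗[k] (H ⊗[k] H)) := by
  have h : Units.map (oneLeft k H (H ⊗[k] (H ⊗[k] H))).toMonoidHom Q.Φ *
      Units.map (onRest k H (onFirst k H Q.Δ)).toMonoidHom Q.Φ *
      Units.map (onRest k H (onRest k H (oneRight k H H))).toMonoidHom Q.Φ =
      Units.map (onRest k H (onRest k H Q.Δ)).toMonoidHom Q.Φ *
      Units.map (onFirst k (H ⊗[k] H) Q.Δ).toMonoidHom Q.Φ := Units.ext Q.cocycle
  have h' := congrArg (fun u => ((u⁻¹ : (H ⊗[k] (H ⊗[k] (H ⊗[k] H)))ˣ) :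
    H ⊗[k] (H ⊗[k] (H ⊗[k] H)))) h
  simp only [mul_inv_rev] at h'
  exact h'

theorem onRest_onRest_oneRight_opp₃ {U V W P : Type*} [Ring U] [Algebra k U] [Ring V]
    [Algebra k V] [Ring W] [Algebra k W] [Ring P] [Algebra k P] (w : U ⊗[k] (V ⊗[k] W)) :
    onRest k Uᵐᵒᵖ (onRest k Vᵐᵒᵖ (oneRight k Wᵐᵒᵖ Pᵐᵒᵖ)) (opp₃ k U V W (MulOpposite.op w)) =
      opp₄ k U V W P (MulOpposite.op (onRest k U (onRest k V (oneRight k W P)) w)) := by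
  rw [opp₃, AlgHom.comp_apply, onRest_onRest]
  exact onRest_opp (onRest_opp oneRight_opp) w

theorem onFirst_opΔ_opp₃ (t : H ⊗[k] (H ⊗[k] H)) :
    onFirst k (Hᵐᵒᵖ ⊗[k] Hᵐᵒᵖ) Q.opΔ (opp₃ k H H H (MulOpposite.op t)) =
      opp₄ k H H H H (MulOpposite.op (onFirst k (H ⊗[k] H) Q.Δ t)) := by
  have h : onFirst k (Hᵐᵒᵖ ⊗[k] Hᵐᵒᵖ) Q.opΔ (opp₃ k H H H (MulOpposite.op t)) =
      onRest k Hᵐᵒᵖ (onRest k Hᵐᵒᵖ (opp₂ k H H)) (onFirst k (H ⊗[k] H)ᵐᵒᵖ Q.opΔ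
        (opp₂ k H (H ⊗[k] H) (MulOpposite.op t))) := by
    induction t using tensor_induction₃ with
    | zero => simp
    | add x y hx hy => simp only [op_add, map_add, hx, hy]
    | tmul p q r =>
      simp only [opp₃_tmul, opp₂_tmul, onFirst, AlgHom.comp_apply,
        Algebra.TensorProduct.map_tmul]
      generalize Q.opΔ (MulOpposite.op p) = d
      induction d using TensorProduct.induction_on with
      | zero => simp
      | add x y hx hy =>
        simp only [map_add, TensorProduct.add_tmul, hx, hy]
      | tmul a b => simp [onRest]
  rw [h, onFirst_opΔ, opp₃, AlgHom.comp_apply, onRest_onRest]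
  rfl

/-- The opposite quasi-bialgebra. -/
def op : QuasiBialgebra k Hᵐᵒᵖ where
  Δ := Q.opΔ
  ε := Q.opε
  Φ := Q.opΦ
  quasi_coassoc h := by
    obtain ⟨x, rfl⟩ := op_surjective h
    rw [opΔ_op, onRest_opΔ, onFirst_opΔ, coe_opΦ, coe_opΦ_inv, ← map_mul, ← map_mul,
      Q.quasi_coassoc, ← MulOpposite.op_mul, ← MulOpposite.op_mul, mul_assoc]
  counit_right h := by
    obtain ⟨x, rfl⟩ := op_surjective h
    rw [opΔ_op, dropLast_opp₂, Q.counit_right]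
  counit_left h := by
    obtain ⟨x, rfl⟩ := op_surjective h
    rw [opΔ_op, dropFirst_opp₂, Q.counit_left]
  cocycle := by
    rw [coe_opΦ]
    generalize hw : (↑Q.Φ⁻¹ : H ⊗[k] (H ⊗[k] H)) = w
    have e₁ : oneLeft k Hᵐᵒᵖ _ (opp₃ k H H H (MulOpposite.op w)) =
        opp₄ k H H H H (MulOpposite.op (oneLeft k H (H ⊗[k] (H ⊗[k] H)) w)) := by
      simp [oneLeft, opp₄, onRest]
    have e₂ : onRest k Hᵐᵒᵖ (onFirst k Hᵐᵒᵖ Q.opΔ) (opp₃ k H H H (MulOpposite.op w)) =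
        opp₄ k H H H H (MulOpposite.op (onRest k H (onFirst k H Q.Δ) w)) := by
      rw [opp₃, AlgHom.comp_apply, onRest_onRest]
      exact onRest_opp Q.onFirst_opΔ w
    have e₄ : onRest k Hᵐᵒᵖ (onRest k Hᵐᵒᵖ Q.opΔ) (opp₃ k H H H (MulOpposite.op w)) =
        opp₄ k H H H H (MulOpposite.op (onRest k H (onRest k H Q.Δ) w)) := by
      rw [opp₃, AlgHom.comp_apply, onRest_onRest]
      exact onRest_opp Q.onRest_opΔ w
    rw [e₁, e₂, e₄, onRest_onRest_oneRight_opp₃, onFirst_opΔ_opp₃, ← map_mul, ← map_mul, ← map_mul, ← MulOpposite.op_mul,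
      ← MulOpposite.op_mul, ← MulOpposite.op_mul, ← hw, cocycle_inv]
  counit_Φ := by
    rw [coe_opΦ, opp₃, AlgHom.comp_apply, onRest_onRest,
      onRest_opp (f := dropFirst k H Q.ε) (θ := AlgHom.id k _) fun d => ?_]
    · have h : onRest k H (dropFirst k H Q.ε) (↑Q.Φ⁻¹ : H ⊗[k] (H ⊗[k] H)) = 1 := by
        have h' : Units.map (onRest k H (dropFirst k H Q.ε)).toMonoidHom Q.Φ = 1 :=
          Units.ext Q.counit_Φ
        have h'' := congrArg (fun u => ((u⁻¹ : (H ⊗[k] H)ˣ) : H ⊗[k] H)) h'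
        simpa using h''
      rw [h]
      simp
    · exact Q.dropFirst_opp₂ d

end QuasiBialgebra

namespace QuasiHopf

variable (Q : QuasiHopf k H)

theorem Sinv_S (h : H) : Q.Sinv (Q.S h) = h := Q.S.symm_apply_apply h

theorem S_Sinv (h : H) : Q.S (Q.Sinv h) = h := Q.S.apply_symm_apply h

theorem Sinv_mul (x y : H) : Q.Sinv (x * y) = Q.Sinv y * Q.Sinv x := by
  apply Q.S.injective
  rw [Q.S_mul, S_Sinv, S_Sinv, S_Sinv]

theorem Sinv_one : Q.Sinv 1 = 1 := by
  apply Q.S.injective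
  rw [Q.S_one, S_Sinv]

theorem ε_Sinv (h : H) : Q.ε (Q.Sinv h) = Q.ε h := by
  rw [← Q.ε_S, S_Sinv]

/-- The opposite quasi-Hopf algebra. -/
def op : QuasiHopf k Hᵐᵒᵖ where
  toQuasiBialgebra := Q.toQuasiBialgebra.op
  S := ((opLinearEquiv k).symm.trans Q.S.symm).trans (opLinearEquiv k)
  S_one := congrArg MulOpposite.op Q.Sinv_one
  S_mul x y := congrArg MulOpposite.op (Q.Sinv_mul (unop y) (unop x))
  α := MulOpposite.op (Q.Sinv Q.β)
  β := MulOpposite.op (Q.Sinv Q.α)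
  antipode_α h := by
    obtain ⟨x, rfl⟩ := op_surjective h
    have e : ∀ z : H ⊗[k] H, mulMap k (LinearMap.mulRight k (MulOpposite.op (Q.Sinv Q.β)) ∘ₗ
        (((opLinearEquiv k).symm.trans Q.S.symm).trans (opLinearEquiv k)).toLinearMap) LinearMap.id
        (opp₂ k H H (MulOpposite.op z)) = MulOpposite.op (Q.Sinv (Q.contrβ z)) := by
      intro z
      induction z using TensorProduct.induction_on with
      | zero => simp
      | add x y hx hy => simp only [op_add, map_add, hx, hy]
      | tmul p q =>
        rw [contrβ_tmul, Sinv_mul, Sinv_mul, Sinv_S, opp₂_tmul, mulMap_tmul]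
        rfl
    refine (e (Q.Δ x)).trans ?_
    rw [show Q.contrβ (Q.Δ x) = _ from Q.antipode_β x, map_smul]
    rfl
  antipode_β h := by
    obtain ⟨x, rfl⟩ := op_surjective h
    have e : ∀ z : H ⊗[k] H, mulMap k (LinearMap.mulRight k (MulOpposite.op (Q.Sinv Q.α)))
        (((opLinearEquiv k).symm.trans Q.S.symm).trans (opLinearEquiv k)).toLinearMap
        (opp₂ k H H (MulOpposite.op z)) = MulOpposite.op (Q.Sinv (Q.contrα z)) := by
      intro z
      induction z using TensorProduct.induction_on with
      | zero => simp
      | add x y hx hy => simp only [op_add, map_add, hx, hy]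
      | tmul p q =>
        rw [contrα_tmul, Sinv_mul, Sinv_mul, Sinv_S, opp₂_tmul, mulMap_tmul]
        rfl
    refine (e (Q.Δ x)).trans ?_
    rw [show Q.contrα (Q.Δ x) = _ from Q.antipode_α x, map_smul]
    rfl
  antipode_Φ := by
    have e : ∀ z : H ⊗[k] (H ⊗[k] H),
        mulMap k (LinearMap.mulRight k (MulOpposite.op (Q.Sinv Q.α)))
        (mulMap k (LinearMap.mulRight k (MulOpposite.op (Q.Sinv Q.β)) ∘ₗ
        (((opLinearEquiv k).symm.trans Q.S.symm).trans (opLinearEquiv k)).toLinearMap)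
          LinearMap.id) (opp₃ k H H H (MulOpposite.op z)) =
        MulOpposite.op (Q.Sinv (Q.contrαβ z)) := by
      intro z
      induction z using tensor_induction₃ with
      | zero => simp
      | add x y hx hy => simp only [op_add, map_add, hx, hy]
      | tmul p q r =>
        rw [contrαβ_tmul, opp₃_tmul, mulMap_tmul, mulMap_tmul]
        simp only [Sinv_mul, Sinv_S]
        rfl
    refine (e (↑Q.Φ⁻¹)).trans ?_
    rw [show Q.contrαβ (↑Q.Φ⁻¹ : H ⊗[k] (H ⊗[k] H)) = 1 from Q.antipode_Φ_inv, Sinv_one]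
    rfl
  antipode_Φ_inv := by
    have e : ∀ z : H ⊗[k] (H ⊗[k] H),
        mulMap k (LinearMap.mulRight k (MulOpposite.op (Q.Sinv Q.β)) ∘ₗ
        (((opLinearEquiv k).symm.trans Q.S.symm).trans (opLinearEquiv k)).toLinearMap)
        (mulMap k (LinearMap.mulRight k (MulOpposite.op (Q.Sinv Q.α)))
        (((opLinearEquiv k).symm.trans Q.S.symm).trans (opLinearEquiv k)).toLinearMap)
        (opp₃ k H H H (MulOpposite.op z)) = MulOpposite.op (Q.Sinv (Q.contrβα z)) := by
      intro z
      induction z using tensor_induction₃ with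
      | zero => simp
      | add x y hx hy => simp only [op_add, map_add, hx, hy]
      | tmul p q r =>
        rw [contrβα_tmul, opp₃_tmul, mulMap_tmul, mulMap_tmul]
        simp only [Sinv_mul, Sinv_S]
        rfl
    refine (e (Q.Φ)).trans ?_
    rw [show Q.contrβα (Q.Φ : H ⊗[k] (H ⊗[k] H)) = 1 from Q.antipode_Φ, Sinv_one]
    rfl
  ε_α := (Q.ε_Sinv _).trans Q.ε_β
  ε_β := (Q.ε_Sinv _).trans Q.ε_α

end QuasiHopf

end Opposite

end QHA
end

/-! ### Tensor products of quasi-Hopf algebras. -/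

noncomputable section

namespace QHA

section FourStandardLegs

variable {k : Type*} [Field k] {B : Type*} [Ring B] [Algebra k B]
  {U V W P : Type*} [Ring U] [Algebra k U] [Ring V] [Algebra k V] [Ring W] [Algebra k W]
  [Ring P] [Algebra k P]

theorem lift₂_comp_oneRight_comp (i : U →ₐ[k] B) (j : V →ₐ[k] B) [LegComm i j] (f : W →ₐ[k] U) :
    (lift₂ i j).comp ((oneRight k U V).comp f) = i.comp f := by
  rw [← AlgHom.comp_assoc, lift₂_comp_oneRight]

theorem lift₂_comp_oneLeft_comp (i : U →ₐ[k] B) (j : V →ₐ[k] B) [LegComm i j] (f : W →ₐ[k] V) :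
    (lift₂ i j).comp ((oneLeft k U V).comp f) = j.comp f := by
  rw [← AlgHom.comp_assoc, lift₂_comp_oneLeft]

theorem lift₂_comp_legs (i : U ⊗[k] V →ₐ[k] B) :
    lift₂ (i.comp (oneRight k U V)) (i.comp (oneLeft k U V)) = i := by
  rw [lift₂_comp_comp, lift₂_oneRight_oneLeft, AlgHom.comp_id]

theorem lift₃_standard : lift₂ (oneRight k U (V ⊗[k] W)) (lift₂
    ((oneLeft k U (V ⊗[k] W)).comp (oneRight k V W))
    ((oneLeft k U (V ⊗[k] W)).comp (oneLeft k V W))) = AlgHom.id k _ := by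
  simp only [lift₂_comp_comp, lift₂_oneRight_oneLeft, AlgHom.comp_id]

theorem lift₂_star_standard (d : P →ₐ[k] V ⊗[k] W) : lift₂ (oneRight k U (V ⊗[k] W))
    (star d ((oneLeft k U (V ⊗[k] W)).comp (oneRight k V W))
      ((oneLeft k U (V ⊗[k] W)).comp (oneLeft k V W))) = onRest k U d := by
  simp only [star_comp_comp, ← lift₂_oneRight_comp]
  congr 2
  rw [star, lift₂_oneRight_oneLeft, AlgHom.id_comp]

theorem lift₄_standard : lift₂ (oneRight k U (V ⊗[k] (W ⊗[k] P))) (lift₂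
    ((oneLeft k U (V ⊗[k] (W ⊗[k] P))).comp (oneRight k V (W ⊗[k] P)))
    (lift₂ ((oneLeft k U (V ⊗[k] (W ⊗[k] P))).comp ((oneLeft k V (W ⊗[k] P)).comp
      (oneRight k W P)))
    ((oneLeft k U (V ⊗[k] (W ⊗[k] P))).comp ((oneLeft k V (W ⊗[k] P)).comp
      (oneLeft k W P))))) = AlgHom.id k _ := by
  simp only [lift₂_comp_comp, lift₂_oneRight_oneLeft, AlgHom.comp_id]

end FourStandardLegs

namespace QuasiBialgebra

variable {k H₁ H₂ : Type*} [Field k] [Ring H₁] [Algebra k H₁] [Ring H₂] [Algebra k H₂]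
  (Q₁ : QuasiBialgebra k H₁) (Q₂ : QuasiBialgebra k H₂) {B : Type*} [Ring B] [Algebra k B]

instance legComm_swap (i j : H₁ ⊗[k] H₂ →ₐ[k] B) [LegComm i j] :
    LegComm (j.comp (oneRight k H₁ H₂)) (i.comp (oneLeft k H₁ H₂)) where
  comm x y := (LegComm.comm (i := i) (j := j) (oneLeft k H₁ H₂ y) (oneRight k H₁ H₂ x)).symm

section Legs

variable (i j l m : H₁ ⊗[k] H₂ →ₐ[k] B) [LegComm i j] [LegComm i l] [LegComm i m]
  [LegComm j l] [LegComm j m] [LegComm l m]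

/-- The restriction of a map to the first tensor factor. -/
abbrev resFst : H₁ →ₐ[k] B := i.comp (oneRight k H₁ H₂)
/-- The restriction of a map to the second tensor factor. -/
abbrev resSnd : H₂ →ₐ[k] B := i.comp (oneLeft k H₁ H₂)

/-- The comultiplication of the tensor product of two quasi-bialgebras. -/
def tensorΔ : H₁ ⊗[k] H₂ →ₐ[k] (H₁ ⊗[k] H₂) ⊗[k] (H₁ ⊗[k] H₂) :=
  lift₂ (star Q₁.Δ (resFst (oneRight k _ _)) (resFst (oneLeft k _ _)))
    (star Q₂.Δ (resSnd (oneRight k _ _)) (resSnd (oneLeft k _ _)))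

/-- The counit of the tensor product of two quasi-bialgebras. -/
def tensorε : H₁ ⊗[k] H₂ →ₐ[k] k :=
  Algebra.TensorProduct.lift Q₁.ε Q₂.ε fun _ _ => Commute.all _ _

/-- The comultiplication of `H₁ ⊗ H₂` is computed on the restrictions of a leg to `H₁` and to `H₂`
separately. Consequently every identity for the tensor product splits into commuting identities for
the two factors. -/
theorem star_tensor_fst : resFst (star (tensorΔ Q₁ Q₂) i j) =
    star Q₁.Δ (resFst i) (resFst j) := by
  rw [resFst, star, AlgHom.comp_assoc, tensorΔ, lift₂_comp_oneRight, ← star_comp_comp]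
  simp only [lift₂_comp_oneRight_comp, lift₂_comp_oneLeft_comp]

theorem star_tensor_snd : resSnd (star (tensorΔ Q₁ Q₂) i j) =
    star Q₂.Δ (resSnd i) (resSnd j) := by
  rw [resSnd, star, AlgHom.comp_assoc, tensorΔ, lift₂_comp_oneLeft, ← star_comp_comp]
  simp only [lift₂_comp_oneRight_comp, lift₂_comp_oneLeft_comp]

theorem triv_tensor_fst : resFst (triv B (tensorε Q₁ Q₂)) = triv B Q₁.ε :=
  AlgHom.ext fun x => by simp [triv_apply, tensorε, oneRight]

theorem triv_tensor_snd : resSnd (triv B (tensorε Q₁ Q₂)) = triv B Q₂.ε :=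
  AlgHom.ext fun x => by simp [triv_apply, tensorε, oneLeft]

theorem star_tensor : star (tensorΔ Q₁ Q₂) i j =
    lift₂ (star Q₁.Δ (resFst i) (resFst j)) (star Q₂.Δ (resSnd i) (resSnd j)) := by
  rw [← lift₂_comp_legs (star (tensorΔ Q₁ Q₂) i j)]
  simp only [star_tensor_fst, star_tensor_snd]

theorem star_star_tensor : star (tensorΔ Q₁ Q₂) (star (tensorΔ Q₁ Q₂) i j) l =
    lift₂ (star Q₁.Δ (star Q₁.Δ (resFst i) (resFst j)) (resFst l))
      (star Q₂.Δ (star Q₂.Δ (resSnd i) (resSnd j)) (resSnd l)) := by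
  rw [← lift₂_comp_legs (star (tensorΔ Q₁ Q₂) (star _ i j) l)]
  simp only [star_tensor_fst, star_tensor_snd]

theorem star_tensor_star : star (tensorΔ Q₁ Q₂) i (star (tensorΔ Q₁ Q₂) j l) =
    lift₂ (star Q₁.Δ (resFst i) (star Q₁.Δ (resFst j) (resFst l)))
      (star Q₂.Δ (resSnd i) (star Q₂.Δ (resSnd j) (resSnd l))) := by
  rw [← lift₂_comp_legs (star (tensorΔ Q₁ Q₂) i (star _ j l))]
  simp only [star_tensor_fst, star_tensor_snd]

/-- The product of `u` on the first factors and `v` on the second factors. -/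
def tensorUnit (u : (H₁ ⊗[k] (H₁ ⊗[k] H₁))ˣ) (v : (H₂ ⊗[k] (H₂ ⊗[k] H₂))ˣ) :
    ((H₁ ⊗[k] H₂) ⊗[k] ((H₁ ⊗[k] H₂) ⊗[k] (H₁ ⊗[k] H₂)))ˣ :=
  place₃ u (resFst (oneRight k _ _)) (resFst ((oneLeft k _ _).comp (oneRight k _ _)))
      (resFst ((oneLeft k _ _).comp (oneLeft k _ _))) *
    place₃ v (resSnd (oneRight k _ _)) (resSnd ((oneLeft k _ _).comp (oneRight k _ _)))
      (resSnd ((oneLeft k _ _).comp (oneLeft k _ _)))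

theorem place_tensorUnit (u : (H₁ ⊗[k] (H₁ ⊗[k] H₁))ˣ) (v : (H₂ ⊗[k] (H₂ ⊗[k] H₂))ˣ) :
    place₃ (tensorUnit u v) i j l =
      place₃ u (resFst i) (resFst j) (resFst l) * place₃ v (resSnd i) (resSnd j) (resSnd l) := by
  refine Units.ext ?_
  rw [coe_place₃, tensorUnit, Units.val_mul, map_mul, Units.val_mul, coe_place₃, coe_place₃,
    lift₂_comp, lift₂_comp]
  simp only [coe_place₃, resFst, resSnd, ← lift₂_comp_comp, AlgHom.comp_assoc,
    lift₂_comp_oneRight_comp, lift₂_comp_oneLeft_comp]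

theorem commute_place_fst_snd {U V W U' V' W' : Type*} [Ring U] [Algebra k U] [Ring V]
    [Algebra k V] [Ring W] [Algebra k W] [Ring U'] [Algebra k U'] [Ring V'] [Algebra k V']
    [Ring W'] [Algebra k W'] (u : (U ⊗[k] (V ⊗[k] W))ˣ) (v : (U' ⊗[k] (V' ⊗[k] W'))ˣ)
    (a₁ : U →ₐ[k] B) (a₂ : V →ₐ[k] B) (a₃ : W →ₐ[k] B) (b₁ : U' →ₐ[k] B) (b₂ : V' →ₐ[k] B)
    (b₃ : W' →ₐ[k] B) [LegComm a₁ a₂] [LegComm a₁ a₃] [LegComm a₂ a₃] [LegComm b₁ b₂]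
    [LegComm b₁ b₃] [LegComm b₂ b₃] [LegComm a₁ b₁] [LegComm a₁ b₂] [LegComm a₁ b₃]
    [LegComm a₂ b₁] [LegComm a₂ b₂] [LegComm a₂ b₃] [LegComm a₃ b₁] [LegComm a₃ b₂]
    [LegComm a₃ b₃] : Commute (place₃ u a₁ a₂ a₃) (place₃ v b₁ b₂ b₃) :=
  place₃_intertwine (place₃ u a₁ a₂ a₃) v b₁ b₁ b₂ b₂ b₃ b₃

theorem tensorUnit_inv (u : (H₁ ⊗[k] (H₁ ⊗[k] H₁))ˣ) (v : (H₂ ⊗[k] (H₂ ⊗[k] H₂))ˣ) :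
    (↑(tensorUnit u v)⁻¹ : (H₁ ⊗[k] H₂) ⊗[k] ((H₁ ⊗[k] H₂) ⊗[k] (H₁ ⊗[k] H₂))) =
      lift₂ (resFst (oneRight k _ _)) (lift₂ (resFst ((oneLeft k _ _).comp (oneRight k _ _)))
        (resFst ((oneLeft k _ _).comp (oneLeft k _ _)))) (↑u⁻¹ : H₁ ⊗[k] (H₁ ⊗[k] H₁)) *
        lift₂ (resSnd (oneRight k _ _)) (lift₂ (resSnd ((oneLeft k _ _).comp (oneRight k _ _)))
        (resSnd ((oneLeft k _ _).comp (oneLeft k _ _)))) (↑v⁻¹ : H₂ ⊗[k] (H₂ ⊗[k] H₂)) := by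
  rw [tensorUnit, (commute_place_fst_snd u v _ _ _ _ _ _).eq, mul_inv_rev, Units.val_mul]
  rfl

end Legs

theorem intertwines_tensorΦ (i j l : H₁ ⊗[k] H₂ →ₐ[k] B) [LegComm i j] [LegComm i l]
    [LegComm j l] : Intertwines (place₃ (tensorUnit Q₁.Φ Q₂.Φ) i j l)
      (star (tensorΔ Q₁ Q₂) (star (tensorΔ Q₁ Q₂) i j) l)
      (star (tensorΔ Q₁ Q₂) i (star (tensorΔ Q₁ Q₂) j l)) where
  semiconj x := by
    rw [place_tensorUnit, star_star_tensor, star_tensor_star]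
    refine lift₂_semiconj (fun y => ?_) (fun y => ?_) x
    · rw [Units.val_mul]
      exact (Intertwines.semiconj (b := place₃ Q₁.Φ (resFst i) (resFst j) (resFst l))
        (i := star Q₁.Δ (star Q₁.Δ (resFst i) (resFst j)) (resFst l)) y).mul_left
        (Intertwines.semiconj (b := place₃ Q₂.Φ (resSnd i) (resSnd j) (resSnd l)) y)
    · rw [Units.val_mul]
      exact (Intertwines.semiconj (b := place₃ Q₁.Φ (resFst i) (resFst j) (resFst l))
        (i := star Q₂.Δ (resSnd i) (star Q₂.Δ (resSnd j) (resSnd l))) y).mul_left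
        (Intertwines.semiconj (b := place₃ Q₂.Φ (resSnd i) (resSnd j) (resSnd l)) y)

/-- The product of the two pentagons: reassociators placed in `H₁`-restrictions commute with those
in `H₂`-restrictions, so the factors may be sorted. -/
theorem tensor_pentagon (i j l m : H₁ ⊗[k] H₂ →ₐ[k] B) [LegComm i j] [LegComm i l] [LegComm i m]
    [LegComm j l] [LegComm j m] [LegComm l m] :
    place₃ (tensorUnit Q₁.Φ Q₂.Φ) j l m *
        place₃ (tensorUnit Q₁.Φ Q₂.Φ) i (star (tensorΔ Q₁ Q₂) j l) m *
        place₃ (tensorUnit Q₁.Φ Q₂.Φ) i j l =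
      place₃ (tensorUnit Q₁.Φ Q₂.Φ) i j (star (tensorΔ Q₁ Q₂) l m) *
        place₃ (tensorUnit Q₁.Φ Q₂.Φ) (star (tensorΔ Q₁ Q₂) i j) l m := by
  simp only [place_tensorUnit, star_tensor_fst, star_tensor_snd]
  have e₁ := Q₁.pentagon (resFst i) (resFst j) (resFst l) (resFst m)
  have e₂ := Q₂.pentagon (resSnd i) (resSnd j) (resSnd l) (resSnd m)
  rw [(commute_place_fst_snd Q₁.Φ Q₂.Φ (star Q₁.Δ (resFst i) (resFst j)) (resFst l) (resFst m)
    (resSnd i) (resSnd j) (star Q₂.Δ (resSnd l) (resSnd m))).symm.mul_mul_mul_comm, ← e₁, ← e₂,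
    (commute_place_fst_snd Q₁.Φ Q₂.Φ (resFst i) (star Q₁.Δ (resFst j) (resFst l)) (resFst m)
    (resSnd j) (resSnd l) (resSnd m)).symm.mul_mul_mul_comm]
  refine Commute.mul_mul_mul_comm (Commute.symm (Commute.mul_right ?_ ?_)) _ _
  · exact commute_place_fst_snd ..
  · exact commute_place_fst_snd ..

/-- The tensor product of two quasi-bialgebras. -/
def tensor : QuasiBialgebra k (H₁ ⊗[k] H₂) where
  Δ := tensorΔ Q₁ Q₂
  ε := tensorε Q₁ Q₂
  Φ := tensorUnit Q₁.Φ Q₂.Φ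
  quasi_coassoc h := by
    rw [Units.eq_mul_inv_iff_mul_eq]
    have e := Intertwines.eq (intertwines_tensorΦ Q₁ Q₂ (oneRight k (H₁ ⊗[k] H₂)
      ((H₁ ⊗[k] H₂) ⊗[k] (H₁ ⊗[k] H₂))) ((oneLeft k _ _).comp (oneRight k _ _))
      ((oneLeft k _ _).comp (oneLeft k _ _))) h
    simp only [coe_place₃, star_apply _ (star _ _ _), star_apply _ (oneRight k _ _),
      ← lift₂_onFirst] at e
    rw [lift₃_standard, lift₂_star_standard] at e
    exact e.symm
  counit_right h := by
    rw [← AlgHom.id_apply (R := k) (dropLast k _ _ _), ← lift₂_dropLast, ← star_apply, star_tensor]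
    simp only [triv_tensor_fst, triv_tensor_snd, star_triv_right]
    rw [lift₂_comp_legs]; rfl
  counit_left h := by
    rw [← AlgHom.id_apply (R := k) (dropFirst k _ _ _), ← lift₂_dropFirst, ← star_apply,
      star_tensor]
    simp only [triv_tensor_fst, triv_tensor_snd, star_triv_left]
    rw [lift₂_comp_legs]; rfl
  cocycle := by
    have e := congrArg Units.val (tensor_pentagon Q₁ Q₂ (oneRight k (H₁ ⊗[k] H₂)
      ((H₁ ⊗[k] H₂) ⊗[k] ((H₁ ⊗[k] H₂) ⊗[k] (H₁ ⊗[k] H₂)))) ((oneLeft k _ _).comp (oneRight k _ _))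
      ((oneLeft k _ _).comp ((oneLeft k _ _).comp (oneRight k _ _)))
      ((oneLeft k _ _).comp ((oneLeft k _ _).comp (oneLeft k _ _))))
    have h : ∀ z, lift₂ _ _ z = z := DFunLike.congr_fun (lift₄_standard (k := k)
      (U := H₁ ⊗[k] H₂) (V := H₁ ⊗[k] H₂) (W := H₁ ⊗[k] H₂) (P := H₁ ⊗[k] H₂))
    refine (h _).symm.trans (Eq.trans ?_ (h _))
    simp only [map_mul, lift₂_oneLeft, lift₂_onRest, lift₂_onFirst, lift₂_comp_onFirst,
      lift₂_comp_onRest, lift₂_comp_oneRight]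
    exact e
  counit_Φ := by
    have h : place₃ (tensorUnit Q₁.Φ Q₂.Φ) (oneRight k (H₁ ⊗[k] H₂) (H₁ ⊗[k] H₂))
        (triv _ (tensorε Q₁ Q₂)) (oneLeft k _ _) = 1 := by
      rw [place_tensorUnit]
      simp only [triv_tensor_fst, triv_tensor_snd, place_triv_mid, mul_one]
    have h' := congrArg Units.val h
    rw [coe_place₃] at h'
    simp only [← lift₂_comp_dropFirst] at h'
    rw [lift₂_oneRight_comp] at h'
    exact h'

end QuasiBialgebra

namespace QuasiHopf

variable {k H₁ H₂ : Type*} [Field k] [Ring H₁] [Algebra k H₁] [Ring H₂] [Algebra k H₂]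
  (Q₁ : QuasiHopf k H₁) (Q₂ : QuasiHopf k H₂)

open QuasiBialgebra

variable (k H₁ H₂) in
/-- `(x ⊗ y) ↦ (x ⊗ 1) ⊗ (y ⊗ 1)`. -/
abbrev fst₂ : H₁ ⊗[k] H₁ →ₐ[k] (H₁ ⊗[k] H₂) ⊗[k] (H₁ ⊗[k] H₂) :=
  lift₂ (resFst (oneRight k _ _)) (resFst (oneLeft k _ _))

variable (k H₁ H₂) in
/-- `(x ⊗ y) ↦ (1 ⊗ x) ⊗ (1 ⊗ y)`. -/
abbrev snd₂ : H₂ ⊗[k] H₂ →ₐ[k] (H₁ ⊗[k] H₂) ⊗[k] (H₁ ⊗[k] H₂) :=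
  lift₂ (resSnd (oneRight k _ _)) (resSnd (oneLeft k _ _))

theorem tensorΔ_tmul (x : H₁) (y : H₂) : (tensor Q₁.toQuasiBialgebra Q₂.toQuasiBialgebra).Δ (x ⊗ₜ y) =
    fst₂ k H₁ H₂ (Q₁.Δ x) * snd₂ k H₁ H₂ (Q₂.Δ y) :=
  lift₂_tmul _ _ x y

section Antipode

/-- The antipode of the tensor product. -/
def tensorS : H₁ ⊗[k] H₂ ≃ₗ[k] H₁ ⊗[k] H₂ := TensorProduct.congr Q₁.S Q₂.S

@[simp]
theorem tensorS_tmul (x : H₁) (y : H₂) : tensorS Q₁ Q₂ (x ⊗ₜ y) = Q₁.S x ⊗ₜ Q₂.S y := by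
  simp [tensorS]

theorem tensor_contrα (z : H₁ ⊗[k] H₁) (w : H₂ ⊗[k] H₂) :
    mulMap k (LinearMap.mulRight k (Q₁.α ⊗ₜ Q₂.α) ∘ₗ (tensorS Q₁ Q₂).toLinearMap) LinearMap.id
      (fst₂ k H₁ H₂ z * snd₂ k H₁ H₂ w) = Q₁.contrα z ⊗ₜ Q₂.contrα w := by
  induction z using TensorProduct.induction_on with
  | zero => simp
  | add x y hx hy => simp only [map_add, add_mul, TensorProduct.add_tmul, hx, hy]
  | tmul p q =>
    induction w using TensorProduct.induction_on with
    | zero => simp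
    | add x y hx hy => simp only [map_add, mul_add, TensorProduct.tmul_add, hx, hy]
    | tmul r s => simp [oneRight, oneLeft]

theorem tensor_contrβ (z : H₁ ⊗[k] H₁) (w : H₂ ⊗[k] H₂) :
    mulMap k (LinearMap.mulRight k (Q₁.β ⊗ₜ Q₂.β)) (tensorS Q₁ Q₂).toLinearMap
      (fst₂ k H₁ H₂ z * snd₂ k H₁ H₂ w) = Q₁.contrβ z ⊗ₜ Q₂.contrβ w := by
  induction z using TensorProduct.induction_on with
  | zero => simp
  | add x y hx hy => simp only [map_add, add_mul, TensorProduct.add_tmul, hx, hy]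
  | tmul p q =>
    induction w using TensorProduct.induction_on with
    | zero => simp
    | add x y hx hy => simp only [map_add, mul_add, TensorProduct.tmul_add, hx, hy]
    | tmul r s => simp [oneRight, oneLeft]

theorem tensor_contrβα (z : H₁ ⊗[k] (H₁ ⊗[k] H₁)) (w : H₂ ⊗[k] (H₂ ⊗[k] H₂)) :
    mulMap k (LinearMap.mulRight k (Q₁.β ⊗ₜ Q₂.β))
      (mulMap k (LinearMap.mulRight k (Q₁.α ⊗ₜ Q₂.α) ∘ₗ (tensorS Q₁ Q₂).toLinearMap)
        LinearMap.id)
      (lift₂ (resFst (oneRight k _ _)) (lift₂ (resFst ((oneLeft k _ _).comp (oneRight k _ _)))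
        (resFst ((oneLeft k _ _).comp (oneLeft k _ _)))) z *
        lift₂ (resSnd (oneRight k _ _)) (lift₂ (resSnd ((oneLeft k _ _).comp (oneRight k _ _)))
        (resSnd ((oneLeft k _ _).comp (oneLeft k _ _)))) w) = Q₁.contrβα z ⊗ₜ Q₂.contrβα w := by
  induction z using tensor_induction₃ with
  | zero => simp
  | add x y hx hy => simp only [map_add, add_mul, TensorProduct.add_tmul, hx, hy]
  | tmul p q r =>
    induction w using tensor_induction₃ with
    | zero => simp
    | add x y hx hy => simp only [map_add, mul_add, TensorProduct.tmul_add, hx, hy]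
    | tmul p' q' r' => simp [oneRight, oneLeft, Algebra.TensorProduct.one_def]

theorem tensor_contrαβ (z : H₁ ⊗[k] (H₁ ⊗[k] H₁)) (w : H₂ ⊗[k] (H₂ ⊗[k] H₂)) :
    mulMap k (LinearMap.mulRight k (Q₁.α ⊗ₜ Q₂.α) ∘ₗ (tensorS Q₁ Q₂).toLinearMap)
      (mulMap k (LinearMap.mulRight k (Q₁.β ⊗ₜ Q₂.β)) (tensorS Q₁ Q₂).toLinearMap)
      (lift₂ (resFst (oneRight k _ _)) (lift₂ (resFst ((oneLeft k _ _).comp (oneRight k _ _)))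
        (resFst ((oneLeft k _ _).comp (oneLeft k _ _)))) z *
        lift₂ (resSnd (oneRight k _ _)) (lift₂ (resSnd ((oneLeft k _ _).comp (oneRight k _ _)))
        (resSnd ((oneLeft k _ _).comp (oneLeft k _ _)))) w) = Q₁.contrαβ z ⊗ₜ Q₂.contrαβ w := by
  induction z using tensor_induction₃ with
  | zero => simp
  | add x y hx hy => simp only [map_add, add_mul, TensorProduct.add_tmul, hx, hy]
  | tmul p q r =>
    induction w using tensor_induction₃ with
    | zero => simp
    | add x y hx hy => simp only [map_add, mul_add, TensorProduct.tmul_add, hx, hy]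
    | tmul p' q' r' => simp [oneRight, oneLeft, Algebra.TensorProduct.one_def]

end Antipode

/-- The tensor product of two quasi-Hopf algebras. -/
def tensor : QuasiHopf k (H₁ ⊗[k] H₂) where
  toQuasiBialgebra := QuasiBialgebra.tensor Q₁.toQuasiBialgebra Q₂.toQuasiBialgebra
  S := tensorS Q₁ Q₂
  S_one := by simp [Algebra.TensorProduct.one_def, Q₁.S_one, Q₂.S_one]
  S_mul x y := by
    induction x using TensorProduct.induction_on with
    | zero => simp
    | add x y hx hy => simp only [map_add, mul_add, add_mul, hx, hy]
    | tmul p q =>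
      induction y using TensorProduct.induction_on with
      | zero => simp
      | add x y hx hy => simp only [map_add, mul_add, add_mul, hx, hy]
      | tmul r s => simp [Q₁.S_mul, Q₂.S_mul]
  α := Q₁.α ⊗ₜ Q₂.α
  β := Q₁.β ⊗ₜ Q₂.β
  antipode_α h := by
    induction h using TensorProduct.induction_on with
    | zero => simp
    | add x y hx hy => simp only [map_add, add_smul, hx, hy]
    | tmul x y =>
      rw [tensorΔ_tmul, tensor_contrα, show Q₁.contrα (Q₁.Δ x) = _ from Q₁.antipode_α x,
        show Q₂.contrα (Q₂.Δ y) = _ from Q₂.antipode_α y]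
      simp [QuasiBialgebra.tensor, tensorε, TensorProduct.smul_tmul', smul_smul, mul_comm]
  antipode_β h := by
    induction h using TensorProduct.induction_on with
    | zero => simp
    | add x y hx hy => simp only [map_add, add_smul, hx, hy]
    | tmul x y =>
      rw [tensorΔ_tmul, tensor_contrβ, show Q₁.contrβ (Q₁.Δ x) = _ from Q₁.antipode_β x,
        show Q₂.contrβ (Q₂.Δ y) = _ from Q₂.antipode_β y]
      simp [QuasiBialgebra.tensor, tensorε, TensorProduct.smul_tmul', smul_smul, mul_comm]
  antipode_Φ := by
    have h := tensor_contrβα Q₁ Q₂ (Q₁.Φ : H₁ ⊗[k] (H₁ ⊗[k] H₁)) (Q₂.Φ : H₂ ⊗[k] (H₂ ⊗[k] H₂))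
    rw [show Q₁.contrβα (Q₁.Φ : H₁ ⊗[k] (H₁ ⊗[k] H₁)) = 1 from Q₁.antipode_Φ,
      show Q₂.contrβα (Q₂.Φ : H₂ ⊗[k] (H₂ ⊗[k] H₂)) = 1 from Q₂.antipode_Φ] at h
    exact h
  antipode_Φ_inv := by
    have h := tensor_contrαβ Q₁ Q₂ (↑Q₁.Φ⁻¹ : H₁ ⊗[k] (H₁ ⊗[k] H₁))
      (↑Q₂.Φ⁻¹ : H₂ ⊗[k] (H₂ ⊗[k] H₂))
    rw [show Q₁.contrαβ (↑Q₁.Φ⁻¹ : H₁ ⊗[k] (H₁ ⊗[k] H₁)) = 1 from Q₁.antipode_Φ_inv,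
      show Q₂.contrαβ (↑Q₂.Φ⁻¹ : H₂ ⊗[k] (H₂ ⊗[k] H₂)) = 1 from Q₂.antipode_Φ_inv] at h
    refine Eq.trans ?_ h
    rw [← tensorUnit_inv Q₁.Φ Q₂.Φ]
    rfl
  ε_α := by simp [QuasiBialgebra.tensor, tensorε, Q₁.ε_α, Q₂.ε_α]
  ε_β := by simp [QuasiBialgebra.tensor, tensorε, Q₁.ε_β, Q₂.ε_β]

end QuasiHopf

end QHA
end

/-! ### The Drinfeld twist of opposite algebras and of tensor products. -/

noncomputable section

namespace QHA

namespace QuasiHopf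

open QuasiBialgebra

section OpTwist

open MulOpposite

variable {k H : Type*} [Field k] [Ring H] [Algebra k H] (Q : QuasiHopf k H)

/-- `x ⊗ y ↦ S⁻¹(y) ⊗ S⁻¹(x)`. -/
def S₂inv : H ⊗[k] H →ₗ[k] H ⊗[k] H :=
  TensorProduct.map Q.Sinv Q.Sinv ∘ₗ (TensorProduct.comm k H H).toLinearMap

@[simp]
theorem S₂inv_tmul (x y : H) : Q.S₂inv (x ⊗ₜ y) = Q.Sinv y ⊗ₜ Q.Sinv x := by simp [S₂inv]

theorem S₂_S₂inv (z : H ⊗[k] H) : Q.S₂ (Q.S₂inv z) = z := by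
  induction z using TensorProduct.induction_on with
  | zero => simp
  | add x y hx hy => simp only [map_add, hx, hy]
  | tmul p q => simp [S_Sinv]

theorem S₂inv_S₂ (z : H ⊗[k] H) : Q.S₂inv (Q.S₂ z) = z := by
  induction z using TensorProduct.induction_on with
  | zero => simp
  | add x y hx hy => simp only [map_add, hx, hy]
  | tmul p q => simp [Sinv_S]

theorem S₂_injective : Function.Injective Q.S₂ := Function.LeftInverse.injective Q.S₂inv_S₂

/-- The relation `f Δ(S(x)) = S₂(Δ(x)) f` at `x = S⁻¹(h)`. -/
theorem S₂_Δ_Sinv (h : H) : Q.S₂ (Q.Δ (Q.Sinv h)) = Q.twist * Q.Δ h * ↑Q.twistUnit⁻¹ := by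
  rw [Units.eq_mul_inv_iff_mul_eq]
  exact (Q.twist_mul_Δ_S (Q.Sinv h)).symm.trans (by rw [S_Sinv])

theorem op_S (x : H) : Q.op.S (MulOpposite.op x) = MulOpposite.op (Q.Sinv x) := rfl

theorem op_Δ (x : H) : Q.op.Δ (MulOpposite.op x) = opp₂ k H H (MulOpposite.op (Q.Δ x)) := rfl

theorem op_S₂ (z : H ⊗[k] H) : Q.op.S₂ (opp₂ k H H (MulOpposite.op z)) =
    opp₂ k H H (MulOpposite.op (Q.S₂inv z)) := by
  induction z using TensorProduct.induction_on with
  | zero => simp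
  | add x y hx hy => simp only [op_add, map_add, hx, hy]
  | tmul p q => simp [op_S]

theorem op_contrα₂ (z : H ⊗[k] (H ⊗[k] (H ⊗[k] H))) :
    Q.op.contrα₂ (opp₄ k H H H H (MulOpposite.op z)) =
      opp₂ k H H (MulOpposite.op (Q.S₂inv (Q.contrβ₂ z))) := by
  induction z using tensor_induction₄ with
  | zero => simp
  | add x y hx hy => simp only [op_add, map_add, hx, hy]
  | tmul u v w q =>
    rw [show opp₄ k H H H H (MulOpposite.op (u ⊗ₜ (v ⊗ₜ (w ⊗ₜ q)))) =
      MulOpposite.op u ⊗ₜ (MulOpposite.op v ⊗ₜ (MulOpposite.op w ⊗ₜ MulOpposite.op q)) by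
      simp [opp₄, onRest]]
    simp only [contrα₂_tmul, contrβ₂_tmul, S₂inv_tmul, opp₂_tmul, Sinv_mul, Sinv_S, op_S,
      MulOpposite.op_mul]
    rfl

theorem op_nestUnit : (Q.op.nestUnit : Hᵐᵒᵖ ⊗[k] (Hᵐᵒᵖ ⊗[k] (Hᵐᵒᵖ ⊗[k] Hᵐᵒᵖ))) =
    opp₄ k H H H H (MulOpposite.op ↑Q.nestUnit⁻¹) := by
  have e₁ := onRest_onRest_oneRight_opp₃ (k := k) (P := H) (↑Q.Φ⁻¹ : H ⊗[k] (H ⊗[k] H))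
  have e₂ := Q.onFirst_opΔ_opp₃ (Q.Φ : H ⊗[k] (H ⊗[k] H))
  have e := congrArg₂ (· * ·) e₁ e₂
  simp only [← map_mul, ← MulOpposite.op_mul] at e
  refine Eq.trans ?_ (e.trans ?_)
  · rw [QuasiBialgebra.nestUnit, Units.val_mul]
    rfl
  · rw [QuasiBialgebra.nestUnit, mul_inv_rev, inv_inv, Units.val_mul]
    rfl

theorem op_γ : Q.op.γ = opp₂ k H H (MulOpposite.op (Q.S₂inv Q.δ)) := by
  rw [γ_eq, op_nestUnit, op_contrα₂]; rfl

/-- The Drinfeld twist of the opposite quasi-Hopf algebra. -/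
theorem op_twist : Q.op.twist = opp₂ k H H (MulOpposite.op (Q.S₂inv ↑Q.twistUnit⁻¹)) := by
  -- The opposite triple is `(S⁻¹, S⁻¹(β), S⁻¹(α))`. The candidate therefore has to satisfy a
  -- relation involving `Δ(β)`, and this is `Δ(β) f⁻¹ = δ`.
  refine Q.op.coproductTriple.compare_unique (σ' := Q.op.S₂Δ) (a' := Q.op.γ)
    (fun h => Q.op.twist_mul_Δ_S h) Q.op.twist_mul_Δ_α (fun h => ?_) ?_
  · obtain ⟨x, rfl⟩ := op_surjective h
    change _ * Q.op.Δ (Q.op.S _) = Q.op.S₂ (Q.op.Δ _) * _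
    rw [op_S, op_Δ, op_Δ, op_S₂, ← map_mul, ← map_mul, ← MulOpposite.op_mul,
      ← MulOpposite.op_mul]
    congr 2
    apply Q.S₂_injective
    rw [S₂_mul, S₂_mul, S₂_S₂inv, S₂_S₂inv, S₂_Δ_Sinv, ← mul_assoc, ← mul_assoc]
    congr 1
    exact congrArg (· * _) Q.twistUnit.inv_mul |>.trans (one_mul _)
  · change _ * Q.op.Δ (MulOpposite.op (Q.Sinv Q.β)) = _
    rw [op_Δ, op_γ, ← map_mul, ← MulOpposite.op_mul]
    congr 2
    apply Q.S₂_injective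
    rw [S₂_mul, S₂_S₂inv, S₂_S₂inv, S₂_Δ_Sinv, ← Δ_β_mul_twist_inv, ← mul_assoc, ← mul_assoc]
    congr 1
    exact congrArg (· * _) Q.twistUnit.inv_mul |>.trans (one_mul _)

end OpTwist

section TensorTwist

variable {k H₁ H₂ : Type*} [Field k] [Ring H₁] [Algebra k H₁] [Ring H₂] [Algebra k H₂]
  (Q₁ : QuasiHopf k H₁) (Q₂ : QuasiHopf k H₂)

theorem tensor_Δ_tmul (x : H₁) (y : H₂) : (tensor Q₁ Q₂).Δ (x ⊗ₜ y) =
    fst₂ k H₁ H₂ (Q₁.Δ x) * snd₂ k H₁ H₂ (Q₂.Δ y) :=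
  tensorΔ_tmul Q₁ Q₂ x y

theorem tensor_S_tmul (x : H₁) (y : H₂) : (tensor Q₁ Q₂).S (x ⊗ₜ y) = Q₁.S x ⊗ₜ Q₂.S y :=
  tensorS_tmul Q₁ Q₂ x y

theorem tensor_α : (tensor Q₁ Q₂).α = Q₁.α ⊗ₜ Q₂.α := rfl

theorem fst₂_snd₂_mul (x x' : H₁ ⊗[k] H₁) (y y' : H₂ ⊗[k] H₂) :
    fst₂ k H₁ H₂ x * snd₂ k H₁ H₂ y * (fst₂ k H₁ H₂ x' * snd₂ k H₁ H₂ y') =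
      fst₂ k H₁ H₂ (x * x') * snd₂ k H₁ H₂ (y * y') := by
  rw [map_mul, map_mul]
  exact (LegComm.comm (i := fst₂ k H₁ H₂) (j := snd₂ k H₁ H₂) x' y).symm.mul_mul_mul_comm _ _

theorem tensor_S₂ (x : H₁ ⊗[k] H₁) (y : H₂ ⊗[k] H₂) :
    (tensor Q₁ Q₂).S₂ (fst₂ k H₁ H₂ x * snd₂ k H₁ H₂ y) =
      fst₂ k H₁ H₂ (Q₁.S₂ x) * snd₂ k H₁ H₂ (Q₂.S₂ y) := by
  induction x using TensorProduct.induction_on with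
  | zero => simp
  | add x y hx hy => simp only [map_add, add_mul, hx, hy]
  | tmul p q =>
    induction y using TensorProduct.induction_on with
    | zero => simp
    | add x y hx hy => simp only [map_add, mul_add, hx, hy]
    | tmul r s => simp [oneRight, oneLeft, tensor_S_tmul]

theorem tensor_contrα₂ (z : H₁ ⊗[k] (H₁ ⊗[k] (H₁ ⊗[k] H₁))) (w : H₂ ⊗[k] (H₂ ⊗[k] (H₂ ⊗[k] H₂))) :
    (tensor Q₁ Q₂).contrα₂
      (lift₂ (resFst (oneRight k _ _)) (lift₂ (resFst ((oneLeft k _ _).comp (oneRight k _ _)))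
        (lift₂ (resFst ((oneLeft k _ _).comp ((oneLeft k _ _).comp (oneRight k _ _))))
        (resFst ((oneLeft k _ _).comp ((oneLeft k _ _).comp (oneLeft k _ _)))))) z *
      lift₂ (resSnd (oneRight k _ _)) (lift₂ (resSnd ((oneLeft k _ _).comp (oneRight k _ _)))
        (lift₂ (resSnd ((oneLeft k _ _).comp ((oneLeft k _ _).comp (oneRight k _ _))))
        (resSnd ((oneLeft k _ _).comp ((oneLeft k _ _).comp (oneLeft k _ _)))))) w) =
      fst₂ k H₁ H₂ (Q₁.contrα₂ z) * snd₂ k H₁ H₂ (Q₂.contrα₂ w) := by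
  induction z using tensor_induction₄ with
  | zero => simp
  | add x y hx hy => simp only [map_add, add_mul, hx, hy]
  | tmul p q r s =>
    induction w using tensor_induction₄ with
    | zero => simp
    | add x y hx hy => simp only [map_add, mul_add, hx, hy]
    | tmul p' q' r' s' =>
      simp [oneRight, oneLeft, Algebra.TensorProduct.one_def, tensor_S_tmul, tensor_α]

theorem tensor_nest {B : Type*} [Ring B] [Algebra k B] (i j l m : H₁ ⊗[k] H₂ →ₐ[k] B)
    [LegComm i j] [LegComm i l] [LegComm i m] [LegComm j l] [LegComm j m] [LegComm l m] :
    (tensor Q₁ Q₂).nest i j l m =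
      Q₁.nest (resFst i) (resFst j) (resFst l) (resFst m) *
        Q₂.nest (resSnd i) (resSnd j) (resSnd l) (resSnd m) := by
  change place₃ (tensorUnit Q₁.Φ Q₂.Φ) i j l *
    (place₃ (tensorUnit Q₁.Φ Q₂.Φ) (star (tensorΔ Q₁.toQuasiBialgebra Q₂.toQuasiBialgebra) i j)
      l m)⁻¹ = _
  simp only [place_tensorUnit, star_tensor_fst, star_tensor_snd, QuasiBialgebra.nest]
  rw [(commute_place_fst_snd Q₁.Φ Q₂.Φ (star Q₁.Δ (resFst i) (resFst j)) (resFst l) (resFst m)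
    (star Q₂.Δ (resSnd i) (resSnd j)) (resSnd l) (resSnd m)).eq, mul_inv_rev]
  refine Commute.mul_mul_mul_comm (Commute.symm (Commute.inv_left ?_)) _ _
  exact commute_place_fst_snd ..

theorem tensor_γ : (tensor Q₁ Q₂).γ = fst₂ k H₁ H₂ Q₁.γ * snd₂ k H₁ H₂ Q₂.γ := by
  rw [γ_eq, γ_eq, γ_eq, ← tensor_contrα₂]
  congr 1
  rw [← QuasiBialgebra.coe_nest, ← QuasiBialgebra.coe_nest, ← Units.val_mul, ← tensor_nest,
    QuasiBialgebra.coe_nest, lift₄_standard]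
  rfl

/-- The Drinfeld twist of a tensor product of quasi-Hopf algebras. -/
theorem tensor_twist : (tensor Q₁ Q₂).twist =
    fst₂ k H₁ H₂ Q₁.twist * snd₂ k H₁ H₂ Q₂.twist := by
  -- Both defining relations split over the two factors, because the antipode, `α` and `γ` of the
  -- tensor product do.
  refine (tensor Q₁ Q₂).coproductTriple.compare_unique (σ' := (tensor Q₁ Q₂).S₂Δ)
    (a' := (tensor Q₁ Q₂).γ) (fun h => (tensor Q₁ Q₂).twist_mul_Δ_S h)
    (tensor Q₁ Q₂).twist_mul_Δ_α (fun h => ?_) ?_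
  · change _ * (tensor Q₁ Q₂).Δ ((tensor Q₁ Q₂).S h) =
      (tensor Q₁ Q₂).S₂ ((tensor Q₁ Q₂).Δ h) * _
    induction h using TensorProduct.induction_on with
    | zero => simp only [map_zero, mul_zero, zero_mul]
    | add x y hx hy => simp only [map_add, mul_add, add_mul, hx, hy]
    | tmul x y =>
      rw [tensor_S_tmul, tensor_Δ_tmul, tensor_Δ_tmul, tensor_S₂, fst₂_snd₂_mul, fst₂_snd₂_mul,
        twist_mul_Δ_S, twist_mul_Δ_S]
  · change _ * (tensor Q₁ Q₂).Δ (tensor Q₁ Q₂).α = _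
    rw [tensor_α, tensor_Δ_tmul, fst₂_snd₂_mul, twist_mul_Δ_α, twist_mul_Δ_α, tensor_γ]

end TensorTwist

end QuasiHopf

end QHA
end

/-! ### Gauge twisting of comodule algebras. -/

noncomputable section

namespace QHA

/-- The relation `r₁` is the original pentagon and the others are naturality squares for `V`. All
remaining occurrences of `V` cancel in pairs. -/
theorem twisted_cocycle_word {G : Type*} [Group G]
    {a v v₁ v₂ v₃ v₄ v₅ v₆ v₇ p₁ p₂ p₃ p₄ p₄' v₇' v₆' v₄' : G} (r₁ : a * p₁ * p₂ = p₃ * p₄)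
    (r₂ : a * v = v₁ * a) (r₃ : p₂ * v₆ = v₂ * p₂) (r₄ : v₅ * v₄ = v₄' * v₅)
    (r₅ : v₅ * p₄ = p₄' * v₅) (r₆ : v₅ * v₆ = v₆' * v₅) (r₇ : v₅ * v₇ = v₇' * v₅) :
    a * (v * p₁ * v₂⁻¹ * v₃⁻¹) * (v₃ * p₂ * v₇⁻¹ * v₅⁻¹) =
      v₁ * p₃ * v₄⁻¹ * v₅⁻¹ * (v₄' * p₄' * v₆'⁻¹ * v₇'⁻¹) := by
  obtain rfl := eq_mul_inv_of_mul_eq r₁.symm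
  obtain rfl := eq_mul_inv_of_mul_eq r₂.symm
  obtain rfl := eq_mul_inv_of_mul_eq r₃.symm
  obtain rfl := eq_mul_inv_of_mul_eq r₄.symm
  obtain rfl := eq_mul_inv_of_mul_eq r₅.symm
  obtain rfl := eq_mul_inv_of_mul_eq r₆.symm
  obtain rfl := eq_mul_inv_of_mul_eq r₇.symm
  group

namespace RightComoduleAlgebra

variable {k K : Type*} [Field k] [Ring K] [Algebra k K] {Q : QuasiBialgebra k K}
  {A : Type*} [Ring A] [Algebra k A]

/-- A right comodule algebra from coherence identities for the standard maps. -/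
def ofLegs (ρ : A →ₐ[k] A ⊗[k] K) (Φρ : (A ⊗[k] (K ⊗[k] K))ˣ)
    (intertwines : Intertwines (place₃ Φρ (oneRight k A (K ⊗[k] K))
        ((oneLeft k A (K ⊗[k] K)).comp (oneRight k K K))
        ((oneLeft k A (K ⊗[k] K)).comp (oneLeft k K K)))
      (star ρ (star ρ (oneRight k A (K ⊗[k] K)) ((oneLeft k A (K ⊗[k] K)).comp (oneRight k K K)))
        ((oneLeft k A (K ⊗[k] K)).comp (oneLeft k K K)))
      (star ρ (oneRight k A (K ⊗[k] K)) (star Q.Δ ((oneLeft k A (K ⊗[k] K)).comp (oneRight k K K))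
        ((oneLeft k A (K ⊗[k] K)).comp (oneLeft k K K)))))
    (pentagon : ∀ (n : A →ₐ[k] A ⊗[k] (K ⊗[k] (K ⊗[k] K)))
      (i j l : K →ₐ[k] A ⊗[k] (K ⊗[k] (K ⊗[k] K))) [LegComm n i] [LegComm n j] [LegComm n l]
      [LegComm i j] [LegComm i l] [LegComm j l],
      place₃ Q.Φ i j l * place₃ Φρ n (star Q.Δ i j) l * place₃ Φρ n i j =
        place₃ Φρ n i (star Q.Δ j l) * place₃ Φρ (star ρ n i) j l)
    (counit : star ρ (AlgHom.id k A) (triv A Q.ε) = AlgHom.id k A)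
    (counit_mid : place₃ Φρ (oneRight k A K) (triv _ Q.ε) (oneLeft k A K) = 1)
    (counit_last : place₃ Φρ (oneRight k A K) (oneLeft k A K) (triv _ Q.ε) = 1) :
    RightComoduleAlgebra Q A where
  ρ := ρ
  Φρ := Φρ
  coassoc_ρ a := by
    have e := Intertwines.eq intertwines a
    simp only [coe_place₃, star_apply _ (star _ _ _), star_apply _ (oneRight k _ _),
      ← lift₂_onFirst] at e
    rw [lift₃_standard, lift₂_star_standard] at e
    exact e
  cocycle_ρ := by
    have e := congrArg Units.val (pentagon (oneRight k A (K ⊗[k] (K ⊗[k] K)))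
      ((oneLeft k _ _).comp (oneRight k _ _))
      ((oneLeft k _ _).comp ((oneLeft k _ _).comp (oneRight k _ _)))
      ((oneLeft k _ _).comp ((oneLeft k _ _).comp (oneLeft k _ _))))
    have h : ∀ z, lift₂ _ _ z = z := DFunLike.congr_fun (lift₄_standard (k := k)
      (U := A) (V := K) (W := K) (P := K))
    refine (h _).symm.trans (Eq.trans ?_ (h _))
    simp only [map_mul, lift₂_oneLeft, lift₂_onRest, lift₂_onFirst, lift₂_comp_onFirst,
      lift₂_comp_onRest, lift₂_comp_oneRight]
    exact e
  counit_ρ a := by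
    rw [← AlgHom.id_apply (R := k) (dropLast k _ _ _), ← lift₂_dropLast, ← star_apply, counit]
    rfl
  counit_Φρ_mid := by
    have h := congrArg Units.val counit_mid
    rw [coe_place₃] at h
    simp only [← lift₂_comp_dropFirst] at h
    rw [lift₂_oneRight_comp] at h
    exact h
  counit_Φρ_last := by
    have h := congrArg Units.val counit_last
    rw [coe_place₃] at h
    simp only [← lift₂_comp_dropLast] at h
    rw [lift₂_oneRight_comp] at h
    exact h

section Twist

variable (R : RightComoduleAlgebra Q A) (V : (A ⊗[k] K)ˣ)

/-- `u ↦ V ρ(u) V⁻¹`. -/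
def twistρ : A →ₐ[k] A ⊗[k] K :=
  AlgHom.ofLinearMap (LinearMap.mulLeft k (V : A ⊗[k] K) ∘ₗ LinearMap.mulRight k ↑V⁻¹ ∘ₗ
    R.ρ.toLinearMap) (by simp) (fun x y => by
      simp only [LinearMap.comp_apply, LinearMap.mulLeft_apply, LinearMap.mulRight_apply,
        AlgHom.toLinearMap_apply, map_mul, mul_assoc, Units.inv_mul_cancel_left])

theorem twistρ_apply (u : A) : R.twistρ V u = V * R.ρ u * ↑V⁻¹ := by
  simp [twistρ, mul_assoc]

variable {B : Type*} [Ring B] [Algebra k B] (n : A →ₐ[k] B) (i j l : K →ₐ[k] B) [LegComm n i]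
  [LegComm n j] [LegComm n l] [LegComm i j] [LegComm i l] [LegComm j l]

/-- In legs the definition of the twisted coaction says exactly that `V` intertwines the old
coaction with the new one. This makes all naturality squares with `V` available. -/
instance intertwines_twistρ : Intertwines (place₂ V n i) (star R.ρ n i) (star (R.twistρ V) n i) where
  semiconj x := by
    have h : R.twistρ V x * V = V * R.ρ x := by
      rw [twistρ_apply, mul_assoc, Units.inv_mul, mul_one]
    have h' := congrArg (lift₂ n i) h
    rw [map_mul, map_mul] at h'
    exact h'.symm

/-- The reassociator of the twisted comodule algebra. -/
def twistΦ : (A ⊗[k] (K ⊗[k] K))ˣ :=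
  Units.map (onRest k A Q.Δ).toMonoidHom V * R.Φρ *
    (Units.map (onFirst k K R.ρ).toMonoidHom V)⁻¹ *
    (Units.map (onRest k A (oneRight k K K)).toMonoidHom V)⁻¹

theorem place_twistΦ : place₃ (R.twistΦ V) n i j =
    place₂ V n (star Q.Δ i j) * place₃ R.Φρ n i j * (place₂ V (star R.ρ n i) j)⁻¹ *
      (place₂ V n i)⁻¹ := by
  simp only [place₃, place₂, twistΦ, map_mul, map_inv]
  congr 1
  · congr 1
    · congr 1
      refine Units.ext ?_
      simp only [coe_unitsMap, lift₂_onRest, star]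
    · congr 1
      refine Units.ext ?_
      simp only [coe_unitsMap, lift₂_onFirst]
  · congr 1
    refine Units.ext ?_
    simp only [coe_unitsMap, lift₂_onRest, lift₂_comp_oneRight]

theorem intertwines_twistΦ : Intertwines (place₃ (R.twistΦ V) n i j)
    (star (R.twistρ V) (star (R.twistρ V) n i) j) (star (R.twistρ V) n (star Q.Δ i j)) where
  semiconj x := by
    rw [place_twistΦ, Units.val_mul, Units.val_mul, Units.val_mul]
    have h₁ := Intertwines.semiconj (b := (place₂ V n i)⁻¹)
      (i := star (R.twistρ V) (star (R.twistρ V) n i) j)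
      (i' := star (R.twistρ V) (star R.ρ n i) j) x
    have h₂ := Intertwines.semiconj (b := (place₂ V (star R.ρ n i) j)⁻¹)
      (i := star (R.twistρ V) (star R.ρ n i) j) (i' := star R.ρ (star R.ρ n i) j) x
    have h₃ := Intertwines.semiconj (b := place₃ R.Φρ n i j)
      (i := star R.ρ (star R.ρ n i) j) (i' := star R.ρ n (star Q.Δ i j)) x
    have h₄ := Intertwines.semiconj (b := place₂ V n (star Q.Δ i j))
      (i := star R.ρ n (star Q.Δ i j)) (i' := star (R.twistρ V) n (star Q.Δ i j)) x
    exact ((h₄.mul_left h₃).mul_left h₂).mul_left h₁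

theorem pentagon_twistΦ :
    place₃ Q.Φ i j l * place₃ (R.twistΦ V) n (star Q.Δ i j) l * place₃ (R.twistΦ V) n i j =
      place₃ (R.twistΦ V) n i (star Q.Δ j l) *
        place₃ (R.twistΦ V) (star (R.twistρ V) n i) j l := by
  simp only [place_twistΦ]
  exact twisted_cocycle_word (R.pentagon_ρ n i j l)
    (place₂_intertwine (place₃ Q.Φ i j l) V n n (star Q.Δ (star Q.Δ i j) l)
      (star Q.Δ i (star Q.Δ j l)))
    (place₂_intertwine (place₃ R.Φρ n i j) V (star R.ρ (star R.ρ n i) j)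
      (star R.ρ n (star Q.Δ i j)) l l)
    (place₂_intertwine (place₂ V n i) V (star R.ρ n i) (star (R.twistρ V) n i) (star Q.Δ j l)
      (star Q.Δ j l))
    (place₃_intertwine (place₂ V n i) R.Φρ (star R.ρ n i) (star (R.twistρ V) n i) j j l l)
    (place₂_intertwine (place₂ V n i) V (star R.ρ (star R.ρ n i) j)
      (star R.ρ (star (R.twistρ V) n i) j) l l)
    (place₂_intertwine (place₂ V n i) V (star R.ρ n i) (star (R.twistρ V) n i) j j)

variable {V}

theorem place₂_triv (hV : dropLast k A Q.ε (V : A ⊗[k] K) = 1) : place₂ V n (triv B Q.ε) = 1 :=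
  Units.ext (by rw [coe_place₂, lift₂_dropLast, hV, map_one, Units.val_one])

/-- The comodule algebra `(V ρ V⁻¹, (id ⊗ Δ)(V) Φ_ρ (ρ ⊗ id)(V)⁻¹ (V ⊗ 1)⁻¹)`. -/
def twist (hV : dropLast k A Q.ε (V : A ⊗[k] K) = 1) : RightComoduleAlgebra Q A :=
  ofLegs (R.twistρ V) (R.twistΦ V) (R.intertwines_twistΦ V _ _ _)
    (fun n i j l => R.pentagon_twistΦ V n i j l)
    (AlgHom.ext fun u => by
      have h := R.twistρ_apply V u
      have h' := congrArg (lift₂ (AlgHom.id k A) (triv A Q.ε)) h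
      rw [map_mul, map_mul, ← coe_place₂, ← coe_place₂_inv, place₂_triv _ hV, ← star_apply,
        ← star_apply, R.star_triv] at h'
      simpa using h')
    (by simp only [place_twistΦ, Q.star_triv_left, R.place_triv_mid, R.star_triv, place₂_triv _ hV]; simp)
    (by simp only [place_twistΦ, Q.star_triv_right, R.place_triv_right, place₂_triv _ hV]; simp)

end Twist

end RightComoduleAlgebra

end QHA
end

/-! ### Right module algebras and associativity of the smash product. -/

noncomputable section

namespace QHA

section Evaluation

variable {k : Type*} [Field k] {A P N M : Type*} [Ring A] [Algebra k A] [Ring P] [Algebra k P]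
  [AddCommGroup N] [Module k N] [AddCommGroup M] [Module k M]

/-- `(a ⊗ p, n) ↦ a ⊗ μ(τ p n)`. -/
def evalAt (τ : P →ₗ[k] Module.End k N) (μ : N →ₗ[k] M) : A ⊗[k] P →ₗ[k] N →ₗ[k] A ⊗[k] M :=
  TensorProduct.curry (TensorProduct.map LinearMap.id (μ ∘ₗ TensorProduct.lift τ) ∘ₗ
    (TensorProduct.assoc k A P N).toLinearMap)

@[simp]
theorem evalAt_tmul (τ : P →ₗ[k] Module.End k N) (μ : N →ₗ[k] M) (a : A) (p : P) (x : N) :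
    evalAt τ μ (a ⊗ₜ p) x = a ⊗ₜ μ (τ p x) := by
  simp [evalAt]

/-- For a right action, acting on the argument beforehand multiplies the tensor on the left.
Products in `A ⊗ M` can thus be computed entirely with tensors over `A ⊗ K ⊗ ⋯ ⊗ K`. -/
theorem evalAt_act {τ : P →ₗ[k] Module.End k N} (hτ : ∀ p q x, τ (p * q) x = τ q (τ p x))
    (μ : N →ₗ[k] M) (t : A ⊗[k] P) (p : P) (x : N) :
    evalAt τ μ t (τ p x) = evalAt τ μ ((1 ⊗ₜ p) * t) x := by
  induction t using TensorProduct.induction_on with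
  | zero => simp
  | add s t hs ht => simp only [map_add, mul_add, LinearMap.add_apply, hs, ht]
  | tmul a q => simp [hτ]

end Evaluation

/-- A right module algebra over a quasi-bialgebra: an algebra in the monoidal category of right
modules. -/
structure RightModuleAlgebra {k K : Type*} [Field k] [Ring K] [Algebra k K]
    (Q : QuasiBialgebra k K) (M : Type*) [AddCommGroup M] [Module k M] where
  act : K →ₗ[k] Module.End k M
  act_one : ∀ m, act 1 m = m
  act_mul : ∀ x y m, act (x * y) m = act y (act x m)
  mul : M →ₗ[k] M →ₗ[k] M
  one : M
  /-- `(a b) c = (a · x¹) [(b · x²) (c · x³)]` -/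
  quasi_assoc : ∀ a b c, mul (mul a b) c =
    TensorProduct.lift mul (TensorProduct.map LinearMap.id (TensorProduct.lift mul)
      (tensorAct act (tensorAct act act) (↑Q.Φ⁻¹ : K ⊗[k] (K ⊗[k] K)) (a ⊗ₜ[k] (b ⊗ₜ[k] c))))
  one_mul' : ∀ a, mul one a = a
  mul_one' : ∀ a, mul a one = a
  act_map_mul : ∀ x a b, act x (mul a b) =
    TensorProduct.lift mul (tensorAct act act (Q.Δ x) (a ⊗ₜ[k] b))
  act_map_one : ∀ x, act x one = Q.ε x • one

section StandardLegs

variable (k A K : Type*) [Field k] [Ring A] [Algebra k A] [Ring K] [Algebra k K]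

/-- The standard maps into `A ⊗ K ⊗ K`. -/
abbrev A₂ : A →ₐ[k] A ⊗[k] (K ⊗[k] K) := oneRight k _ _
/-- The standard maps into `A ⊗ K ⊗ K`. -/
abbrev K₂₁ : K →ₐ[k] A ⊗[k] (K ⊗[k] K) := (oneLeft k _ _).comp (oneRight k _ _)
/-- The standard maps into `A ⊗ K ⊗ K`. -/
abbrev K₂₂ : K →ₐ[k] A ⊗[k] (K ⊗[k] K) := (oneLeft k _ _).comp (oneLeft k _ _)
/-- The standard maps into `A ⊗ K ⊗ K ⊗ K`. -/
abbrev A₃ : A →ₐ[k] A ⊗[k] (K ⊗[k] (K ⊗[k] K)) := oneRight k _ _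
/-- The standard maps into `A ⊗ K ⊗ K ⊗ K`. -/
abbrev K₃₁ : K →ₐ[k] A ⊗[k] (K ⊗[k] (K ⊗[k] K)) := (oneLeft k _ _).comp (oneRight k _ _)
/-- The standard maps into `A ⊗ K ⊗ K ⊗ K`. -/
abbrev K₃₂ : K →ₐ[k] A ⊗[k] (K ⊗[k] (K ⊗[k] K)) :=
  (oneLeft k _ _).comp ((oneLeft k _ _).comp (oneRight k _ _))
/-- The standard maps into `A ⊗ K ⊗ K ⊗ K`. -/
abbrev K₃₃ : K →ₐ[k] A ⊗[k] (K ⊗[k] (K ⊗[k] K)) :=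
  (oneLeft k _ _).comp ((oneLeft k _ _).comp (oneLeft k _ _))

end StandardLegs

namespace RightModuleAlgebra

variable {k K : Type*} [Field k] [Ring K] [Algebra k K] {Q : QuasiBialgebra k K}
  {M : Type*} [AddCommGroup M] [Module k M] (𝓜 : RightModuleAlgebra Q M)
  {A : Type*} [Ring A] [Algebra k A]

/-- The diagonal action of `K ⊗ K` on `M ⊗ M`. -/
abbrev act₂ : K ⊗[k] K →ₗ[k] Module.End k (M ⊗[k] M) := tensorAct 𝓜.act 𝓜.act
/-- The diagonal action of `K ⊗ K ⊗ K` on `M ⊗ M ⊗ M`. -/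
abbrev act₃ : K ⊗[k] (K ⊗[k] K) →ₗ[k] Module.End k (M ⊗[k] (M ⊗[k] M)) :=
  tensorAct 𝓜.act 𝓜.act₂
/-- The product `M ⊗ M → M`. -/
abbrev mul₂ : M ⊗[k] M →ₗ[k] M := TensorProduct.lift 𝓜.mul
/-- The product `a ⊗ b ⊗ c ↦ a (b c)`. -/
abbrev mul₃ : M ⊗[k] (M ⊗[k] M) →ₗ[k] M := 𝓜.mul₂ ∘ₗ TensorProduct.map LinearMap.id 𝓜.mul₂
/-- `a ⊗ p, φ ↦ a ⊗ φ · p`. -/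
abbrev ev₁ : A ⊗[k] K →ₗ[k] M →ₗ[k] A ⊗[k] M := evalAt 𝓜.act LinearMap.id
/-- `a ⊗ p ⊗ q, φ ⊗ ψ ↦ a ⊗ (φ · p)(ψ · q)`. -/
abbrev ev₂ : A ⊗[k] (K ⊗[k] K) →ₗ[k] M ⊗[k] M →ₗ[k] A ⊗[k] M := evalAt 𝓜.act₂ 𝓜.mul₂
/-- `a ⊗ p ⊗ q ⊗ r, φ ⊗ ψ ⊗ ξ ↦ a ⊗ (φ · p)((ψ · q)(ξ · r))`. -/
abbrev ev₃ : A ⊗[k] (K ⊗[k] (K ⊗[k] K)) →ₗ[k] M ⊗[k] (M ⊗[k] M) →ₗ[k] A ⊗[k] M :=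
  evalAt 𝓜.act₃ 𝓜.mul₃

theorem act₂_mul (x y : K ⊗[k] K) (z : M ⊗[k] M) :
    𝓜.act₂ (x * y) z = 𝓜.act₂ y (𝓜.act₂ x z) :=
  tensorAct_mul_rev 𝓜.act_mul 𝓜.act_mul x y z

theorem act₃_mul (x y : K ⊗[k] (K ⊗[k] K)) (z : M ⊗[k] (M ⊗[k] M)) :
    𝓜.act₃ (x * y) z = 𝓜.act₃ y (𝓜.act₃ x z) :=
  tensorAct_mul_rev 𝓜.act_mul 𝓜.act₂_mul x y z

theorem act_mul₂ (x : K) (z : M ⊗[k] M) : 𝓜.act x (𝓜.mul₂ z) = 𝓜.mul₂ (𝓜.act₂ (Q.Δ x) z) := by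
  induction z using TensorProduct.induction_on with
  | zero => simp
  | add x y hx hy => simp only [map_add, hx, hy]
  | tmul a b => exact 𝓜.act_map_mul x a b

theorem mul₂_mul₂ (z : M ⊗[k] M) (c : M) : 𝓜.mul₂ (𝓜.mul₂ z ⊗ₜ c) =
    𝓜.mul₃ (𝓜.act₃ (↑Q.Φ⁻¹ : K ⊗[k] (K ⊗[k] K)) (TensorProduct.assoc k M M M (z ⊗ₜ c))) := by
  induction z using TensorProduct.induction_on with
  | zero => simp
  | add x y hx hy => simp only [map_add, TensorProduct.add_tmul, hx, hy]
  | tmul a b => exact 𝓜.quasi_assoc a b c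

theorem assoc_act₂ (d : K ⊗[k] K) (s : K) (z : M ⊗[k] M) (c : M) :
    TensorProduct.assoc k M M M (𝓜.act₂ d z ⊗ₜ 𝓜.act s c) =
      𝓜.act₃ (Algebra.TensorProduct.assoc k k k K K K (d ⊗ₜ s))
        (TensorProduct.assoc k M M M (z ⊗ₜ c)) := by
  induction z using TensorProduct.induction_on with
  | zero => simp
  | add x y hx hy => simp only [map_add, TensorProduct.add_tmul, hx, hy]
  | tmul a b =>
    induction d using TensorProduct.induction_on with
    | zero => simp
    | add x y hx hy => simp only [map_add, TensorProduct.add_tmul, LinearMap.add_apply, hx, hy]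
    | tmul p q => simp [tensorAct_tmul]

theorem ev₁_mul₂ (t : A ⊗[k] K) (z : M ⊗[k] M) :
    𝓜.ev₁ t (𝓜.mul₂ z) = 𝓜.ev₂ (onRest k A Q.Δ t) z := by
  induction t using TensorProduct.induction_on with
  | zero => simp
  | add s t hs ht => simp only [map_add, LinearMap.add_apply, hs, ht]
  | tmul a p => simp [onRest, act_mul₂]

theorem ev₂_mul₂_right (t : A ⊗[k] (K ⊗[k] K)) (φ : M) (z : M ⊗[k] M) :
    𝓜.ev₂ t (φ ⊗ₜ 𝓜.mul₂ z) = 𝓜.ev₃ (onRest k A (onRest k K Q.Δ) t) (φ ⊗ₜ z) := by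
  induction t using tensor_induction₃ with
  | zero => simp
  | add s t hs ht => simp only [map_add, LinearMap.add_apply, hs, ht]
  | tmul a p q => simp [onRest, act_mul₂, tensorAct_tmul]

/-- Acting on a product produces `Δ`, and rebracketing the triple product to the right produces the
extra factor `Φ⁻¹`. -/
theorem ev₂_mul₂_left (t : A ⊗[k] (K ⊗[k] K)) (z : M ⊗[k] M) (φ : M) :
    𝓜.ev₂ t (𝓜.mul₂ z ⊗ₜ φ) = 𝓜.ev₃ (onRest k A (onFirst k K Q.Δ) t *
      oneLeft k A _ (↑Q.Φ⁻¹ : K ⊗[k] (K ⊗[k] K))) (TensorProduct.assoc k M M M (z ⊗ₜ φ)) := by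
  induction t using tensor_induction₃ with
  | zero => simp
  | add s t hs ht => simp only [map_add, add_mul, LinearMap.add_apply, hs, ht]
  | tmul a p q =>
    rw [evalAt_tmul, tensorAct_tmul, act_mul₂, mul₂_mul₂, assoc_act₂, ← act₃_mul]
    simp [onRest, onFirst, oneLeft]

theorem ev₂_one_left (t : A ⊗[k] (K ⊗[k] K)) (φ : M) :
    𝓜.ev₂ t (𝓜.one ⊗ₜ φ) = 𝓜.ev₁ (onRest k A (dropFirst k K Q.ε) t) φ := by
  induction t using tensor_induction₃ with
  | zero => simp
  | add s t hs ht => simp only [map_add, LinearMap.add_apply, hs, ht]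
  | tmul a p q => simp [onRest, dropFirst, tensorAct_tmul, act_map_one, one_mul']

theorem ev₂_one_right (t : A ⊗[k] (K ⊗[k] K)) (φ : M) :
    𝓜.ev₂ t (φ ⊗ₜ 𝓜.one) = 𝓜.ev₁ (onRest k A (dropLast k K Q.ε) t) φ := by
  induction t using tensor_induction₃ with
  | zero => simp
  | add s t hs ht => simp only [map_add, LinearMap.add_apply, hs, ht]
  | tmul a p q => simp [onRest, dropLast, tensorAct_tmul, act_map_one, mul_one']

theorem ev₁_one (t : A ⊗[k] K) : 𝓜.ev₁ t 𝓜.one = dropLast k A Q.ε t ⊗ₜ 𝓜.one := by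
  induction t using TensorProduct.induction_on with
  | zero => simp
  | add s t hs ht => simp only [map_add, LinearMap.add_apply, TensorProduct.add_tmul, hs, ht]
  | tmul a p => simp [dropLast, act_map_one, TensorProduct.smul_tmul']

theorem ev₁_tmul_one (a : A) (φ : M) : 𝓜.ev₁ (a ⊗ₜ 1) φ = a ⊗ₜ φ := by
  simp [act_one]

section Smash

variable (R : RightComoduleAlgebra Q A)

/-- The right generalized smash product of a right comodule algebra and a right module algebra. -/
abbrev smash : Product k (A ⊗[k] M) :=
  smashProduct R.ρ (R.Φρ : A ⊗[k] (K ⊗[k] K)) 𝓜.act 𝓜.mul 𝓜.one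

/-- The tensor `u u'₀ x̃¹ ⊗ u'₁ x̃² ⊗ x̃³`. -/
def _root_.QHA.RightComoduleAlgebra.smashTensor (u u' : A) : A ⊗[k] (K ⊗[k] K) :=
  A₂ k A K u * star R.ρ (A₂ k A K) (K₂₁ k A K) u' * (↑R.Φρ⁻¹ : A ⊗[k] (K ⊗[k] K))

theorem smash_mul_tmul (u u' : A) (φ ψ : M) :
    (𝓜.smash R).mul (u ⊗ₜ φ) (u' ⊗ₜ ψ) = 𝓜.ev₂ (R.smashTensor u u') (φ ⊗ₜ ψ) := by
  have h : onRest k A (oneRight k K K) (R.ρ u') =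
      star R.ρ (A₂ k A K) (K₂₁ k A K) u' := by
    rw [star_apply, lift₂_oneRight_comp]
  simp only [smash, smashProduct, productAM, TensorProduct.curry_apply, LinearMap.comp_apply,
    LinearEquiv.coe_coe, TensorProduct.tensorTensorTensorComm_tmul, TensorProduct.map_tmul,
    TensorProduct.lift.tmul, LinearMap.mk₂_apply, LinearMap.id_apply, Ring.inverse_unit, h]
  rfl

theorem smash_mul_ev₁ (v w : A ⊗[k] K) (φ ψ : M) :
    (𝓜.smash R).mul (𝓜.ev₁ v φ) (𝓜.ev₁ w ψ) =
      𝓜.ev₂ (lift₂ (A₂ k A K) (K₂₁ k A K) v *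
        lift₂ (star R.ρ (A₂ k A K) (K₂₁ k A K)) (K₂₂ k A K) w *
        (↑R.Φρ⁻¹ : A ⊗[k] (K ⊗[k] K))) (φ ⊗ₜ ψ) := by
  induction v using TensorProduct.induction_on with
  | zero => simp
  | add s t hs ht => simp only [map_add, add_mul, LinearMap.add_apply, hs, ht]
  | tmul a p =>
    induction w using TensorProduct.induction_on with
    | zero => simp
    | add s t hs ht => simp only [map_add, add_mul, mul_add, LinearMap.add_apply, hs, ht]
    | tmul b q =>
      rw [evalAt_tmul, evalAt_tmul, LinearMap.id_apply, LinearMap.id_apply, smash_mul_tmul,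
        ← tensorAct_tmul, evalAt_act 𝓜.act₂_mul, RightComoduleAlgebra.smashTensor, lift₂_tmul,
        lift₂_tmul]
      have h₁ : (1 ⊗ₜ (p ⊗ₜ q) : A ⊗[k] (K ⊗[k] K)) = K₂₁ k A K p * K₂₂ k A K q := by
        simp [oneLeft, oneRight]
      have h₂ := (LegComm.comm (i := A₂ k A K) (j := K₂₁ k A K) a p).eq
      have h₃ := (LegComm.comm (i := A₂ k A K) (j := K₂₂ k A K) a q).eq
      have h₄ := (LegComm.comm (i := star R.ρ (A₂ k A K) (K₂₁ k A K)) (j := K₂₂ k A K) b q).eq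
      congr 2
      rw [h₁, h₂, h₄]
      simp only [← mul_assoc]
      congr 2
      rw [mul_assoc _ _ (A₂ k A K a), ← h₃, mul_assoc]

theorem _root_.QHA.RightComoduleAlgebra.lift_smashTensor {B : Type*} [Ring B] [Algebra k B]
    (n : A →ₐ[k] B) (i j : K →ₐ[k] B) [LegComm n i] [LegComm n j] [LegComm i j] (u u' : A) :
    lift₂ n (lift₂ i j) (R.smashTensor u u') =
      n u * star R.ρ n i u' * Units.val (place₃ R.Φρ n i j)⁻¹ := by
  rw [RightComoduleAlgebra.smashTensor, map_mul, map_mul, lift₂_oneRight, coe_place₃_inv,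
    star_apply, lift₂_comp]
  simp only [lift₂_comp_oneRight, lift₂_comp_oneLeft_comp]
  rfl

theorem _root_.QHA.lift_standard₄ (t : A ⊗[k] (K ⊗[k] (K ⊗[k] K))) :
    lift₂ (A₃ k A K) (lift₂ (K₃₁ k A K) (lift₂ (K₃₂ k A K) (K₃₃ k A K))) t = t :=
  DFunLike.congr_fun lift₄_standard t

theorem _root_.QHA.lift_standard₃ (t : A ⊗[k] (K ⊗[k] K)) :
    lift₂ (A₂ k A K) (lift₂ (K₂₁ k A K) (K₂₂ k A K)) t = t :=
  DFunLike.congr_fun lift₃_standard t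

theorem _root_.QHA.onRest_onFirst_standard (Q : QuasiBialgebra k K) (t : A ⊗[k] (K ⊗[k] K)) :
    onRest k A (onFirst k K Q.Δ) t =
      lift₂ (A₃ k A K) (lift₂ (star Q.Δ (K₃₁ k A K) (K₃₂ k A K)) (K₃₃ k A K)) t := by
  rw [← lift_standard₄ (onRest k A (onFirst k K Q.Δ) t), lift₂_onRest]
  simp only [lift₂_comp_onFirst]

theorem _root_.QHA.onRest_onRest_standard (Q : QuasiBialgebra k K) (t : A ⊗[k] (K ⊗[k] K)) :
    onRest k A (onRest k K Q.Δ) t =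
      lift₂ (A₃ k A K) (lift₂ (K₃₁ k A K) (star Q.Δ (K₃₂ k A K) (K₃₃ k A K))) t := by
  rw [← lift_standard₄ (onRest k A (onRest k K Q.Δ) t), lift₂_onRest]
  simp only [lift₂_comp_onRest]
  rfl

theorem _root_.QHA.one_tmul_assoc (p : K ⊗[k] K) :
    (1 ⊗ₜ Algebra.TensorProduct.assoc k k k K K K (p ⊗ₜ 1) : A ⊗[k] (K ⊗[k] (K ⊗[k] K))) =
      lift₂ (K₃₁ k A K) (K₃₂ k A K) p := by
  induction p using TensorProduct.induction_on with
  | zero => simp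
  | add s t hs ht => simp only [map_add, TensorProduct.add_tmul, TensorProduct.tmul_add, hs, ht]
  | tmul x y => simp [oneLeft, oneRight]

theorem smash_ev₂_mul (w : A ⊗[k] (K ⊗[k] K)) (z : M ⊗[k] M) (u : A) (φ : M) :
    (𝓜.smash R).mul (𝓜.ev₂ w z) (u ⊗ₜ φ) =
      𝓜.ev₃ (lift₂ (A₃ k A K) (lift₂ (K₃₁ k A K) (K₃₂ k A K)) w *
        star R.ρ (A₃ k A K) (star Q.Δ (K₃₁ k A K) (K₃₂ k A K)) u *
        Units.val (place₃ R.Φρ (A₃ k A K) (star Q.Δ (K₃₁ k A K) (K₃₂ k A K)) (K₃₃ k A K))⁻¹ *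
        Units.val (place₃ Q.Φ (K₃₁ k A K) (K₃₂ k A K) (K₃₃ k A K))⁻¹)
        (TensorProduct.assoc k M M M (z ⊗ₜ φ)) := by
  induction w using TensorProduct.induction_on with
  | zero => simp
  | add s t hs ht => simp only [map_add, add_mul, LinearMap.add_apply, hs, ht]
  | tmul a p =>
    have h := 𝓜.assoc_act₂ p 1 z φ
    rw [𝓜.act_one] at h
    rw [evalAt_tmul, smash_mul_tmul, ev₂_mul₂_left, h, evalAt_act 𝓜.act₃_mul,
      onRest_onFirst_standard, RightComoduleAlgebra.lift_smashTensor, lift₂_tmul, one_tmul_assoc,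
      ← lift_standard₄ (oneLeft k A _ _), lift₂_oneLeft, coe_place₃_inv Q.Φ]
    rw [(LegComm.comm (i := A₃ k A K) (j := lift₂ (K₃₁ k A K) (K₃₂ k A K)) a p).eq]
    simp only [mul_assoc]

theorem smash_mul_ev₂ (w : A ⊗[k] (K ⊗[k] K)) (z : M ⊗[k] M) (u : A) (φ : M) :
    (𝓜.smash R).mul (u ⊗ₜ φ) (𝓜.ev₂ w z) =
      𝓜.ev₃ (A₃ k A K u *
        lift₂ (star R.ρ (A₃ k A K) (K₃₁ k A K)) (lift₂ (K₃₂ k A K) (K₃₃ k A K)) w *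
        Units.val (place₃ R.Φρ (A₃ k A K) (K₃₁ k A K) (star Q.Δ (K₃₂ k A K) (K₃₃ k A K)))⁻¹)
        (φ ⊗ₜ z) := by
  induction w using TensorProduct.induction_on with
  | zero => simp
  | add s t hs ht => simp only [map_add, add_mul, mul_add, LinearMap.add_apply, hs, ht]
  | tmul a p =>
    have h : φ ⊗ₜ[k] 𝓜.act₂ p z = 𝓜.act₃ (1 ⊗ₜ p) (φ ⊗ₜ z) := by
      rw [tensorAct_tmul, 𝓜.act_one]
    rw [evalAt_tmul, smash_mul_tmul, ev₂_mul₂_right, h, evalAt_act 𝓜.act₃_mul,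
      onRest_onRest_standard, RightComoduleAlgebra.lift_smashTensor, lift₂_tmul]
    have h₁ : (1 ⊗ₜ (1 ⊗ₜ p) : A ⊗[k] (K ⊗[k] (K ⊗[k] K))) =
        lift₂ (K₃₂ k A K) (K₃₃ k A K) p := by
      rw [lift₂_comp_comp, lift₂_comp_comp, lift₂_oneRight_oneLeft]
      simp [oneLeft]
    have h₂ := (LegComm.comm (i := star R.ρ (A₃ k A K) (K₃₁ k A K))
      (j := lift₂ (K₃₂ k A K) (K₃₃ k A K)) a p).eq
    rw [h₁, h₂, ← mul_assoc, ← mul_assoc, ← mul_assoc,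
      (LegComm.comm (i := A₃ k A K) (j := lift₂ (K₃₂ k A K) (K₃₃ k A K)) u p).eq]

/-- Both triple products are evaluations of explicit tensors in `A ⊗ K ⊗ K ⊗ K` on the same element.
The tensors agree by the inverse of the pentagon for `Φ_ρ` and the quasi-coassociativity of `ρ`. -/
theorem smash_assoc (x y z : A ⊗[k] M) :
    (𝓜.smash R).mul ((𝓜.smash R).mul x y) z = (𝓜.smash R).mul x ((𝓜.smash R).mul y z) := by
  induction x using TensorProduct.induction_on with
  | zero => simp
  | add s t hs ht => simp only [map_add, LinearMap.add_apply, hs, ht]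
  | tmul u φ =>
    induction y using TensorProduct.induction_on with
    | zero => simp
    | add s t hs ht => simp only [map_add, LinearMap.add_apply, hs, ht]
    | tmul u' ψ =>
      induction z using TensorProduct.induction_on with
      | zero => simp
      | add s t hs ht => simp only [map_add, hs, ht]
      | tmul u'' ξ =>
        rw [smash_mul_tmul, smash_mul_tmul, smash_ev₂_mul, smash_mul_ev₂, TensorProduct.assoc_tmul,
          RightComoduleAlgebra.lift_smashTensor, RightComoduleAlgebra.lift_smashTensor]
        congr 2
        -- The coaction of the last factor is moved past `Φ_ρ⁻¹`, after which only `Φ` and `Φ_ρ`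
        -- remain and the pentagon applies.
        have h₁ := Intertwines.eq (b := (place₃ R.Φρ (A₃ k A K) (K₃₁ k A K) (K₃₂ k A K))⁻¹)
          (i := star R.ρ (A₃ k A K) (star Q.Δ (K₃₁ k A K) (K₃₂ k A K)))
          (i' := star R.ρ (star R.ρ (A₃ k A K) (K₃₁ k A K)) (K₃₂ k A K)) inferInstance u''
        have h₂ := congrArg (fun b => Units.val b⁻¹)
          (R.pentagon_ρ (A₃ k A K) (K₃₁ k A K) (K₃₂ k A K) (K₃₃ k A K))
        simp only [mul_inv_rev, Units.val_mul] at h₂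
        simp only [mul_assoc] at h₁ h₂ ⊢
        rw [← h₂, ← mul_assoc (Units.val _) (star R.ρ _ _ _), h₁]
        simp only [mul_assoc]

/-- The smash product of a right comodule algebra and a right module algebra is an algebra. -/
theorem smash_isAlgebra : (𝓜.smash R).IsAlgebra where
  assoc := 𝓜.smash_assoc R
  one_mul x := by
    induction x using TensorProduct.induction_on with
    | zero => simp
    | add s t hs ht => simp only [map_add, hs, ht]
    | tmul u φ =>
      change (𝓜.smash R).mul (1 ⊗ₜ 𝓜.one) _ = _
      have h := R.lift_smashTensor (oneRight k A K) (triv _ Q.ε) (oneLeft k A K) 1 u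
      rw [R.place_triv_mid, R.star_triv, map_one, inv_one, Units.val_one, one_mul, mul_one] at h
      rw [smash_mul_tmul, ev₂_one_left, ← AlgHom.id_apply (R := k) (onRest k A _ _),
        ← lift₂_oneRight_oneLeft, lift₂_onRest]
      simp only [lift₂_comp_dropFirst]
      rw [h]
      exact 𝓜.ev₁_tmul_one u φ
  mul_one x := by
    induction x using TensorProduct.induction_on with
    | zero => simp
    | add s t hs ht => simp only [map_add, LinearMap.add_apply, hs, ht]
    | tmul u φ =>
      change (𝓜.smash R).mul _ (1 ⊗ₜ 𝓜.one) = _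
      have h := R.lift_smashTensor (oneRight k A K) (oneLeft k A K) (triv _ Q.ε) u 1
      rw [R.place_triv_right, map_one, inv_one, Units.val_one, mul_one, mul_one] at h
      rw [smash_mul_tmul, ev₂_one_right, ← AlgHom.id_apply (R := k) (onRest k A _ _),
        ← lift₂_oneRight_oneLeft, lift₂_onRest]
      simp only [lift₂_comp_dropLast]
      rw [h]
      exact 𝓜.ev₁_tmul_one u φ

end Smash

end RightModuleAlgebra

end QHA
end

/-! ### Invariance of the smash product under gauge twisting. -/

noncomputable section

namespace QHA

section Substitution

variable {k : Type*} [Field k] {A P : Type*} [Ring A] [Algebra k A] [Ring P] [Algebra k P]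

/-- `a ⊗ p ↦ (1 ⊗ p) g(a)`. -/
def subst (g : A →ₗ[k] A ⊗[k] P) : A ⊗[k] P →ₗ[k] A ⊗[k] P :=
  TensorProduct.lift (((LinearMap.mul k (A ⊗[k] P)).flip.compl₂
    (oneLeft k A P).toLinearMap) ∘ₗ g)

@[simp]
theorem subst_tmul (g : A →ₗ[k] A ⊗[k] P) (a : A) (p : P) :
    subst g (a ⊗ₜ p) = oneLeft k A P p * g a := by
  simp [subst]

theorem subst_mulRight (W : A ⊗[k] P) (t : A ⊗[k] P) :
    subst (LinearMap.mulRight k W ∘ₗ (oneRight k A P).toLinearMap) t = t * W := by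
  induction t using TensorProduct.induction_on with
  | zero => simp
  | add s t hs ht => simp only [map_add, add_mul, hs, ht]
  | tmul a p => simp [← mul_assoc, oneRight, oneLeft]

end Substitution

theorem Product.Iso.isAlgebra {k V W : Type*} [Field k] [AddCommGroup V] [Module k V]
    [AddCommGroup W] [Module k W] {p : Product k V} {q : Product k W} (h : p.Iso q) (hq : q.IsAlgebra) :
    p.IsAlgebra := by
  obtain ⟨e, h₁, h₂⟩ := h
  constructor
  · intro x y z; apply e.injective; simp only [h₂, hq.assoc]
  · intro x; apply e.injective; rw [h₂, h₁, hq.one_mul]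
  · intro x; apply e.injective; rw [h₂, h₁, hq.mul_one]

namespace RightModuleAlgebra

variable {k K : Type*} [Field k] [Ring K] [Algebra k K] {Q : QuasiBialgebra k K}
  {M : Type*} [AddCommGroup M] [Module k M] (𝓜 : RightModuleAlgebra Q M)
  {A : Type*} [Ring A] [Algebra k A]

/-- `a ⊗ φ ↦ g¹(a) ⊗ φ · g²(a)`, where `g(a) = g¹(a) ⊗ g²(a)`. -/
def evMap (g : A →ₗ[k] A ⊗[k] K) : A ⊗[k] M →ₗ[k] A ⊗[k] M :=
  TensorProduct.lift (𝓜.ev₁ ∘ₗ g)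

@[simp]
theorem evMap_tmul (g : A →ₗ[k] A ⊗[k] K) (a : A) (φ : M) :
    𝓜.evMap g (a ⊗ₜ φ) = 𝓜.ev₁ (g a) φ := by
  simp [evMap]

theorem evMap_ev₁ (g : A →ₗ[k] A ⊗[k] K) (t : A ⊗[k] K) (φ : M) :
    𝓜.evMap g (𝓜.ev₁ t φ) = 𝓜.ev₁ (subst g t) φ := by
  induction t using TensorProduct.induction_on with
  | zero => simp
  | add s t hs ht => simp only [map_add, LinearMap.add_apply, hs, ht]
  | tmul a p =>
    rw [evalAt_tmul, evMap_tmul, LinearMap.id_apply, evalAt_act 𝓜.act_mul, subst_tmul]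
    rfl

/-- This reduces multiplicativity of an evaluation map to an identity of tensors in `A ⊗ K ⊗ K`; the
comultiplication appears because the new action falls on a product. -/
theorem evMap_ev₂ (g : A →ₗ[k] A ⊗[k] K) (t : A ⊗[k] (K ⊗[k] K)) (z : M ⊗[k] M) :
    𝓜.evMap g (𝓜.ev₂ t z) = 𝓜.ev₂ (subst ((onRest k A Q.Δ).toLinearMap ∘ₗ g) t) z := by
  induction t using TensorProduct.induction_on with
  | zero => simp
  | add s t hs ht => simp only [map_add, LinearMap.add_apply, hs, ht]
  | tmul a p =>
    rw [evalAt_tmul, evMap_tmul, ev₁_mul₂, evalAt_act 𝓜.act₂_mul, subst_tmul]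
    rfl

/-- The linear equivalence given by two mutually inverse substitutions. -/
def evEquiv (g g' : A →ₗ[k] A ⊗[k] K) (h : ∀ a, subst g (g' a) = a ⊗ₜ 1)
    (h' : ∀ a, subst g' (g a) = a ⊗ₜ 1) : A ⊗[k] M ≃ₗ[k] A ⊗[k] M :=
  LinearEquiv.ofLinearMap (𝓜.evMap g) (𝓜.evMap g')
    (TensorProduct.ext' fun a φ => by simp [evMap_ev₁, h, act_one])
    (TensorProduct.ext' fun a φ => by simp [evMap_ev₁, h', act_one])

theorem evEquiv_apply (g g' : A →ₗ[k] A ⊗[k] K) (h : ∀ a, subst g (g' a) = a ⊗ₜ 1)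
    (h' : ∀ a, subst g' (g a) = a ⊗ₜ 1) (x : A ⊗[k] M) :
    𝓜.evEquiv g g' h h' x = 𝓜.evMap g x := rfl

/-- Twisting the coaction does not change the smash product. -/
theorem smash_twist_iso (R : RightComoduleAlgebra Q A) {V : (A ⊗[k] K)ˣ}
    (hV : dropLast k A Q.ε (V : A ⊗[k] K) = 1) : (𝓜.smash (R.twist hV)).Iso (𝓜.smash R) := by
  -- The isomorphism is `u ⊗ φ ↦ u V¹ ⊗ φ · V²`, with inverse given by `V⁻¹`. It preserves the unit
  -- because `(id ⊗ ε)(V) = 1`.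
  refine ⟨𝓜.evEquiv (LinearMap.mulRight k (V : A ⊗[k] K) ∘ₗ (oneRight k A K).toLinearMap)
    (LinearMap.mulRight k (↑V⁻¹ : A ⊗[k] K) ∘ₗ (oneRight k A K).toLinearMap)
    (fun a => ?_) (fun a => ?_), ?_, fun x y => ?_⟩
  · rw [subst_mulRight]; simp [oneRight]
  · rw [subst_mulRight]; simp [oneRight]
  · change 𝓜.evMap _ (1 ⊗ₜ 𝓜.one) = 1 ⊗ₜ 𝓜.one
    rw [evMap_tmul, ev₁_one]
    simp [oneRight, ← Algebra.TensorProduct.one_def, hV]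
  · simp only [evEquiv_apply]
    induction x using TensorProduct.induction_on with
    | zero => simp
    | add s t hs ht => simp only [map_add, LinearMap.add_apply, hs, ht]
    | tmul u φ =>
      induction y using TensorProduct.induction_on with
      | zero => simp
      | add s t hs ht => simp only [map_add, hs, ht]
      | tmul u' ψ =>
        rw [smash_mul_tmul, evMap_ev₂, evMap_tmul, evMap_tmul, smash_mul_ev₁]
        congr 2
        have h₁ : (onRest k A Q.Δ).toLinearMap ∘ₗ LinearMap.mulRight k (V : A ⊗[k] K) ∘ₗ
            (oneRight k A K).toLinearMap =
            LinearMap.mulRight k (onRest k A Q.Δ (V : A ⊗[k] K)) ∘ₗ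
              (oneRight k A (K ⊗[k] K)).toLinearMap := by
          refine LinearMap.ext fun a => ?_
          change onRest k A Q.Δ (oneRight k A K a * V) = _ * onRest k A Q.Δ V
          rw [map_mul]
          congr 1
          simp [onRest, oneRight]
        have h₂ : onRest k A Q.Δ (V : A ⊗[k] K) =
            Units.val (place₂ V (A₂ k A K) (star Q.Δ (K₂₁ k A K) (K₂₂ k A K))) := by
          rw [coe_place₂, lift₂_star_standard]
        have h₃ := Intertwines.eq (R.intertwines_twistρ V (A₂ k A K) (K₂₁ k A K)) u'
        rw [h₁, subst_mulRight, h₂, ← lift_standard₃ (RightComoduleAlgebra.smashTensor _ _ _),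
          RightComoduleAlgebra.lift_smashTensor]
        change _ * star (R.twistρ V) _ _ _ * Units.val (place₃ (R.twistΦ V) _ _ _)⁻¹ * _ = _
        rw [R.place_twistΦ, ← lift_standard₃ (Units.val R.Φρ⁻¹), ← coe_place₃_inv]
        simp only [mul_inv_rev, inv_inv, Units.val_mul, LinearMap.comp_apply,
          LinearMap.mulRight_apply, AlgHom.toLinearMap_apply, map_mul, lift₂_oneRight,
          ← coe_place₂, mul_assoc, Units.inv_mul, mul_one]
        rw [← mul_assoc _ (star R.ρ _ _ _), h₃]
        simp only [mul_assoc]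

end RightModuleAlgebra

end QHA
end

/-! ### The elements linking left and right smash products. -/

noncomputable section

namespace QHA

namespace QuasiHopf

variable {k K : Type*} [Field k] [Ring K] [Algebra k K] (Q : QuasiHopf k K)

/-- `x ⊗ y ↦ S⁻¹(S(x) α y) = S⁻¹(y) S⁻¹(α) x`. -/
def contrα' : K ⊗[k] K →ₗ[k] K := Q.Sinv ∘ₗ Q.contrα

/-- `x ⊗ y ↦ S⁻¹(x β S(y)) = y S⁻¹(β) S⁻¹(x)`. -/
def contrβ' : K ⊗[k] K →ₗ[k] K := Q.Sinv ∘ₗ Q.contrβ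

@[simp]
theorem contrα'_tmul (x y : K) : Q.contrα' (x ⊗ₜ y) = Q.Sinv y * Q.Sinv Q.α * x := by
  simp [contrα', Sinv_mul, Sinv_S, mul_assoc]

@[simp]
theorem contrβ'_tmul (x y : K) : Q.contrβ' (x ⊗ₜ y) = y * Q.Sinv Q.β * Q.Sinv x := by
  simp [contrβ', Sinv_mul, Sinv_S, mul_assoc]

theorem contrα'_Δ_mul (h : K) (z : K ⊗[k] K) :
    Q.contrα' (Q.Δ h * z) = Q.ε h • Q.contrα' z := by
  rw [contrα', LinearMap.comp_apply, contrα_Δ_mul, map_smul]; rfl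

theorem S₂inv_contrα₂ (P R : K ⊗[k] K) (z : K ⊗[k] (K ⊗[k] (K ⊗[k] K))) :
    Q.S₂inv (Q.S₂ P * Q.contrα₂ z * R) =
      TensorProduct.map Q.contrα' Q.contrα' (outerFirst z * (lift₂ (pair₁ k K) (pair₃ k K) P *
        lift₂ (pair₄ k K) (pair₂ k K) R)) := by
  induction P using TensorProduct.induction_on with
  | zero => simp
  | add x y hx hy => simp only [map_add, mul_add, add_mul, hx, hy]
  | tmul p p' =>
    induction R using TensorProduct.induction_on with
    | zero => simp
    | add x y hx hy => simp only [map_add, mul_add, hx, hy]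
    | tmul r r' =>
      induction z using tensor_induction₄ with
      | zero => simp
      | add x y hx hy => simp only [map_add, mul_add, add_mul, hx, hy]
      | tmul u v w q => simp [oneLeft, oneRight, Sinv_mul, Sinv_S, mul_assoc]

/-- Conjugation by `f` exchanges `S₂(Δ(S⁻¹(h)))` and `Δ(h)`. This is what absorbs the twist present
in the left product. -/
theorem S₂inv_twist_mul_Δ (r : K ⊗[k] K) (h : K) :
    Q.S₂inv (Q.twist * r) * Q.Δ (Q.Sinv h) = Q.S₂inv (Q.twist * Q.Δ h * r) := by
  apply Q.S₂_injective
  rw [S₂_mul, S₂_Δ_Sinv, S₂_S₂inv, S₂_S₂inv]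
  have e : (↑Q.twistUnit⁻¹ : K ⊗[k] K) * (Q.twist * r) = r := Q.twistUnit.inv_mul_cancel_left r
  rw [mul_assoc, e]

/-- Take `h = S(x) α y` in `S₂inv_twist_mul_Δ`. Then `f Δ(h)` equals `S₂(Δ(x)) γ Δ(y)`, and `γ`
opens into two nested contractions. -/
theorem S₂inv_twist_mul_contrα' (r : K ⊗[k] K) (x y : K) :
    Q.S₂inv (Q.twist * r) * Q.Δ (Q.contrα' (x ⊗ₜ y)) =
      TensorProduct.map Q.contrα' Q.contrα' (outerFirst (Q.nestUnit : K ⊗[k] (K ⊗[k] (K ⊗[k] K))) *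
        (star Q.Δ (pair₁ k K) (pair₃ k K) x *
          (star Q.Δ (pair₄ k K) (pair₂ k K) y * lift₂ (pair₄ k K) (pair₂ k K) r))) := by
  rw [contrα', LinearMap.comp_apply, S₂inv_twist_mul_Δ, contrα_tmul, map_mul Q.Δ, map_mul Q.Δ,
    ← mul_assoc, ← mul_assoc, twist_mul_Δ_S, mul_assoc _ Q.twist, twist_mul_Δ_α, γ_eq,
    mul_assoc _ (Q.Δ y), S₂inv_contrα₂,
    map_mul (lift₂ (pair₄ k K) (pair₂ k K))]
  rfl

end QuasiHopf

namespace RightComoduleAlgebra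

variable {k K : Type*} [Field k] [Ring K] [Algebra k K] (Q : QuasiHopf k K)
  {A : Type*} [Ring A] [Algebra k A] (R : RightComoduleAlgebra Q.toQuasiBialgebra A)

/-- `u ↦ X̃¹ u₀ ⊗ S⁻¹(α X̃³) X̃² u₁`. -/
def shift : A →ₗ[k] A ⊗[k] K :=
  TensorProduct.map LinearMap.id Q.contrα' ∘ₗ LinearMap.mulLeft k (R.Φρ : A ⊗[k] (K ⊗[k] K)) ∘ₗ
    (star R.ρ (A₂ k A K) (K₂₁ k A K)).toLinearMap

/-- `u ↦ u₀ x̃¹ ⊗ x̃³ S⁻¹(u₁ x̃² β)`. -/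
def unshift : A →ₗ[k] A ⊗[k] K :=
  TensorProduct.map LinearMap.id Q.contrβ' ∘ₗ
    LinearMap.mulRight k (↑R.Φρ⁻¹ : A ⊗[k] (K ⊗[k] K)) ∘ₗ
    (star R.ρ (A₂ k A K) (K₂₁ k A K)).toLinearMap

theorem shift_apply (u : A) : R.shift Q u = TensorProduct.map LinearMap.id Q.contrα'
    ((R.Φρ : A ⊗[k] (K ⊗[k] K)) * star R.ρ (A₂ k A K) (K₂₁ k A K) u) := rfl

theorem unshift_apply (u : A) : R.unshift Q u = TensorProduct.map LinearMap.id Q.contrβ'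
    (star R.ρ (A₂ k A K) (K₂₁ k A K) u * (↑R.Φρ⁻¹ : A ⊗[k] (K ⊗[k] K))) := rfl

theorem map_contrα'_mul (t : A ⊗[k] (K ⊗[k] K)) (w : A ⊗[k] K) :
    TensorProduct.map LinearMap.id Q.contrα' (t * lift₂ (A₂ k A K) (K₂₁ k A K) w) =
      TensorProduct.map LinearMap.id Q.contrα' t * w := by
  induction w using TensorProduct.induction_on with
  | zero => simp
  | add x y hx hy => simp only [map_add, mul_add, hx, hy]
  | tmul a p =>
    induction t using tensor_induction₃ with
    | zero => simp
    | add x y hx hy => simp only [map_add, add_mul, hx, hy]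
    | tmul b q r => simp [oneLeft, oneRight, mul_assoc]

/-- The algebra argument enters `shift` only through `ρ` at the right end, so the map is determined
by its value at `1` and is linear over `A` along `ρ`. -/
theorem shift_mul (u u' : A) : R.shift Q (u * u') = R.shift Q u * R.ρ u' := by
  rw [shift_apply, map_mul (star _ _ _), ← mul_assoc, star_apply _ _ _ u', map_contrα'_mul]
  rfl

section Inverse

open QuasiBialgebra

/-- Composing the two substitutions merges a contraction with `β` and one with `α` into the
threefold contraction `S⁻¹(S(·) α · β S(·))`; the comparison with `1` can then be made under one
linear map. -/
theorem subst_shift (t : A ⊗[k] (K ⊗[k] K)) :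
    subst (R.shift Q) (TensorProduct.map LinearMap.id Q.contrβ' t) =
      TensorProduct.map LinearMap.id (Q.Sinv ∘ₗ Q.contrαβ)
        (lift₂ (A₃ k A K) (lift₂ (K₃₁ k A K) (K₃₂ k A K)) R.Φρ *
          lift₂ (star R.ρ (A₃ k A K) (K₃₁ k A K)) (lift₂ (K₃₂ k A K) (K₃₃ k A K)) t) := by
  have h : ∀ (s : A ⊗[k] (K ⊗[k] K)) (w : A ⊗[k] K) (p q : K),
      oneLeft k A K (Q.contrβ' (p ⊗ₜ q)) * TensorProduct.map LinearMap.id Q.contrα'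
        (s * lift₂ (A₂ k A K) (K₂₁ k A K) w) =
      TensorProduct.map LinearMap.id (Q.Sinv ∘ₗ Q.contrαβ)
        (lift₂ (A₃ k A K) (lift₂ (K₃₁ k A K) (K₃₂ k A K)) s *
          (lift₂ (A₃ k A K) (K₃₁ k A K) w * (K₃₂ k A K p * K₃₃ k A K q))) := by
    intro s w p q
    induction w using TensorProduct.induction_on with
    | zero => simp
    | add x y hx hy => simp only [map_add, mul_add, add_mul, hx, hy]
    | tmul b r =>
      induction s using tensor_induction₃ with
      | zero => simp
      | add x y hx hy => simp only [map_add, mul_add, add_mul, hx, hy]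
      | tmul a x y =>
        simp [oneLeft, oneRight, Q.Sinv_mul, Q.Sinv_S, mul_assoc, Algebra.TensorProduct.one_def]
  induction t using tensor_induction₃ with
  | zero => simp
  | add x y hx hy => simp only [map_add, mul_add, hx, hy]
  | tmul a p q =>
    rw [TensorProduct.map_tmul, subst_tmul, shift_apply, star_apply, h, lift₂_tmul, lift₂_tmul]
    rfl

theorem subst_unshift (t : A ⊗[k] (K ⊗[k] K)) :
    subst (R.unshift Q) (TensorProduct.map LinearMap.id Q.contrα' t) =
      TensorProduct.map LinearMap.id (Q.Sinv ∘ₗ Q.contrβα)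
        (lift₂ (star R.ρ (A₃ k A K) (K₃₁ k A K)) (lift₂ (K₃₂ k A K) (K₃₃ k A K)) t *
          Units.val (place₃ R.Φρ (A₃ k A K) (K₃₁ k A K) (K₃₂ k A K))⁻¹) := by
  have h : ∀ (s : A ⊗[k] (K ⊗[k] K)) (w : A ⊗[k] K) (p q : K),
      oneLeft k A K (Q.contrα' (p ⊗ₜ q)) * TensorProduct.map LinearMap.id Q.contrβ'
        (lift₂ (A₂ k A K) (K₂₁ k A K) w * s) =
      TensorProduct.map LinearMap.id (Q.Sinv ∘ₗ Q.contrβα)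
        (lift₂ (A₃ k A K) (K₃₁ k A K) w * (K₃₂ k A K p * K₃₃ k A K q) *
        lift₂ (A₃ k A K) (lift₂ (K₃₁ k A K) (K₃₂ k A K)) s) := by
    intro s w p q
    induction w using TensorProduct.induction_on with
    | zero => simp
    | add x y hx hy => simp only [map_add, mul_add, add_mul, hx, hy]
    | tmul b r =>
      induction s using tensor_induction₃ with
      | zero => simp
      | add x y hx hy => simp only [map_add, mul_add, hx, hy]
      | tmul a x y =>
        simp [oneLeft, oneRight, Q.Sinv_mul, Q.Sinv_S, mul_assoc, Algebra.TensorProduct.one_def]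
  rw [coe_place₃_inv]
  induction t using tensor_induction₃ with
  | zero => simp
  | add x y hx hy => simp only [map_add, add_mul, hx, hy]
  | tmul a p q =>
    rw [TensorProduct.map_tmul, subst_tmul, unshift_apply, star_apply, h, lift₂_tmul, lift₂_tmul]
    rfl

end Inverse

end RightComoduleAlgebra

end QHA
end

/-! ### Mutual inverses and multiplicativity of the linking map. -/

noncomputable section

namespace QHA

theorem lift_star_standard {k A K P B : Type*} [Field k] [Ring A] [Algebra k A] [Ring K]
    [Algebra k K] [Ring P] [Algebra k P] [Ring B] [Algebra k B] (d : P →ₐ[k] A ⊗[k] K)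
    (n : A →ₐ[k] B) (i j : K →ₐ[k] B) [LegComm n i] [LegComm n j] [LegComm i j] (x : P) :
    lift₂ n (lift₂ i j) (star d (A₂ k A K) (K₂₁ k A K) x) = star d n i x := by
  rw [star_apply, lift₂_comp]
  simp only [lift₂_comp_oneRight, lift₂_comp_oneLeft_comp]
  rfl

theorem star_K₃₁₂ {k A K : Type*} [Field k] [Ring A] [Algebra k A] [Ring K] [Algebra k K]
    (Q : QuasiBialgebra k K) (x : K) : star Q.Δ (K₃₁ k A K) (K₃₂ k A K) x =
      oneLeft k _ _ (onRest k K (oneRight k K K) (Q.Δ x)) := by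
  rw [star_apply, lift₂_comp_comp, lift₂_oneRight_comp]; rfl

theorem star_K₃₂₃ {k A K : Type*} [Field k] [Ring A] [Algebra k A] [Ring K] [Algebra k K]
    (Q : QuasiBialgebra k K) (x : K) : star Q.Δ (K₃₂ k A K) (K₃₃ k A K) x =
      oneLeft k _ _ (oneLeft k K (K ⊗[k] K) (Q.Δ x)) := by
  rw [star_apply, lift₂_comp_comp, lift₂_comp_comp, lift₂_oneRight_oneLeft]; rfl

section DoubleLegs

open QuasiHopf

variable (k A K : Type*) [Field k] [Ring A] [Algebra k A] [Ring K] [Algebra k K]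

/-- The standard maps into `A ⊗ (K ⊗ K) ⊗ (K ⊗ K)`. -/
abbrev A₄ : A →ₐ[k] A ⊗[k] ((K ⊗[k] K) ⊗[k] (K ⊗[k] K)) := oneRight k _ _
/-- The standard maps into `A ⊗ (K ⊗ K) ⊗ (K ⊗ K)`. -/
abbrev K₄₁ : K →ₐ[k] A ⊗[k] ((K ⊗[k] K) ⊗[k] (K ⊗[k] K)) := (oneLeft k _ _).comp (pair₁ k K)
/-- The standard maps into `A ⊗ (K ⊗ K) ⊗ (K ⊗ K)`. -/
abbrev K₄₂ : K →ₐ[k] A ⊗[k] ((K ⊗[k] K) ⊗[k] (K ⊗[k] K)) := (oneLeft k _ _).comp (pair₂ k K)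
/-- The standard maps into `A ⊗ (K ⊗ K) ⊗ (K ⊗ K)`. -/
abbrev K₄₃ : K →ₐ[k] A ⊗[k] ((K ⊗[k] K) ⊗[k] (K ⊗[k] K)) := (oneLeft k _ _).comp (pair₃ k K)
/-- The standard maps into `A ⊗ (K ⊗ K) ⊗ (K ⊗ K)`. -/
abbrev K₄₄ : K →ₐ[k] A ⊗[k] ((K ⊗[k] K) ⊗[k] (K ⊗[k] K)) := (oneLeft k _ _).comp (pair₄ k K)

end DoubleLegs

namespace RightComoduleAlgebra

variable {k K : Type*} [Field k] [Ring K] [Algebra k K] (Q : QuasiHopf k K)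
  {A : Type*} [Ring A] [Algebra k A] (R : RightComoduleAlgebra Q.toQuasiBialgebra A)

theorem Sinv_comp_smul {U : Type*} [AddCommGroup U] [Module k U] {c : U →ₗ[k] K} {e : k} {x y : U}
    (h : c x = e • c y) : (Q.Sinv ∘ₗ c) x = e • (Q.Sinv ∘ₗ c) y := by
  rw [LinearMap.comp_apply, h, map_smul]; rfl

/-- After collapsing, `u` loses its coaction and the only reassociator left is `Φ⁻¹` in the three
`K`-legs; its contraction is `S⁻¹(S(x¹) α x² β S(x³)) = 1`. The opposite composite ends with `X¹ β
S(X²) α X³ = 1`. -/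
theorem subst_shift_unshift (u : A) : subst (R.shift Q) (R.unshift Q u) = u ⊗ₜ 1 := by
  let c := TensorProduct.map (LinearMap.id : A →ₗ[k] A) (Q.Sinv ∘ₗ Q.contrαβ)
  have _ : Collapse c true (star Q.Δ (K₃₁ k A K) (K₃₂ k A K)) (star Q.Δ (K₃₁ k A K) (K₃₂ k A K))
      (triv _ Q.ε) := Collapse.of_left c _ _ fun t z => by
    rw [star_K₃₁₂]
    exact map_oneLeft_mul _ _ (fun z => Sinv_comp_smul Q
      ((Q.triple.leftPair.mulRight Q.β).tail _ t z)) z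
  have _ : Collapse c false (star Q.Δ (K₃₂ k A K) (K₃₃ k A K)) (star Q.Δ (K₃₂ k A K) (K₃₃ k A K))
      (triv _ Q.ε) := Collapse.of_right c _ _ fun t z => by
    rw [star_K₃₂₃]
    exact map_mul_oneLeft _ _ (fun z => Sinv_comp_smul Q
      (mulMap_mul_oneLeft _ _ (Q.contrβ_mul_Δ t) z)) z
  rw [unshift_apply, subst_shift, map_mul (lift₂ _ _), lift_star_standard, ← coe_place₃, ← coe_place₃_inv,
    ← mul_assoc, Intertwines.eq (b := place₃ R.Φρ (A₃ k A K) (K₃₁ k A K) (K₃₂ k A K))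
      (i' := star R.ρ (A₃ k A K) (star Q.Δ (K₃₁ k A K) (K₃₂ k A K))) inferInstance, mul_assoc,
    ← Units.val_mul]
  -- The pentagon trades two copies of `Φ_ρ` for `Φ⁻¹` flanked by copies with a combined leg, which
  -- collapse at the two ends.
  have e : place₃ R.Φρ (A₃ k A K) (K₃₁ k A K) (K₃₂ k A K) *
      (place₃ R.Φρ (star R.ρ (A₃ k A K) (K₃₁ k A K)) (K₃₂ k A K) (K₃₃ k A K))⁻¹ =
      (place₃ R.Φρ (A₃ k A K) (star Q.Δ (K₃₁ k A K) (K₃₂ k A K)) (K₃₃ k A K))⁻¹ *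
        ((place₃ Q.Φ (K₃₁ k A K) (K₃₂ k A K) (K₃₃ k A K))⁻¹ *
          place₃ R.Φρ (A₃ k A K) (K₃₁ k A K) (star Q.Δ (K₃₂ k A K) (K₃₃ k A K))) := by
    rw [mul_inv_eq_iff_eq_mul, mul_assoc, mul_assoc, ← R.pentagon_ρ]
    simp only [mul_assoc, inv_mul_cancel_left]
  rw [e, Units.val_mul, Units.val_mul, ← mul_assoc]
  change c _ = _
  have h₁ := (Collapse.rel (c := c) (s := true) (a := star Q.Δ (K₃₁ k A K) (K₃₂ k A K))
    (i := star R.ρ (A₃ k A K) (star Q.Δ (K₃₁ k A K) (K₃₂ k A K)))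
    (i' := star R.ρ (A₃ k A K) (triv _ Q.ε)) u).mul
    (collapse_place₃_inv c true (star Q.Δ (K₃₁ k A K) (K₃₂ k A K)) R.Φρ (A₃ k A K) (A₃ k A K)
      (star Q.Δ (K₃₁ k A K) (K₃₂ k A K)) (triv _ Q.ε) (K₃₃ k A K) (K₃₃ k A K))
  have h₂ := collapse_place₃ c false (star Q.Δ (K₃₂ k A K) (K₃₃ k A K)) R.Φρ (A₃ k A K)
    (A₃ k A K) (K₃₁ k A K) (K₃₁ k A K) (star Q.Δ (K₃₂ k A K) (K₃₃ k A K)) (triv _ Q.ε)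
  have h₃ : Q.contrαβ (↑Q.Φ⁻¹ : K ⊗[k] (K ⊗[k] K)) = 1 := Q.antipode_Φ_inv
  rw [h₁.eval_left, R.place_triv_mid, R.star_triv, inv_one, Units.val_one, mul_one, ← mul_assoc,
    h₂.eval_right, R.place_triv_right, Units.val_one, mul_one, coe_place₃_inv]
  simp only [lift₂_comp_comp, lift₂_oneRight_oneLeft, AlgHom.comp_id]
  simp [c, oneLeft, oneRight, h₃, Q.Sinv_one]

theorem subst_unshift_shift (u : A) : subst (R.unshift Q) (R.shift Q u) = u ⊗ₜ 1 := by
  let c := TensorProduct.map (LinearMap.id : A →ₗ[k] A) (Q.Sinv ∘ₗ Q.contrβα)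
  have _ : Collapse c true (star Q.Δ (K₃₂ k A K) (K₃₃ k A K)) (star Q.Δ (K₃₂ k A K) (K₃₃ k A K))
      (triv _ Q.ε) := Collapse.of_left c _ _ fun t z => by
    rw [star_K₃₂₃]
    exact map_oneLeft_mul _ _ (fun z => Sinv_comp_smul Q
      (mulMap_oneLeft_mul _ _ (Q.contrα_Δ_mul t) z)) z
  have _ : Collapse c false (star Q.Δ (K₃₁ k A K) (K₃₂ k A K)) (star Q.Δ (K₃₁ k A K) (K₃₂ k A K))
      (triv _ Q.ε) := Collapse.of_right c _ _ fun t z => by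
    rw [star_K₃₁₂]
    exact map_mul_oneLeft _ _ (fun z => Sinv_comp_smul Q
      ((Q.triple.rightPair.mulRight Q.α).tail _ t z)) z
  rw [shift_apply, subst_unshift, map_mul (lift₂ _ _), lift_star_standard, ← coe_place₃, mul_assoc,
    ← Intertwines.eq (b := (place₃ R.Φρ (A₃ k A K) (K₃₁ k A K) (K₃₂ k A K))⁻¹)
      (i := star R.ρ (A₃ k A K) (star Q.Δ (K₃₁ k A K) (K₃₂ k A K))) inferInstance, ← mul_assoc,
    ← Units.val_mul]
  have e : place₃ R.Φρ (star R.ρ (A₃ k A K) (K₃₁ k A K)) (K₃₂ k A K) (K₃₃ k A K) *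
      (place₃ R.Φρ (A₃ k A K) (K₃₁ k A K) (K₃₂ k A K))⁻¹ =
      (place₃ R.Φρ (A₃ k A K) (K₃₁ k A K) (star Q.Δ (K₃₂ k A K) (K₃₃ k A K)))⁻¹ *
        (place₃ Q.Φ (K₃₁ k A K) (K₃₂ k A K) (K₃₃ k A K) *
          place₃ R.Φρ (A₃ k A K) (star Q.Δ (K₃₁ k A K) (K₃₂ k A K)) (K₃₃ k A K)) := by
    rw [mul_inv_eq_iff_eq_mul, mul_assoc, R.pentagon_ρ]
    simp only [inv_mul_cancel_left]
  rw [e, Units.val_mul, Units.val_mul, mul_assoc, mul_assoc]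
  change c _ = _
  have h₁ := collapse_place₃_inv c true (star Q.Δ (K₃₂ k A K) (K₃₃ k A K)) R.Φρ (A₃ k A K)
    (A₃ k A K) (K₃₁ k A K) (K₃₁ k A K) (star Q.Δ (K₃₂ k A K) (K₃₃ k A K)) (triv _ Q.ε)
  have h₂ := (collapse_place₃ c false (star Q.Δ (K₃₁ k A K) (K₃₂ k A K)) R.Φρ (A₃ k A K)
      (A₃ k A K) (star Q.Δ (K₃₁ k A K) (K₃₂ k A K)) (triv _ Q.ε) (K₃₃ k A K) (K₃₃ k A K)).mul
    (Collapse.rel (c := c) (s := false) (a := star Q.Δ (K₃₁ k A K) (K₃₂ k A K))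
    (i := star R.ρ (A₃ k A K) (star Q.Δ (K₃₁ k A K) (K₃₂ k A K)))
    (i' := star R.ρ (A₃ k A K) (triv _ Q.ε)) u)
  have h₃ : Q.contrβα (Q.Φ : K ⊗[k] (K ⊗[k] K)) = 1 := Q.antipode_Φ
  rw [h₁.eval_left, R.place_triv_right, inv_one, Units.val_one, one_mul,
    h₂.eval_right, R.place_triv_mid, R.star_triv, Units.val_one, one_mul, coe_place₃]
  simp only [lift₂_comp_comp, lift₂_oneRight_oneLeft, AlgHom.comp_id]
  simp [c, oneLeft, oneRight, h₃, Q.Sinv_one]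

section Double

open QuasiHopf

variable (A) in
/-- `a ⊗ z ⊗ w ↦ a ⊗ contrα'(z) ⊗ contrα'(w)`. -/
def contrPair : A ⊗[k] ((K ⊗[k] K) ⊗[k] (K ⊗[k] K)) →ₗ[k] A ⊗[k] (K ⊗[k] K) :=
  TensorProduct.map LinearMap.id (TensorProduct.map Q.contrα' Q.contrα')

theorem contrPair_mul (X Z : A ⊗[k] (K ⊗[k] K)) (b : A ⊗[k] (K ⊗[k] K)) :
    contrPair Q A (lift₂ (A₄ k A K) (lift₂ (K₄₁ k A K) (K₄₂ k A K)) X *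
      lift₂ (star R.ρ (A₄ k A K) (K₄₁ k A K)) (lift₂ (K₄₃ k A K) (K₄₄ k A K)) Z *
      lift₂ (A₄ k A K) (lift₂ (K₄₁ k A K) (K₄₃ k A K)) b) =
    lift₂ (A₂ k A K) (K₂₁ k A K) (TensorProduct.map LinearMap.id Q.contrα' X) *
      lift₂ (star R.ρ (A₂ k A K) (K₂₁ k A K)) (K₂₂ k A K)
        (TensorProduct.map LinearMap.id Q.contrα' Z) * b := by
  induction Z using tensor_induction₃ with
  | zero => simp
  | add x y hx hy => simp only [map_add, mul_add, add_mul, hx, hy]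
  | tmul z r s =>
    rw [TensorProduct.map_tmul, LinearMap.id_apply, lift₂_tmul, lift₂_tmul, lift₂_tmul,
      star_apply, star_apply]
    generalize R.ρ z = w
    induction w using TensorProduct.induction_on with
    | zero => simp
    | add x y hx hy => simp only [map_add, mul_add, add_mul, hx, hy]
    | tmul ζ t =>
      induction X using tensor_induction₃ with
      | zero => simp
      | add x y hx hy => simp only [map_add, add_mul, hx, hy]
      | tmul x p q =>
        induction b using tensor_induction₃ with
        | zero => simp
        | add x y hx hy => simp only [map_add, mul_add, hx, hy]
        | tmul b₁ b₂ b₃ => simp [contrPair, oneLeft, oneRight, mul_assoc]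

/-- The twist turns the comultiplied contraction into a pair of contractions at the cost of a `nest`
factor, which will be cancelled by the comodule pentagon. -/
theorem contrPair_nest (T : A ⊗[k] (K ⊗[k] K)) (r : K ⊗[k] K) :
    oneLeft k A (K ⊗[k] K) (Q.S₂inv (Q.twist * r)) *
        onRest k A Q.Δ (TensorProduct.map LinearMap.id Q.contrα' T) =
      contrPair Q A (Q.nest (K₄₁ k A K) (K₄₃ k A K) (K₄₄ k A K) (K₄₂ k A K) *
        lift₂ (A₄ k A K) (lift₂ (star Q.Δ (K₄₁ k A K) (K₄₃ k A K))
          (star Q.Δ (K₄₄ k A K) (K₄₂ k A K))) T * lift₂ (K₄₄ k A K) (K₄₂ k A K) r) := by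
  induction T using tensor_induction₃ with
  | zero => simp
  | add x y hx hy => simp only [map_add, mul_add, add_mul, hx, hy]
  | tmul t x y =>
    rw [QuasiBialgebra.coe_nest, lift₂_tmul, lift₂_tmul]
    simp only [lift₂_comp_comp, star_comp_comp, AlgHom.comp_apply]
    have h := Q.S₂inv_twist_mul_contrα' r x y
    simp only [contrPair, onRest, oneLeft, oneRight, TensorProduct.map_tmul, LinearMap.id_apply,
      Algebra.TensorProduct.map_tmul, AlgHom.id_apply, Algebra.TensorProduct.includeLeft_apply,
      Algebra.TensorProduct.includeRight_apply, Algebra.TensorProduct.tmul_mul_tmul, one_mul,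
      mul_one, mul_assoc] at h ⊢
    rw [h]

/-- The tensor `ω¹ u₀ u' ⊗ ω³ ⊗ S⁻¹(u₁) ω²`, where `ω = (id ⊗ S⁻¹ ⊗ S⁻¹)((1 ⊗ f) Φ_ρ)`. -/
def leftTensor (u u' : A) : A ⊗[k] (K ⊗[k] K) :=
  TensorProduct.map LinearMap.id Q.S₂inv (oneLeft k A (K ⊗[k] K) Q.twist *
    (R.Φρ : A ⊗[k] (K ⊗[k] K)) * star R.ρ (A₂ k A K) (K₂₁ k A K) u) * A₂ k A K u'

theorem subst_shift₂_mul (t : A ⊗[k] (K ⊗[k] K)) (u : A) :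
    subst ((onRest k A Q.Δ).toLinearMap ∘ₗ R.shift Q) (t * A₂ k A K u) =
      subst ((onRest k A Q.Δ).toLinearMap ∘ₗ R.shift Q) t *
        star R.ρ (A₂ k A K) (star Q.Δ (K₂₁ k A K) (K₂₂ k A K)) u := by
  induction t using TensorProduct.induction_on with
  | zero => simp
  | add x y hx hy => simp only [map_add, add_mul, hx, hy]
  | tmul a p =>
    have h : (a ⊗ₜ[k] p) * A₂ k A K u = (a * u) ⊗ₜ[k] p := by simp [oneRight]
    have h' : onRest k A Q.Δ (R.ρ u) =
        star R.ρ (A₂ k A K) (star Q.Δ (K₂₁ k A K) (K₂₂ k A K)) u := by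
      rw [star_apply, lift₂_star_standard]
    rw [h, subst_tmul, subst_tmul, LinearMap.comp_apply, LinearMap.comp_apply, shift_mul,
      AlgHom.toLinearMap_apply, AlgHom.toLinearMap_apply, map_mul (onRest k A Q.Δ), h', mul_assoc]

theorem subst_shift₂_map (y : A ⊗[k] (K ⊗[k] K)) :
    subst ((onRest k A Q.Δ).toLinearMap ∘ₗ R.shift Q)
        (TensorProduct.map LinearMap.id Q.S₂inv (oneLeft k A (K ⊗[k] K) Q.twist * y)) =
      contrPair Q A (Q.nest (K₄₁ k A K) (K₄₃ k A K) (K₄₄ k A K) (K₄₂ k A K) *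
        place₃ R.Φρ (A₄ k A K) (star Q.Δ (K₄₁ k A K) (K₄₃ k A K))
          (star Q.Δ (K₄₄ k A K) (K₄₂ k A K)) *
        lift₂ (star R.ρ (A₄ k A K) (star Q.Δ (K₄₁ k A K) (K₄₃ k A K)))
          (lift₂ (K₄₄ k A K) (K₄₂ k A K)) y) := by
  induction y using TensorProduct.induction_on with
  | zero => simp
  | add x y hx hy => simp only [map_add, mul_add, hx, hy]
  | tmul a r =>
    have h : oneLeft k A (K ⊗[k] K) Q.twist * (a ⊗ₜ r) = a ⊗ₜ (Q.twist * r) := by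
      simp [oneLeft]
    rw [h, TensorProduct.map_tmul, subst_tmul, LinearMap.comp_apply, AlgHom.toLinearMap_apply,
      shift_apply, contrPair_nest, map_mul (lift₂ _ _), lift_star_standard, lift₂_tmul, coe_place₃]
    simp only [mul_assoc]
    rfl

/-- This is multiplicativity of the linking map at the level of tensors. The left side produces
`nest` and two copies of `Φ_ρ`; `nest_mul` rewrites them so that the pair `3 4`, contracted by `S(·)
α ·`, can be absorbed. The remaining word is the product of the two shifted elements in the smash
product. -/
theorem subst_shift_leftTensor (u u' : A) :
    subst ((onRest k A Q.Δ).toLinearMap ∘ₗ R.shift Q) (R.leftTensor Q u u') =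
      lift₂ (A₂ k A K) (K₂₁ k A K) (R.shift Q u) *
        lift₂ (star R.ρ (A₂ k A K) (K₂₁ k A K)) (K₂₂ k A K) (R.shift Q u') *
        (↑R.Φρ⁻¹ : A ⊗[k] (K ⊗[k] K)) := by
  rw [leftTensor, subst_shift₂_mul, mul_assoc (oneLeft k _ _ _), subst_shift₂_map,
    map_mul (lift₂ _ _), lift_star_standard, ← coe_place₃]
  have e₂ := Intertwines.eq (b := (place₃ R.Φρ (A₄ k A K) (K₄₁ k A K) (K₄₃ k A K))⁻¹)
    (i := star R.ρ (star R.ρ (A₄ k A K) (star Q.Δ (K₄₁ k A K) (K₄₃ k A K))) (K₄₄ k A K))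
    (i' := star R.ρ (star R.ρ (star R.ρ (A₄ k A K) (K₄₁ k A K)) (K₄₃ k A K)) (K₄₄ k A K))
    inferInstance u
  have e₃ := Intertwines.eq
    (b := place₃ R.Φρ (star R.ρ (A₄ k A K) (K₄₁ k A K)) (K₄₃ k A K) (K₄₄ k A K))
    (i := star R.ρ (star R.ρ (star R.ρ (A₄ k A K) (K₄₁ k A K)) (K₄₃ k A K)) (K₄₄ k A K))
    (i' := star R.ρ (star R.ρ (A₄ k A K) (K₄₁ k A K)) (star Q.Δ (K₄₃ k A K) (K₄₄ k A K)))
    inferInstance u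
  have _ : Collapse (contrPair Q A) true (star Q.Δ (K₄₃ k A K) (K₄₄ k A K))
      (star Q.Δ (K₄₃ k A K) (K₄₄ k A K)) (triv _ Q.ε) := Collapse.of_left _ _ _ fun t z => by
    rw [star_comp_comp, AlgHom.comp_apply, star_pair₃₄]
    exact map_oneLeft_mul _ _ (fun z => map_oneLeft_mul _ _ (Q.contrα'_Δ_mul t) z) z
  -- After `nest_mul` the iterated coaction of `u` stands at the right end. It is moved to the left
  -- past two reassociators, so that it too carries `3 4` only as a combined leg.
  have e : ↑(Q.nest (K₄₁ k A K) (K₄₃ k A K) (K₄₄ k A K) (K₄₂ k A K)) *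
        ↑(place₃ R.Φρ (A₄ k A K) (star Q.Δ (K₄₁ k A K) (K₄₃ k A K))
          (star Q.Δ (K₄₄ k A K) (K₄₂ k A K))) *
        (↑(place₃ R.Φρ (star R.ρ (A₄ k A K) (star Q.Δ (K₄₁ k A K) (K₄₃ k A K))) (K₄₄ k A K)
          (K₄₂ k A K)) *
        star R.ρ (star R.ρ (A₄ k A K) (star Q.Δ (K₄₁ k A K) (K₄₃ k A K))) (K₄₄ k A K) u) =
      ↑(place₃ R.Φρ (A₄ k A K) (star Q.Δ (K₄₁ k A K) (star Q.Δ (K₄₃ k A K) (K₄₄ k A K)))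
          (K₄₂ k A K)) *
        ↑(place₃ R.Φρ (A₄ k A K) (K₄₁ k A K) (star Q.Δ (K₄₃ k A K) (K₄₄ k A K))) *
        star R.ρ (star R.ρ (A₄ k A K) (K₄₁ k A K)) (star Q.Δ (K₄₃ k A K) (K₄₄ k A K)) u *
        (↑(place₃ R.Φρ (star R.ρ (A₄ k A K) (K₄₁ k A K)) (K₄₃ k A K) (K₄₄ k A K)) *
        Units.val (place₃ R.Φρ (A₄ k A K) (K₄₁ k A K) (K₄₃ k A K))⁻¹) := by
    rw [← mul_assoc, ← Units.val_mul, ← Units.val_mul, ← Units.val_mul,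
      eq_mul_inv_iff_mul_eq.mpr (R.nest_mul (A₄ k A K) (K₄₁ k A K) (K₄₃ k A K) (K₄₄ k A K)
        (K₄₂ k A K)), Units.val_mul, mul_assoc, e₂, Units.val_mul, Units.val_mul]
    simp only [mul_assoc]
    rw [← mul_assoc _ (star R.ρ _ _ u), e₃]
    simp only [mul_assoc]
  -- Absorbing `3 4` leaves `Φ_ρ ρ(u)` in the legs `1, 2`, the data of `shift u`, and `Φ_ρ` in the
  -- legs `3, 4`, the data of `shift u'` before `ρ(u')` is restored.
  have h := ((collapse_place₃ (contrPair Q A) true (star Q.Δ (K₄₃ k A K) (K₄₄ k A K)) R.Φρ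
      (A₄ k A K) (A₄ k A K) (star Q.Δ (K₄₁ k A K) (star Q.Δ (K₄₃ k A K) (K₄₄ k A K)))
      (star Q.Δ (K₄₁ k A K) (triv _ Q.ε)) (K₄₂ k A K) (K₄₂ k A K)).mul
    (collapse_place₃ (contrPair Q A) true (star Q.Δ (K₄₃ k A K) (K₄₄ k A K)) R.Φρ
      (A₄ k A K) (A₄ k A K) (K₄₁ k A K) (K₄₁ k A K) (star Q.Δ (K₄₃ k A K) (K₄₄ k A K))
      (triv _ Q.ε))).mul
    (Collapse.rel (c := contrPair Q A) (s := true) (a := star Q.Δ (K₄₃ k A K) (K₄₄ k A K))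
    (i := star R.ρ (star R.ρ (A₄ k A K) (K₄₁ k A K)) (star Q.Δ (K₄₃ k A K) (K₄₄ k A K)))
    (i' := star R.ρ (star R.ρ (A₄ k A K) (K₄₁ k A K)) (triv _ Q.ε)) u)
  have hX : lift₂ (A₄ k A K) (lift₂ (K₄₁ k A K) (K₄₂ k A K))
      ((R.Φρ : A ⊗[k] (K ⊗[k] K)) * star R.ρ (A₂ k A K) (K₂₁ k A K) u) =
      ↑(place₃ R.Φρ (A₄ k A K) (K₄₁ k A K) (K₄₂ k A K)) *
        star R.ρ (A₄ k A K) (K₄₁ k A K) u := by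
    rw [map_mul (lift₂ _ _), lift_star_standard, coe_place₃]
  have h₁ : R.shift Q u' = TensorProduct.map LinearMap.id Q.contrα'
      (R.Φρ : A ⊗[k] (K ⊗[k] K)) * R.ρ u' := by
    rw [shift_apply, star_apply, map_contrα'_mul]
  have h₂ := Intertwines.eq (b := (place₃ R.Φρ (A₂ k A K) (K₂₁ k A K) (K₂₂ k A K))⁻¹)
    (i := star R.ρ (A₂ k A K) (star Q.Δ (K₂₁ k A K) (K₂₂ k A K)))
    (i' := star R.ρ (star R.ρ (A₂ k A K) (K₂₁ k A K)) (K₂₂ k A K)) inferInstance u'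
  have h₃ : Units.val (place₃ R.Φρ (A₂ k A K) (K₂₁ k A K) (K₂₂ k A K))⁻¹ =
      (↑R.Φρ⁻¹ : A ⊗[k] (K ⊗[k] K)) := by
    rw [coe_place₃_inv]
    simp only [lift₂_comp_comp, lift₂_oneRight_oneLeft, AlgHom.comp_id]
    rfl
  rw [e, h.eval_left]
  simp only [Q.star_triv_right]
  rw [R.place_triv_right, R.star_triv, Units.val_one, mul_one, ← hX, coe_place₃, ← mul_assoc, coe_place₃_inv, contrPair_mul, mul_assoc, ← h₃, h₂, h₁,
    map_mul (lift₂ (star _ _ _) _), star_apply _ _ (K₂₂ k A K) u', shift_apply]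
  simp only [mul_assoc]

end Double

end RightComoduleAlgebra

end QHA
end

/-! ### The left smash product and its isomorphism with the right one. -/

noncomputable section

namespace QHA

section LeftSmash

variable {k K : Type*} [Field k] [Ring K] [Algebra k K] {Q : QuasiHopf k K}
  {A : Type*} [Ring A] [Algebra k A] (R : RightComoduleAlgebra Q.toQuasiBialgebra A)
  {M : Type*} [AddCommGroup M] [Module k M]

/-- Under `ε` the contraction of `X̃² ⊗ X̃³` becomes `ε(X̃²) ε(X̃³)`, since `ε(S⁻¹(α)) = 1`, and
`Φ_ρ` with trivial last legs is `1`. Hence the linking map preserves units. -/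
theorem RightComoduleAlgebra.dropLast_shift_one : dropLast k A Q.ε (R.shift Q 1) = 1 := by
  have h : ∀ t : A ⊗[k] (K ⊗[k] K), dropLast k A Q.ε (TensorProduct.map LinearMap.id Q.contrα' t) =
      lift₂ (AlgHom.id k A) (lift₂ (triv A Q.ε) (triv A Q.ε)) t := by
    intro t
    induction t using tensor_induction₃ with
    | zero => simp
    | add x y hx hy => simp only [map_add, hx, hy]
    | tmul a p q =>
      have hα : Q.ε (Q.Sinv Q.α) = 1 := by rw [Q.ε_Sinv, Q.ε_α]
      have hc : Q.ε (Q.contrα' (p ⊗ₜ q)) = Q.ε p * Q.ε q := by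
        rw [Q.contrα'_tmul, map_mul, map_mul, hα, Q.ε_Sinv, mul_one, mul_comm]
      rw [TensorProduct.map_tmul, lift₂_tmul, lift₂_tmul, triv_apply, triv_apply, ← map_mul, ← hc]
      exact DFunLike.congr_fun (lift₂_comp_dropLast (AlgHom.id k A) Q.ε) (a ⊗ₜ Q.contrα' (p ⊗ₜ q))
        |>.trans (lift₂_tmul _ _ _ _)
  rw [R.shift_apply, map_one, mul_one, h, ← coe_place₃, R.place_triv_right, Units.val_one]

namespace RightModuleAlgebra

variable (𝓜 : RightModuleAlgebra Q.toQuasiBialgebra M)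

/-- The left generalized smash product of a right comodule algebra and a right module algebra:
`(φ ⊗ u)(ψ ⊗ u') = (φ · ω³)(ψ · S⁻¹(u₁) ω²) ⊗ ω¹ u₀ u'`. -/
def leftSmash : Product k (M ⊗[k] A) where
  mul := productMA 𝓜.act 𝓜.mul (LinearMap.mk₂ k (R.leftTensor Q)
    (fun u v u' => by simp only [RightComoduleAlgebra.leftTensor, map_add, mul_add, add_mul])
    (fun t u u' => by
      simp only [RightComoduleAlgebra.leftTensor, map_smul, mul_smul_comm, smul_mul_assoc])
    (fun u u' v' => by simp only [RightComoduleAlgebra.leftTensor, map_add, mul_add])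
    (fun t u u' => by simp only [RightComoduleAlgebra.leftTensor, map_smul, mul_smul_comm]))
  one := 𝓜.one ⊗ₜ 1

theorem leftSmash_mul_tmul (φ ψ : M) (u u' : A) :
    (𝓜.leftSmash R).mul (φ ⊗ₜ u) (ψ ⊗ₜ u') =
      TensorProduct.comm k A M (𝓜.ev₂ (R.leftTensor Q u u') (φ ⊗ₜ ψ)) := by
  simp only [leftSmash, productMA, TensorProduct.curry_apply, LinearMap.comp_apply,
    LinearEquiv.coe_coe, TensorProduct.tensorTensorTensorComm_tmul, TensorProduct.map_tmul,
    TensorProduct.comm_tmul, TensorProduct.lift.tmul, LinearMap.id_apply]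
  rfl

/-- The linking map followed by its inverse property needs no associativity of the left product;
associativity of that product is obtained afterwards by transport. -/
theorem leftSmash_iso : (𝓜.leftSmash R).Iso (𝓜.smash R) := by
  refine ⟨(TensorProduct.comm k M A).trans (𝓜.evEquiv (R.shift Q) (R.unshift Q)
    (R.subst_shift_unshift Q) (R.subst_unshift_shift Q)), ?_, fun x y => ?_⟩
  · change 𝓜.evMap _ (1 ⊗ₜ 𝓜.one) = 1 ⊗ₜ 𝓜.one
    rw [evMap_tmul, ev₁_one, R.dropLast_shift_one]
  · simp only [LinearEquiv.trans_apply, evEquiv_apply]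
    induction x using TensorProduct.induction_on with
    | zero => simp
    | add s t hs ht => simp only [map_add, LinearMap.add_apply, hs, ht]
    | tmul φ u =>
      induction y using TensorProduct.induction_on with
      | zero => simp
      | add s t hs ht => simp only [map_add, hs, ht]
      | tmul ψ u' =>
        rw [leftSmash_mul_tmul, TensorProduct.comm_tmul, TensorProduct.comm_tmul, evMap_tmul,
          evMap_tmul, smash_mul_ev₁, ← R.subst_shift_leftTensor Q, ← evMap_ev₂,
          TensorProduct.comm_comm]

end RightModuleAlgebra

end LeftSmash

end QHA
end

/-! ### Legs for the quasi-Hopf algebra `Hᵒᵖ ⊗ H`. -/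

noncomputable section

namespace QHA

open QuasiBialgebra QuasiHopf MulOpposite

section OppositeLegs

variable {k H : Type*} [Field k] [Ring H] [Algebra k H] (Q : QuasiHopf k H)
  {A : Type*} [Ring A] [Algebra k A] {B : Type*} [Ring B] [Algebra k B]

/-- The map `h ↦ i(S⁻¹(h) ⊗ 1)`, for `i : Hᵒᵖ ⊗ H → B`. -/
def sleg (i : Hᵐᵒᵖ ⊗[k] H →ₐ[k] B) : H →ₐ[k] B := (resFst i).comp Q.SinvOp

variable (n : A →ₐ[k] B) (i j l : Hᵐᵒᵖ ⊗[k] H →ₐ[k] B)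

theorem SinvOp_apply (h : H) : Q.SinvOp h = op (Q.Sinv h) := rfl

theorem sleg_apply (h : H) : sleg Q i h = resFst i (op (Q.Sinv h)) := rfl

instance sleg_left [LegComm n i] : LegComm (sleg Q i) n where
  comm _ y := (LegComm.comm (i := n) (j := i) y _).symm

instance sleg_right [LegComm n i] : LegComm n (sleg Q i) where
  comm x _ := LegComm.comm (i := n) (j := i) x _

instance sleg_sleg [LegComm i j] : LegComm (sleg Q j) (sleg Q i) where
  comm _ _ := (LegComm.comm (i := i) (j := j) _ _).symm

instance sleg_resSnd : LegComm (sleg Q i) (resSnd i) where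
  comm _ y := LegComm.comm (i := oneRight k Hᵐᵒᵖ H) (j := oneLeft k Hᵐᵒᵖ H) _ y |>.map i

instance sleg_resSnd_left [LegComm i j] : LegComm (sleg Q i) (resSnd j) where
  comm _ _ := LegComm.comm (i := i) (j := j) _ _

instance sleg_resSnd_right [LegComm i j] : LegComm (sleg Q j) (resSnd i) where
  comm _ _ := (LegComm.comm (i := i) (j := j) _ _).symm

section

variable [LegComm n i] [LegComm n j] [LegComm n l] [LegComm i j] [LegComm i l] [LegComm j l]

theorem lift_toRightCoaction (t : H ⊗[k] (A ⊗[k] H)) :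
    lift₂ n i (toRightCoaction Q A t) = lift₂ (sleg Q i) (lift₂ n (resSnd i)) t := by
  induction t using tensor_induction₃ with
  | zero => simp
  | add x y hx hy => simp only [map_add, hx, hy]
  | tmul h a h' =>
    have e : toRightCoaction Q A (h ⊗ₜ (a ⊗ₜ h')) = a ⊗ₜ (op (Q.Sinv h) ⊗ₜ h') := by
      simp [toRightCoaction, onRest, SinvOp_apply]
    have e' : (op (Q.Sinv h) ⊗ₜ[k] h' : Hᵐᵒᵖ ⊗[k] H) =
        oneRight k Hᵐᵒᵖ H (op (Q.Sinv h)) * oneLeft k Hᵐᵒᵖ H h' := by simp [oneRight, oneLeft]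
    rw [e, lift₂_tmul, lift₂_tmul, lift₂_tmul, e', map_mul, ← mul_assoc, ← mul_assoc]
    exact congrArg (· * _) (LegComm.comm (i := sleg Q i) (j := n) h a).eq.symm

/-- The two left-hand legs appear in reversed order, `j` before `i`, because `S⁻¹` reverses the
coproduct: this is where the outer and inner positions of the two-sided coaction become the second
and first copies of `Hᵒᵖ ⊗ H`. -/
theorem lift_toReassociator (t : H ⊗[k] (H ⊗[k] (A ⊗[k] (H ⊗[k] H)))) :
    lift₂ n (lift₂ i j) (toReassociator Q A t) =
      lift₂ (sleg Q j) (lift₂ (sleg Q i) (lift₂ n (lift₂ (resSnd i) (resSnd j)))) t := by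
  induction t using TensorProduct.induction_on with
  | zero => simp
  | add x y hx hy => simp only [map_add, hx, hy]
  | tmul p t =>
    induction t using tensor_induction₄ with
    | zero => simp
    | add x y hx hy => simp only [TensorProduct.tmul_add, map_add, hx, hy]
    | tmul q a r t =>
      have e : toReassociator Q A (p ⊗ₜ (q ⊗ₜ (a ⊗ₜ (r ⊗ₜ t)))) =
          a ⊗ₜ ((op (Q.Sinv q) ⊗ₜ r) ⊗ₜ (op (Q.Sinv p) ⊗ₜ t)) := by
        simp [toReassociator, regroup_tmul, SinvOp_apply]
      have e' : ∀ x y : H, (op (Q.Sinv x) ⊗ₜ[k] y : Hᵐᵒᵖ ⊗[k] H) =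
          oneRight k Hᵐᵒᵖ H (op (Q.Sinv x)) * oneLeft k Hᵐᵒᵖ H y := by simp [oneRight, oneLeft]
      have h₁ : ∀ x : H, i (oneRight k Hᵐᵒᵖ H (op (Q.Sinv x))) = sleg Q i x := fun x => rfl
      have h₂ : ∀ x : H, j (oneRight k Hᵐᵒᵖ H (op (Q.Sinv x))) = sleg Q j x := fun x => rfl
      have h₃ : ∀ x : H, i (oneLeft k Hᵐᵒᵖ H x) = resSnd i x := fun x => rfl
      have h₄ : ∀ x : H, j (oneLeft k Hᵐᵒᵖ H x) = resSnd j x := fun x => rfl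
      rw [e]
      simp only [lift₂_tmul, e', map_mul, h₁, h₂, h₃, h₄]
      have c₁ := (LegComm.comm (i := sleg Q i) (j := n) q a).eq
      have c₂ := (LegComm.comm (i := sleg Q j) (j := resSnd i) p r).eq
      have c₃ := (LegComm.comm (i := sleg Q j) (j := sleg Q i) p q).eq
      have c₄ := (LegComm.comm (i := sleg Q j) (j := n) p a).eq
      rw [← mul_assoc (sleg Q i q), c₁, ← mul_assoc (sleg Q j p), ← mul_assoc (sleg Q j p), c₄,
        mul_assoc (n a) (sleg Q j p), c₃, mul_assoc (n a), mul_assoc (sleg Q i q), mul_assoc,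
        ← mul_assoc (sleg Q j p), c₂]
      simp only [mul_assoc]

theorem resSnd_star : resSnd (star (Q.op.tensor Q).Δ i j) = star Q.Δ (resSnd i) (resSnd j) :=
  star_tensor_snd _ _ i j

theorem resFst_star : resFst (star (Q.op.tensor Q).Δ i j) = star Q.op.Δ (resFst i) (resFst j) :=
  star_tensor_fst _ _ i j

theorem lift_sleg_S₂ (t : H ⊗[k] H) : lift₂ (sleg Q j) (sleg Q i) (Q.S₂ t) =
    lift₂ (resFst i) (resFst j) (opp₂ k H H (op t)) := by
  induction t using TensorProduct.induction_on with
  | zero => simp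
  | add x y hx hy => simp only [map_add, op_add, hx, hy]
  | tmul x y =>
    rw [S₂_tmul, opp₂_tmul, lift₂_tmul, lift₂_tmul, sleg_apply, sleg_apply, Q.Sinv_S, Q.Sinv_S]
    exact (LegComm.comm (i := resFst i) (j := resFst j) _ _).eq.symm

theorem lift_sleg_S₃ (t : H ⊗[k] (H ⊗[k] H)) :
    lift₂ (sleg Q l) (lift₂ (sleg Q j) (sleg Q i)) (Q.S₃ t) =
      lift₂ (resFst i) (lift₂ (resFst j) (resFst l)) (opp₃ k H H H (op t)) := by
  induction t using tensor_induction₃ with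
  | zero => simp
  | add x y hx hy => simp only [map_add, op_add, hx, hy]
  | tmul x y z =>
    rw [S₃_tmul, opp₃_tmul]
    simp only [lift₂_tmul]
    rw [sleg_apply, sleg_apply, sleg_apply, Q.Sinv_S, Q.Sinv_S, Q.Sinv_S]
    have h₁ := (LegComm.comm (i := resFst i) (j := resFst j) (op x) (op y)).eq
    have h₂ := (LegComm.comm (i := resFst i) (j := resFst l) (op x) (op z)).eq
    have h₃ := (LegComm.comm (i := resFst j) (j := resFst l) (op y) (op z)).eq
    rw [← h₁, ← mul_assoc, ← h₂, mul_assoc, ← h₃]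

/-- The failure of `S⁻¹` to be comultiplicative is measured by `f`. The combined leg of two copies
of `Hᵒᵖ ⊗ H`, restricted along `S⁻¹`, is the `f`-conjugate of the combined `S⁻¹`-legs in reversed
order. -/
instance intertwines_twist : Intertwines (place₂ Q.twistUnit (sleg Q j) (sleg Q i))
    (star Q.Δ (sleg Q j) (sleg Q i)) (sleg Q (star (Q.op.tensor Q).Δ i j)) where
  semiconj h := by
    have e : sleg Q (star (Q.op.tensor Q).Δ i j) h =
        lift₂ (sleg Q j) (sleg Q i) (Q.S₂ (Q.Δ (Q.Sinv h))) := by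
      rw [sleg_apply, resFst_star, lift_sleg_S₂]; rfl
    rw [SemiconjBy, e, S₂_Δ_Sinv, coe_place₂, star_apply, ← map_mul, ← map_mul]
    congr 1
    exact (Q.twistUnit.inv_mul_cancel_right _).symm

/-- In the legs `sleg` the antipodes in the twisted cocycle identity cancel, and `S₃(Φ)` becomes the
inverse of the reassociator of `Hᵒᵖ`. -/
theorem twist_cocycle_sleg :
    place₂ Q.twistUnit (sleg Q j) (sleg Q i) *
        place₂ Q.twistUnit (sleg Q l) (star Q.Δ (sleg Q j) (sleg Q i)) *
        place₃ Q.Φ (sleg Q l) (sleg Q j) (sleg Q i) =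
      (place₃ Q.op.Φ (resFst i) (resFst j) (resFst l))⁻¹ *
        place₂ Q.twistUnit (sleg Q l) (sleg Q j) *
        place₂ Q.twistUnit (star Q.Δ (sleg Q l) (sleg Q j)) (sleg Q i) := by
  have h := congrArg (lift₂ (sleg Q l) (lift₂ (sleg Q j) (sleg Q i))) Q.twist_cocycle
  rw [map_mul, map_mul, map_mul, map_mul, lift₂_oneLeft, lift₂_onRest, lift₂_onRest,
    lift₂_onFirst] at h
  simp only [lift₂_comp_oneRight] at h
  rw [lift_sleg_S₃] at h
  exact Units.ext h

theorem sleg_triv : sleg Q (triv B (Q.op.tensor Q).ε) = triv B Q.ε := by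
  refine AlgHom.ext fun h => ?_
  have e : resFst (triv B (Q.op.tensor Q).ε) = triv B Q.op.ε := triv_tensor_fst _ _
  rw [sleg_apply, e, triv_apply, triv_apply]
  exact congrArg _ (Q.ε_Sinv h)

theorem resSnd_triv : resSnd (triv B (Q.op.tensor Q).ε) = triv B Q.ε := triv_tensor_snd _ _

theorem twist_triv_right (i : H →ₐ[k] B) : place₂ Q.twistUnit i (triv B Q.ε) = 1 :=
  Units.ext (by
    rw [coe_place₂, lift₂_dropLast]
    exact (congrArg i Q.dropLast_twist).trans (map_one i))

theorem twist_triv_left (i : H →ₐ[k] B) : place₂ Q.twistUnit (triv B Q.ε) i = 1 :=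
  Units.ext (by
    rw [coe_place₂, lift₂_dropFirst]
    exact (congrArg i Q.dropFirst_twist).trans (map_one i))

end

end OppositeLegs

end QHA
end

/-! ### The comodule algebras `A¹` and `A²` over `Hᵒᵖ ⊗ H`. -/

noncomputable section

namespace QHA

theorem opposite_pentagon_word {G : Type*} [Group G]
    {a b c f₁ f₂ f₂' f₃ f₄ f₄' p₁ p₁' p₂ p₃ p₃' p₄ : G} (r₁ : f₁ * f₂ = f₂' * f₁)
    (r₂ : f₁ * p₁ = p₁' * f₁) (r₃ : f₃ * f₄ = f₄' * f₃) (r₄ : f₃ * p₃ = p₃' * f₃)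
    (r₅ : p₂ * p₁ * (c * b⁻¹) = p₄ * p₃) (r₆ : f₁ * f₂ * c = a⁻¹ * f₃ * f₄)
    (r₇ : b * f₁ = f₁ * b) (r₈ : b * f₂ = f₂ * b) (r₉ : b * c = c * b) :
    a * b * (f₂' * p₁'⁻¹) * (f₁ * p₂⁻¹) = f₄' * p₃'⁻¹ * (f₃ * p₄⁻¹) := by
  obtain rfl := eq_mul_inv_of_mul_eq r₁.symm
  obtain rfl := eq_mul_inv_of_mul_eq r₂.symm
  obtain rfl := eq_mul_inv_of_mul_eq r₃.symm
  obtain rfl := eq_mul_inv_of_mul_eq r₄.symm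
  obtain rfl := eq_mul_inv_of_mul_eq r₅.symm
  have h : b * (f₁ * f₂ * c) = f₁ * f₂ * c * b :=
    ((show Commute b f₁ from r₇).mul_right (show Commute b f₂ from r₈)).mul_right
      (show Commute b c from r₉)
  calc _ = a * (b * (f₁ * f₂ * c)) * c⁻¹ * p₁⁻¹ * p₂⁻¹ := by group
    _ = a * (f₁ * f₂ * c) * b * c⁻¹ * p₁⁻¹ * p₂⁻¹ := by rw [h, ← mul_assoc]
    _ = _ := by rw [r₆]; group

open QuasiBialgebra QuasiHopf MulOpposite

section OppositeComodule

variable {k H : Type*} [Field k] [Ring H] [Algebra k H] (Q : QuasiHopf k H)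
  {A : Type*} [Ring A] [Algebra k A] (𝔸 : BicomoduleAlgebra Q.toQuasiBialgebra A)
  {B : Type*} [Ring B] [Algebra k B]

/-- The reassociator `Ψ⁻¹` with its outer legs twisted, with values in
`A ⊗ (Hᵒᵖ ⊗ H) ⊗ (Hᵒᵖ ⊗ H)`. -/
def reassociator (Ψ : (H ⊗[k] (H ⊗[k] (A ⊗[k] (H ⊗[k] H))))ˣ) :
    (A ⊗[k] ((Hᵐᵒᵖ ⊗[k] H) ⊗[k] (Hᵐᵒᵖ ⊗[k] H)))ˣ :=
  Units.map (toReassociator Q A).toMonoidHom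
    (Units.map (onRest k H (oneRight k H (A ⊗[k] (H ⊗[k] H)))).toMonoidHom Q.twistUnit * Ψ⁻¹)

section

variable (n : A →ₐ[k] B) (i j l : Hᵐᵒᵖ ⊗[k] H →ₐ[k] B) [LegComm n i] [LegComm n j] [LegComm n l]
  [LegComm i j] [LegComm i l] [LegComm j l]

theorem place_reassociator (Ψ : (H ⊗[k] (H ⊗[k] (A ⊗[k] (H ⊗[k] H))))ˣ) :
    place₃ (reassociator Q Ψ) n i j = place₂ Q.twistUnit (sleg Q j) (sleg Q i) *
      (place₅ (sleg Q j) (sleg Q i) n (resSnd i) (resSnd j) Ψ)⁻¹ := by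
  refine Units.ext ?_
  rw [coe_place₃, reassociator, coe_unitsMap, lift_toReassociator, Units.val_mul, map_mul,
    coe_unitsMap, lift₂_onRest, Units.val_mul, coe_place₂, place₅, coe_place₂_inv]
  simp only [lift₂_comp_oneRight]

theorem star_ρ₁ : star (ρ₁ Q 𝔸) n i = star 𝔸.ρ (star 𝔸.lam (sleg Q i) n) (resSnd i) := by
  refine AlgHom.ext fun x => ?_
  rw [star_apply, ρ₁, AlgHom.comp_apply, lift_toRightCoaction, δl, AlgHom.comp_apply,
    lift₂_onFirst]
  rfl

theorem star_ρ₂ : star (ρ₂ Q 𝔸) n i = star 𝔸.lam (sleg Q i) (star 𝔸.ρ n (resSnd i)) := by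
  refine AlgHom.ext fun x => ?_
  rw [star_apply, ρ₂, AlgHom.comp_apply, lift_toRightCoaction, δr, AlgHom.comp_apply,
    lift₂_onRest]
  rfl

instance sleg_star_star : LegComm (sleg Q (star (Q.op.tensor Q).Δ i j))
    (star Q.Δ (resSnd i) (resSnd j)) := by
  rw [← resSnd_star]; infer_instance

theorem intertwines_reassociator : Intertwines (place₃ (reassociator Q (Ψl 𝔸)) n i j)
    (star (ρ₁ Q 𝔸) (star (ρ₁ Q 𝔸) n i) j) (star (ρ₁ Q 𝔸) n (star (Q.op.tensor Q).Δ i j)) where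
  semiconj x := by
    rw [place_reassociator, Units.val_mul]
    simp only [star_ρ₁, resSnd_star]
    have h₁ := Intertwines.semiconj
      (b := (place₅ (sleg Q j) (sleg Q i) n (resSnd i) (resSnd j) (Ψl 𝔸))⁻¹)
      (i := star 𝔸.ρ (star 𝔸.lam (sleg Q j) (star 𝔸.ρ (star 𝔸.lam (sleg Q i) n) (resSnd i)))
        (resSnd j))
      (i' := star 𝔸.ρ (star 𝔸.lam (star Q.Δ (sleg Q j) (sleg Q i)) n)
        (star Q.Δ (resSnd i) (resSnd j))) x
    have h₂ := Intertwines.semiconj (b := place₂ Q.twistUnit (sleg Q j) (sleg Q i))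
      (i := star 𝔸.ρ (star 𝔸.lam (star Q.Δ (sleg Q j) (sleg Q i)) n)
        (star Q.Δ (resSnd i) (resSnd j)))
      (i' := star 𝔸.ρ (star 𝔸.lam (sleg Q (star (Q.op.tensor Q).Δ i j)) n)
        (star Q.Δ (resSnd i) (resSnd j))) x
    exact h₂.mul_left h₁

theorem place₅_intertwine (b : Bˣ) (Ψ : (H ⊗[k] (H ⊗[k] (A ⊗[k] (H ⊗[k] H))))ˣ)
    (x x' y y' : H →ₐ[k] B) (m m' : A →ₐ[k] B) (u u' v v' : H →ₐ[k] B)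
    [LegComm x y] [LegComm x m] [LegComm x u] [LegComm x v] [LegComm y m] [LegComm y u]
    [LegComm y v] [LegComm m u] [LegComm m v] [LegComm u v]
    [LegComm x' y'] [LegComm x' m'] [LegComm x' u'] [LegComm x' v'] [LegComm y' m']
    [LegComm y' u'] [LegComm y' v'] [LegComm m' u'] [LegComm m' v'] [LegComm u' v']
    [Intertwines b x x'] [Intertwines b y y'] [Intertwines b m m'] [Intertwines b u u']
    [Intertwines b v v'] : b * place₅ x y m u v Ψ = place₅ x' y' m' u' v' Ψ * b :=
  place₂_intertwine b Ψ x x' _ _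

/-- The reassociator of `Hᵒᵖ ⊗ H` is the product of one on the `Hᵒᵖ`-parts and one on the `H`-parts.
The pentagon is then the inverse of the two-sided pentagon for `Ψ_l`, corrected by the cocycle
identity of `f`; the remaining relations are naturality and commutation of left with right legs. -/
theorem pentagon_reassociator :
    place₃ (Q.op.tensor Q).Φ i j l *
        place₃ (reassociator Q (Ψl 𝔸)) n (star (Q.op.tensor Q).Δ i j) l *
        place₃ (reassociator Q (Ψl 𝔸)) n i j =
      place₃ (reassociator Q (Ψl 𝔸)) n i (star (Q.op.tensor Q).Δ j l) *
        place₃ (reassociator Q (Ψl 𝔸)) (star (ρ₁ Q 𝔸) n i) j l := by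
  have h : place₃ (Q.op.tensor Q).Φ i j l = place₃ Q.op.Φ (resFst i) (resFst j) (resFst l) *
      place₃ Q.Φ (resSnd i) (resSnd j) (resSnd l) := place_tensorUnit i j l _ _
  rw [h]
  simp only [place_reassociator, star_ρ₁, resSnd_star]
  refine opposite_pentagon_word
    (place₂_intertwine (place₂ Q.twistUnit (sleg Q j) (sleg Q i)) Q.twistUnit
      (sleg Q l) (sleg Q l) (star Q.Δ (sleg Q j) (sleg Q i))
      (sleg Q (star (Q.op.tensor Q).Δ i j)))
    (place₅_intertwine (place₂ Q.twistUnit (sleg Q j) (sleg Q i)) (Ψl 𝔸)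
      (sleg Q l) (sleg Q l) (star Q.Δ (sleg Q j) (sleg Q i))
      (sleg Q (star (Q.op.tensor Q).Δ i j)) n n (star Q.Δ (resSnd i) (resSnd j))
      (star Q.Δ (resSnd i) (resSnd j)) (resSnd l) (resSnd l))
    (place₂_intertwine (place₂ Q.twistUnit (sleg Q l) (sleg Q j)) Q.twistUnit
      (star Q.Δ (sleg Q l) (sleg Q j)) (sleg Q (star (Q.op.tensor Q).Δ j l))
      (sleg Q i) (sleg Q i))
    (place₅_intertwine (place₂ Q.twistUnit (sleg Q l) (sleg Q j)) (Ψl 𝔸)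
      (star Q.Δ (sleg Q l) (sleg Q j)) (sleg Q (star (Q.op.tensor Q).Δ j l))
      (sleg Q i) (sleg Q i) n n (resSnd i) (resSnd i)
      (star Q.Δ (resSnd j) (resSnd l)) (star Q.Δ (resSnd j) (resSnd l)))
    (𝔸.Ψl_pentagon (sleg Q l) (sleg Q j) (sleg Q i) n (resSnd i) (resSnd j) (resSnd l))
    (twist_cocycle_sleg Q i j l)
    (place₂_intertwine _ _ _ _ _ _) (place₂_intertwine _ _ _ _ _ _)
    (place₃_intertwine _ _ _ _ _ _ _ _)

end

theorem ρ₁_counit : star (ρ₁ Q 𝔸) (AlgHom.id k A) (triv A (Q.op.tensor Q).ε) = AlgHom.id k A := by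
  rw [star_ρ₁]
  simp only [sleg_triv, resSnd_triv, 𝔸.star_lam_triv, 𝔸.star_ρ_triv]

/-- The right comodule algebra `(A, ρ₁, Φ_{ρ₁})` over `Hᵒᵖ ⊗ H`. -/
def comodule₁ : RightComoduleAlgebra (Q.op.tensor Q).toQuasiBialgebra A :=
  RightComoduleAlgebra.ofLegs (ρ₁ Q 𝔸) (reassociator Q (Ψl 𝔸))
    (intertwines_reassociator Q 𝔸 _ _ _) (fun n i j l => pentagon_reassociator Q 𝔸 n i j l)
    (ρ₁_counit Q 𝔸)
    (by
      rw [place_reassociator]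
      simp only [sleg_triv, resSnd_triv, 𝔸.Ψl_triv_inner, twist_triv_right, inv_one, mul_one])
    (by
      rw [place_reassociator]
      simp only [sleg_triv, resSnd_triv, 𝔸.Ψl_triv_outer, twist_triv_left, inv_one, mul_one])

/-- The element `Φ_{λ,ρ}` as an invertible element of `A ⊗ (Hᵒᵖ ⊗ H)`. -/
def gauge : (A ⊗[k] (Hᵐᵒᵖ ⊗[k] H))ˣ := Units.map (toRightCoaction Q A).toMonoidHom 𝔸.Φlr

theorem place_gauge (n : A →ₐ[k] B) (i : Hᵐᵒᵖ ⊗[k] H →ₐ[k] B) [LegComm n i] :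
    place₂ (gauge Q 𝔸) n i = place₃ 𝔸.Φlr (sleg Q i) n (resSnd i) :=
  Units.ext (by rw [coe_place₂, gauge, coe_unitsMap, lift_toRightCoaction, coe_place₃])

theorem dropLast_gauge : dropLast k A (Q.op.tensor Q).ε
    (gauge Q 𝔸 : A ⊗[k] (Hᵐᵒᵖ ⊗[k] H)) = 1 := by
  have h := congrArg Units.val (place_gauge Q 𝔸 (AlgHom.id k A) (triv A (Q.op.tensor Q).ε))
  simp only [sleg_triv, resSnd_triv, 𝔸.Φlr_triv_last] at h
  rwa [coe_place₂, lift₂_dropLast] at h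

/-- The right comodule algebra `(A, ρ₂, Φ_{ρ₂})` over `Hᵒᵖ ⊗ H`, obtained from `(A, ρ₁, Φ_{ρ₁})`
by twisting. -/
def comodule₂ : RightComoduleAlgebra (Q.op.tensor Q).toQuasiBialgebra A :=
  (comodule₁ Q 𝔸).twist (dropLast_gauge Q 𝔸)

/-- Both the gauge element and `Φ_{λ,ρ}` are the same unit in legs, and it intertwines `δ_l` with
`δ_r`. Cancelling it identifies the twisted coaction with `ρ₂`. -/
theorem comodule₂_ρ : (comodule₂ Q 𝔸).ρ = ρ₂ Q 𝔸 := by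
  have h : star (comodule₂ Q 𝔸).ρ (oneRight k A (Hᵐᵒᵖ ⊗[k] H)) (oneLeft k A _) =
      star (ρ₂ Q 𝔸) (oneRight k A (Hᵐᵒᵖ ⊗[k] H)) (oneLeft k A _) := by
    refine AlgHom.ext fun x => ?_
    have h₁ := Intertwines.eq ((comodule₁ Q 𝔸).intertwines_twistρ (gauge Q 𝔸)
      (oneRight k A (Hᵐᵒᵖ ⊗[k] H)) (oneLeft k A _)) x
    have h₂ : star (comodule₁ Q 𝔸).ρ (oneRight k A (Hᵐᵒᵖ ⊗[k] H)) (oneLeft k A _) = _ :=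
      star_ρ₁ Q 𝔸 _ _
    rw [place_gauge, h₂, Intertwines.eq
      (i' := star 𝔸.lam (sleg Q (oneLeft k A _)) (star 𝔸.ρ (oneRight k A (Hᵐᵒᵖ ⊗[k] H))
        (resSnd (oneLeft k A _)))) inferInstance x] at h₁
    rw [star_ρ₂]
    exact (Units.mul_left_inj _).mp h₁.symm
  simpa only [star, lift₂_oneRight_oneLeft, AlgHom.id_comp] using h

/-- In the formula for the twisted reassociator, the leftmost gauge factor is moved past `f`. What
remains to the right of `f` is the inverse of `Ψr_twist`. -/
theorem place_comodule₂ (n : A →ₐ[k] B) (i j : Hᵐᵒᵖ ⊗[k] H →ₐ[k] B) [LegComm n i] [LegComm n j]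
    [LegComm i j] : place₃ (comodule₂ Q 𝔸).Φρ n i j = place₃ (reassociator Q (Ψr 𝔸)) n i j := by
  have h : place₃ (comodule₂ Q 𝔸).Φρ n i j = _ :=
    (comodule₁ Q 𝔸).place_twistΦ (gauge Q 𝔸) n i j
  have h₁ : place₃ (comodule₁ Q 𝔸).Φρ n i j = _ := place_reassociator Q n i j (Ψl 𝔸)
  have h₂ : star (comodule₁ Q 𝔸).ρ n i = _ := star_ρ₁ Q 𝔸 n i
  simp only [h₁, h₂, place_gauge, resSnd_star] at h
  rw [h, place_reassociator, ← mul_assoc, ← place₃_intertwine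
    (place₂ Q.twistUnit (sleg Q j) (sleg Q i)) 𝔸.Φlr (star Q.Δ (sleg Q j) (sleg Q i)) _ n n
    (star Q.Δ (resSnd i) (resSnd j)) (star Q.Δ (resSnd i) (resSnd j)),
    ← mul_inv_eq_iff_eq_mul.mpr (𝔸.Ψr_twist (sleg Q j) (sleg Q i) n (resSnd i) (resSnd j)).symm]
  group

theorem comodule₂_Φρ : (comodule₂ Q 𝔸).Φρ = reassociator Q (Ψr 𝔸) := by
  have h := congrArg Units.val (place_comodule₂ Q 𝔸 (A₂ k A (Hᵐᵒᵖ ⊗[k] H)) (K₂₁ k A _) (K₂₂ k A _))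
  rw [coe_place₃, coe_place₃, lift_standard₃, lift_standard₃] at h
  exact Units.ext h

end OppositeComodule

end QHA
end

/-! ### The explicit reassociators and the action of `Hᵒᵖ ⊗ H`. -/

noncomputable section

namespace QHA

open QuasiBialgebra QuasiHopf

section Reassociators

variable {k H : Type*} [Field k] [Ring H] [Algebra k H] (Q : QuasiHopf k H)
  {A : Type*} [Ring A] [Algebra k A] (𝔸 : BicomoduleAlgebra Q.toQuasiBialgebra A)
  {B : Type*} [Ring B] [Algebra k B]

section FiveLegs

variable (k H A)

/-- The standard maps into `H ⊗ H ⊗ A ⊗ H ⊗ H`. -/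
abbrev H₅₁ : H →ₐ[k] H ⊗[k] (H ⊗[k] (A ⊗[k] (H ⊗[k] H))) := oneRight k _ _
/-- The standard maps into `H ⊗ H ⊗ A ⊗ H ⊗ H`. -/
abbrev H₅₂ : H →ₐ[k] H ⊗[k] (H ⊗[k] (A ⊗[k] (H ⊗[k] H))) :=
  (oneLeft k _ _).comp (oneRight k _ _)
/-- The standard maps into `H ⊗ H ⊗ A ⊗ H ⊗ H`. -/
abbrev A₅ : A →ₐ[k] H ⊗[k] (H ⊗[k] (A ⊗[k] (H ⊗[k] H))) :=
  (oneLeft k _ _).comp ((oneLeft k _ _).comp (oneRight k _ _))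
/-- The standard maps into `H ⊗ H ⊗ A ⊗ H ⊗ H`. -/
abbrev H₅₃ : H →ₐ[k] H ⊗[k] (H ⊗[k] (A ⊗[k] (H ⊗[k] H))) :=
  (oneLeft k _ _).comp ((oneLeft k _ _).comp ((oneLeft k _ _).comp (oneRight k _ _)))
/-- The standard maps into `H ⊗ H ⊗ A ⊗ H ⊗ H`. -/
abbrev H₅₄ : H →ₐ[k] H ⊗[k] (H ⊗[k] (A ⊗[k] (H ⊗[k] H))) :=
  (oneLeft k _ _).comp ((oneLeft k _ _).comp ((oneLeft k _ _).comp (oneLeft k _ _)))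

variable {k H A}

theorem lift₅_standard (t : H ⊗[k] (H ⊗[k] (A ⊗[k] (H ⊗[k] H)))) :
    lift₂ (H₅₁ k H A) (lift₂ (H₅₂ k H A) (lift₂ (A₅ k H A) (lift₂ (H₅₃ k H A) (H₅₄ k H A)))) t =
      t := by
  simp only [lift₂_comp_comp, lift₂_oneRight_oneLeft, AlgHom.comp_id, AlgHom.id_apply]

/-- The five standard legs together give the identity map, so an equation of tensors may be checked
as an equation of placed units. -/
theorem five_ext {s t : H ⊗[k] (H ⊗[k] (A ⊗[k] (H ⊗[k] H)))}
    (h : lift₂ (H₅₁ k H A) (lift₂ (H₅₂ k H A)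
        (lift₂ (A₅ k H A) (lift₂ (H₅₃ k H A) (H₅₄ k H A)))) s =
      lift₂ (H₅₁ k H A) (lift₂ (H₅₂ k H A)
        (lift₂ (A₅ k H A) (lift₂ (H₅₃ k H A) (H₅₄ k H A)))) t) : s = t := by
  rwa [lift₅_standard, lift₅_standard] at h

end FiveLegs

theorem coe_reassociator (Ψ : (H ⊗[k] (H ⊗[k] (A ⊗[k] (H ⊗[k] H))))ˣ) :
    (reassociator Q Ψ : A ⊗[k] ((Hᵐᵒᵖ ⊗[k] H) ⊗[k] (Hᵐᵒᵖ ⊗[k] H))) =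
      toReassociator Q A (onRest k H (oneRight k H (A ⊗[k] (H ⊗[k] H))) Q.twist *
        (↑Ψ⁻¹ : H ⊗[k] (H ⊗[k] (A ⊗[k] (H ⊗[k] H))))) := rfl

theorem Φρ₁_eq : Φρ₁ Q 𝔸 = reassociator Q (Ψl 𝔸) := by
  rw [Φρ₁, coe_reassociator]
  congr 1
  rw [mul_assoc, mul_assoc]
  congr 1
  refine five_ext ?_
  change _ = Units.val (place₅ (H₅₁ k H A) (H₅₂ k H A) (A₅ k H A) (H₅₃ k H A) (H₅₄ k H A)
    (Ψl 𝔸))⁻¹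
  -- The factors of `Ψ_l⁻¹` come in the order `Φ_λ⁻¹`, `Φ_ρ`, `Φ_{λ,ρ}⁻¹`. Moving `Φ_λ⁻¹` past `Φ_ρ`
  -- replaces an iterated `λ` by `(Δ ⊗ id)λ`, as in the formula for `Φ_{ρ₁}`.
  rw [𝔸.place_Ψl, mul_inv_rev, mul_inv_rev, inv_inv,
    ← mul_assoc (place₃ 𝔸.Φlam (H₅₁ k H A) (H₅₂ k H A) (A₅ k H A))⁻¹, place₃_intertwine
    (place₃ 𝔸.Φlam (H₅₁ k H A) (H₅₂ k H A) (A₅ k H A))⁻¹ 𝔸.Φρ _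
    (star 𝔸.lam (star Q.Δ (H₅₁ k H A) (H₅₂ k H A)) (A₅ k H A)) (H₅₃ k H A) (H₅₃ k H A)
    (H₅₄ k H A) (H₅₄ k H A)]
  simp only [map_mul, Units.val_mul, coe_place₃, coe_place₃_inv,
    lift₂_onRest, lift₂_onFirst, lift₂_comp_onFirst, lift₂_comp_onRest,
    lift₂_comp_oneRight, mul_assoc]

theorem Φρ₂_eq : Φρ₂ Q 𝔸 = reassociator Q (Ψr 𝔸) := by
  rw [Φρ₂, coe_reassociator]
  congr 1
  rw [mul_assoc, mul_assoc]
  congr 1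
  refine five_ext ?_
  change _ = Units.val (place₅ (H₅₁ k H A) (H₅₂ k H A) (A₅ k H A) (H₅₃ k H A) (H₅₄ k H A)
    (Ψr 𝔸))⁻¹
  -- Here `Φ_ρ` is moved past `Φ_λ`, which replaces the iterated `ρ` on the last leg of `Φ_λ` by
  -- `(id ⊗ Δ)ρ`, as in the formula for `Φ_{ρ₂}`.
  have h := place₃_intertwine (place₃ 𝔸.Φρ (A₅ k H A) (H₅₃ k H A) (H₅₄ k H A)) 𝔸.Φlam
    (H₅₁ k H A) (H₅₁ k H A) (H₅₂ k H A) (H₅₂ k H A)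
    (star 𝔸.ρ (star 𝔸.ρ (A₅ k H A) (H₅₃ k H A)) (H₅₄ k H A))
    (star 𝔸.ρ (A₅ k H A) (star Q.Δ (H₅₃ k H A) (H₅₄ k H A)))
  have h' : place₅ (H₅₁ k H A) (H₅₂ k H A) (A₅ k H A) (H₅₃ k H A) (H₅₄ k H A) (Ψr 𝔸) =
      (place₃ 𝔸.Φlr (H₅₂ k H A) (star 𝔸.ρ (A₅ k H A) (H₅₃ k H A)) (H₅₄ k H A))⁻¹ *
        ((place₃ 𝔸.Φρ (A₅ k H A) (H₅₃ k H A) (H₅₄ k H A))⁻¹ *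
        place₃ 𝔸.Φlam (H₅₁ k H A) (H₅₂ k H A)
          (star 𝔸.ρ (A₅ k H A) (star Q.Δ (H₅₃ k H A) (H₅₄ k H A)))) := by
    rw [𝔸.place_Ψr, mul_assoc]
    congr 1
    rw [eq_inv_mul_iff_mul_eq, ← mul_assoc, h, mul_inv_cancel_right]
  rw [h', mul_inv_rev, mul_inv_rev, inv_inv, inv_inv]
  simp only [map_mul, Units.val_mul, coe_place₃, coe_place₃_inv, ← AlgHom.comp_assoc,
    lift₂_onRest, lift₂_oneLeft, lift₂_comp_onFirst, lift₂_comp_onRest, mul_assoc]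
  rfl

end Reassociators

section ModuleAlgebra

open MulOpposite

variable {k H : Type*} [Field k] [Ring H] [Algebra k H] {Q : QuasiHopf k H}
  {M : Type*} [AddCommGroup M] [Module k M]

variable (k H) in
/-- `h ⊗ h' ↦ op h ⊗ h'`. -/
def opFirst : H ⊗[k] H ≃ₗ[k] Hᵐᵒᵖ ⊗[k] H :=
  TensorProduct.congr (opLinearEquiv k) (LinearEquiv.refl k H)

@[simp]
theorem opFirst_tmul (h h' : H) : opFirst k H (h ⊗ₜ h') = op h ⊗ₜ h' := by simp [opFirst]

namespace BimoduleAlgebra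

variable (ℳ : BimoduleAlgebra Q.toQuasiBialgebra M)

/-- The right action of `Hᵒᵖ ⊗ H` on an `H`-bimodule algebra. -/
def opAct : Hᵐᵒᵖ ⊗[k] H →ₗ[k] Module.End k M := ℳ.biAct ∘ₗ (opFirst k H).symm.toLinearMap

theorem opAct_opFirst (x : H ⊗[k] H) : ℳ.opAct (opFirst k H x) = ℳ.biAct x := by
  simp [opAct]

theorem opAct_tmul (h h' : H) (m : M) :
    ℳ.opAct (op h ⊗ₜ h') m = ℳ.left h (ℳ.right h' m) := by
  rw [← opFirst_tmul, opAct_opFirst, Bimodule.biAct_tmul]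

theorem opAct_mul (x y : Hᵐᵒᵖ ⊗[k] H) (m : M) :
    ℳ.opAct (x * y) m = ℳ.opAct y (ℳ.opAct x m) := by
  induction x using TensorProduct.induction_on with
  | zero => simp
  | add x y hx hy => simp only [add_mul, map_add, LinearMap.add_apply, hx, hy]
  | tmul g g' =>
    induction y using TensorProduct.induction_on with
    | zero => simp
    | add x y hx hy => simp only [mul_add, map_add, LinearMap.add_apply, hx, hy]
    | tmul h h' =>
      induction g using MulOpposite.rec' with | _ g =>
      induction h using MulOpposite.rec' with | _ h =>
      rw [Algebra.TensorProduct.tmul_mul_tmul, ← op_mul, opAct_tmul, opAct_tmul, opAct_tmul,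
        ℳ.left_mul, ℳ.right_mul, ℳ.left_right]

theorem opAct_fst₂ (t : H ⊗[k] H) (z : M ⊗[k] M) :
    tensorAct ℳ.opAct ℳ.opAct (fst₂ k Hᵐᵒᵖ H (opp₂ k H H (op t))) z =
      tensorAct ℳ.left ℳ.left t z := by
  induction t using TensorProduct.induction_on with
  | zero => simp
  | add x y hx hy => simp only [op_add, map_add, LinearMap.add_apply, hx, hy]
  | tmul p q =>
    induction z using TensorProduct.induction_on with
    | zero => simp
    | add x y hx hy => simp only [map_add, hx, hy]
    | tmul a b => simp [oneRight, oneLeft, tensorAct_tmul, opAct_tmul, ℳ.right_one]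

theorem opAct_snd₂ (t : H ⊗[k] H) (z : M ⊗[k] M) :
    tensorAct ℳ.opAct ℳ.opAct (snd₂ k Hᵐᵒᵖ H t) z = tensorAct ℳ.right ℳ.right t z := by
  induction t using TensorProduct.induction_on with
  | zero => simp
  | add x y hx hy => simp only [map_add, LinearMap.add_apply, hx, hy]
  | tmul p q =>
    induction z using TensorProduct.induction_on with
    | zero => simp
    | add x y hx hy => simp only [map_add, hx, hy]
    | tmul a b => simp [oneRight, oneLeft, tensorAct_tmul, ← op_one, opAct_tmul, ℳ.left_one]

end BimoduleAlgebra

end ModuleAlgebra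

end QHA
end

/-! ### Bimodule algebras as module algebras, and comparison of the product formulas. -/

noncomputable section

namespace QHA

open QuasiBialgebra QuasiHopf MulOpposite

variable {k H : Type*} [Field k] [Ring H] [Algebra k H] {Q : QuasiHopf k H}
  {M : Type*} [AddCommGroup M] [Module k M] {A : Type*} [Ring A] [Algebra k A]

namespace BimoduleAlgebra

variable (ℳ : BimoduleAlgebra Q.toQuasiBialgebra M)

theorem opAct_fst₃ (t : H ⊗[k] (H ⊗[k] H)) (z : M ⊗[k] (M ⊗[k] M)) :
    tensorAct ℳ.opAct (tensorAct ℳ.opAct ℳ.opAct)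
      (lift₂ (resFst (oneRight k _ _)) (lift₂ (resFst ((oneLeft k _ _).comp (oneRight k _ _)))
        (resFst ((oneLeft k (Hᵐᵒᵖ ⊗[k] H) _).comp (oneLeft k _ _)))) (opp₃ k H H H (op t))) z =
      tensorAct ℳ.left (tensorAct ℳ.left ℳ.left) t z := by
  induction t using tensor_induction₃ with
  | zero => simp
  | add x y hx hy => simp only [op_add, map_add, LinearMap.add_apply, hx, hy]
  | tmul p q r =>
    induction z using tensor_induction₃ with
    | zero => simp
    | add x y hx hy => simp only [map_add, hx, hy]
    | tmul a b c =>
      simp [oneRight, oneLeft, tensorAct_tmul, opAct_tmul, ℳ.right_one,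
        Algebra.TensorProduct.one_def]

theorem opAct_snd₃ (t : H ⊗[k] (H ⊗[k] H)) (z : M ⊗[k] (M ⊗[k] M)) :
    tensorAct ℳ.opAct (tensorAct ℳ.opAct ℳ.opAct)
      (lift₂ (resSnd (oneRight k _ _)) (lift₂ (resSnd ((oneLeft k _ _).comp (oneRight k _ _)))
        (resSnd ((oneLeft k (Hᵐᵒᵖ ⊗[k] H) _).comp (oneLeft k _ _)))) t) z =
      tensorAct ℳ.right (tensorAct ℳ.right ℳ.right) t z := by
  induction t using tensor_induction₃ with
  | zero => simp
  | add x y hx hy => simp only [map_add, LinearMap.add_apply, hx, hy]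
  | tmul p q r =>
    induction z using tensor_induction₃ with
    | zero => simp
    | add x y hx hy => simp only [map_add, hx, hy]
    | tmul a b c =>
      have h : ∀ x m, ℳ.opAct ((1 : Hᵐᵒᵖ) ⊗ₜ x) m = ℳ.right x m := fun x m => by
        rw [← op_one, opAct_tmul, ℳ.left_one]
      simp [oneRight, oneLeft, tensorAct_tmul, h, Algebra.TensorProduct.one_def]

theorem right_lift_mul (h : H) (z : M ⊗[k] M) : ℳ.right h (TensorProduct.lift ℳ.mul z) =
    TensorProduct.lift ℳ.mul (tensorAct ℳ.right ℳ.right (Q.Δ h) z) := by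
  induction z using TensorProduct.induction_on with
  | zero => simp
  | add x y hx hy => simp only [map_add, hx, hy]
  | tmul a b => exact ℳ.right_map_mul h a b

/-- An `H`-bimodule algebra, regarded as a right module algebra over `Hᵒᵖ ⊗ H`. -/
def toRightModuleAlgebra : RightModuleAlgebra (Q.op.tensor Q).toQuasiBialgebra M where
  act := ℳ.opAct
  act_one m := by
    rw [Algebra.TensorProduct.one_def, ← op_one, opAct_tmul, ℳ.left_one, ℳ.right_one]
  act_mul := ℳ.opAct_mul
  mul := ℳ.mul
  one := ℳ.one
  quasi_assoc a b c := by
    rw [ℳ.quasi_assoc, ← opAct_snd₃, ← opAct_fst₃,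
      ← tensorAct_mul_rev ℳ.opAct_mul (tensorAct_mul_rev ℳ.opAct_mul ℳ.opAct_mul)]
    -- The inverse reassociator of `Hᵒᵖ ⊗ H` is `Φ` in the `Hᵒᵖ`-legs times `Φ⁻¹` in the `H`-legs,
    -- which is the two-sided action in the bimodule associativity law.
    have h : (↑(Q.op.tensor Q).Φ⁻¹ : (Hᵐᵒᵖ ⊗[k] H) ⊗[k] ((Hᵐᵒᵖ ⊗[k] H) ⊗[k] (Hᵐᵒᵖ ⊗[k] H))) = _ :=
      tensorUnit_inv Q.op.Φ Q.Φ
    rw [h]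
    rfl
  one_mul' := ℳ.one_mul'
  mul_one' := ℳ.mul_one'
  act_map_mul x a b := by
    induction x using TensorProduct.induction_on with
    | zero => simp
    | add x y hx hy => simp only [map_add, LinearMap.add_apply, hx, hy]
    | tmul h h' =>
      induction h using MulOpposite.rec' with | _ h =>
      rw [opAct_tmul, tensor_Δ_tmul, op_Δ, ℳ.left_right, ℳ.left_map_mul, right_lift_mul,
        tensorAct_mul_rev ℳ.opAct_mul ℳ.opAct_mul, opAct_fst₂, opAct_snd₂]
  act_map_one x := by
    induction x using TensorProduct.induction_on with
    | zero => simp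
    | add x y hx hy => simp only [map_add, LinearMap.add_apply, add_smul, hx, hy]
    | tmul h h' =>
      induction h using MulOpposite.rec' with | _ h =>
      have e : (Q.op.tensor Q).ε (op h ⊗ₜ h') = Q.ε h * Q.ε h' := by
        simp [QuasiHopf.tensor, QuasiBialgebra.tensor, tensorε]
        exact Or.inl rfl
      rw [opAct_tmul, ℳ.right_map_one, map_smul, ℳ.left_map_one, smul_smul, e, mul_comm]

end BimoduleAlgebra

section Relabel

variable (k H A) in
/-- `p ⊗ q ⊗ a ⊗ r ⊗ t ↦ a ⊗ (q ⊗ r) ⊗ (p ⊗ t)`, with values in `A ⊗ (Hᵒᵖ ⊗ H) ⊗ (Hᵒᵖ ⊗ H)`. -/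
def relabel : A ⊗[k] ((H ⊗[k] H) ⊗[k] (H ⊗[k] H)) →ₗ[k]
    A ⊗[k] ((Hᵐᵒᵖ ⊗[k] H) ⊗[k] (Hᵐᵒᵖ ⊗[k] H)) :=
  TensorProduct.map LinearMap.id
    (TensorProduct.map (opFirst k H).toLinearMap (opFirst k H).toLinearMap)

@[simp]
theorem relabel_tmul (a : A) (p q r t : H) :
    relabel k H A (a ⊗ₜ ((p ⊗ₜ q) ⊗ₜ (r ⊗ₜ t))) = a ⊗ₜ ((op p ⊗ₜ q) ⊗ₜ (op r ⊗ₜ t)) := by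
  simp [relabel]

theorem relabel_mul_left (u : A) (t : A ⊗[k] ((H ⊗[k] H) ⊗[k] (H ⊗[k] H))) :
    relabel k H A ((u ⊗ₜ 1) * t) = (u ⊗ₜ 1) * relabel k H A t := by
  induction t using TensorProduct.induction_on with
  | zero => simp
  | add x y hx hy => simp only [map_add, mul_add, hx, hy]
  | tmul a z => simp [relabel]

theorem relabel_mul_right (u : A) (t : A ⊗[k] ((H ⊗[k] H) ⊗[k] (H ⊗[k] H))) :
    relabel k H A (t * (u ⊗ₜ 1)) = relabel k H A t * (u ⊗ₜ 1) := by
  induction t using TensorProduct.induction_on with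
  | zero => simp
  | add x y hx hy => simp only [map_add, add_mul, hx, hy]
  | tmul a z => simp [relabel]

theorem evalTensor_opAct (ℳ : BimoduleAlgebra Q.toQuasiBialgebra M)
    (t : A ⊗[k] ((H ⊗[k] H) ⊗[k] (H ⊗[k] H))) (z : M ⊗[k] M) :
    evalTensor ℳ.opAct ℳ.mul (relabel k H A t ⊗ₜ z) = evalTensor ℳ.biAct ℳ.mul (t ⊗ₜ z) := by
  induction t using tensor_induction₃ with
  | zero => simp
  | add x y hx hy => simp only [map_add, TensorProduct.add_tmul, hx, hy]
  | tmul a p q =>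
    induction z using TensorProduct.induction_on with
    | zero => simp
    | add x y hx hy => simp only [map_add, TensorProduct.tmul_add, hx, hy]
    | tmul x y => simp [relabel, evalTensor, BimoduleAlgebra.opAct_opFirst, tensorAct_tmul]

theorem productAM_congr (ℳ : BimoduleAlgebra Q.toQuasiBialgebra M)
    {E : A →ₗ[k] A →ₗ[k] A ⊗[k] ((H ⊗[k] H) ⊗[k] (H ⊗[k] H))}
    {E' : A →ₗ[k] A →ₗ[k] A ⊗[k] ((Hᵐᵒᵖ ⊗[k] H) ⊗[k] (Hᵐᵒᵖ ⊗[k] H))}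
    (h : ∀ u u', E' u u' = relabel k H A (E u u')) :
    productAM ℳ.opAct ℳ.mul E' = productAM ℳ.biAct ℳ.mul E := by
  refine TensorProduct.ext' fun u φ => TensorProduct.ext' fun u' ψ => ?_
  simp only [productAM, TensorProduct.curry_apply, LinearMap.comp_apply,
    LinearEquiv.coe_coe, TensorProduct.tensorTensorTensorComm_tmul, TensorProduct.map_tmul,
    TensorProduct.lift.tmul, LinearMap.id_apply, h, evalTensor_opAct]

theorem productMA_congr (ℳ : BimoduleAlgebra Q.toQuasiBialgebra M)
    {E : A →ₗ[k] A →ₗ[k] A ⊗[k] ((H ⊗[k] H) ⊗[k] (H ⊗[k] H))}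
    {E' : A →ₗ[k] A →ₗ[k] A ⊗[k] ((Hᵐᵒᵖ ⊗[k] H) ⊗[k] (Hᵐᵒᵖ ⊗[k] H))}
    (h : ∀ u u', E' u u' = relabel k H A (E u u')) :
    productMA ℳ.opAct ℳ.mul E' = productMA ℳ.biAct ℳ.mul E := by
  refine TensorProduct.ext' fun φ u => TensorProduct.ext' fun ψ u' => ?_
  simp only [productMA, TensorProduct.curry_apply, LinearMap.comp_apply,
    LinearEquiv.coe_coe, TensorProduct.tensorTensorTensorComm_tmul, TensorProduct.map_tmul,
    TensorProduct.comm_tmul, TensorProduct.lift.tmul, LinearMap.id_apply, h, evalTensor_opAct]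

theorem tensor_induction₅ {motive : H ⊗[k] (H ⊗[k] (A ⊗[k] (H ⊗[k] H))) → Prop}
    (t : H ⊗[k] (H ⊗[k] (A ⊗[k] (H ⊗[k] H)))) (zero : motive 0)
    (add : ∀ x y, motive x → motive y → motive (x + y))
    (tmul : ∀ p q a r s, motive (p ⊗ₜ (q ⊗ₜ (a ⊗ₜ (r ⊗ₜ s))))) : motive t := by
  induction t using TensorProduct.induction_on with
  | zero => exact zero
  | add x y hx hy => exact add _ _ hx hy
  | tmul p t =>
    induction t using tensor_induction₄ with
    | zero => simpa using zero
    | add x y hx hy => rw [TensorProduct.tmul_add]; exact add _ _ hx hy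
    | tmul q a r s => exact tmul p q a r s

@[simp]
theorem toRightCoaction_tmul (p q : H) (a : A) :
    toRightCoaction Q A (p ⊗ₜ (a ⊗ₜ q)) = a ⊗ₜ (op (Q.Sinv p) ⊗ₜ q) := by
  simp [toRightCoaction, onRest, SinvOp_apply]

@[simp]
theorem toReassociator_tmul (p q r s : H) (a : A) :
    toReassociator Q A (p ⊗ₜ (q ⊗ₜ (a ⊗ₜ (r ⊗ₜ s)))) =
      a ⊗ₜ ((op (Q.Sinv q) ⊗ₜ r) ⊗ₜ (op (Q.Sinv p) ⊗ₜ s)) := by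
  simp [toReassociator, regroup_tmul, SinvOp_apply]

theorem relabel_mulΩR (Ω : H ⊗[k] (H ⊗[k] (A ⊗[k] (H ⊗[k] H)))) (v : H ⊗[k] (A ⊗[k] H)) :
    relabel k H A (regroup H H A H H (mulΩR Q Ω v)) =
      onRest k A (oneRight k _ _) (toRightCoaction Q A v) *
        relabel k H A (regroup H H A H H Ω) := by
  induction v using tensor_induction₃ with
  | zero => simp
  | add x y hx hy => simp only [map_add, add_mul, hx, hy]
  | tmul v₁ v₂ v₃ =>
    induction Ω using tensor_induction₅ with
    | zero => simp [mulΩR]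
    | add x y hx hy =>
      simp only [map_add, mul_add, ← hx, ← hy]
      simp [mulΩR, mul_add, add_mul]
    | tmul p q a r s => simp [mulΩR, regroup_tmul, onRest, oneRight]

theorem relabel_ΩR (g : H ⊗[k] H) (t : H ⊗[k] (H ⊗[k] (A ⊗[k] (H ⊗[k] H)))) :
    relabel k H A (regroup H H A H H
      (onRest k H (oneRight k H (A ⊗[k] (H ⊗[k] H))) (TensorProduct.map Q.Sinv Q.Sinv g) *
        TensorProduct.map Q.Sinv (TensorProduct.map Q.Sinv LinearMap.id) t)) =
      toReassociator Q A (t * onRest k H (oneRight k H (A ⊗[k] (H ⊗[k] H))) g) := by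
  induction g using TensorProduct.induction_on with
  | zero => simp
  | add x y hx hy => simp only [map_add, mul_add, add_mul, hx, hy]
  | tmul g₁ g₂ =>
    induction t using tensor_induction₅ with
    | zero => simp
    | add x y hx hy => simp only [map_add, mul_add, add_mul, hx, hy]
    | tmul p q a r s => simp [regroup_tmul, onRest, oneRight, Q.Sinv_mul]

/-- The `S⁻¹` in the first two legs reverses products, so `f⁻¹`, standing on the left in `Ω_R`, ends
up on the right of `Ψ`. The result is `(f Ψ⁻¹)⁻¹`. -/
theorem relabel_ΩR_eq (Ψ : (H ⊗[k] (H ⊗[k] (A ⊗[k] (H ⊗[k] H))))ˣ) :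
    relabel k H A (regroup H H A H H (ΩR Q Ψ)) = Units.val (reassociator Q Ψ)⁻¹ := by
  rw [ΩR, relabel_ΩR, Q.twistInv_eq, reassociator, ← map_inv, mul_inv_rev, inv_inv]
  rfl

/-- This matches the raw `Ω_L` formula with the shape of the left smash tensor. The antipode of `Hᵒᵖ
⊗ H` cancels the `S⁻¹` on the left legs and introduces the `S⁻¹` on the right legs. -/
theorem relabel_mulΩL (g : H ⊗[k] H) (t : H ⊗[k] (H ⊗[k] (A ⊗[k] (H ⊗[k] H))))
    (v : H ⊗[k] (A ⊗[k] H)) :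
    relabel k H A (onRest k A (Algebra.TensorProduct.comm k (H ⊗[k] H) (H ⊗[k] H)).toAlgHom
      (regroup H H A H H (mulΩL Q (TensorProduct.map LinearMap.id (TensorProduct.map LinearMap.id
        (TensorProduct.map LinearMap.id (TensorProduct.map Q.Sinv Q.Sinv))) t
        * ((1 : H) ⊗ₜ[k] ((1 : H) ⊗ₜ[k] ((1 : A) ⊗ₜ[k] TensorProduct.map Q.Sinv Q.Sinv g)))) v))) =
      TensorProduct.map LinearMap.id (Q.op.tensor Q).S₂inv
        (oneLeft k A _ (snd₂ k Hᵐᵒᵖ H g) * toReassociator Q A t *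
          onRest k A (oneRight k _ _) (toRightCoaction Q A v)) := by
  -- The antipode of `Hᵒᵖ ⊗ H` is `S⁻¹` on the first factor and `S` on the second, so its inverse is
  -- `S` and `S⁻¹`.
  have hS : ∀ x y, (Q.op.tensor Q).Sinv (op x ⊗ₜ y) = op (Q.S x) ⊗ₜ Q.Sinv y := by
    intro x y
    exact (LinearEquiv.symm_apply_eq _).mpr (by rw [tensor_S_tmul, op_S, Q.Sinv_S, Q.S_Sinv])
  induction v using tensor_induction₃ with
  | zero => simp
  | add x y hx hy => simp only [map_add, mul_add, hx, hy]
  | tmul v₁ v₂ v₃ =>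
    induction g using TensorProduct.induction_on with
    | zero => simp [mulΩL]
    | add x y hx hy =>
      simp only [map_add, add_mul, ← hx, ← hy]
      simp [mulΩL, mul_add, add_mul, TensorProduct.tmul_add]
    | tmul g₁ g₂ =>
      induction t using tensor_induction₅ with
      | zero => simp [mulΩL]
      | add x y hx hy =>
        simp only [map_add, mul_add, add_mul, ← hx, ← hy]
        simp [mulΩL, mul_add, add_mul]
      | tmul p q a r s =>
        simp [mulΩL, regroup_tmul, onRest, oneRight, oneLeft, Q.Sinv_mul, hS, ← op_mul, Q.S_mul,
          Q.S_Sinv, mul_assoc]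

end Relabel

end QHA
end

/-! ### Identification of the six products and conclusion. -/

noncomputable section

namespace QHA

open QuasiBialgebra QuasiHopf MulOpposite

namespace Product

variable {k U V W : Type*} [Field k] [AddCommGroup U] [Module k U] [AddCommGroup V] [Module k V]
  [AddCommGroup W] [Module k W] {p : Product k U} {q : Product k V} {r : Product k W}

theorem Iso.refl (p : Product k U) : p.Iso p := ⟨LinearEquiv.refl k U, rfl, fun _ _ => rfl⟩

theorem Iso.symm (h : p.Iso q) : q.Iso p := by
  obtain ⟨e, h₁, h₂⟩ := h
  refine ⟨e.symm, by rw [← h₁, e.symm_apply_apply], fun x y => e.injective ?_⟩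
  rw [e.apply_symm_apply, h₂, e.apply_symm_apply, e.apply_symm_apply]

theorem Iso.trans (h : p.Iso q) (h' : q.Iso r) : p.Iso r := by
  obtain ⟨e, h₁, h₂⟩ := h
  obtain ⟨e', h₁', h₂'⟩ := h'
  exact ⟨e.trans e', by simp [h₁, h₁'], fun x y => by simp [h₂, h₂']⟩

theorem eq_of_mul_one {p q : Product k U} (h : p.mul = q.mul) (h' : p.one = q.one) : p = q := by
  cases p; cases q; subst h; subst h'; rfl

end Product

section Crossed

variable {k H : Type*} [Field k] [Ring H] [Algebra k H] {Q : QuasiHopf k H}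
  {M : Type*} [AddCommGroup M] [Module k M] {A : Type*} [Ring A] [Algebra k A]

theorem oneLeft_fst_S₂inv (g : H ⊗[k] H) :
    oneLeft k A _ (fst₂ k Hᵐᵒᵖ H (opp₂ k H H (op (Q.S₂inv g)))) =
      toReassociator Q A (onRest k H (oneRight k H (A ⊗[k] (H ⊗[k] H))) g) := by
  induction g using TensorProduct.induction_on with
  | zero => simp
  | add x y hx hy => simp only [map_add, op_add, hx, hy]
  | tmul p q => simp [onRest, oneRight, oneLeft, Algebra.TensorProduct.one_def]

/-- The twist of `Hᵒᵖ ⊗ H` is the product of one built from `f⁻¹` on the `Hᵒᵖ`-part and of `f` on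
the `H`-part. The first cancels the `f` in the reassociator, so that only `Ψ⁻¹` and the `f` of `Ω_L`
remain. -/
theorem twist_mul_reassociator (Ψ : (H ⊗[k] (H ⊗[k] (A ⊗[k] (H ⊗[k] H))))ˣ) :
    oneLeft k A _ (Q.op.tensor Q).twist * ↑(reassociator Q Ψ) =
      oneLeft k A _ (snd₂ k Hᵐᵒᵖ H Q.twist) *
        toReassociator Q A (↑Ψ⁻¹ : H ⊗[k] (H ⊗[k] (A ⊗[k] (H ⊗[k] H)))) := by
  rw [tensor_twist, LegComm.comm (i := fst₂ k Hᵐᵒᵖ H) (j := snd₂ k Hᵐᵒᵖ H), op_twist, map_mul,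
    oneLeft_fst_S₂inv, coe_reassociator, mul_assoc, ← map_mul, ← mul_assoc, ← map_mul]
  have h : (↑Q.twistUnit⁻¹ : H ⊗[k] H) * Q.twist = 1 := Q.twistUnit.inv_mul
  rw [h, map_one, one_mul]

variable (R : RightComoduleAlgebra (Q.op.tensor Q).toQuasiBialgebra A)
  {δ : A →ₐ[k] H ⊗[k] (A ⊗[k] H)} {Ψ : (H ⊗[k] (H ⊗[k] (A ⊗[k] (H ⊗[k] H))))ˣ}
  (ℳ : BimoduleAlgebra Q.toQuasiBialgebra M)

theorem smash_eq_rightCrossed (hρ : R.ρ = (toRightCoaction Q A).comp δ)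
    (hΦ : R.Φρ = reassociator Q Ψ) :
    ℳ.toRightModuleAlgebra.smash R = rightCrossed Q δ (ΩR Q Ψ) ℳ := by
  refine Product.eq_of_mul_one (productAM_congr ℳ fun u u' => ?_) rfl
  rw [LinearMap.mk₂_apply, LinearMap.mk₂_apply, relabel_mul_left, relabel_mulΩR, relabel_ΩR_eq,
    hρ, hΦ, Ring.inverse_unit, mul_assoc, AlgHom.comp_apply]

/-- The cancellation in `twist_mul_reassociator` is the reason why the left smash product over `Hᵒᵖ
⊗ H` has exactly the structure tensor `Ω_L`. -/
theorem leftSmash_eq_leftCrossed (hρ : R.ρ = (toRightCoaction Q A).comp δ)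
    (hΦ : R.Φρ = reassociator Q Ψ) :
    ℳ.toRightModuleAlgebra.leftSmash R = leftCrossed Q δ (ΩL Q Ψ) ℳ := by
  refine Product.eq_of_mul_one (productMA_congr ℳ fun u u' => ?_) rfl
  change R.leftTensor (Q.op.tensor Q) u u' = relabel k H A (_ * (u' ⊗ₜ 1))
  rw [relabel_mul_right, ΩL, relabel_mulΩL,
    RightComoduleAlgebra.leftTensor, hΦ, twist_mul_reassociator, star_apply, lift₂_oneRight_comp,
    hρ, AlgHom.comp_apply]
  rfl

end Crossed

section Main

variable {k H A C : Type*} [Field k] [Ring H] [Algebra k H] [Ring A] [Algebra k A]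
  [AddCommGroup C] [Module k C] (Q : QuasiHopf k H) (𝔸 : BicomoduleAlgebra Q.toQuasiBialgebra A)
  (K : BimoduleCoalgebra Q.toQuasiBialgebra C)

theorem transposeAct_opAct : transposeAct K.opAct = K.dual.opAct := by
  refine TensorProduct.ext' fun h h' => ?_
  induction h using MulOpposite.rec' with | _ h =>
  ext φ c
  rw [BimoduleAlgebra.opAct_tmul, transposeAct_apply, BimoduleCoalgebra.opAct_tmul]
  change _ = transposeAct K.right h (transposeAct K.left h' φ) c
  rw [transposeAct_apply, transposeAct_apply]

theorem smash₁_eq : smash₁ Q 𝔸 K = K.dual.toRightModuleAlgebra.smash (comodule₁ Q 𝔸) := by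
  rw [smash₁, Φρ₁_eq, transposeAct_opAct]
  rfl

theorem smash₂_eq : smash₂ Q 𝔸 K = K.dual.toRightModuleAlgebra.smash (comodule₂ Q 𝔸) := by
  rw [smash₂, Φρ₂_eq, transposeAct_opAct, ← comodule₂_ρ, ← comodule₂_Φρ]
  rfl

theorem smash₁_eq_rightDiagonal : smash₁ Q 𝔸 K = rightDiagonal_l Q 𝔸 K.dual := by
  rw [smash₁_eq]
  exact smash_eq_rightCrossed _ _ rfl rfl

theorem smash₂_eq_rightDiagonal : smash₂ Q 𝔸 K = rightDiagonal_r Q 𝔸 K.dual := by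
  rw [smash₂_eq]
  exact smash_eq_rightCrossed _ _ (comodule₂_ρ Q 𝔸) (comodule₂_Φρ Q 𝔸)

theorem smash₁_isAlgebra : (smash₁ Q 𝔸 K).IsAlgebra := by
  rw [smash₁_eq]
  exact RightModuleAlgebra.smash_isAlgebra _ _

theorem smash₂_iso_smash₁ : (smash₂ Q 𝔸 K).Iso (smash₁ Q 𝔸 K) := by
  rw [smash₁_eq, smash₂_eq]
  exact RightModuleAlgebra.smash_twist_iso _ _ _

theorem leftDiagonal_l_iso_smash₁ : (leftDiagonal_l Q 𝔸 K.dual).Iso (smash₁ Q 𝔸 K) := by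
  have h : K.dual.toRightModuleAlgebra.leftSmash (comodule₁ Q 𝔸) = leftDiagonal_l Q 𝔸 K.dual :=
    leftSmash_eq_leftCrossed _ _ rfl rfl
  rw [smash₁_eq, ← h]
  exact RightModuleAlgebra.leftSmash_iso _ _

theorem leftDiagonal_r_iso_smash₂ : (leftDiagonal_r Q 𝔸 K.dual).Iso (smash₂ Q 𝔸 K) := by
  have h : K.dual.toRightModuleAlgebra.leftSmash (comodule₂ Q 𝔸) = leftDiagonal_r Q 𝔸 K.dual :=
    leftSmash_eq_leftCrossed _ _ (comodule₂_ρ Q 𝔸) (comodule₂_Φρ Q 𝔸)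
  rw [smash₂_eq, ← h]
  exact RightModuleAlgebra.leftSmash_iso _ _

end Main

end QHA
end

theorem proposition3p10 {k H A C : Type*} [Field k] [Ring H] [Algebra k H]
    [Ring A] [Algebra k A] [AddCommGroup C] [Module k C]
    (Q : QHA.QuasiHopf k H)
    (𝔸 : QHA.BicomoduleAlgebra Q.toQuasiBialgebra A)
    (K : QHA.BimoduleCoalgebra Q.toQuasiBialgebra C) :
    -- the inverses that occur in the definitions of the products are genuine inverses
    (IsUnit Q.twist ∧ IsUnit (QHA.Φρ₁ Q 𝔸) ∧ IsUnit (QHA.Φρ₂ Q 𝔸)) ∧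
    -- all six products are associative and unital
    ((QHA.smash₁ Q 𝔸 K).IsAlgebra ∧ (QHA.smash₂ Q 𝔸 K).IsAlgebra ∧
      (QHA.rightDiagonal_l Q 𝔸 K.dual).IsAlgebra ∧
      (QHA.rightDiagonal_r Q 𝔸 K.dual).IsAlgebra ∧
      (QHA.leftDiagonal_l Q 𝔸 K.dual).IsAlgebra ∧
      (QHA.leftDiagonal_r Q 𝔸 K.dual).IsAlgebra) ∧
    -- the smash products coincide with the right generalized diagonal crossed products
    QHA.smash₁ Q 𝔸 K = QHA.rightDiagonal_l Q 𝔸 K.dual ∧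
    QHA.smash₂ Q 𝔸 K = QHA.rightDiagonal_r Q 𝔸 K.dual ∧
    -- the smash products are isomorphic to each other and to the four crossed products
    (QHA.smash₁ Q 𝔸 K).Iso (QHA.smash₂ Q 𝔸 K) ∧
    ((QHA.smash₁ Q 𝔸 K).Iso (QHA.rightDiagonal_l Q 𝔸 K.dual) ∧
      (QHA.smash₁ Q 𝔸 K).Iso (QHA.rightDiagonal_r Q 𝔸 K.dual) ∧
      (QHA.smash₁ Q 𝔸 K).Iso (QHA.leftDiagonal_l Q 𝔸 K.dual) ∧
      (QHA.smash₁ Q 𝔸 K).Iso (QHA.leftDiagonal_r Q 𝔸 K.dual)) ∧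
    ((QHA.smash₂ Q 𝔸 K).Iso (QHA.rightDiagonal_l Q 𝔸 K.dual) ∧
      (QHA.smash₂ Q 𝔸 K).Iso (QHA.rightDiagonal_r Q 𝔸 K.dual) ∧
      (QHA.smash₂ Q 𝔸 K).Iso (QHA.leftDiagonal_l Q 𝔸 K.dual) ∧
      (QHA.smash₂ Q 𝔸 K).Iso (QHA.leftDiagonal_r Q 𝔸 K.dual)) := by
  have h₂₁ := QHA.smash₂_iso_smash₁ Q 𝔸 K
  have hl := QHA.leftDiagonal_l_iso_smash₁ Q 𝔸 K
  have hr := QHA.leftDiagonal_r_iso_smash₂ Q 𝔸 K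
  have a₁ := QHA.smash₁_isAlgebra Q 𝔸 K
  have a₂ := h₂₁.isAlgebra a₁
  refine ⟨⟨Q.twistUnit.isUnit, ?_, ?_⟩, ?_⟩
  · rw [QHA.Φρ₁_eq]
    exact Units.isUnit _
  · rw [QHA.Φρ₂_eq]
    exact Units.isUnit _
  -- The right crossed products equal the smash products, so their claims coincide with those for
  -- `A¹` and `A²`. The left ones inherit associativity and unit through their isomorphisms, and all
  -- further isomorphisms are composites.
  rw [← QHA.smash₁_eq_rightDiagonal, ← QHA.smash₂_eq_rightDiagonal]
  exact ⟨⟨a₁, a₂, a₁, a₂, hl.isAlgebra a₁, hr.isAlgebra a₂⟩, rfl, rfl, h₂₁.symm,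
    ⟨.refl _, h₂₁.symm, hl.symm, h₂₁.symm.trans hr.symm⟩,
    ⟨h₂₁, .refl _, h₂₁.trans hl.symm, hr.symm⟩⟩
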